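/- Let $\alpha,\beta,\gamma,\delta\in\mathbb C$ with $\alpha\neq0$, $\delta\neq0$, and fix a square root $\sqrt\alpha$ of $\alpha$. Consider the Hamiltonian system (Ince-XII) $$\frac{dx}{dt}=\frac{\partial H}{\partial y}=x^2y-\frac{\gamma}{\delta}x+\delta,\qquad \frac{dy}{dt}=-\frac{\partial H}{\partial x}=-xy^2+\alpha x+\frac{\gamma}{\delta}y+\beta,$$ $$H=\frac{x^2y^2}{2}-\frac{\alpha}{2}x^2-\frac{\gamma}{\delta}xy+\delta y-\beta x .$$ Put $c_\pm=\dfrac{\sqrt\alpha\,\gamma\pm\beta\delta}{\sqrt\alpha\,\delta}$. (1) Let $\mathbb P^2\supset\mathbb C^2$ be the projective plane with affine coordinates $(x,y)$. Blow up, successively, the ten points that are the origins of the local coordinate systems $$\left(\tfrac1x,\tfrac yx\right),\ \left(\tfrac1x,\,y-\sqrt\alpha\right),\ \left(\tfrac1x,\,(y-\sqrt\alpha)x-c_+\right),\ \left(\tfrac1x,\,y+\sqrt\alpha\right),\ \left(\tfrac1x,\,(y+\sqrt\alpha)x-c_-\right),$$ $$\left(\tfrac xy,\tfrac1y\right),\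 \left(x,\tfrac1y\right),\ \left(x,\tfrac1{xy}\right),\ \left(x,\,x^2y+2\delta\right),\ \left(x,\,\tfrac{x^2y+2\delta}{x}-\tfrac{2\gamma}{\delta}\right).$$ On the resulting surface $\mathcal Z$ the strict transform of the line at infinity can be contracted: $\mathcal Z$ is the blow-up of a surface $\mathcal X$ at the point $\frac1x=\frac1y=0$, with this strict transform as exceptional curve. The surface $\mathcal X$ is also obtained by blow-ups only, from the projective plane with affine coordinates $\left(x,w\right)$, $w=\frac{1}{y-\sqrt\alpha}$: blow up successively the nine points that are the origins of $$\left(\tfrac1x,\tfrac wx\right),\ \left(\tfrac xw,\tfrac1w\right),\ \left(\tfrac1x,\,(y-\sqrt\alpha)x-c_+\right),\ \left(\tfrac1x,\,y+\sqrt\alpha\right),\ \left(\tfrac1x,\,(y+\sqrt\alpha)x-c_-\right),$$ $$\left(x,\tfrac1y\right),\ \left(x,\tfrac1{xy}\right),\ \left(x,\,x^2y+2\delta\right),\ \left(x,\,\tfrac{x^2y+2\delta}{x}-\tfrac{2\gamma}{\delta}\right).$$ (2) $\mathcal X$ is a rational surface of type $D_6^{(1)}$: the divisor $-\operatorname{div}(dx\wedge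 dy)$ of $\mathcal X$ is an anticanonical divisor $D_0+D_1+2D_2+2D_3+2D_4+D_5+D_6$ with seven distinct smooth rational components $D_i$ with $D_i^2=-2$, with $D_i\cdot D_j=1$ for $\{i,j\}$ one of $\{0,2\},\{1,2\},\{2,3\},\{3,4\},\{4,5\},\{4,6\}$, and with $D_i\cdot D_j=0$ for all other $i\neq j$. (3) The complement $\mathcal X\setminus\bigcup_iD_i$ is obtained by gluing four copies $U_j=\mathbb C^2\ni(x_j,y_j)$, $j=0,1,2,3$ (so that, with the time $t$, the phase space $(\mathcal X\setminus\bigcup_iD_i)\times\mathbb C$ is glued from the four pieces $U_j\times\mathbb C\ni(x_j,y_j,t)$), via the birational and symplectic (that is, $dx_j\wedge dy_j=dx\wedge dy$) transformations $$\begin{aligned} 0)\quad& x_0=x,& y_0&=y,\\ 1)\quad& x_1=\tfrac1x,& y_1&=-\left((y-\sqrt\alpha)x-\tfrac{\sqrt\alpha\gamma+\beta\delta}{\sqrt\alpha\delta}\right)x,\\ 2)\quad& x_2=\tfrac1x,& y_2&=-\left((y+\sqrt\alpha)x-\tfrac{\sqrt\alpha\gamma-\beta\delta}{\sqrt\alpha\delta}\right)x,\\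 3)\quad& x_3=x,& y_3&=y-\tfrac{2\gamma}{\delta x}+\tfrac{2\delta}{x^2}. \end{aligned}$$ (4) It is a phase space of the system: $H$ is a polynomial $H_j$ in $(x_j,y_j)$ for each $j$, and the system becomes the polynomial Hamiltonian system $dx_j/dt=\partial H_j/\partial y_j$, $dy_j/dt=-\partial H_j/\partial x_j$ on $U_j$; and for each point $p$ of $\mathcal X\setminus\bigcup_iD_i$ and each $t_0\in\mathbb C$ there is exactly one holomorphic solution $\varphi:\mathbb C\to\mathcal X\setminus\bigcup_iD_i$ with $\varphi(t_0)=p$. -/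

import Mathlib

/-!
# Models of the function field `ℂ(x, y)`, blow-ups, and the Hamiltonian system Ince-XII

Surfaces are described in Zariski's classical language.  Fix a field `K` of functions.  A (separated,
integral) algebraic variety with function field `K` is the same thing as the set of the local rings of
its points, all of them regarded as subrings of `K`.  Such a set of local rings is a *model* of `K`.
In this language
* gluing affine varieties along birational maps (on the largest open sets where these maps are
  isomorphisms) is the union of sets of local rings inside `K`;
* the generic point of an irreducible curve `C` of a smooth surface is a discrete valuation ring of
  `K`, and it is the same ring for `C` and for the strict transforms of `C`;
* the point `q` is a specialization of the point `p` exactly when `O_q ⊆ O_p`.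
-/

namespace InceXII

noncomputable section

open scoped Classical in
/-- The localization of a subring `A` of the field `K` at the ideal generated by those elements of the
set `S` that are in `A`.  (All ideals used below are prime; otherwise the value is the field `K`.) -/
def localizationAt {K : Type*} [Field K] (A : Subring K) (S : Set K) : LocalSubring K :=
  if h : (Ideal.span {a : A | (a : K) ∈ S}).IsPrime then
    haveI := h
    LocalSubring.ofPrime A (Ideal.span {a : A | (a : K) ∈ S})
  else ⟨⊤⟩

section Models

variable {K : Type*} [Field K]

/-- A set of local rings in the field `K` (the local rings of all points, closed or not, of a variety
with function field `K`). -/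
abbrev Model (K : Type*) [Field K] := Set (LocalSubring K)

/-- `LiesOn p q`: the point `p` lies in the closure of the point `q` (`O_p ⊆ O_q`). -/
def LiesOn (p q : LocalSubring K) : Prop := p.toSubring ≤ q.toSubring

/-- `p` is a closed point of the model `X`. -/
def IsClosedPoint (X : Model K) (p : LocalSubring K) : Prop :=
  p ∈ X ∧ ∀ q ∈ X, LiesOn q p → q = p

/-- The irreducible curves of a smooth surface `X`, each given by the local ring of its generic
point. -/
def curves (X : Model K) : Set (LocalSubring K) :=
  {C | C ∈ X ∧ IsDiscreteValuationRing C.toSubring}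

/-- The ring `R[𝔪 / u]`, where `𝔪` is the maximal ideal of `R`: the coordinate ring of one of the
affine pieces that cover the blow-up of `Spec R` at its closed point. -/
def dilatation (R : LocalSubring K) (u : K) : Subring K :=
  Subring.closure ((R.toSubring : Set K) ∪
    {z | ∃ a ∈ IsLocalRing.maximalIdeal R.toSubring, z = (a : K) / u})

/-- The blow-up of the model `X` at its closed point `p`: the point `p` is removed and replaced with
all the points above `p` (that is, whose local rings dominate the local ring of `p`) of the affine
pieces `Spec R[𝔪 / u]`, `0 ≠ u ∈ 𝔪`. In Mathlib, `p ≤ S` for local subrings means that `S`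
dominates `p`. -/
def blowUp (X : Model K) (p : LocalSubring K) : Model K :=
  (X \ {p}) ∪ {S | p ≤ S ∧ ∃ u ∈ IsLocalRing.maximalIdeal p.toSubring, u ≠ 0 ∧
    ∃ (P : Ideal (dilatation p (u : K))) (_ : P.IsPrime),
      S = LocalSubring.ofPrime (dilatation p (u : K)) P}

/-- `IsBlowUpSequence X [p₁, …, pₙ] Y`: the surface `Y` is obtained from `X` by blowing up the point
`p₁` of `X`, then the point `p₂` of the resulting surface, and so on. -/
def IsBlowUpSequence : Model K → List (LocalSubring K) → Model K → Prop
  | X, [], Y => Y = X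
  | X, p :: ps, Y => IsClosedPoint X p ∧ IsBlowUpSequence (blowUp X p) ps Y

/-! ### Orders, intersection numbers -/

/-- `f = ε ϖ ^ n` with a unit `ε` and a uniformizer `ϖ` of the discrete valuation ring of `C`:
the rational function `f` has order `n` along the curve `C`. -/
def IsOrd (C : LocalSubring K) (f : K) (n : ℤ) : Prop :=
  ∃ (e : (C.toSubring)ˣ) (w : C.toSubring), Irreducible w ∧
    f = ((e : C.toSubring) : K) * (w : K) ^ n

open scoped Classical in
/-- The order of a rational function along a curve (with value `0` for the zero function). -/
def ord (C : LocalSubring K) (f : K) : ℤ :=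
  if h : ∃ n : ℤ, IsOrd C f n then h.choose else 0

open scoped Classical in
/-- The ideal of the curve `C` in the local ring of the point `p` (the unit ideal if `p` is not
on `C`). -/
def curveIdeal (p C : LocalSubring K) : Ideal p.toSubring :=
  if h : LiesOn p C then
    (IsLocalRing.maximalIdeal C.toSubring).comap (Subring.inclusion h)
  else ⊤

/-- The local intersection number at the closed point `p` of two distinct curves: the length of
`O_p / (I_C + I_{C'})`. -/
def localInter (p C C' : LocalSubring K) : ℕ :=
  (Module.length p.toSubring (p.toSubring ⧸ (curveIdeal p C ⊔ curveIdeal p C'))).toNat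

/-- The intersection number of two distinct curves of the complete smooth surface `X`. -/
def inter (X : Model K) (C C' : LocalSubring K) : ℤ :=
  ∑ᶠ p ∈ {p | IsClosedPoint X p}, (localInter p C C' : ℤ)

/-- The curve `C` of the complete smooth surface `X` has self-intersection number `n`: if the
rational function `f` has order `1` along `C`, then `C` is linearly equivalent to
`C - div f = - ∑ ord_{C'}(f) C'` (sum over the curves `C' ≠ C`), and `n` is the intersection number of
the latter divisor with `C`.  (It does not depend on `f`.) -/
def HasSelfInter (X : Model K) (C : LocalSubring K) (n : ℤ) : Prop :=
  ∃ f : K, IsOrd C f 1 ∧ n = - ∑ᶠ C' ∈ curves X \ {C}, ord C' f * inter X C' C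

/-! ### Affine and projective planes with given coordinate functions -/

variable [Algebra ℂ K]

/-- The subring `ℂ[f, g]` of `K`. -/
def coordRing (f g : K) : Subring K := (Algebra.adjoin ℂ {f, g}).toSubring

/-- The affine variety `Spec ℂ[f, g]`, as a set of local rings.  For algebraically independent
`f, g` it is the affine plane with the coordinates `f, g`. -/
def affinePlane (f g : K) : Model K :=
  {S | ∃ (P : Ideal (coordRing f g)) (_ : P.IsPrime), S = LocalSubring.ofPrime (coordRing f g) P}

/-- The projective plane with the affine coordinates `(f, g) = (z₁ / z₀, z₂ / z₀)`. -/
def projectivePlane (f g : K) : Model K :=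
  affinePlane f g ∪ affinePlane (1 / f) (g / f) ∪ affinePlane (f / g) (1 / g)

/-- The local ring of the closed point `f = g = 0` of `Spec ℂ[f, g]`. -/
def origin (f g : K) : LocalSubring K := localizationAt (coordRing f g) {f, g}

/-- The local ring of the generic point of the curve `f = 0` of `Spec ℂ[f, g]`. -/
def axis (f g : K) : LocalSubring K := localizationAt (coordRing f g) {f}

/-- The pair `(f, g)` is a birational coordinate system: `f, g` are algebraically independent and
`K = ℂ(f, g)`. -/
def IsBirationalChart (f g : K) : Prop :=
  AlgebraicIndependent ℂ ![f, g] ∧ IntermediateField.adjoin ℂ {f, g} = ⊤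

/-- The rational two-form `df ∧ dg`. -/
def twoForm (f g : K) : ⋀[K]^2 (Ω[K⁄ℂ]) :=
  exteriorPower.ιMulti K 2 ![KaehlerDifferential.D ℂ K f, KaehlerDifferential.D ℂ K g]

/-- The two-form `df ∧ dg` has order `n` along the curve `C` of the smooth surface `X`: one has
`df ∧ dg = h du ∧ dv` where `u, v` are local coordinates at some closed point of `C` (generators of
its maximal ideal) and `h` has order `n` along `C`. -/
def IsFormOrd (X : Model K) (f g : K) (C : LocalSubring K) (n : ℤ) : Prop :=
  ∃ p, IsClosedPoint X p ∧ LiesOn p C ∧ ∃ u v : p.toSubring,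
    IsLocalRing.maximalIdeal p.toSubring = Ideal.span {u, v} ∧
    ∃ h : K, twoForm f g = h • twoForm (u : K) (v : K) ∧ IsOrd C h n

/-- `C` is a smooth rational curve of the smooth surface `X`: at each of its points its ideal is not
contained in the square of the maximal ideal, and its function field is generated over `ℂ` by one
element. -/
def IsSmoothRationalCurve (X : Model K) (C : LocalSubring K) : Prop :=
  C ∈ curves X ∧
  (∀ p, IsClosedPoint X p → LiesOn p C →
    ∃ a ∈ curveIdeal p C, a ∉ IsLocalRing.maximalIdeal p.toSubring ^ 2) ∧
  ∃ z : IsLocalRing.ResidueField C.toSubring,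
    Subfield.closure ({z} ∪ {w | ∃ c : C.toSubring, (c : K) ∈ Set.range (algebraMap ℂ K) ∧
      w = IsLocalRing.residue C.toSubring c}) = ⊤

/-- The components `D i` (`i ∈ ι`) and the multiplicities `m i` form an anticanonical divisor
`∑ m i D i` of the complete smooth surface `X`, with smooth rational components and intersection
matrix `M`.  Here `f, g` are functions such that `- div (df ∧ dg) = ∑ m i D i`. -/
structure IsAnticanonicalConfiguration {ι : Type*} (X : Model K) (f g : K)
    (D : ι → LocalSubring K) (m : ι → ℤ) (M : Matrix ι ι ℤ) : Prop where
  injective : Function.Injective D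
  smoothRational : ∀ i, IsSmoothRationalCurve X (D i)
  selfInter : ∀ i, HasSelfInter X (D i) (M i i)
  inter_eq : ∀ i j, i ≠ j → inter X (D i) (D j) = M i j
  order_component : ∀ i, IsFormOrd X f g (D i) (- m i)
  order_other : ∀ C ∈ curves X, C ∉ Set.range D → IsFormOrd X f g C 0

/-- The open complement in `X` of the curves `D i`. -/
def complement {ι : Type*} (X : Model K) (D : ι → LocalSubring K) : Model K :=
  {p | p ∈ X ∧ ∀ i, ¬ LiesOn p (D i)}

end Models

/-- Minus the generalized Cartan matrix of type `D₆⁽¹⁾`: the nodes `0, 1` are joined to `2`, the nodes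
`2, 3, 4` form a chain and the nodes `5, 6` are joined to `4`. -/
def matrixD6 : Matrix (Fin 7) (Fin 7) ℤ :=
  !![-2, 0, 1, 0, 0, 0, 0;
      0, -2, 1, 0, 0, 0, 0;
      1, 1, -2, 1, 0, 0, 0;
      0, 0, 1, -2, 1, 0, 0;
      0, 0, 0, 1, -2, 1, 1;
      0, 0, 0, 0, 1, -2, 0;
      0, 0, 0, 0, 1, 0, -2]

/-- The coefficients of the null root of `D₆⁽¹⁾`. -/
def nullRootD6 : Fin 7 → ℤ := ![1, 1, 2, 2, 2, 1, 1]

/-! ### The system Ince-XII -/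

/-- The field `ℂ(x, y)`. -/
abbrev K := FractionRing (MvPolynomial (Fin 2) ℂ)

/-- The function `x`. -/
def x : K := algebraMap (MvPolynomial (Fin 2) ℂ) K (MvPolynomial.X 0)

/-- The function `y`. -/
def y : K := algebraMap (MvPolynomial (Fin 2) ℂ) K (MvPolynomial.X 1)

/-- A complex number as a constant function. -/
abbrev const (c : ℂ) : K := algebraMap ℂ K c

/-- The Hamiltonian `x²y²/2 - (α/2) x² - (γ/δ) x y + δ y - β x`; the variable `X 0` is `x` and `X 1`
is `y`. -/
def hamiltonian (α β γ δ : ℂ) : MvPolynomial (Fin 2) ℂ :=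
  let X : MvPolynomial (Fin 2) ℂ := MvPolynomial.X 0
  let Y : MvPolynomial (Fin 2) ℂ := MvPolynomial.X 1
  MvPolynomial.C (1 / 2) * X ^ 2 * Y ^ 2 - MvPolynomial.C (α / 2) * X ^ 2
    - MvPolynomial.C (γ / δ) * X * Y + MvPolynomial.C δ * Y - MvPolynomial.C β * X

/-- The coordinate functions `x₀, x₁, x₂, x₃`. -/
def chartX : Fin 4 → K := ![x, 1 / x, 1 / x, x]

/-- The coordinate functions `y₀, y₁, y₂, y₃`; the number `s` is the chosen square root of `α`. -/
def chartY (s β γ δ : ℂ) : Fin 4 → K :=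
  ![y,
    -(((y - const s) * x - const ((s * γ + β * δ) / (s * δ))) * x),
    -(((y + const s) * x - const ((s * γ - β * δ) / (s * δ))) * x),
    y - const (2 * γ / δ) / x + const (2 * δ) / x ^ 2]

/-- The ten points blown up, starting from the projective plane with affine coordinates `(x, y)`. -/
def centers (s β γ δ : ℂ) : List (LocalSubring K) :=
  [origin (1 / x) (y / x),
   origin (1 / x) (y - const s),
   origin (1 / x) ((y - const s) * x - const ((s * γ + β * δ) / (s * δ))),
   origin (1 / x) (y + const s),
   origin (1 / x) ((y + const s) * x - const ((s * γ - β * δ) / (s * δ))),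
   origin (x / y) (1 / y),
   origin x (1 / y),
   origin x (1 / (x * y)),
   origin x (x ^ 2 * y + const (2 * δ)),
   origin x ((x ^ 2 * y + const (2 * δ)) / x - const (2 * γ / δ))]

/-- The nine points blown up, starting from the projective plane with affine coordinates
`(x, w)`, `w = 1 / (y - s)`. -/
def centers' (s β γ δ : ℂ) : List (LocalSubring K) :=
  [origin (1 / x) ((1 / (y - const s)) / x),
   origin (x * (y - const s)) (y - const s),
   origin (1 / x) ((y - const s) * x - const ((s * γ + β * δ) / (s * δ))),
   origin (1 / x) (y + const s),
   origin (1 / x) ((y + const s) * x - const ((s * γ - β * δ) / (s * δ))),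
   origin x (1 / y),
   origin x (1 / (x * y)),
   origin x (x ^ 2 * y + const (2 * δ)),
   origin x ((x ^ 2 * y + const (2 * δ)) / x - const (2 * γ / δ))]

/-- The line at infinity of the projective plane with affine coordinates `(x, y)`. -/
def lineAtInfinity : LocalSubring K := axis (1 / x) (y / x)

/-- The closed point with coordinates `(a, b)` of the plane with the coordinate functions `f, g`. -/
def chartPoint (f g : K) (a b : ℂ) : LocalSubring K := origin (f - const a) (g - const b)

/-- `φ` is a holomorphic solution, defined on all of the `t`-plane, of the Hamiltonian system that is
given in the chart with coordinate functions `X j, Y j` by the polynomial Hamiltonian `H j`: near each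
time there are a chart and holomorphic functions `ξ, η` such that `φ t` is the point of this chart with
coordinates `(ξ t, η t)` and `ξ' = ∂H/∂y`, `η' = - ∂H/∂x`. -/
def IsGlobalSolution {ι : Type*} (X Y : ι → K) (H : ι → MvPolynomial (Fin 2) ℂ)
    (φ : ℂ → LocalSubring K) : Prop :=
  ∀ t₁ : ℂ, ∃ (j : ι) (ξ η : ℂ → ℂ), ∀ᶠ t in nhds t₁,
    φ t = chartPoint (X j) (Y j) (ξ t) (η t) ∧
    HasDerivAt ξ (MvPolynomial.eval ![ξ t, η t] (MvPolynomial.pderiv 1 (H j))) t ∧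
    HasDerivAt η (- MvPolynomial.eval ![ξ t, η t] (MvPolynomial.pderiv 0 (H j))) t

end

end InceXII

open InceXII

/-! A point is its local ring, and such a ring is known once it is known which functions vanish
there (`Vanishes`). In a chart `(f, g)` every element of `ℂ[f, g]` is `f b + q(g)` with a unique
polynomial `q`; it vanishes along the axis `f = 0` iff `q = 0`, and at the origin iff `q(0) = 0`. As
`ℂ` is algebraically closed, the points of the plane with `f = 0` are the axis and the closed points
`g = b` (`eq_axis_or_origin`), and the points above a blown-up origin lie in the charts `(f, g / f)`
and `(f / g, g)` (`mem_exceptional`). The valuative form of separatedness survives blow-ups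
(`IsSeparatedModel.blowUp`); it turns domination into equality and so identifies points by the
values of coordinate functions.

Both constructions pass through `ℙ¹ × ℙ¹`. The plane blown up at its two coordinate points at
infinity is the quadric blown up at the corner `1/x = 1/y = 0`, and the line at infinity is the
exceptional curve (`blowUp_projectivePlane`). The other eight centers are incomparable with the
corner, so the corner can be blown up last: `𝒵` is the blow-up at the corner of `𝒳`, the quadric
blown up at eight points. With `w = 1 / (y - s)` instead of `y`, the corner of the quadric is the
first of these eight centers, so the same identity gives `𝒳` by nine blow-ups and no contraction.

Outside the open set `x ≠ 0, ∞`, `y ≠ ∞` the surface consists of eleven special curves, which meet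
transversally in ten corners. Intersection numbers count corners, the self-intersections of the
seven components follow from the divisors of `x`, `1/x` and `1/y`, and the order of `dx ∧ dy` is
read off from a Jacobian in a chart of each curve. The form has poles exactly along the seven
components. Without them there remain the `(x, y)`-plane and the affine pieces of the last three
exceptional curves, which are the other three charts.

The relation `c r = (γ/δ) r + β`, for `r = ± s` with `c` the matching `c_±`, is what cancels the
poles of `H` in the charts at `x = ∞`; in the chart at `x = 0` the Hamiltonian has its old form with
`γ/δ` and `δ` replaced by their negatives.

Solutions are global because `H` is a first integral and each of its level sets is covered by
bounded parts of the four charts (`exists_norm_le_of_energy_eq`). For `|x| ≤ 1` the product of `x y`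
and `x y₃` is bounded on a level set, so one of the factors is; for `|x| ≥ 1` the quantity `(y² - α)
x` is bounded, so one of `(y ∓ s) x` is. In either case the Hamiltonian bounds the second coordinate
of a suitable chart. Picard iteration then has one radius for the whole level set, and running the
flow twice for half the time doubles the disc again and again (`exists_isSolutionOn_double`).
Uniqueness combines local uniqueness with the closedness of the gluing relation, that is, with the
Hausdorff property. -/

namespace InceXII

/-! ### Local rings of points and localizations -/

section LocalRings

variable {K : Type*} [Field K]

/-- The function `z` is regular at the point `S` and vanishes there. -/
def Vanishes (S : LocalSubring K) (z : K) : Prop :=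
  ∃ h : z ∈ S.toSubring, (⟨z, h⟩ : S.toSubring) ∈ IsLocalRing.maximalIdeal S.toSubring

theorem isUnit_mk_iff {R : Subring K} {z : K} (h : z ∈ R) :
    IsUnit (⟨z, h⟩ : R) ↔ z ≠ 0 ∧ z⁻¹ ∈ R := by
  constructor
  · rintro ⟨u, hu⟩
    have h1 : z * ((u⁻¹ : Rˣ) : R) = 1 := by
      have := congrArg Subtype.val u.mul_inv
      simpa [hu] using this
    have hz : z ≠ 0 := left_ne_zero_of_mul_eq_one h1
    refine ⟨hz, ?_⟩
    rw [← eq_inv_of_mul_eq_one_right h1]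
    exact ((u⁻¹ : Rˣ) : R).2
  · rintro ⟨h0, h1⟩
    exact IsUnit.of_mul_eq_one ⟨z⁻¹, h1⟩ (Subtype.ext (mul_inv_cancel₀ h0))

/-- Vanishing expressed by membership alone. The case `z = 0` is separate because `0⁻¹ = 0` does
belong to the ring. -/
theorem vanishes_iff {S : LocalSubring K} {z : K} :
    Vanishes S z ↔ z ∈ S.toSubring ∧ (z = 0 ∨ z⁻¹ ∉ S.toSubring) := by
  constructor
  · rintro ⟨h, hz⟩
    refine ⟨h, ?_⟩
    rw [IsLocalRing.mem_maximalIdeal, mem_nonunits_iff, isUnit_mk_iff] at hz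
    tauto
  · rintro ⟨h, hz⟩
    refine ⟨h, ?_⟩
    rw [IsLocalRing.mem_maximalIdeal, mem_nonunits_iff, isUnit_mk_iff]
    tauto

theorem vanishes_mk_iff {S : LocalSubring K} (z : S.toSubring) :
    Vanishes S (z : K) ↔ z ∈ IsLocalRing.maximalIdeal S.toSubring :=
  ⟨fun h => h.2, fun h => ⟨z.2, h⟩⟩

theorem vanishes_zero (S : LocalSubring K) : Vanishes S 0 :=
  vanishes_iff.2 ⟨zero_mem _, Or.inl rfl⟩

theorem not_vanishes_of_inv_mem {S : LocalSubring K} {z : K} (h0 : z ≠ 0)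
    (h : z⁻¹ ∈ S.toSubring) : ¬ Vanishes S z := by
  rw [vanishes_iff]; tauto

theorem not_vanishes_one (S : LocalSubring K) : ¬ Vanishes S 1 :=
  not_vanishes_of_inv_mem one_ne_zero (by simp [one_mem])

theorem inv_mem_of_not_vanishes {S : LocalSubring K} {z : K} (h : z ∈ S.toSubring)
    (hv : ¬ Vanishes S z) : z⁻¹ ∈ S.toSubring := by
  rw [vanishes_iff] at hv; tauto

theorem ne_zero_of_not_vanishes {S : LocalSubring K} {z : K} (hv : ¬ Vanishes S z) : z ≠ 0 := by
  rintro rfl; exact hv (vanishes_zero S)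

theorem inv_notMem_of_vanishes {S : LocalSubring K} {z : K} (h : Vanishes S z) (h0 : z ≠ 0) :
    z⁻¹ ∉ S.toSubring := by
  rw [vanishes_iff] at h; tauto

theorem Vanishes.add {S : LocalSubring K} {z w : K} (hz : Vanishes S z) (hw : Vanishes S w) :
    Vanishes S (z + w) :=
  ⟨add_mem hz.1 hw.1, Ideal.add_mem _ hz.2 hw.2⟩

theorem Vanishes.mul_left {S : LocalSubring K} {z w : K} (hz : z ∈ S.toSubring)
    (hw : Vanishes S w) : Vanishes S (z * w) :=
  ⟨mul_mem hz hw.1, Ideal.mul_mem_left _ ⟨z, hz⟩ hw.2⟩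

theorem Vanishes.mul_right {S : LocalSubring K} {z w : K} (hz : z ∈ S.toSubring)
    (hw : Vanishes S w) : Vanishes S (w * z) := mul_comm z w ▸ hw.mul_left hz

theorem Vanishes.neg {S : LocalSubring K} {z : K} (hz : Vanishes S z) : Vanishes S (-z) := by
  simpa using hz.mul_left (z := -1) (neg_mem (one_mem _))

theorem Vanishes.sub {S : LocalSubring K} {z w : K} (hz : Vanishes S z) (hw : Vanishes S w) :
    Vanishes S (z - w) := by
  simpa [sub_eq_add_neg] using hz.add hw.neg

theorem vanishes_mul_iff {S : LocalSubring K} {z w : K} (hz : z ∈ S.toSubring)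
    (hw : w ∈ S.toSubring) : Vanishes S (z * w) ↔ Vanishes S z ∨ Vanishes S w := by
  constructor
  · intro h
    rcases (inferInstance : (IsLocalRing.maximalIdeal S.toSubring).IsPrime).mem_or_mem
      (show (⟨z, hz⟩ : S.toSubring) * ⟨w, hw⟩ ∈ _ from h.2) with h | h
    · exact Or.inl ⟨hz, h⟩
    · exact Or.inr ⟨hw, h⟩
  · rintro (h | h)
    · exact h.mul_right hw
    · exact h.mul_left hz

theorem vanishes_add_iff_right {S : LocalSubring K} {z w : K} (hz : Vanishes S z) :
    Vanishes S (z + w) ↔ Vanishes S w :=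
  ⟨fun h => by simpa using h.sub hz, fun h => hz.add h⟩

/-- A local homomorphism is one that sends nonunits to nonunits; in this form domination can be
tested on functions. -/
theorem localSubring_le_iff {S T : LocalSubring K} :
    S ≤ T ↔ S.toSubring ≤ T.toSubring ∧ ∀ z, Vanishes S z → Vanishes T z := by
  rw [LocalSubring.le_def]
  constructor
  · rintro ⟨h, hl⟩
    refine ⟨h, fun z hz => ?_⟩
    rw [vanishes_iff] at hz ⊢
    refine ⟨h hz.1, ?_⟩
    rcases hz.2 with h0 | h1
    · exact Or.inl h0
    · by_cases h0 : z = 0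
      · exact Or.inl h0
      refine Or.inr fun h2 => h1 ?_
      have h3 : IsUnit (Subring.inclusion h ⟨z, hz.1⟩) := (isUnit_mk_iff (h hz.1)).2 ⟨h0, h2⟩
      exact ((isUnit_mk_iff hz.1).1 (hl.map_nonunit _ h3)).2
  · rintro ⟨h, hv⟩
    refine ⟨h, ⟨fun a ha => ?_⟩⟩
    by_contra hn
    have h1 : Vanishes S (a : K) := (vanishes_mk_iff a).2 hn
    exact (hv _ h1).2 ha

theorem vanishes_iff_of_le {S T : LocalSubring K} (h : S ≤ T) {z : K} (hz : z ∈ S.toSubring) :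
    Vanishes T z ↔ Vanishes S z := by
  rw [localSubring_le_iff] at h
  refine ⟨fun hT => ?_, h.2 z⟩
  by_contra hS
  exact inv_notMem_of_vanishes hT (ne_zero_of_not_vanishes hS) (h.1 (inv_mem_of_not_vanishes hz hS))

/-- `S` is the localization of the subring `A` at a prime ideal. -/
def IsLoc (A : Subring K) (S : LocalSubring K) : Prop :=
  A ≤ S.toSubring ∧ ∀ z ∈ S.toSubring, ∃ a ∈ A, ∃ b ∈ A, ¬ Vanishes S b ∧ z = a / b

theorem isLoc_ofPrime (A : Subring K) (P : Ideal A) [P.IsPrime] :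
    IsLoc A (LocalSubring.ofPrime A P) := by
  refine ⟨LocalSubring.le_ofPrime A P, fun z hz => ?_⟩
  obtain ⟨a, b, h⟩ := IsLocalization.exists_mk'_eq P.primeCompl
    (⟨z, hz⟩ : (LocalSubring.ofPrime A P).toSubring)
  have hb : ¬ Vanishes (LocalSubring.ofPrime A P) ((b : A) : K) := fun hv =>
    hv.2 (IsLocalization.map_units (LocalSubring.ofPrime A P).toSubring b)
  refine ⟨a, a.2, b, (b : A).2, hb, ?_⟩
  rw [eq_div_iff (ne_zero_of_not_vanishes hb)]
  rw [IsLocalization.mk'_eq_iff_eq_mul] at h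
  exact (congrArg Subtype.val h).symm

theorem vanishes_ofPrime (A : Subring K) (P : Ideal A) [P.IsPrime] (a : A) :
    Vanishes (LocalSubring.ofPrime A P) (a : K) ↔ a ∈ P := by
  rw [← IsLocalization.AtPrime.to_map_mem_maximal_iff (LocalSubring.ofPrime A P).toSubring P a]
  exact ⟨fun h => h.2, fun h => ⟨_, h⟩⟩

/-- A denominator that is a unit at `S` cannot vanish at `T`, so each fraction in `S` is already a
fraction in `T`. -/
theorem IsLoc.le_of_vanishes {A : Subring K} {S T : LocalSubring K} (hS : IsLoc A S)
    (hA : A ≤ T.toSubring) (h : ∀ a ∈ A, Vanishes T a → Vanishes S a) :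
    S.toSubring ≤ T.toSubring := by
  intro z hz
  obtain ⟨a, ha, b, hb, hv, rfl⟩ := hS.2 z hz
  rw [div_eq_mul_inv]
  exact mul_mem (hA ha) (inv_mem_of_not_vanishes (hA hb) fun h' => hv (h b hb h'))

theorem IsLoc.ext {A : Subring K} {S T : LocalSubring K} (hS : IsLoc A S) (hT : IsLoc A T)
    (h : ∀ a ∈ A, Vanishes S a ↔ Vanishes T a) : S = T :=
  LocalSubring.toSubring_injective (le_antisymm
    (hS.le_of_vanishes hT.1 fun a ha => (h a ha).2) (hT.le_of_vanishes hS.1 fun a ha => (h a ha).1))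

theorem IsLoc.le {A : Subring K} {S T : LocalSubring K} (hS : IsLoc A S) (hA : A ≤ T.toSubring)
    (h : ∀ a ∈ A, Vanishes T a ↔ Vanishes S a) : S ≤ T := by
  have hle := hS.le_of_vanishes hA fun a ha => (h a ha).1
  refine localSubring_le_iff.2 ⟨hle, fun z hz => ?_⟩
  obtain ⟨a, ha, b, hb, hv, rfl⟩ := hS.2 z hz.1
  have hb' := inv_mem_of_not_vanishes (hS.1 hb) hv
  have : Vanishes S a := by
    have := hz.mul_right (hS.1 hb)
    rwa [div_mul_cancel₀ _ (ne_zero_of_not_vanishes hv)] at this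
  rw [div_eq_mul_inv]
  exact ((h a ha).2 this).mul_right (hle hb')

/-- Separatedness of an affine variety: both prime ideals consist of the elements of `A` that vanish
at `T`. -/
theorem IsLoc.eq_of_le {A : Subring K} {S S' T : LocalSubring K} (hS : IsLoc A S)
    (hS' : IsLoc A S') (h : S ≤ T) (h' : S' ≤ T) : S = S' :=
  hS.ext hS' fun a ha => by
    rw [← vanishes_iff_of_le h (hS.1 ha), vanishes_iff_of_le h' (hS'.1 ha)]

/-- The center of a local ring on `Spec A`. -/
theorem exists_isLoc_le {A : Subring K} {T : LocalSubring K} (hA : A ≤ T.toSubring) :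
    ∃ S, IsLoc A S ∧ S ≤ T := by
  let P := (IsLocalRing.maximalIdeal T.toSubring).comap (Subring.inclusion hA)
  have hP : P.IsPrime := Ideal.comap_isPrime _ _
  refine ⟨LocalSubring.ofPrime A P, isLoc_ofPrime A P, (isLoc_ofPrime A P).le hA fun a ha => ?_⟩
  rw [vanishes_ofPrime A P ⟨a, ha⟩]
  exact ⟨fun h => h.2, fun h => ⟨hA ha, h⟩⟩

theorem isLoc_iff {A : Subring K} {S : LocalSubring K} :
    IsLoc A S ↔ ∃ (P : Ideal A) (_ : P.IsPrime), S = LocalSubring.ofPrime A P := by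
  constructor
  · intro hS
    let P := (IsLocalRing.maximalIdeal S.toSubring).comap (Subring.inclusion hS.1)
    have hP : P.IsPrime := Ideal.comap_isPrime _ _
    refine ⟨P, hP, hS.ext (isLoc_ofPrime A P) fun a ha => ?_⟩
    rw [vanishes_ofPrime A P ⟨a, ha⟩]
    exact ⟨fun h => h.2, fun h => ⟨hS.1 ha, h⟩⟩
  · rintro ⟨P, hP, rfl⟩
    exact isLoc_ofPrime A P

/-- The fractions `a / b` with `a, b ∈ A` and `b` a unit at `S`. -/
def fractions (A : Subring K) (S : LocalSubring K) (hA : A ≤ S.toSubring) : Subring K where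
  carrier := {z | ∃ a ∈ A, ∃ b ∈ A, ¬ Vanishes S b ∧ z = a / b}
  zero_mem' := ⟨0, zero_mem _, 1, one_mem _, not_vanishes_one S, by simp⟩
  one_mem' := ⟨1, one_mem _, 1, one_mem _, not_vanishes_one S, by simp⟩
  add_mem' := by
    rintro _ _ ⟨a, ha, b, hb, hv, rfl⟩ ⟨c, hc, d, hd, hw, rfl⟩
    refine ⟨a * d + b * c, add_mem (mul_mem ha hd) (mul_mem hb hc), b * d, mul_mem hb hd, ?_,
      div_add_div _ _ (ne_zero_of_not_vanishes hv) (ne_zero_of_not_vanishes hw)⟩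
    rw [vanishes_mul_iff (hA hb) (hA hd)]; tauto
  mul_mem' := by
    rintro _ _ ⟨a, ha, b, hb, hv, rfl⟩ ⟨c, hc, d, hd, hw, rfl⟩
    refine ⟨a * c, mul_mem ha hc, b * d, mul_mem hb hd, ?_, div_mul_div_comm _ _ _ _⟩
    rw [vanishes_mul_iff (hA hb) (hA hd)]; tauto
  neg_mem' := by
    rintro _ ⟨a, ha, b, hb, hv, rfl⟩
    exact ⟨-a, neg_mem ha, b, hb, hv, by ring⟩

theorem mem_fractions {A : Subring K} {S : LocalSubring K} (hA : A ≤ S.toSubring) {z : K} :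
    z ∈ fractions A S hA ↔ ∃ a ∈ A, ∃ b ∈ A, ¬ Vanishes S b ∧ z = a / b := Iff.rfl

theorem le_fractions {A : Subring K} {S : LocalSubring K} (hA : A ≤ S.toSubring) :
    A ≤ fractions A S hA :=
  fun a ha => ⟨a, ha, 1, one_mem _, not_vanishes_one S, by simp⟩

theorem inv_mem_fractions {A : Subring K} {S : LocalSubring K} (hA : A ≤ S.toSubring) {z : K}
    (hz : z ∈ fractions A S hA) (hv : ¬ Vanishes S z) : z⁻¹ ∈ fractions A S hA := by
  obtain ⟨a, ha, b, hb, hw, rfl⟩ := hz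
  refine ⟨b, hb, a, ha, fun h => hv ?_, by simp⟩
  rw [div_eq_mul_inv]
  exact h.mul_right (inv_mem_of_not_vanishes (hA hb) hw)

/-- The device for all changes of chart: it suffices to write the generators of `A` as fractions of
`B` whose denominators are units at `S`. -/
theorem IsLoc.trans {A B : Subring K} {S : LocalSubring K} (hS : IsLoc A S)
    (hB : B ≤ S.toSubring) (h : A ≤ fractions B S hB) : IsLoc B S := by
  refine ⟨hB, fun z hz => (mem_fractions hB).1 ?_⟩
  obtain ⟨a, ha, b, hb, hv, rfl⟩ := hS.2 z hz
  exact div_eq_mul_inv a b ▸ mul_mem (h ha) (inv_mem_fractions hB (h hb) hv)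

theorem IsLoc.of_le {A B : Subring K} {S : LocalSubring K} (hS : IsLoc A S)
    (hB : B ≤ S.toSubring) (h : A ≤ B) : IsLoc B S :=
  hS.trans hB (h.trans (le_fractions hB))

/-- `b` is associated to a power of the uniformizer, and the uniformizer divides `w`. -/
theorem exists_pow_mul_eq {C : LocalSubring K} [IsDiscreteValuationRing C.toSubring]
    {w b : C.toSubring} (hw : w ∈ IsLocalRing.maximalIdeal C.toSubring) (hb : b ≠ 0) :
    ∃ (n : ℕ) (c : C.toSubring), w ^ n = b * c := by
  obtain ⟨p, hp⟩ := IsDiscreteValuationRing.exists_irreducible C.toSubring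
  obtain ⟨n, hn⟩ := IsDiscreteValuationRing.associated_pow_irreducible hb hp
  rw [hp.maximalIdeal_eq, Ideal.mem_span_singleton] at hw
  exact ⟨n, hn.dvd.trans (pow_dvd_pow_of_dvd hw n)⟩

theorem not_vanishes_of_le {S T : LocalSubring K} (h : S ≤ T) {z : K} (h0 : z ≠ 0)
    (hT : z⁻¹ ∈ T.toSubring) : ¬ Vanishes S z := fun hv =>
  not_vanishes_of_inv_mem h0 hT ((localSubring_le_iff.1 h).2 z hv)

end LocalRings
end InceXII

namespace InceXII

/-! ### Birational charts -/

section Charts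

variable {K : Type*} [Field K] [Algebra ℂ K] {f g f' g' : K}

/-- Generators of `K` make `K` algebraic over `ℂ[f', g']`. Since the transcendence degree is at
least two, two such elements form a transcendence basis. -/
theorem IsBirationalChart.of_adjoin_eq_top (h : IsBirationalChart f g)
    (h' : IntermediateField.adjoin ℂ {f', g'} = ⊤) : IsBirationalChart f' g' := by
  refine ⟨?_, h'⟩
  have hr : Set.range ![f', g'] = {f', g'} := by simp [Set.pair_comm]
  have halg : Algebra.IsAlgebraic (Algebra.adjoin ℂ (Set.range ![f', g'])) K := by
    rw [hr]
    refine ⟨fun z => ?_⟩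
    have hz : z ∈ IntermediateField.adjoin ℂ {f', g'} := h' ▸ IntermediateField.mem_top
    obtain ⟨a, ha, b, hb, rfl⟩ := (IntermediateField.mem_adjoin_iff_div).1 hz
    have h1 : IsAlgebraic (Algebra.adjoin ℂ {f', g'}) a :=
      isAlgebraic_algebraMap (⟨a, ha⟩ : Algebra.adjoin ℂ {f', g'})
    have h2 : IsAlgebraic (Algebra.adjoin ℂ {f', g'}) b :=
      isAlgebraic_algebraMap (⟨b, hb⟩ : Algebra.adjoin ℂ {f', g'})
    rw [div_eq_mul_inv]
    exact h1.mul h2.inv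
  exact (Algebra.IsAlgebraic.isTranscendenceBasis_of_lift_le_trdeg_of_finite ℂ ![f', g']
    h.1.lift_cardinalMk_le_trdeg).1

theorem IsBirationalChart.of_mem (h : IsBirationalChart f g)
    (hf : f ∈ IntermediateField.adjoin ℂ {f', g'}) (hg : g ∈ IntermediateField.adjoin ℂ {f', g'}) :
    IsBirationalChart f' g' := by
  refine h.of_adjoin_eq_top (top_le_iff.1 (h.2 ▸ IntermediateField.adjoin_le_iff.2 ?_))
  rintro z (rfl | rfl)
  · exact hf
  · exact hg

theorem left_mem_adjoin (f g : K) : f ∈ IntermediateField.adjoin ℂ {f, g} :=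
  IntermediateField.subset_adjoin _ _ (by simp)

theorem right_mem_adjoin (f g : K) : g ∈ IntermediateField.adjoin ℂ {f, g} :=
  IntermediateField.subset_adjoin _ _ (by simp)

theorem IsBirationalChart.left_ne_zero (h : IsBirationalChart f g) : f ≠ 0 := by
  simpa using h.1.ne_zero 0

theorem IsBirationalChart.right_ne_zero (h : IsBirationalChart f g) : g ≠ 0 := by
  simpa using h.1.ne_zero 1

theorem IsBirationalChart.swap (h : IsBirationalChart f g) : IsBirationalChart g f :=
  h.of_mem (right_mem_adjoin _ _) (left_mem_adjoin _ _)

theorem IsBirationalChart.sub_const (h : IsBirationalChart f g) (c : ℂ) :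
    IsBirationalChart f (g - algebraMap ℂ K c) :=
  h.of_mem (left_mem_adjoin _ _) (by
    simpa using add_mem (right_mem_adjoin f (g - algebraMap ℂ K c))
      (IntermediateField.algebraMap_mem _ c))

theorem IsBirationalChart.add_const (h : IsBirationalChart f g) (c : ℂ) :
    IsBirationalChart f (g + algebraMap ℂ K c) := by
  simpa using h.sub_const (-c)

theorem IsBirationalChart.inv_right (h : IsBirationalChart f g) : IsBirationalChart f (1 / g) :=
  h.of_mem (left_mem_adjoin _ _) (by simpa using inv_mem (right_mem_adjoin f (1 / g)))

theorem IsBirationalChart.inv_left (h : IsBirationalChart f g) : IsBirationalChart (1 / f) g :=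
  h.swap.inv_right.swap

theorem IsBirationalChart.div_right (h : IsBirationalChart f g) : IsBirationalChart f (g / f) :=
  h.of_mem (left_mem_adjoin _ _) (by
    have := mul_mem (left_mem_adjoin f (g / f)) (right_mem_adjoin f (g / f))
    rwa [mul_div_cancel₀ _ h.left_ne_zero] at this)

theorem IsBirationalChart.div_left (h : IsBirationalChart f g) : IsBirationalChart (f / g) g :=
  h.swap.div_right.swap

theorem IsBirationalChart.mul_right (h : IsBirationalChart f g) : IsBirationalChart f (g * f) := by
  refine h.of_mem (left_mem_adjoin _ _) ?_
  have := div_mem (right_mem_adjoin f (g * f)) (left_mem_adjoin f (g * f))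
  rwa [mul_div_cancel_right₀ _ h.left_ne_zero] at this

/-! ### The coordinate ring of an affine plane -/

theorem mem_affinePlane {S : LocalSubring K} :
    S ∈ affinePlane f g ↔ IsLoc (coordRing f g) S := isLoc_iff.symm

theorem algebraMap_mem_coordRing (c : ℂ) : algebraMap ℂ K c ∈ coordRing f g :=
  (Algebra.adjoin ℂ {f, g}).algebraMap_mem c

theorem left_mem_coordRing : f ∈ coordRing f g := Algebra.subset_adjoin (by simp)

theorem right_mem_coordRing : g ∈ coordRing f g := Algebra.subset_adjoin (by simp)

theorem coordRing_le {R : Subring K} (hc : ∀ c, algebraMap ℂ K c ∈ R) (hf : f ∈ R) (hg : g ∈ R) :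
    coordRing f g ≤ R := by
  intro z hz
  refine Algebra.adjoin_induction (p := fun z _ => z ∈ R) ?_ hc (fun _ _ _ _ => add_mem)
    (fun _ _ _ _ => mul_mem) hz
  rintro z (rfl | rfl)
  · exact hf
  · exact hg

theorem coordRing_comm : coordRing f g = coordRing g f := by
  rw [coordRing, coordRing, Set.pair_comm]

theorem coordRing_sub_const (c : ℂ) : coordRing f (g - algebraMap ℂ K c) = coordRing f g :=
  le_antisymm
    (coordRing_le algebraMap_mem_coordRing left_mem_coordRing
      (sub_mem right_mem_coordRing (algebraMap_mem_coordRing c)))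
    (coordRing_le algebraMap_mem_coordRing left_mem_coordRing (by
      simpa using add_mem (right_mem_coordRing (f := f) (g := g - algebraMap ℂ K c))
        (algebraMap_mem_coordRing c)))

theorem aeval_mem_coordRing (q : Polynomial ℂ) : Polynomial.aeval g q ∈ coordRing f g :=
  (Algebra.adjoin_mono (by simp) : Algebra.adjoin ℂ {g} ≤ Algebra.adjoin ℂ {f, g})
    (Polynomial.aeval_mem_adjoin_singleton ℂ g)

/-- Normal form modulo `f`. All questions about the axis `f = 0` and the origin reduce to the
one-variable polynomial `q`. -/
theorem exists_eq_mul_add_aeval {a : K} (ha : a ∈ coordRing f g) :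
    ∃ b ∈ coordRing f g, ∃ q : Polynomial ℂ, a = f * b + Polynomial.aeval g q := by
  refine Algebra.adjoin_induction (p := fun a _ => ∃ b ∈ coordRing f g, ∃ q : Polynomial ℂ,
    a = f * b + Polynomial.aeval g q) ?_ ?_ ?_ ?_ ha
  · rintro z (rfl | rfl)
    · exact ⟨1, one_mem _, 0, by simp⟩
    · exact ⟨0, zero_mem _, Polynomial.X, by simp⟩
  · exact fun c => ⟨0, zero_mem _, Polynomial.C c, by simp⟩
  · rintro _ _ _ _ ⟨b, hb, q, rfl⟩ ⟨b', hb', q', rfl⟩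
    exact ⟨b + b', add_mem hb hb', q + q', by simp; ring⟩
  · rintro _ _ _ _ ⟨b, hb, q, rfl⟩ ⟨b', hb', q', rfl⟩
    refine ⟨b * (f * b') + b * Polynomial.aeval g q' + Polynomial.aeval g q * b',
      add_mem (add_mem (mul_mem hb (mul_mem left_mem_coordRing hb'))
        (mul_mem hb (aeval_mem_coordRing q'))) (mul_mem (aeval_mem_coordRing q) hb'),
      q * q', by simp; ring⟩

/-- Uniqueness of the normal form: algebraic independence lifts the relation to the polynomial ring,
where the first variable is set to zero. -/
theorem IsBirationalChart.eq_zero_of_mul_add_aeval (h : IsBirationalChart f g) {b : K}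
    (hb : b ∈ coordRing f g) {q : Polynomial ℂ} (hq : f * b + Polynomial.aeval g q = 0) : q = 0 := by
  have hb' : b ∈ Algebra.adjoin ℂ (Set.range ![f, g]) := by
    have : Set.range ![f, g] = {f, g} := by simp [Set.pair_comm]
    rw [this]; exact hb
  rw [Algebra.adjoin_range_eq_range_aeval] at hb'
  obtain ⟨P, rfl⟩ := hb'
  have h1 : MvPolynomial.aeval ![f, g]
      (MvPolynomial.X 0 * P + Polynomial.aeval (MvPolynomial.X 1) q) = 0 := by
    rw [map_add, map_mul, ← Polynomial.aeval_algHom_apply]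
    simpa using hq
  have h2 := (injective_iff_map_eq_zero _).1 h.1 _ h1
  have h3 := congrArg (MvPolynomial.aeval ![(0 : Polynomial ℂ), Polynomial.X]) h2
  rw [map_add, map_mul, ← Polynomial.aeval_algHom_apply] at h3
  simpa using h3

/-! ### The points of an affine plane on a coordinate axis -/

theorem setOf_coe_mem_singleton :
    {a : coordRing f g | (a : K) ∈ ({f} : Set K)} = {⟨f, left_mem_coordRing⟩} := by
  ext a; simp [Subtype.ext_iff]

theorem setOf_coe_mem_pair :
    {a : coordRing f g | (a : K) ∈ ({f, g} : Set K)} =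
      {⟨f, left_mem_coordRing⟩, ⟨g, right_mem_coordRing⟩} := by
  ext a; simp [Subtype.ext_iff]

theorem IsBirationalChart.mem_span_left (h : IsBirationalChart f g) {b : K}
    (hb : b ∈ coordRing f g) {q : Polynomial ℂ} (ha : f * b + Polynomial.aeval g q ∈ coordRing f g) :
    (⟨f * b + Polynomial.aeval g q, ha⟩ : coordRing f g) ∈
      Ideal.span {a : coordRing f g | (a : K) ∈ ({f} : Set K)} ↔ q = 0 := by
  rw [setOf_coe_mem_singleton, Ideal.mem_span_singleton']
  constructor
  · rintro ⟨⟨c, hc⟩, h1⟩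
    have h2 : c * f = f * b + Polynomial.aeval g q := congrArg Subtype.val h1
    exact h.eq_zero_of_mul_add_aeval (sub_mem hb hc) (by linear_combination -h2)
  · rintro rfl
    exact ⟨⟨b, hb⟩, Subtype.ext (by simp [mul_comm])⟩

theorem IsBirationalChart.mem_span_pair (h : IsBirationalChart f g) {b : K}
    (hb : b ∈ coordRing f g) {q : Polynomial ℂ} (ha : f * b + Polynomial.aeval g q ∈ coordRing f g) :
    (⟨f * b + Polynomial.aeval g q, ha⟩ : coordRing f g) ∈
      Ideal.span {a : coordRing f g | (a : K) ∈ ({f, g} : Set K)} ↔ q.eval 0 = 0 := by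
  rw [setOf_coe_mem_pair, Ideal.mem_span_pair]
  constructor
  · rintro ⟨⟨c, hc⟩, ⟨d, hd⟩, h1⟩
    have h2 : c * f + d * g = f * b + Polynomial.aeval g q := congrArg Subtype.val h1
    obtain ⟨d', hd', r, rfl⟩ := exists_eq_mul_add_aeval hd
    have := h.eq_zero_of_mul_add_aeval (b := b - c - g * d') (q := q - Polynomial.X * r)
      (sub_mem (sub_mem hb hc) (mul_mem right_mem_coordRing hd'))
      (by simp; linear_combination -h2)
    rw [sub_eq_zero.1 this]; simp
  · intro h0
    obtain ⟨r, rfl⟩ := Polynomial.X_dvd_iff.2 (Polynomial.coeff_zero_eq_eval_zero q ▸ h0)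
    exact ⟨⟨b, hb⟩, ⟨Polynomial.aeval g r, aeval_mem_coordRing r⟩, Subtype.ext (by simp; ring)⟩

/-- The normal form is multiplicative in `q`, so the quotient by `f` behaves as the domain `ℂ[g]`.
-/
theorem IsBirationalChart.isPrime_span_left (h : IsBirationalChart f g) :
    (Ideal.span {a : coordRing f g | (a : K) ∈ ({f} : Set K)}).IsPrime := by
  refine ⟨fun ht => ?_, ?_⟩
  · have h1 := (Ideal.eq_top_iff_one _).1 ht
    have h2 := (h.mem_span_left (zero_mem _) (q := 1) (by simp [one_mem])).1
      (by convert h1 using 1; exact Subtype.ext (by simp))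
    exact one_ne_zero h2
  · rintro ⟨_, ha⟩ ⟨_, ha'⟩ hm
    obtain ⟨b, hb, q, rfl⟩ := exists_eq_mul_add_aeval ha
    obtain ⟨b', hb', q', rfl⟩ := exists_eq_mul_add_aeval ha'
    rw [h.mem_span_left hb, h.mem_span_left hb']
    have h1 : (f * b + Polynomial.aeval g q) * (f * b' + Polynomial.aeval g q') =
        f * (b * (f * b') + b * Polynomial.aeval g q' + Polynomial.aeval g q * b') +
          Polynomial.aeval g (q * q') := by simp; ring
    have hm' := mul_mem ha ha'
    rw [h1] at hm'
    have := (h.mem_span_left (add_mem (add_mem (mul_mem hb (mul_mem left_mem_coordRing hb'))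
        (mul_mem hb (aeval_mem_coordRing q'))) (mul_mem (aeval_mem_coordRing q) hb')) hm').1
      (by convert hm using 1; exact Subtype.ext h1.symm)
    exact mul_eq_zero.1 this

theorem IsBirationalChart.isPrime_span_pair (h : IsBirationalChart f g) :
    (Ideal.span {a : coordRing f g | (a : K) ∈ ({f, g} : Set K)}).IsPrime := by
  refine ⟨fun ht => ?_, ?_⟩
  · have h1 := (Ideal.eq_top_iff_one _).1 ht
    have h2 := (h.mem_span_pair (zero_mem _) (q := 1) (by simp [one_mem])).1
      (by convert h1 using 1; exact Subtype.ext (by simp))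
    simp at h2
  · rintro ⟨_, ha⟩ ⟨_, ha'⟩ hm
    obtain ⟨b, hb, q, rfl⟩ := exists_eq_mul_add_aeval ha
    obtain ⟨b', hb', q', rfl⟩ := exists_eq_mul_add_aeval ha'
    rw [h.mem_span_pair hb, h.mem_span_pair hb']
    have h1 : (f * b + Polynomial.aeval g q) * (f * b' + Polynomial.aeval g q') =
        f * (b * (f * b') + b * Polynomial.aeval g q' + Polynomial.aeval g q * b') +
          Polynomial.aeval g (q * q') := by simp; ring
    have hm' := mul_mem ha ha'
    rw [h1] at hm'
    have := (h.mem_span_pair (add_mem (add_mem (mul_mem hb (mul_mem left_mem_coordRing hb'))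
        (mul_mem hb (aeval_mem_coordRing q'))) (mul_mem (aeval_mem_coordRing q) hb')) hm').1
      (by convert hm using 1; exact Subtype.ext h1.symm)
    rwa [Polynomial.eval_mul, mul_eq_zero] at this

theorem IsBirationalChart.axis_eq (h : IsBirationalChart f g) : axis f g =
    have := h.isPrime_span_left
    LocalSubring.ofPrime (coordRing f g) (Ideal.span {a : coordRing f g | (a : K) ∈ ({f} : Set K)}) :=
  dif_pos h.isPrime_span_left

theorem IsBirationalChart.origin_eq (h : IsBirationalChart f g) : origin f g =
    have := h.isPrime_span_pair
    LocalSubring.ofPrime (coordRing f g)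
      (Ideal.span {a : coordRing f g | (a : K) ∈ ({f, g} : Set K)}) :=
  dif_pos h.isPrime_span_pair

theorem IsBirationalChart.isLoc_axis (h : IsBirationalChart f g) :
    IsLoc (coordRing f g) (axis f g) := by
  have := h.isPrime_span_left
  rw [h.axis_eq]; exact isLoc_ofPrime _ _

theorem IsBirationalChart.isLoc_origin (h : IsBirationalChart f g) :
    IsLoc (coordRing f g) (origin f g) := by
  have := h.isPrime_span_pair
  rw [h.origin_eq]; exact isLoc_ofPrime _ _

theorem IsBirationalChart.vanishes_axis (h : IsBirationalChart f g) {b : K}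
    (hb : b ∈ coordRing f g) (q : Polynomial ℂ) :
    Vanishes (axis f g) (f * b + Polynomial.aeval g q) ↔ q = 0 := by
  have := h.isPrime_span_left
  have ha : f * b + Polynomial.aeval g q ∈ coordRing f g :=
    add_mem (mul_mem left_mem_coordRing hb) (aeval_mem_coordRing q)
  rw [h.axis_eq, ← h.mem_span_left hb ha]
  exact vanishes_ofPrime (coordRing f g) _ ⟨_, ha⟩

theorem IsBirationalChart.vanishes_origin (h : IsBirationalChart f g) {b : K}
    (hb : b ∈ coordRing f g) (q : Polynomial ℂ) :
    Vanishes (origin f g) (f * b + Polynomial.aeval g q) ↔ q.eval 0 = 0 := by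
  have := h.isPrime_span_pair
  have ha : f * b + Polynomial.aeval g q ∈ coordRing f g :=
    add_mem (mul_mem left_mem_coordRing hb) (aeval_mem_coordRing q)
  rw [h.origin_eq, ← h.mem_span_pair hb ha]
  exact vanishes_ofPrime (coordRing f g) _ ⟨_, ha⟩

theorem IsBirationalChart.axis_vanishes_left (h : IsBirationalChart f g) :
    Vanishes (axis f g) f := by
  simpa using (h.vanishes_axis (one_mem _) 0).2 rfl

theorem IsBirationalChart.axis_not_vanishes_aeval (h : IsBirationalChart f g) {q : Polynomial ℂ}
    (hq : q ≠ 0) : ¬ Vanishes (axis f g) (Polynomial.aeval g q) := by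
  simpa using (h.vanishes_axis (zero_mem _) q).not.2 hq

theorem IsBirationalChart.axis_not_vanishes_sub (h : IsBirationalChart f g) (c : ℂ) :
    ¬ Vanishes (axis f g) (g - algebraMap ℂ K c) := by
  simpa using h.axis_not_vanishes_aeval (Polynomial.X_sub_C_ne_zero c)

theorem IsBirationalChart.origin_vanishes_left (h : IsBirationalChart f g) :
    Vanishes (origin f g) f := by
  simpa using (h.vanishes_origin (one_mem _) 0).2 (by simp)

theorem IsBirationalChart.origin_vanishes_right (h : IsBirationalChart f g) :
    Vanishes (origin f g) g := by
  simpa using (h.vanishes_origin (zero_mem _) Polynomial.X).2 (by simp)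

theorem origin_comm : origin f g = origin g f := by
  rw [origin, origin, coordRing_comm, Set.pair_comm]

theorem IsLoc.algebraMap_mem {S : LocalSubring K} (hS : IsLoc (coordRing f g) S) (c : ℂ) :
    algebraMap ℂ K c ∈ S.toSubring := hS.1 (algebraMap_mem_coordRing c)

theorem not_vanishes_algebraMap {S : LocalSubring K} {c : ℂ} (hS : ∀ c, algebraMap ℂ K c ∈ S.toSubring)
    (hc : c ≠ 0) : ¬ Vanishes S (algebraMap ℂ K c) :=
  not_vanishes_of_inv_mem (by simpa using hc) (by simpa using hS c⁻¹)

theorem vanishes_aeval_iff {S : LocalSubring K} (hc : ∀ c, algebraMap ℂ K c ∈ S.toSubring)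
    {b : ℂ} (hb : Vanishes S (g - algebraMap ℂ K b)) (q : Polynomial ℂ) :
    Vanishes S (Polynomial.aeval g q) ↔ q.eval b = 0 := by
  have hg : g ∈ S.toSubring := by simpa using add_mem hb.1 (hc b)
  obtain ⟨r, hr⟩ := Polynomial.X_sub_C_dvd_sub_C_eval (a := b) (p := q)
  have h1 : Polynomial.aeval g q = Polynomial.aeval g r * (g - algebraMap ℂ K b) +
      algebraMap ℂ K (q.eval b) := by
    rw [sub_eq_iff_eq_add.1 hr]; simp [mul_comm]
  have hm : Polynomial.aeval g r ∈ S.toSubring :=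
    coordRing_le (f := g) (g := g) hc hg hg (aeval_mem_coordRing r)
  rw [h1, vanishes_add_iff_right (hb.mul_left hm)]
  constructor
  · intro h; by_contra h0; exact not_vanishes_algebraMap hc h0 h
  · intro h; rw [h, map_zero]; exact vanishes_zero S

/-- A local ring that contains the coordinates of a chart, and in which they vanish, dominates the
origin. -/
theorem IsBirationalChart.origin_le (h : IsBirationalChart f g) {S : LocalSubring K}
    (hc : ∀ c, algebraMap ℂ K c ∈ S.toSubring) (hf : Vanishes S f) (hg : Vanishes S g) :
    origin f g ≤ S := by
  refine h.isLoc_origin.le (coordRing_le hc hf.1 hg.1) fun a ha => ?_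
  obtain ⟨b, hb, q, rfl⟩ := exists_eq_mul_add_aeval ha
  rw [h.vanishes_origin hb, vanishes_add_iff_right (hf.mul_right (coordRing_le hc hf.1 hg.1 hb)),
    vanishes_aeval_iff hc (b := 0) (by simpa using hg)]

theorem IsBirationalChart.eq_origin (h : IsBirationalChart f g) {S : LocalSubring K}
    (hS : IsLoc (coordRing f g) S) (hf : Vanishes S f) (hg : Vanishes S g) :
    S = origin f g :=
  hS.eq_of_le h.isLoc_origin le_rfl (h.origin_le hS.algebraMap_mem hf hg)

/-- Over `ℂ` the polynomial splits into factors `g - b`, none of which vanishes at `S`. -/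
theorem not_vanishes_aeval {S : LocalSubring K} (hc : ∀ c, algebraMap ℂ K c ∈ S.toSubring)
    (hg : g ∈ S.toSubring) (hb : ∀ b, ¬ Vanishes S (g - algebraMap ℂ K b)) {q : Polynomial ℂ}
    (hq : q ≠ 0) : ¬ Vanishes S (Polynomial.aeval g q) := by
  induction hn : q.natDegree generalizing q with
  | zero =>
    obtain ⟨c, rfl⟩ := Polynomial.natDegree_eq_zero.1 hn
    rw [Polynomial.aeval_C]
    exact not_vanishes_algebraMap hc (by simpa using hq)
  | succ n ih =>
    obtain ⟨b, hroot⟩ := IsAlgClosed.exists_root q (by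
      intro h0; rw [Polynomial.degree_eq_natDegree hq, hn] at h0
      exact absurd h0 (by exact_mod_cast Nat.succ_ne_zero n))
    obtain ⟨r, rfl⟩ := Polynomial.dvd_iff_isRoot.2 hroot
    have hr : r ≠ 0 := right_ne_zero_of_mul hq
    rw [Polynomial.natDegree_mul (Polynomial.X_sub_C_ne_zero b) hr,
      Polynomial.natDegree_X_sub_C] at hn
    have hm : Polynomial.aeval g r ∈ S.toSubring :=
      coordRing_le (f := g) (g := g) hc hg hg (aeval_mem_coordRing r)
    rw [map_mul, vanishes_mul_iff (by simpa using sub_mem hg (hc b)) hm]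
    have := hb b
    have := ih hr (by omega)
    simp_all

theorem IsBirationalChart.axis_le (h : IsBirationalChart f g) {S : LocalSubring K}
    (hc : ∀ c, algebraMap ℂ K c ∈ S.toSubring) (hf : Vanishes S f) (hg : g ∈ S.toSubring)
    (hb : ∀ b, ¬ Vanishes S (g - algebraMap ℂ K b)) : axis f g ≤ S := by
  refine h.isLoc_axis.le (coordRing_le hc hf.1 hg) fun a ha => ?_
  obtain ⟨b, hb', q, rfl⟩ := exists_eq_mul_add_aeval ha
  rw [h.vanishes_axis hb', vanishes_add_iff_right (hf.mul_right (coordRing_le hc hf.1 hg hb'))]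
  constructor
  · intro hv; by_contra hq; exact not_vanishes_aeval hc hg hb hq hv
  · rintro rfl; simpa using vanishes_zero S

/-- The points of the plane on the axis `f = 0`. -/
theorem IsBirationalChart.eq_axis_or_origin (h : IsBirationalChart f g) {S : LocalSubring K}
    (hS : IsLoc (coordRing f g) S) (hf : Vanishes S f) :
    S = axis f g ∨ ∃ b, S = origin f (g - algebraMap ℂ K b) := by
  by_cases hb : ∃ b, Vanishes S (g - algebraMap ℂ K b)
  · obtain ⟨b, hb⟩ := hb
    exact Or.inr ⟨b, (h.sub_const b).eq_origin (by rwa [coordRing_sub_const]) hf hb⟩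
  · push Not at hb
    exact Or.inl (hS.eq_of_le h.isLoc_axis le_rfl
      (h.axis_le hS.algebraMap_mem hf (hS.1 right_mem_coordRing) hb))

end Charts
end InceXII

namespace InceXII

/-! ### Discrete valuation rings and regular points -/

section Regularity

variable {K : Type*} [Field K] [Algebra ℂ K] {f g : K}

/-- `S` is the local ring of a point of an affine plane with function field `K`. -/
def HasChart (S : LocalSubring K) : Prop :=
  ∃ f g : K, IsBirationalChart f g ∧ IsLoc (coordRing f g) S

theorem IsBirationalChart.hasChart (h : IsBirationalChart f g) {S : LocalSubring K}
    (hS : IsLoc (coordRing f g) S) : HasChart S := ⟨f, g, h, hS⟩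

theorem HasChart.algebraMap_mem {S : LocalSubring K} (hS : HasChart S) (c : ℂ) :
    algebraMap ℂ K c ∈ S.toSubring := by
  obtain ⟨f, g, -, hS⟩ := hS
  exact hS.algebraMap_mem c

theorem HasChart.exists_div {S : LocalSubring K} (hS : HasChart S) (z : K) :
    ∃ a b : S.toSubring, b ≠ 0 ∧ z * b = a := by
  obtain ⟨f, g, h, hS⟩ := hS
  obtain ⟨a, ha, b, hb, rfl⟩ := (IntermediateField.mem_adjoin_iff_div).1
    (h.2 ▸ IntermediateField.mem_top : z ∈ IntermediateField.adjoin ℂ {f, g})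
  by_cases h0 : b = 0
  · exact ⟨0, 1, one_ne_zero, by simp [h0]⟩
  · exact ⟨⟨a, hS.1 ha⟩, ⟨b, hS.1 hb⟩, fun h => h0 (congrArg Subtype.val h), div_mul_cancel₀ a h0⟩

theorem isNoetherianRing_of_isLoc {S : LocalSubring K} (hS : IsLoc (coordRing f g) S) :
    IsNoetherianRing S.toSubring := by
  obtain ⟨P, hP, rfl⟩ := isLoc_iff.1 hS
  have hA : IsNoetherianRing (coordRing f g) :=
    isNoetherianRing_of_fg (S := Algebra.adjoin ℂ {f, g})
      (Subalgebra.fg_def.2 ⟨{f, g}, by simp, rfl⟩)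
  exact IsLocalization.isNoetherianRing P.primeCompl _ hA

theorem IsBirationalChart.axis_mem_maximalIdeal_iff (h : IsBirationalChart f g)
    (hf : f ∈ (axis f g).toSubring) :
    IsLocalRing.maximalIdeal (axis f g).toSubring = Ideal.span {⟨f, hf⟩} := by
  apply le_antisymm
  · intro z hz
    obtain ⟨a, ha, b, hb, hv, hab⟩ := h.isLoc_axis.2 z z.2
    obtain ⟨a', ha', q, rfl⟩ := exists_eq_mul_add_aeval ha
    have hbi := inv_mem_of_not_vanishes (h.isLoc_axis.1 hb) hv
    have hva : Vanishes (axis f g) (f * a' + Polynomial.aeval g q) := by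
      have := ((vanishes_mk_iff z).2 hz).mul_right (h.isLoc_axis.1 hb)
      rwa [hab, div_mul_cancel₀ _ (ne_zero_of_not_vanishes hv)] at this
    rw [h.vanishes_axis ha'] at hva
    subst hva
    refine Ideal.mem_span_singleton'.2 ⟨⟨a' * b⁻¹, mul_mem (h.isLoc_axis.1 ha') hbi⟩, ?_⟩
    apply Subtype.ext
    simp [hab]; ring
  · rw [Ideal.span_singleton_le_iff_mem]
    exact h.axis_vanishes_left.2

theorem IsBirationalChart.isDiscreteValuationRing_axis (h : IsBirationalChart f g) :
    IsDiscreteValuationRing (axis f g).toSubring := by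
  have hN := isNoetherianRing_of_isLoc h.isLoc_axis
  have hf := h.axis_vanishes_left
  have hm := h.axis_mem_maximalIdeal_iff hf.1
  -- Entries 0 and 4 of the list of equivalent conditions are that the ring is principal and that
  -- its maximal ideal is principal.
  have hp : IsPrincipalIdealRing (axis f g).toSubring :=
    ((tfae_of_isNoetherianRing_of_isLocalRing_of_isDomain (R := (axis f g).toSubring)).out 0 4).2
      (Submodule.IsPrincipal.mk ⟨_, hm⟩)
  refine { not_a_field' := fun h0 => ?_ }
  have : (⟨f, hf.1⟩ : (axis f g).toSubring) ∈ (⊥ : Ideal _) := h0 ▸ hf.2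
  exact h.left_ne_zero (congrArg Subtype.val (Ideal.mem_bot.1 this))

theorem mem_or_inv_mem {C : LocalSubring K} (hC : HasChart C)
    [IsDiscreteValuationRing C.toSubring] (z : K) :
    z ∈ C.toSubring ∨ z⁻¹ ∈ C.toSubring := by
  obtain ⟨a, b, hb, hz⟩ := hC.exists_div z
  have hb' : (b : K) ≠ 0 := fun h => hb (Subtype.ext h)
  rcases ValuationRing.dvd_total a b with ⟨c, hc⟩ | ⟨c, hc⟩
  · have hbc : (b : K) = a * c := congrArg Subtype.val hc
    have : z⁻¹ = c := by
      have h1 : z * c = 1 := by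
        rw [← hz, mul_right_comm] at hbc
        exact mul_right_cancel₀ hb' (by rw [one_mul]; exact hbc.symm)
      exact inv_eq_of_mul_eq_one_right h1
    exact Or.inr (this ▸ c.2)
  · have hac : (a : K) = b * c := congrArg Subtype.val hc
    have : z = c := mul_right_cancel₀ hb' (by rw [hz, hac, mul_comm])
    exact Or.inl (this ▸ c.2)

/-- A discrete valuation ring is a maximal subring of its field of fractions. -/
theorem eq_of_toSubring_le {C T : LocalSubring K} (hC : HasChart C)
    [IsDiscreteValuationRing C.toSubring] [IsDiscreteValuationRing T.toSubring]
    (h : C.toSubring ≤ T.toSubring) : C = T := by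
  refine LocalSubring.toSubring_injective (le_antisymm h fun z hz => ?_)
  by_contra hzC
  have hz0 : z ≠ 0 := by rintro rfl; exact hzC (zero_mem _)
  have hzi : z⁻¹ ∈ C.toSubring := (mem_or_inv_mem hC z).resolve_left hzC
  have hv : Vanishes C z⁻¹ := vanishes_iff.2 ⟨hzi, Or.inr (by simpa using hzC)⟩
  -- As `z⁻¹` is a nonunit of `C`, every denominator `b` divides a power of it in `C`. So every `w`
  -- is an element of `C` times a power of `z`, and `T` would be the whole field.
  have key : ∀ w : K, w ∈ T.toSubring := by
    intro w
    obtain ⟨a, b, hb, hw⟩ := hC.exists_div w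
    obtain ⟨n, c, hn⟩ := exists_pow_mul_eq hv.2 hb
    have hb' : (b : K) ≠ 0 := fun h => hb (Subtype.ext h)
    have hn' : (z⁻¹) ^ n = (b : K) * c := congrArg Subtype.val hn
    have : w = a * c * z ^ n := by
      have h1 : (b : K) * c * z ^ n = 1 := by rw [← hn', ← mul_pow, inv_mul_cancel₀ hz0, one_pow]
      apply mul_right_cancel₀ hb'
      rw [hw]; linear_combination -(a : K) * h1
    rw [this]
    exact mul_mem (h (mul_mem a.2 c.2)) (pow_mem hz n)
  refine IsDiscreteValuationRing.not_isField T.toSubring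
    ⟨exists_pair_ne _, mul_comm, fun {a} ha => ⟨⟨(a : K)⁻¹, key _⟩, Subtype.ext ?_⟩⟩
  exact mul_inv_cancel₀ fun h0 => ha (Subtype.ext h0)

/-- If `f / g = a / b`, then reducing `f b = g a` modulo `g` gives `g ∣ b`, so `b` vanishes at the
origin. This one fact shows below that the origin is not a curve and that `f` is not in the square
of the maximal ideal. -/
theorem IsBirationalChart.div_notMem_origin (h : IsBirationalChart f g) :
    f / g ∉ (origin f g).toSubring := by
  intro hm
  obtain ⟨a, ha, b, hb, hv, hab⟩ := h.isLoc_origin.2 _ hm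
  rw [div_eq_div_iff h.right_ne_zero (ne_zero_of_not_vanishes hv)] at hab
  rw [coordRing_comm] at ha hb
  obtain ⟨b', hb', r, rfl⟩ := exists_eq_mul_add_aeval hb
  have h0 := h.swap.eq_zero_of_mul_add_aeval (b := f * b' - a) (q := Polynomial.X * r)
    (sub_mem (mul_mem right_mem_coordRing hb') ha) (by simp; linear_combination hab)
  rw [mul_eq_zero, or_iff_right Polynomial.X_ne_zero] at h0
  subst h0
  rw [coordRing_comm] at hb'
  exact hv (by simpa using h.origin_vanishes_right.mul_right (h.isLoc_origin.1 hb'))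

theorem IsBirationalChart.not_isDiscreteValuationRing_origin (h : IsBirationalChart f g) :
    ¬ IsDiscreteValuationRing (origin f g).toSubring := by
  intro hd
  rcases mem_or_inv_mem (h.hasChart h.isLoc_origin) (f / g) with h1 | h1
  · exact h.div_notMem_origin h1
  · rw [inv_div, origin_comm] at h1
    exact h.swap.div_notMem_origin h1

theorem IsBirationalChart.maximalIdeal_origin (h : IsBirationalChart f g) :
    IsLocalRing.maximalIdeal (origin f g).toSubring =
      Ideal.span {⟨f, h.origin_vanishes_left.1⟩, ⟨g, h.origin_vanishes_right.1⟩} := by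
  apply le_antisymm
  · intro z hz
    obtain ⟨a, ha, b, hb, hv, hab⟩ := h.isLoc_origin.2 z z.2
    obtain ⟨a', ha', q, rfl⟩ := exists_eq_mul_add_aeval ha
    have hbi := inv_mem_of_not_vanishes (h.isLoc_origin.1 hb) hv
    have hva : Vanishes (origin f g) (f * a' + Polynomial.aeval g q) := by
      have := ((vanishes_mk_iff z).2 hz).mul_right (h.isLoc_origin.1 hb)
      rwa [hab, div_mul_cancel₀ _ (ne_zero_of_not_vanishes hv)] at this
    rw [h.vanishes_origin ha', ← Polynomial.coeff_zero_eq_eval_zero] at hva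
    obtain ⟨r, rfl⟩ := Polynomial.X_dvd_iff.2 hva
    refine Ideal.mem_span_pair.2 ⟨⟨a' * b⁻¹, mul_mem (h.isLoc_origin.1 ha') hbi⟩,
      ⟨Polynomial.aeval g r * b⁻¹, mul_mem (h.isLoc_origin.1 (aeval_mem_coordRing r)) hbi⟩,
      Subtype.ext ?_⟩
    simp [hab]; ring
  · rw [Ideal.span_le]
    rintro z (rfl | rfl)
    · exact h.origin_vanishes_left.2
    · exact h.origin_vanishes_right.2

/-- By Nakayama, `f ∈ 𝔪²` would make `g` alone a generator of `𝔪`, and then `f / g` would be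
regular. -/
theorem IsBirationalChart.left_notMem_maximalIdeal_sq (h : IsBirationalChart f g) :
    (⟨f, h.origin_vanishes_left.1⟩ : (origin f g).toSubring) ∉
      IsLocalRing.maximalIdeal (origin f g).toSubring ^ 2 := by
  intro hf
  have hN := isNoetherianRing_of_isLoc h.isLoc_origin
  have hm : IsLocalRing.maximalIdeal (origin f g).toSubring ≤
      Ideal.span {⟨g, h.origin_vanishes_right.1⟩} := by
    apply Submodule.le_of_le_smul_of_le_jacobson_bot
      (I := IsLocalRing.maximalIdeal (origin f g).toSubring) (IsNoetherian.noetherian _)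
      (IsLocalRing.jacobson_eq_maximalIdeal _ bot_ne_top).ge
    nth_rw 1 [h.maximalIdeal_origin]
    rw [Ideal.span_le]
    rintro z (rfl | rfl)
    · exact Ideal.mem_sup_right (by rwa [smul_eq_mul, ← pow_two])
    · exact Ideal.mem_sup_left (Ideal.subset_span rfl)
  obtain ⟨c, hc⟩ := Ideal.mem_span_singleton'.1 (hm h.origin_vanishes_left.2)
  apply h.div_notMem_origin
  have : f / g = c := by
    rw [div_eq_iff h.right_ne_zero]
    exact (congrArg Subtype.val hc).symm
  exact this ▸ c.2

/-- The residue field at the origin is the field of constants. -/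
theorem IsBirationalChart.exists_vanishes_origin_sub (h : IsBirationalChart f g) {z : K}
    (hz : z ∈ (origin f g).toSubring) : ∃ c, Vanishes (origin f g) (z - algebraMap ℂ K c) := by
  have hc := h.isLoc_origin.algebraMap_mem
  have key : ∀ a ∈ coordRing f g, ∃ c, Vanishes (origin f g) (a - algebraMap ℂ K c) := by
    intro a ha
    obtain ⟨b, hb, q, rfl⟩ := exists_eq_mul_add_aeval ha
    refine ⟨q.eval 0, ?_⟩
    have : f * b + Polynomial.aeval g q - algebraMap ℂ K (q.eval 0) =
        f * b + Polynomial.aeval g (q - Polynomial.C (q.eval 0)) := by simp; ring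
    rw [this, h.vanishes_origin hb]; simp
  obtain ⟨a, ha, b, hb, hv, rfl⟩ := h.isLoc_origin.2 z hz
  obtain ⟨c, hc1⟩ := key a ha
  obtain ⟨d, hd1⟩ := key b hb
  have hd0 : d ≠ 0 := by rintro rfl; exact hv (by simpa using hd1)
  have hd0' : algebraMap ℂ K d ≠ 0 := by simpa using hd0
  refine ⟨c / d, ?_⟩
  have hbi := inv_mem_of_not_vanishes (h.isLoc_origin.1 hb) hv
  have : a / b - algebraMap ℂ K (c / d) = (a - algebraMap ℂ K c) * b⁻¹ -
      (b - algebraMap ℂ K d) * (algebraMap ℂ K (c / d) * b⁻¹) := by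
    have := ne_zero_of_not_vanishes hv
    rw [map_div₀]; field_simp; ring
  rw [this]
  exact (hc1.mul_right hbi).sub (hd1.mul_right (mul_mem (hc _) hbi))

/-- The function field of an axis is generated by the other coordinate. -/
theorem IsBirationalChart.residueField_axis (h : IsBirationalChart f g) :
    ∃ z : IsLocalRing.ResidueField (axis f g).toSubring,
      Subfield.closure ({z} ∪ {w | ∃ c : (axis f g).toSubring,
        (c : K) ∈ Set.range (algebraMap ℂ K) ∧ w = IsLocalRing.residue (axis f g).toSubring c}) =
        ⊤ := by
  have hA := h.isLoc_axis
  refine ⟨IsLocalRing.residue _ ⟨g, hA.1 right_mem_coordRing⟩, top_le_iff.1 fun w _ => ?_⟩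
  obtain ⟨z, rfl⟩ := IsLocalRing.residue_surjective w
  set F := Subfield.closure ({IsLocalRing.residue (axis f g).toSubring
    ⟨g, hA.1 right_mem_coordRing⟩} ∪ {w | ∃ c : (axis f g).toSubring,
        (c : K) ∈ Set.range (algebraMap ℂ K) ∧ w = IsLocalRing.residue (axis f g).toSubring c})
    with hF
  -- The functions with residue in `F` form a subring that contains the constants, `g`, and also
  -- `f`, whose residue is zero.
  have key : coordRing f g ≤
      ((F.toSubring.comap (IsLocalRing.residue (axis f g).toSubring)).map
        (axis f g).toSubring.subtype) := by
    apply coordRing_le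
    · exact fun c => ⟨⟨algebraMap ℂ K c, hA.algebraMap_mem c⟩,
        Subfield.subset_closure (Or.inr ⟨_, ⟨c, rfl⟩, rfl⟩), rfl⟩
    · refine ⟨⟨f, hA.1 left_mem_coordRing⟩, ?_, rfl⟩
      have : IsLocalRing.residue (axis f g).toSubring ⟨f, hA.1 left_mem_coordRing⟩ = 0 :=
        (IsLocalRing.residue_eq_zero_iff _).2 h.axis_vanishes_left.2
      change IsLocalRing.residue (axis f g).toSubring ⟨f, hA.1 left_mem_coordRing⟩ ∈ F
      rw [this]
      exact zero_mem F
    · exact ⟨⟨g, hA.1 right_mem_coordRing⟩, Subfield.subset_closure (Or.inl rfl), rfl⟩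
  obtain ⟨a, ha, b, hb, hv, hab⟩ := hA.2 z z.2
  obtain ⟨a', ha', rfl⟩ := key ha
  obtain ⟨b', hb', rfl⟩ := key hb
  have hb0 : IsLocalRing.residue (axis f g).toSubring b' ≠ 0 := fun h0 =>
    hv ((vanishes_mk_iff b').2 ((IsLocalRing.residue_eq_zero_iff _).1 h0))
  have hz : z * b' = a' := Subtype.ext (by
    simpa [hab] using div_mul_cancel₀ (a' : K) (ne_zero_of_not_vanishes hv))
  have : IsLocalRing.residue (axis f g).toSubring z =
      IsLocalRing.residue (axis f g).toSubring a' / IsLocalRing.residue (axis f g).toSubring b' := by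
    rw [eq_div_iff hb0, ← map_mul, hz]
  rw [this]
  exact div_mem (show IsLocalRing.residue _ a' ∈ F from ha')
    (show IsLocalRing.residue _ b' ∈ F from hb')

/-! ### Changes of coordinates -/

theorem axis_sub_const (c : ℂ) : axis f (g - algebraMap ℂ K c) = axis f g := by
  rw [axis, axis, coordRing_sub_const]

theorem not_vanishes_one_div_sub {S : LocalSubring K} (hc : ∀ c, algebraMap ℂ K c ∈ S.toSubring)
    (hg : g ∈ S.toSubring) (hb : ∀ b, ¬ Vanishes S (g - algebraMap ℂ K b)) (b : ℂ) :
    ¬ Vanishes S (1 / g - algebraMap ℂ K b) := by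
  have hg1 : ¬ Vanishes S g := by simpa using hb 0
  have hg0 := ne_zero_of_not_vanishes hg1
  intro hv
  by_cases h0 : b = 0
  · subst h0
    rw [map_zero, sub_zero, one_div] at hv
    exact not_vanishes_of_inv_mem (inv_ne_zero hg0) (by simpa using hg) hv
  · refine hb b⁻¹ ?_
    have h0' : algebraMap ℂ K b ≠ 0 := by simpa using h0
    have : g - algebraMap ℂ K b⁻¹ = (1 / g - algebraMap ℂ K b) * -(g * algebraMap ℂ K b⁻¹) := by
      rw [map_inv₀]; field_simp; ring
    rw [this]
    exact hv.mul_right (neg_mem (mul_mem hg (hc _)))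

/-- At the generic point of the axis `g` is a unit and equals no constant, and the same then holds
for `1 / g`. One inequality suffices, because inversion is an involution. -/
theorem IsBirationalChart.axis_inv_le (h : IsBirationalChart f g) : axis f (1 / g) ≤ axis f g := by
  have hA := h.isLoc_axis
  have hb := h.axis_not_vanishes_sub
  have hg := hA.1 right_mem_coordRing
  refine h.inv_right.axis_le hA.algebraMap_mem h.axis_vanishes_left ?_
    (not_vanishes_one_div_sub hA.algebraMap_mem hg hb)
  rw [one_div]
  exact inv_mem_of_not_vanishes hg (by simpa using hb 0)

theorem IsBirationalChart.axis_inv (h : IsBirationalChart f g) : axis f (1 / g) = axis f g :=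
  le_antisymm h.axis_inv_le (by simpa using h.inv_right.axis_inv_le)

/-- At the generic point of `f = 0` the function `g` is a unit, so `f` and `f / g` define the same
curve: a curve and its strict transform share their generic point. -/
theorem IsBirationalChart.axis_div (h : IsBirationalChart f g) : axis (f / g) g = axis f g := by
  apply le_antisymm
  · have hA := h.isLoc_axis
    have hb := h.axis_not_vanishes_sub
    have hg := hA.1 right_mem_coordRing
    exact h.div_left.axis_le hA.algebraMap_mem (div_eq_mul_inv f g ▸ h.axis_vanishes_left.mul_right
      (inv_mem_of_not_vanishes hg (by simpa using hb 0))) hg hb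
  · have hA := h.div_left.isLoc_axis
    have hg := hA.1 right_mem_coordRing
    refine h.axis_le hA.algebraMap_mem ?_ hg h.div_left.axis_not_vanishes_sub
    have := h.div_left.axis_vanishes_left.mul_right hg
    rwa [div_mul_cancel₀ _ h.right_ne_zero] at this

theorem IsBirationalChart.axis_exceptional_le (h : IsBirationalChart f g) :
    axis g (f / g) ≤ axis f (g / f) := by
  have hA := h.div_right.isLoc_axis
  have hb := h.div_right.axis_not_vanishes_sub
  have hg := hA.1 right_mem_coordRing
  refine h.swap.div_right.axis_le hA.algebraMap_mem ?_ ?_ fun b => ?_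
  · have := h.div_right.axis_vanishes_left.mul_right hg
    rwa [mul_div_cancel₀ _ h.left_ne_zero] at this
  · rw [← inv_div g f]
    exact inv_mem_of_not_vanishes hg (by simpa using hb 0)
  · rw [← one_div_div g f]
    exact not_vanishes_one_div_sub hA.algebraMap_mem hg hb b

/-- The exceptional curve of the blow-up of the origin, in the two charts of the blow-up. -/
theorem IsBirationalChart.axis_exceptional (h : IsBirationalChart f g) :
    axis g (f / g) = axis f (g / f) :=
  le_antisymm h.axis_exceptional_le h.swap.axis_exceptional_le

theorem IsLoc.inv_left {S : LocalSubring K} (hS : IsLoc (coordRing f g) S)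
    (hv : ¬ Vanishes S f) : IsLoc (coordRing (1 / f) g) S := by
  have hf := hS.1 left_mem_coordRing
  have hg := hS.1 right_mem_coordRing
  have hB : coordRing (1 / f) g ≤ S.toSubring := coordRing_le hS.algebraMap_mem
    (by rw [one_div]; exact inv_mem_of_not_vanishes hf hv) hg
  refine hS.trans hB (coordRing_le (fun c => le_fractions hB (algebraMap_mem_coordRing c)) ?_
    (le_fractions hB right_mem_coordRing))
  have := inv_mem_fractions hB (le_fractions hB left_mem_coordRing)
    (not_vanishes_of_inv_mem (z := 1 / f) (by simpa using ne_zero_of_not_vanishes hv)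
      (by simpa using hf))
  simpa using this

theorem IsLoc.inv_right {S : LocalSubring K} (hS : IsLoc (coordRing f g) S)
    (hv : ¬ Vanishes S g) : IsLoc (coordRing f (1 / g)) S := by
  rw [coordRing_comm] at hS ⊢; exact hS.inv_left hv

theorem IsLoc.div_right {S : LocalSubring K} (hS : IsLoc (coordRing f g) S)
    (hv : ¬ Vanishes S f) : IsLoc (coordRing f (g / f)) S := by
  have hf := hS.1 left_mem_coordRing
  have hg := hS.1 right_mem_coordRing
  have hB : coordRing f (g / f) ≤ S.toSubring := coordRing_le hS.algebraMap_mem hf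
    (div_eq_mul_inv g f ▸ mul_mem hg (inv_mem_of_not_vanishes hf hv))
  refine hS.of_le hB (coordRing_le algebraMap_mem_coordRing left_mem_coordRing ?_)
  have := mul_mem (left_mem_coordRing (f := f) (g := g / f)) right_mem_coordRing
  rwa [mul_div_cancel₀ _ (ne_zero_of_not_vanishes hv)] at this

theorem IsLoc.mul_right {S : LocalSubring K} (hS : IsLoc (coordRing f g) S)
    (hv : ¬ Vanishes S f) : IsLoc (coordRing f (g * f)) S := by
  have hf := hS.1 left_mem_coordRing
  have hg := hS.1 right_mem_coordRing
  have hB : coordRing f (g * f) ≤ S.toSubring := coordRing_le hS.algebraMap_mem hf (mul_mem hg hf)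
  refine hS.trans hB (coordRing_le (fun c => le_fractions hB (algebraMap_mem_coordRing c))
    (le_fractions hB left_mem_coordRing) ?_)
  have := mul_mem (le_fractions hB right_mem_coordRing)
    (inv_mem_fractions hB (le_fractions hB left_mem_coordRing) hv)
  rwa [mul_inv_cancel_right₀ (ne_zero_of_not_vanishes hv)] at this

/-- The coordinate change between two of the standard affine charts of the projective plane. -/
theorem IsLoc.projective {S : LocalSubring K} (hS : IsLoc (coordRing f g) S)
    (hv : ¬ Vanishes S f) : IsLoc (coordRing (1 / f) (g / f)) S := by
  have hf := hS.1 left_mem_coordRing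
  have h1 := (hS.inv_left hv).mul_right (not_vanishes_of_inv_mem
    (by simpa using ne_zero_of_not_vanishes hv) (by simpa using hf))
  rwa [mul_one_div] at h1

end Regularity
end InceXII

namespace InceXII

/-! ### Blow-ups -/

section BlowUps

variable {K : Type*} [Field K]

/-- The points of the blow-up above its center `p`. -/
def exceptional (p : LocalSubring K) : Model K :=
  {S | p ≤ S ∧ ∃ u ∈ IsLocalRing.maximalIdeal p.toSubring, u ≠ 0 ∧
    ∃ (P : Ideal (dilatation p (u : K))) (_ : P.IsPrime),
      S = LocalSubring.ofPrime (dilatation p (u : K)) P}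

theorem mem_blowUp {X : Model K} {p S : LocalSubring K} :
    S ∈ blowUp X p ↔ (S ∈ X ∧ S ≠ p) ∨ S ∈ exceptional p := Iff.rfl

theorem le_of_mem_exceptional {p S : LocalSubring K} (h : S ∈ exceptional p) : p ≤ S := h.1

/-- A point above `p` dominates `p`, hence is not `q`, and vice versa; so neither blow-up affects
the center of the other. -/
theorem blowUp_comm (X : Model K) {p q : LocalSubring K} (hpq : ¬ p ≤ q) (hqp : ¬ q ≤ p) :
    blowUp (blowUp X p) q = blowUp (blowUp X q) p := by
  ext S
  simp only [mem_blowUp]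
  have h1 : S ∈ exceptional p → S ≠ q := by rintro h rfl; exact hpq h.1
  have h2 : S ∈ exceptional q → S ≠ p := by rintro h rfl; exact hqp h.1
  tauto

theorem not_le_of_mem_of_inv_mem {S T : LocalSubring K} {z : K} (hS : Vanishes S z)
    (h0 : z ≠ 0) (hT : z⁻¹ ∈ T.toSubring) : ¬ S ≤ T := fun h =>
  not_vanishes_of_le h h0 hT hS

theorem not_ge_of_mem_of_inv_mem {S T : LocalSubring K} {z : K} (hS : Vanishes S z)
    (h0 : z ≠ 0) (hT : z⁻¹ ∈ T.toSubring) : ¬ T ≤ S := fun h =>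
  inv_notMem_of_vanishes hS h0 ((localSubring_le_iff.1 h).1 hT)

variable [Algebra ℂ K] {f g : K}

/-- Comparison of the piece for an arbitrary `u = a f + b g` with the standard piece for `f`: where
`f / u` is a unit, so is `u / f = a + b (g / f)`, and division by `u` can be replaced by division by
`f`. -/
theorem IsBirationalChart.isLoc_of_mem_exceptional (h : IsBirationalChart f g)
    {S : LocalSubring K} {u : K} (hle : origin f g ≤ S)
    (hu : u ∈ (origin f g).toSubring) (hS : IsLoc (dilatation (origin f g) u) S)
    (hfu : f / u ∈ S.toSubring) (hgu : g / u ∈ S.toSubring) (hv : ¬ Vanishes S (f / u))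
    (hu' : ∃ a ∈ (origin f g).toSubring, ∃ b ∈ (origin f g).toSubring, u = a * f + b * g) :
    IsLoc (coordRing f (g / f)) S := by
  have hO := h.isLoc_origin
  have hle' := localSubring_le_iff.1 hle
  have hc : ∀ c, algebraMap ℂ K c ∈ S.toSubring := fun c => hle'.1 (hO.algebraMap_mem c)
  have hf0 := h.left_ne_zero
  have hu0 : u ≠ 0 := by
    rintro rfl; exact ne_zero_of_not_vanishes hv (by simp)
  have hgf : g / f ∈ S.toSubring := by
    have := mul_mem hgu (inv_mem_of_not_vanishes hfu hv)
    rwa [inv_div, div_mul_div_cancel₀ hu0] at this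
  have hB : coordRing f (g / f) ≤ S.toSubring :=
    coordRing_le hc (hle'.1 h.origin_vanishes_left.1) hgf
  have hAB : coordRing f g ≤ coordRing f (g / f) :=
    coordRing_le algebraMap_mem_coordRing left_mem_coordRing (by
      have := mul_mem (left_mem_coordRing (f := f) (g := g / f)) right_mem_coordRing
      rwa [mul_div_cancel₀ _ hf0] at this)
  have hOF : (origin f g).toSubring ≤ fractions (coordRing f (g / f)) S hB := by
    intro z hz
    obtain ⟨a, ha, b, hb, hw, rfl⟩ := hO.2 z hz
    exact ⟨a, hAB ha, b, hAB hb, fun hw' => hw ((vanishes_iff_of_le hle (hO.1 hb)).1 hw'), rfl⟩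
  have hgf' : g / f ∈ fractions (coordRing f (g / f)) S hB := le_fractions hB right_mem_coordRing
  have hfuF : f / u ∈ fractions (coordRing f (g / f)) S hB := by
    obtain ⟨a, ha, b, hb, rfl⟩ := hu'
    have hm := add_mem (hOF ha) (mul_mem (hOF hb) hgf')
    have he : a + b * (g / f) = (f / (a * f + b * g))⁻¹ := by
      rw [inv_div]; field_simp
    have := inv_mem_fractions hB hm (by
      rw [he]
      exact not_vanishes_of_inv_mem (inv_ne_zero (ne_zero_of_not_vanishes hv)) (by simpa using hfu))
    rwa [he, inv_inv] at this
  refine hS.trans hB (Subring.closure_le.2 ?_)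
  rintro z (hz | ⟨a, ha, rfl⟩)
  · exact hOF hz
  · rw [h.maximalIdeal_origin, Ideal.mem_span_pair] at ha
    obtain ⟨c, d, rfl⟩ := ha
    have := mul_mem (add_mem (hOF c.2) (mul_mem (hOF d.2) hgf')) hfuF
    rw [SetLike.mem_coe]
    convert this using 1
    simp only [Subring.coe_add, Subring.coe_mul]
    field_simp

theorem IsBirationalChart.mem_exceptional_of_isLoc (h : IsBirationalChart f g)
    {S : LocalSubring K} (hS : IsLoc (coordRing f (g / f)) S) (hf : Vanishes S f) :
    S ∈ exceptional (origin f g) := by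
  have hgf := hS.1 right_mem_coordRing
  have hg : Vanishes S g := by
    have := hf.mul_right hgf
    rwa [mul_div_cancel₀ _ h.left_ne_zero] at this
  have hle := h.origin_le hS.algebraMap_mem hf hg
  have hle' := localSubring_le_iff.1 hle
  refine ⟨hle, ⟨f, h.origin_vanishes_left.1⟩, h.origin_vanishes_left.2,
    fun h0 => h.left_ne_zero (congrArg Subtype.val h0), isLoc_iff.1 (hS.of_le ?_ ?_)⟩
  · refine Subring.closure_le.2 ?_
    rintro z (hz | ⟨a, ha, rfl⟩)
    · exact hle'.1 hz
    · rw [h.maximalIdeal_origin, Ideal.mem_span_pair] at ha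
      obtain ⟨c, d, rfl⟩ := ha
      have := add_mem (hle'.1 c.2) (mul_mem (hle'.1 d.2) hgf)
      have h0 := h.left_ne_zero
      rw [SetLike.mem_coe]
      convert this using 1
      simp only [Subring.coe_add, Subring.coe_mul]
      field_simp
  · refine coordRing_le (fun c => Subring.subset_closure (Or.inl (h.isLoc_origin.algebraMap_mem c)))
      (Subring.subset_closure (Or.inl h.origin_vanishes_left.1)) (Subring.subset_closure (Or.inr
        ⟨⟨g, h.origin_vanishes_right.1⟩, h.origin_vanishes_right.2, rfl⟩))

/-- The points above the center of the blow-up of a plane at the origin lie on the two planes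
that cover the blow-up. -/
theorem IsBirationalChart.mem_exceptional (h : IsBirationalChart f g) {S : LocalSubring K} :
    S ∈ exceptional (origin f g) ↔ (IsLoc (coordRing f (g / f)) S ∧ Vanishes S f) ∨
      (IsLoc (coordRing (f / g) g) S ∧ Vanishes S g) := by
  constructor
  · rintro ⟨hle, u, hu, hu0, P, hP, hSP⟩
    have hS := isLoc_iff.2 ⟨P, hP, hSP⟩
    have hle' := localSubring_le_iff.1 hle
    have hu0' : (u : K) ≠ 0 := fun h0 => hu0 (Subtype.ext h0)
    have hdil : ∀ a : K, Vanishes (origin f g) a → a / u ∈ S.toSubring := fun a ha =>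
      hS.1 (Subring.subset_closure (Or.inr ⟨⟨a, ha.1⟩, ha.2, rfl⟩))
    have hfu := hdil f h.origin_vanishes_left
    have hgu := hdil g h.origin_vanishes_right
    have hu1 := hu
    rw [h.maximalIdeal_origin, Ideal.mem_span_pair] at hu1
    obtain ⟨c, d, hcd⟩ := hu1
    have hcd' : (c : K) * f + d * g = u := congrArg Subtype.val hcd
    -- This relation prevents `f / u` and `g / u` from both vanishing at `S`, so two of the affine
    -- pieces cover the whole blow-up.
    have hone : (c : K) * (f / u) + d * (g / u) = 1 := by
      rw [← mul_div_assoc, ← mul_div_assoc, ← add_div, hcd', div_self hu0']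
    have : ¬ Vanishes S (f / u) ∨ ¬ Vanishes S (g / u) := by
      by_contra hcon
      push Not at hcon
      exact not_vanishes_one S (hone ▸ (hcon.1.mul_left (hle'.1 c.2)).add
        (hcon.2.mul_left (hle'.1 d.2)))
    rcases this with hv | hv
    · exact Or.inl ⟨h.isLoc_of_mem_exceptional hle u.2 hS hfu hgu hv
        ⟨c, c.2, d, d.2, hcd'.symm⟩, hle'.2 _ h.origin_vanishes_left⟩
    · refine Or.inr ⟨?_, hle'.2 _ h.origin_vanishes_right⟩
      rw [coordRing_comm]
      obtain ⟨c', hc'⟩ := c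
      obtain ⟨d', hd'⟩ := d
      obtain ⟨u', hu''⟩ := u
      simp only at hS hfu hgu hv hcd'
      rw [origin_comm] at hle hS hd' hc' hu''
      exact h.swap.isLoc_of_mem_exceptional hle hu'' hS hgu hfu hv
        ⟨d', hd', c', hc', by rw [add_comm]; exact hcd'.symm⟩
  · rintro (⟨h1, h2⟩ | ⟨h1, h2⟩)
    · exact h.mem_exceptional_of_isLoc h1 h2
    · rw [origin_comm]
      rw [coordRing_comm] at h1
      exact h.swap.mem_exceptional_of_isLoc h1 h2

theorem IsBirationalChart.mem_exceptional_iff (h : IsBirationalChart f g) {S : LocalSubring K} :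
    S ∈ exceptional (origin f g) ↔ S = axis f (g / f) ∨
      (∃ c, S = origin f (g / f - algebraMap ℂ K c)) ∨ S = origin (f / g) g := by
  rw [h.mem_exceptional]
  constructor
  · rintro (⟨h1, h2⟩ | ⟨h1, h2⟩)
    · rcases h.div_right.eq_axis_or_origin h1 h2 with h3 | h3 <;> tauto
    · by_cases hv : Vanishes S (f / g)
      · exact Or.inr (Or.inr (h.div_left.eq_origin h1 hv h2))
      · have h3 : Vanishes S f := by
          have := h2.mul_left (h1.1 left_mem_coordRing)
          rwa [div_mul_cancel₀ _ h.right_ne_zero] at this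
        have h4 : IsLoc (coordRing f (g / f)) S := by
          have h5 := h1.inv_left hv
          rw [one_div_div] at h5
          have hB : coordRing f (g / f) ≤ S.toSubring :=
            coordRing_le h5.algebraMap_mem h3.1 (h5.1 left_mem_coordRing)
          refine h5.of_le hB (coordRing_le algebraMap_mem_coordRing right_mem_coordRing ?_)
          have := mul_mem (left_mem_coordRing (f := f) (g := g / f)) right_mem_coordRing
          rwa [mul_div_cancel₀ _ h.left_ne_zero] at this
        rcases h.div_right.eq_axis_or_origin h4 h3 with h6 | h6 <;> tauto
  · rintro (rfl | ⟨c, rfl⟩ | rfl)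
    · exact Or.inl ⟨h.div_right.isLoc_axis, h.div_right.axis_vanishes_left⟩
    · refine Or.inl ⟨?_, (h.div_right.sub_const c).origin_vanishes_left⟩
      have := (h.div_right.sub_const c).isLoc_origin
      rwa [coordRing_sub_const] at this
    · exact Or.inr ⟨h.div_left.isLoc_origin, h.div_left.origin_vanishes_right⟩

/-! ### Separated models -/

/-- The valuative criterion: no local ring dominates two distinct points of the model. -/
structure IsSeparatedModel (X : Model K) : Prop where
  hasChart : ∀ S ∈ X, HasChart S
  eq_of_le : ∀ S ∈ X, ∀ T ∈ X, ∀ R, S ≤ R → T ≤ R → S = T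

/-- The residue field at the origin is `ℂ`. A function that vanishes at a specialization `q` but has
the value `c ≠ 0` at the origin would make `z - c` invertible at `q` and noninvertible at the
origin. So the inclusion of local rings is a domination, and separatedness applies. -/
theorem IsSeparatedModel.isClosedPoint {X : Model K} (hX : IsSeparatedModel X)
    (h : IsBirationalChart f g) (hp : origin f g ∈ X) : IsClosedPoint X (origin f g) := by
  refine ⟨hp, fun q hq hle => hX.eq_of_le q hq _ hp (origin f g) ?_ le_rfl⟩
  refine localSubring_le_iff.2 ⟨hle, fun z hz => ?_⟩
  obtain ⟨c, hc⟩ := h.exists_vanishes_origin_sub (hle hz.1)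
  have hqc := (hX.hasChart q hq).algebraMap_mem
  by_cases h0 : c = 0
  · simpa [h0] using hc
  have h1 : ¬ Vanishes q (z - algebraMap ℂ K c) := by
    intro hv
    have := hz.sub hv
    rw [sub_sub_cancel] at this
    exact not_vanishes_algebraMap hqc h0 this
  exact absurd hc (not_vanishes_of_inv_mem (ne_zero_of_not_vanishes h1)
    (hle (inv_mem_of_not_vanishes (sub_mem hz.1 (hqc c)) h1)))

/-- On a separated model `S ≠ p` may be replaced by `¬ p ≤ S`, which is disproved or proved by
exhibiting a function. -/
theorem IsSeparatedModel.mem_blowUp {X : Model K} (hX : IsSeparatedModel X) {p S : LocalSubring K}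
    (hp : p ∈ X) : S ∈ blowUp X p ↔ (S ∈ X ∧ ¬ p ≤ S) ∨ S ∈ exceptional p := by
  rw [InceXII.mem_blowUp]
  have : S ∈ X → (S ≠ p ↔ ¬ p ≤ S) := fun hS =>
    not_congr ⟨fun h => h.ge, fun h => hX.eq_of_le S hS p hp S le_rfl h⟩
  constructor <;> rintro (⟨h1, h2⟩ | h1) <;> [have := this h1; skip; have := this h1; skip] <;> tauto

/-- A local ring that dominates an old point and a point above the center also dominates the center,
so the old point would be the center. For two new points only the overlap of the two standard pieces
is at issue. -/
theorem IsSeparatedModel.blowUp {X : Model K} (hX : IsSeparatedModel X)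
    (h : IsBirationalChart f g) (hp : origin f g ∈ X) :
    IsSeparatedModel (blowUp X (origin f g)) := by
  have key : ∀ S T R : LocalSubring K, S ≤ R → T ≤ R → IsLoc (coordRing f (g / f)) S →
      IsLoc (coordRing (f / g) g) T → S = T := by
    intro S T R hSR hTR hS hT
    have hv : ¬ Vanishes S (g / f) := not_vanishes_of_le hSR
      (div_ne_zero h.right_ne_zero h.left_ne_zero)
      (by rw [inv_div]; exact (localSubring_le_iff.1 hTR).1 (hT.1 left_mem_coordRing))
    have h1 := hS.inv_right hv
    rw [coordRing_comm, one_div_div] at h1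
    have hg : g ∈ S.toSubring := by
      have := mul_mem (hS.1 left_mem_coordRing) (hS.1 right_mem_coordRing)
      rwa [mul_div_cancel₀ _ h.left_ne_zero] at this
    have h2 : IsLoc (coordRing (f / g) g) S := by
      refine h1.of_le (coordRing_le hS.algebraMap_mem (h1.1 left_mem_coordRing) hg)
        (coordRing_le algebraMap_mem_coordRing left_mem_coordRing ?_)
      have := mul_mem (left_mem_coordRing (f := f / g) (g := g)) right_mem_coordRing
      rwa [div_mul_cancel₀ _ h.right_ne_zero] at this
    exact h2.eq_of_le hT hSR hTR
  refine ⟨?_, ?_⟩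
  · rintro S (hS | hS)
    · exact hX.hasChart S hS.1
    · rcases h.mem_exceptional.1 hS with hS | hS
      · exact h.div_right.hasChart hS.1
      · exact h.div_left.hasChart hS.1
  · rintro S (hS | hS) T (hT | hT) R hSR hTR
    · exact hX.eq_of_le S hS.1 T hT.1 R hSR hTR
    · exact absurd (hX.eq_of_le S hS.1 _ hp R hSR
        ((le_of_mem_exceptional hT).trans hTR)) hS.2
    · exact absurd (hX.eq_of_le T hT.1 _ hp R hTR
        ((le_of_mem_exceptional hS).trans hSR)) hT.2
    · rcases h.mem_exceptional.1 hS with ⟨hS, -⟩ | ⟨hS, -⟩ <;>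
        rcases h.mem_exceptional.1 hT with ⟨hT, -⟩ | ⟨hT, -⟩
      · exact hS.eq_of_le hT hSR hTR
      · exact key S T R hSR hTR hS hT
      · exact (key T S R hTR hSR hT hS).symm
      · exact hS.eq_of_le hT hSR hTR

/-- `ℙ¹ × ℙ¹` with the affine coordinates `f, g`. -/
def quadric (f g : K) : Model K :=
  affinePlane f g ∪ affinePlane (1 / f) g ∪ affinePlane f (1 / g) ∪ affinePlane (1 / f) (1 / g)

theorem mem_quadric {S : LocalSubring K} : S ∈ quadric f g ↔
    IsLoc (coordRing f g) S ∨ IsLoc (coordRing (1 / f) g) S ∨ IsLoc (coordRing f (1 / g)) S ∨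
      IsLoc (coordRing (1 / f) (1 / g)) S := by
  simp only [quadric, Set.mem_union, mem_affinePlane]; tauto

theorem mem_projectivePlane {S : LocalSubring K} : S ∈ projectivePlane f g ↔
    IsLoc (coordRing f g) S ∨ IsLoc (coordRing (1 / f) (g / f)) S ∨
      IsLoc (coordRing (f / g) (1 / g)) S := by
  simp only [projectivePlane, Set.mem_union, mem_affinePlane]; tauto

theorem IsBirationalChart.projective (h : IsBirationalChart f g) :
    IsBirationalChart (1 / f) (g / f) := by
  simpa [div_eq_mul_inv] using h.inv_left.mul_right

theorem IsBirationalChart.projective' (h : IsBirationalChart f g) :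
    IsBirationalChart (f / g) (1 / g) := h.swap.projective.swap

theorem IsBirationalChart.isSeparatedModel_projectivePlane (h : IsBirationalChart f g) :
    IsSeparatedModel (projectivePlane f g) := by
  have hf := h.left_ne_zero
  have hg := h.right_ne_zero
  refine ⟨?_, ?_⟩
  · intro S hS
    rcases mem_projectivePlane.1 hS with hS | hS | hS
    exacts [h.hasChart hS, h.projective.hasChart hS, h.projective'.hasChart hS]
  -- If `R` dominates points of both planes, then `1 / f ∈ R`, so `f` is a unit at `S` and `S` lies
  -- in the second plane too.
  have key : ∀ {f g : K} {S T R : LocalSubring K}, f ≠ 0 → S ≤ R → T ≤ R →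
      IsLoc (coordRing f g) S → IsLoc (coordRing (1 / f) (g / f)) T → S = T := by
    intro f g S T R hf hSR hTR hS hT
    refine (hS.projective (not_vanishes_of_le hSR hf ?_)).eq_of_le hT hSR hTR
    rw [← one_div]
    exact (localSubring_le_iff.1 hTR).1 (hT.1 left_mem_coordRing)
  have key2 : ∀ {S T R : LocalSubring K}, S ≤ R → T ≤ R →
      IsLoc (coordRing f g) S → IsLoc (coordRing (f / g) (1 / g)) T → S = T := by
    intro S T R hSR hTR hS hT
    rw [coordRing_comm] at hS hT
    exact key hg hSR hTR hS hT
  have key3 : ∀ {S T R : LocalSubring K}, S ≤ R → T ≤ R →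
      IsLoc (coordRing (1 / f) (g / f)) S → IsLoc (coordRing (f / g) (1 / g)) T → S = T := by
    intro S T R hSR hTR hS hT
    rw [coordRing_comm] at hS
    refine key (f := g / f) (g := 1 / f) (div_ne_zero hg hf) hSR hTR hS ?_
    convert hT using 2 <;> field_simp
  intro S hS T hT R hSR hTR
  rcases mem_projectivePlane.1 hS with hS | hS | hS <;>
    rcases mem_projectivePlane.1 hT with hT | hT | hT
  · exact hS.eq_of_le hT hSR hTR
  · exact key hf hSR hTR hS hT
  · exact key2 hSR hTR hS hT
  · exact (key hf hTR hSR hT hS).symm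
  · exact hS.eq_of_le hT hSR hTR
  · exact key3 hSR hTR hS hT
  · exact (key2 hTR hSR hT hS).symm
  · exact (key3 hTR hSR hT hS).symm
  · exact hS.eq_of_le hT hSR hTR

theorem IsBirationalChart.isSeparatedModel_quadric (h : IsBirationalChart f g) :
    IsSeparatedModel (quadric f g) := by
  have hf := h.left_ne_zero
  have hg := h.right_ne_zero
  refine ⟨?_, ?_⟩
  · intro S hS
    rcases mem_quadric.1 hS with hS | hS | hS | hS
    exacts [h.hasChart hS, h.inv_left.hasChart hS, h.inv_right.hasChart hS,
      h.inv_left.inv_right.hasChart hS]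
  have move : ∀ {f g e : K} {S R : LocalSubring K}, f ≠ 0 → S ≤ R → IsLoc (coordRing f g) S →
      (e = f ∨ e = 1 / f) → e ∈ R.toSubring → IsLoc (coordRing e g) S := by
    rintro f g e S R hf hSR hS (rfl | rfl) he
    · exact hS
    · exact hS.inv_left (not_vanishes_of_le hSR hf (by rwa [← one_div]))
  have key : ∀ {f₁ g₁ f₂ g₂ : K} {S T R : LocalSubring K}, f₁ ≠ 0 → g₁ ≠ 0 → S ≤ R → T ≤ R →
      IsLoc (coordRing f₁ g₁) S → IsLoc (coordRing f₂ g₂) T → (f₂ = f₁ ∨ f₂ = 1 / f₁) →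
      (g₂ = g₁ ∨ g₂ = 1 / g₁) → S = T := by
    intro f₁ g₁ f₂ g₂ S T R hf hg hSR hTR hS hT h1 h2
    have hR := (localSubring_le_iff.1 hTR).1
    have h3 := move hf hSR hS h1 (hR (hT.1 left_mem_coordRing))
    rw [coordRing_comm] at h3
    have h4 := move hg hSR h3 h2 (hR (hT.1 right_mem_coordRing))
    rw [coordRing_comm] at h4
    exact h4.eq_of_le hT hSR hTR
  intro S hS T hT R hSR hTR
  rcases mem_quadric.1 hS with hS | hS | hS | hS <;>
    rcases mem_quadric.1 hT with hT | hT | hT | hT <;>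
    exact key (by simp [hf]) (by simp [hg]) hSR hTR hS hT (by simp) (by simp)

/-- A projective line does not depend on the choice of the affine coordinate. -/
theorem isLoc_one_div_sub_const {S : LocalSubring K} (c : ℂ)
    (hS : IsLoc (coordRing f (1 / g)) S) (hv : Vanishes S (1 / g))
    (hg : g ≠ 0) (hg' : g - algebraMap ℂ K c ≠ 0) :
    IsLoc (coordRing f (1 / (g - algebraMap ℂ K c))) S := by
  have hc := hS.algebraMap_mem
  have h1 : ¬ Vanishes S (1 - algebraMap ℂ K c * (1 / g)) := by
    intro h2
    have := h2.add (hv.mul_left (hc c))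
    rw [sub_add_cancel] at this
    exact not_vanishes_one S this
  have h2 : 1 / (g - algebraMap ℂ K c) = 1 / g * (1 - algebraMap ℂ K c * (1 / g))⁻¹ := by
    have : 1 - algebraMap ℂ K c * (1 / g) = (g - algebraMap ℂ K c) / g := by field_simp
    rw [this]; field_simp
  have h3 : 1 / (g - algebraMap ℂ K c) ∈ S.toSubring := by
    rw [h2]
    exact mul_mem hv.1 (inv_mem_of_not_vanishes (sub_mem (one_mem _) (mul_mem (hc c) hv.1)) h1)
  have hB := coordRing_le hc (hS.1 left_mem_coordRing) h3
  have h4 : (1 - algebraMap ℂ K c * (1 / g))⁻¹ =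
      1 + algebraMap ℂ K c * (1 / (g - algebraMap ℂ K c)) := by
    have : 1 - algebraMap ℂ K c * (1 / g) = (g - algebraMap ℂ K c) / g := by field_simp
    rw [this]; field_simp; ring
  refine hS.trans hB (coordRing_le (fun c => le_fractions hB (algebraMap_mem_coordRing c))
    (le_fractions hB left_mem_coordRing) ?_)
  refine ⟨_, right_mem_coordRing, 1 + algebraMap ℂ K c * (1 / (g - algebraMap ℂ K c)),
    add_mem (one_mem _) (mul_mem (algebraMap_mem_coordRing c) right_mem_coordRing), ?_, ?_⟩
  · rw [← h4]
    exact not_vanishes_of_inv_mem (inv_ne_zero (ne_zero_of_not_vanishes h1))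
      (by rw [inv_inv]; exact sub_mem (one_mem _) (mul_mem (hc c) hv.1))
  · rw [← h4, h2, div_inv_eq_mul, inv_mul_cancel_right₀ (ne_zero_of_not_vanishes h1)]

/-- Near `g = ∞` the functions `1 / g` and `1 / (g - c)` differ by a unit factor. This independence
of the affine coordinate allows `y` to be replaced by `1 / (y - s)` later. -/
theorem IsBirationalChart.quadric_sub_const_subset (h : IsBirationalChart f g) (c : ℂ) :
    quadric f g ⊆ quadric f (g - algebraMap ℂ K c) := by
  have hg := h.right_ne_zero
  have hg' := (h.sub_const c).right_ne_zero
  intro S hS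
  rw [mem_quadric] at hS ⊢
  rw [coordRing_sub_const, coordRing_sub_const]
  rcases hS with hS | hS | hS | hS
  · exact Or.inl hS
  · exact Or.inr (Or.inl hS)
  · by_cases hv : Vanishes S (1 / g)
    · exact Or.inr (Or.inr (Or.inl (isLoc_one_div_sub_const c hS hv hg hg')))
    · exact Or.inl (by simpa using hS.inv_right hv)
  · by_cases hv : Vanishes S (1 / g)
    · exact Or.inr (Or.inr (Or.inr (isLoc_one_div_sub_const c hS hv hg hg')))
    · exact Or.inr (Or.inl (by simpa using hS.inv_right hv))

theorem quadric_inv_right : quadric f (1 / g) = quadric f g := by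
  ext S; simp only [mem_quadric, one_div_one_div]; tauto

theorem IsBirationalChart.quadric_sub_const (h : IsBirationalChart f g) (c : ℂ) :
    quadric f (g - algebraMap ℂ K c) = quadric f g := by
  refine subset_antisymm ?_ (h.quadric_sub_const_subset c)
  have := (h.sub_const c).quadric_sub_const_subset (-c)
  simpa using this

/-- The projective plane blown up at two points is the quadric blown up at one point. -/
theorem IsBirationalChart.blowUp_projectivePlane (h : IsBirationalChart f g) :
    InceXII.blowUp (InceXII.blowUp (projectivePlane f g) (origin (1 / f) (g / f)))
        (origin (f / g) (1 / g)) =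
      InceXII.blowUp (quadric f g) (origin (1 / f) (1 / g)) := by
  have hf := h.left_ne_zero
  have hg := h.right_ne_zero
  have hc1 := h.projective
  have hc2 := h.projective'
  have hc3 := h.inv_left.inv_right
  -- The exceptional curves over the plane become the lines `f = ∞` and `g = ∞` of the quadric. The
  -- exceptional curve over the corner of the quadric lies in the charts `(1/f, f/g)` and `(1/g,
  -- g/f)`, where the equations `1/f = 0` and `1/g = 0` describe the line at infinity of the plane.
  have e1 : ∀ S, S ∈ exceptional (origin (1 / f) (g / f)) ↔
      (IsLoc (coordRing (1 / f) g) S ∧ Vanishes S (1 / f)) ∨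
        (IsLoc (coordRing (1 / g) (g / f)) S ∧ Vanishes S (g / f)) := by
    intro S
    rw [hc1.mem_exceptional]
    have h1 : g / f / (1 / f) = g := by field_simp
    have h2 : 1 / f / (g / f) = 1 / g := by field_simp
    rw [h1, h2]
  have e2 : ∀ S, S ∈ exceptional (origin (f / g) (1 / g)) ↔
      (IsLoc (coordRing f (1 / g)) S ∧ Vanishes S (1 / g)) ∨
        (IsLoc (coordRing (1 / f) (f / g)) S ∧ Vanishes S (f / g)) := by
    intro S
    rw [hc2.mem_exceptional]
    have h1 : 1 / g / (f / g) = 1 / f := by field_simp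
    have h2 : f / g / (1 / g) = f := by field_simp
    rw [h1, h2, coordRing_comm (f := f / g), or_comm]
  have e3 : ∀ S, S ∈ exceptional (origin (1 / f) (1 / g)) ↔
      (IsLoc (coordRing (1 / f) (f / g)) S ∧ Vanishes S (1 / f)) ∨
        (IsLoc (coordRing (1 / g) (g / f)) S ∧ Vanishes S (1 / g)) := by
    intro S
    rw [hc3.mem_exceptional]
    have h1 : 1 / g / (1 / f) = f / g := by field_simp
    have h2 : 1 / f / (1 / g) = g / f := by field_simp
    rw [h1, h2, coordRing_comm (f := g / f)]
  have hP := h.isSeparatedModel_projectivePlane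
  have hp1 : origin (1 / f) (g / f) ∈ projectivePlane f g :=
    mem_projectivePlane.2 (Or.inr (Or.inl hc1.isLoc_origin))
  have hp2' : origin (f / g) (1 / g) ∈ projectivePlane f g :=
    mem_projectivePlane.2 (Or.inr (Or.inr hc2.isLoc_origin))
  have hinc : ∀ S : LocalSubring K, f / g ∈ S.toSubring → ¬ origin (1 / f) (g / f) ≤ S :=
    fun S hS => not_le_of_mem_of_inv_mem hc1.origin_vanishes_right (div_ne_zero hg hf)
      (by rwa [inv_div])
  have hinc' : ∀ S : LocalSubring K, g / f ∈ S.toSubring → ¬ origin (f / g) (1 / g) ≤ S :=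
    fun S hS => not_le_of_mem_of_inv_mem hc2.origin_vanishes_left (div_ne_zero hf hg)
      (by rwa [inv_div])
  have hp2 : origin (f / g) (1 / g) ∈ InceXII.blowUp (projectivePlane f g) (origin (1 / f) (g / f)) :=
    (hP.mem_blowUp hp1).2 (Or.inl ⟨hp2', hinc _ hc2.origin_vanishes_left.1⟩)
  have hQ := h.isSeparatedModel_quadric
  have hp3 : origin (1 / f) (1 / g) ∈ quadric f g :=
    mem_quadric.2 (Or.inr (Or.inr (Or.inr hc3.isLoc_origin)))
  have hinf : ∀ S : LocalSubring K, f ∈ S.toSubring → ¬ Vanishes S (1 / f) := fun S hS =>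
    not_vanishes_of_inv_mem (by simpa using hf) (by simpa using hS)
  have hing : ∀ S : LocalSubring K, g ∈ S.toSubring → ¬ Vanishes S (1 / g) := fun S hS =>
    not_vanishes_of_inv_mem (by simpa using hg) (by simpa using hS)
  have l1 : ∀ S, origin (1 / f) (g / f) ≤ S → Vanishes S (1 / f) ∧ Vanishes S (g / f) :=
    fun S hS => ⟨(localSubring_le_iff.1 hS).2 _ hc1.origin_vanishes_left,
      (localSubring_le_iff.1 hS).2 _ hc1.origin_vanishes_right⟩
  have l2 : ∀ S, origin (f / g) (1 / g) ≤ S → Vanishes S (f / g) ∧ Vanishes S (1 / g) :=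
    fun S hS => ⟨(localSubring_le_iff.1 hS).2 _ hc2.origin_vanishes_left,
      (localSubring_le_iff.1 hS).2 _ hc2.origin_vanishes_right⟩
  have l3 : ∀ S, origin (1 / f) (1 / g) ≤ S → Vanishes S (1 / f) ∧ Vanishes S (1 / g) :=
    fun S hS => ⟨(localSubring_le_iff.1 hS).2 _ hc3.origin_vanishes_left,
      (localSubring_le_iff.1 hS).2 _ hc3.origin_vanishes_right⟩
  have hplane : ∀ S, IsLoc (coordRing f g) S →
      S ∈ InceXII.blowUp (InceXII.blowUp (projectivePlane f g) (origin (1 / f) (g / f)))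
        (origin (f / g) (1 / g)) := by
    intro S hS
    rw [(hP.blowUp hc1 hp1).mem_blowUp hp2, hP.mem_blowUp hp1]
    exact Or.inl ⟨Or.inl ⟨mem_projectivePlane.2 (Or.inl hS), fun hl =>
      hinf S (hS.1 left_mem_coordRing) (l1 S hl).1⟩, fun hl =>
        hing S (hS.1 right_mem_coordRing) (l2 S hl).2⟩
  have hexc1 : ∀ S, S ∈ exceptional (origin (1 / f) (g / f)) →
      S ∈ InceXII.blowUp (InceXII.blowUp (projectivePlane f g) (origin (1 / f) (g / f)))
        (origin (f / g) (1 / g)) := by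
    intro S hS
    rw [(hP.blowUp hc1 hp1).mem_blowUp hp2, hP.mem_blowUp hp1]
    exact Or.inl ⟨Or.inr hS, hinc' S (l1 S (le_of_mem_exceptional hS)).2.1⟩
  have hexc2 : ∀ S, S ∈ exceptional (origin (f / g) (1 / g)) →
      S ∈ InceXII.blowUp (InceXII.blowUp (projectivePlane f g) (origin (1 / f) (g / f)))
        (origin (f / g) (1 / g)) := by
    intro S hS
    rw [(hP.blowUp hc1 hp1).mem_blowUp hp2, hP.mem_blowUp hp1]
    exact Or.inr hS
  have huf : ∀ S, IsLoc (coordRing (1 / f) g) S →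
      S ∈ InceXII.blowUp (InceXII.blowUp (projectivePlane f g) (origin (1 / f) (g / f)))
        (origin (f / g) (1 / g)) := by
    intro S hS
    by_cases hv : Vanishes S (1 / f)
    · exact hexc1 S ((e1 S).2 (Or.inl ⟨hS, hv⟩))
    · exact hplane S (by simpa using hS.inv_left hv)
  have hug : ∀ S, IsLoc (coordRing f (1 / g)) S →
      S ∈ InceXII.blowUp (InceXII.blowUp (projectivePlane f g) (origin (1 / f) (g / f)))
        (origin (f / g) (1 / g)) := by
    intro S hS
    by_cases hv : Vanishes S (1 / g)
    · exact hexc2 S ((e2 S).2 (Or.inl ⟨hS, hv⟩))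
    · exact hplane S (by simpa using hS.inv_right hv)
  have projf : ∀ S, IsLoc (coordRing (1 / f) (g / f)) S → ¬ Vanishes S (1 / f) →
      IsLoc (coordRing f g) S := by
    intro S hS hv
    have := hS.projective hv
    convert this using 2 <;> field_simp
  have projg : ∀ S, IsLoc (coordRing (f / g) (1 / g)) S → ¬ Vanishes S (1 / g) →
      IsLoc (coordRing f g) S := by
    intro S hS hv
    rw [coordRing_comm] at hS ⊢
    have := hS.projective hv
    convert this using 2 <;> field_simp
  ext S
  constructor
  · rw [(hP.blowUp hc1 hp1).mem_blowUp hp2, hP.mem_blowUp hp1, hQ.mem_blowUp hp3]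
    have hQp : IsLoc (coordRing f g) S → S ∈ quadric f g ∧ ¬ origin (1 / f) (1 / g) ≤ S := fun hS =>
      ⟨mem_quadric.2 (Or.inl hS), fun hl => hinf S (hS.1 left_mem_coordRing) (l3 S hl).1⟩
    have hQf : IsLoc (coordRing (1 / f) g) S →
        S ∈ quadric f g ∧ ¬ origin (1 / f) (1 / g) ≤ S := fun hS =>
      ⟨mem_quadric.2 (Or.inr (Or.inl hS)), fun hl =>
        hing S (hS.1 right_mem_coordRing) (l3 S hl).2⟩
    have hQg : IsLoc (coordRing f (1 / g)) S →
        S ∈ quadric f g ∧ ¬ origin (1 / f) (1 / g) ≤ S := fun hS =>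
      ⟨mem_quadric.2 (Or.inr (Or.inr (Or.inl hS))), fun hl =>
        hinf S (hS.1 left_mem_coordRing) (l3 S hl).1⟩
    rintro (⟨⟨hS, hl1⟩ | hS, hl2⟩ | hS)
    · rcases mem_projectivePlane.1 hS with hS | hS | hS
      · exact Or.inl (hQp hS)
      · by_cases hv : Vanishes S (1 / f)
        · refine Or.inr ((e3 S).2 (Or.inl ⟨?_, hv⟩))
          have := hS.inv_right fun hw => hl1 (hc1.origin_le hS.algebraMap_mem hv hw)
          rwa [one_div_div] at this
        · exact Or.inl (hQp (projf S hS hv))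
      · by_cases hv : Vanishes S (1 / g)
        · refine Or.inr ((e3 S).2 (Or.inr ⟨?_, hv⟩))
          have := hS.inv_left fun hw => hl2 (hc2.origin_le hS.algebraMap_mem hw hv)
          rwa [one_div_div, coordRing_comm] at this
        · exact Or.inl (hQp (projg S hS hv))
    · rcases (e1 S).1 hS with ⟨hS, hv⟩ | ⟨hS, hv⟩
      · exact Or.inl (hQf hS)
      · by_cases hw : Vanishes S (1 / g)
        · exact Or.inr ((e3 S).2 (Or.inr ⟨hS, hw⟩))
        · refine Or.inl (hQf ?_)
          have := (hS.mul_right hw).inv_left hw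
          rw [coordRing_comm] at this
          convert this using 2 <;> field_simp
    · rcases (e2 S).1 hS with ⟨hS, hv⟩ | ⟨hS, hv⟩
      · exact Or.inl (hQg hS)
      · by_cases hw : Vanishes S (1 / f)
        · exact Or.inr ((e3 S).2 (Or.inl ⟨hS, hw⟩))
        · refine Or.inl (hQg ?_)
          have := (hS.mul_right hw).inv_left hw
          convert this using 2 <;> field_simp
  · rw [hQ.mem_blowUp hp3]
    rintro (⟨hS, hl⟩ | hS)
    · rcases mem_quadric.1 hS with hS | hS | hS | hS
      · exact hplane S hS
      · exact huf S hS
      · exact hug S hS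
      · by_cases hv : Vanishes S (1 / f)
        · refine huf S ?_
          have := hS.inv_right fun hw => hl (hc3.origin_le hS.algebraMap_mem hv hw)
          rwa [one_div_one_div] at this
        · refine hug S ?_
          simpa using hS.inv_left hv
    · rcases (e3 S).1 hS with ⟨hS, hv⟩ | ⟨hS, hv⟩
      · by_cases hw : Vanishes S (f / g)
        · exact hexc2 S ((e2 S).2 (Or.inr ⟨hS, hw⟩))
        · rw [(hP.blowUp hc1 hp1).mem_blowUp hp2, hP.mem_blowUp hp1]
          have h1 := hS.inv_right hw
          rw [one_div_div] at h1
          exact Or.inl ⟨Or.inl ⟨mem_projectivePlane.2 (Or.inr (Or.inl h1)),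
            hinc S (hS.1 right_mem_coordRing)⟩, fun hl => hw (l2 S hl).1⟩
      · by_cases hw : Vanishes S (g / f)
        · exact hexc1 S ((e1 S).2 (Or.inr ⟨hS, hw⟩))
        · rw [(hP.blowUp hc1 hp1).mem_blowUp hp2, hP.mem_blowUp hp1]
          have h1 := hS.inv_right hw
          rw [one_div_div, coordRing_comm] at h1
          exact Or.inl ⟨Or.inl ⟨mem_projectivePlane.2 (Or.inr (Or.inr h1)),
            fun hl => hw (l1 S hl).2⟩, hinc' S (hS.1 right_mem_coordRing)⟩

end BlowUps
end InceXII

namespace InceXII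

/-! ### The two constructions of the surface -/

noncomputable section Surface

variable {K : Type*} [Field K]

/-- The result of successive blow-ups. -/
def blowUps (X : Model K) (ps : List (LocalSubring K)) : Model K := ps.foldl blowUp X

theorem blowUps_cons (X : Model K) (p : LocalSubring K) (ps : List (LocalSubring K)) :
    blowUps X (p :: ps) = blowUps (blowUp X p) ps := rfl

theorem not_vanishes_one_div {S : LocalSubring K} {z : K} (h0 : z ≠ 0) (hz : z ∈ S.toSubring) :
    ¬ Vanishes S (1 / z) :=
  not_vanishes_of_inv_mem (by simpa using h0) (by simpa using hz)

theorem isBlowUpSequence_append {X Y Z : Model K} {ps qs : List (LocalSubring K)}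
    (h1 : IsBlowUpSequence X ps Y) (h2 : IsBlowUpSequence Y qs Z) :
    IsBlowUpSequence X (ps ++ qs) Z := by
  induction ps generalizing X with
  | nil => obtain rfl : Y = X := h1; exact h2
  | cons p ps ih => exact ⟨h1.1, ih h1.2⟩

/-- Used to move the blow-up of a coordinate point at infinity, or of the corner, past the other
centers. -/
theorem blowUps_blowUp_comm (X : Model K) {p : LocalSubring K} {ps : List (LocalSubring K)}
    (h : ∀ q ∈ ps, ¬ p ≤ q ∧ ¬ q ≤ p) : blowUps (blowUp X p) ps = blowUp (blowUps X ps) p := by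
  induction ps generalizing X with
  | nil => rfl
  | cons q ps ih =>
    have hq := h q (by simp)
    rw [blowUps_cons, blowUps_cons, blowUp_comm X hq.1 hq.2]
    exact ih _ fun q' hq' => h q' (List.mem_cons_of_mem _ hq')

variable [Algebra ℂ K]

/-- The point `x = ∞, y = r`. -/
def poleCenter (x y : K) (r : ℂ) : LocalSubring K := origin (1 / x) (y - algebraMap ℂ K r)

/-- The point `x = ∞, (y - r) x = c`. -/
def poleCenter' (x y : K) (r c : ℂ) : LocalSubring K :=
  origin (1 / x) ((y - algebraMap ℂ K r) * x - algebraMap ℂ K c)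

/-- The point `x = 0, y = ∞`. -/
def zeroCenter₁ (x y : K) : LocalSubring K := origin x (1 / y)

/-- The point `x = 0, x y = ∞`. -/
def zeroCenter₂ (x y : K) : LocalSubring K := origin x (1 / (x * y))

/-- The point `x = 0, x² y = - d`. -/
def zeroCenter₃ (x y : K) (d : ℂ) : LocalSubring K := origin x (x ^ 2 * y + algebraMap ℂ K d)

/-- The point `x = 0, (x² y + d) / x = e`. -/
def zeroCenter₄ (x y : K) (d e : ℂ) : LocalSubring K :=
  origin x ((x ^ 2 * y + algebraMap ℂ K d) / x - algebraMap ℂ K e)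

/-- The blown-up points of the quadric, in the fibre `x = ∞`. -/
def poleCenters (x y : K) (s c c' : ℂ) : List (LocalSubring K) :=
  [poleCenter x y s, poleCenter' x y s c, poleCenter x y (-s), poleCenter' x y (-s) c']

/-- The blown-up points of the quadric, in the fibre `x = 0`. -/
def zeroCenters (x y : K) (d e : ℂ) : List (LocalSubring K) :=
  [zeroCenter₁ x y, zeroCenter₂ x y, zeroCenter₃ x y d, zeroCenter₄ x y d e]

/-- The surface: the quadric blown up at eight points. -/
def surface (x y : K) (s c c' d e : ℂ) : Model K :=
  blowUps (blowUps (quadric x y) (poleCenters x y s c c')) (zeroCenters x y d e)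

variable {x y : K} {s c c' d e r r' : ℂ}

theorem IsBirationalChart.pole (h : IsBirationalChart x y) (r : ℂ) :
    IsBirationalChart (1 / x) (y - algebraMap ℂ K r) := h.inv_left.sub_const r

theorem IsBirationalChart.poleMul (h : IsBirationalChart x y) (r : ℂ) :
    IsBirationalChart (1 / x) ((y - algebraMap ℂ K r) * x) := by
  have := (h.pole r).div_right
  rwa [div_div_eq_mul_div, div_one] at this

theorem IsBirationalChart.pole' (h : IsBirationalChart x y) (r c : ℂ) :
    IsBirationalChart (1 / x) ((y - algebraMap ℂ K r) * x - algebraMap ℂ K c) :=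
  (h.poleMul r).sub_const c

theorem IsBirationalChart.pole'' (h : IsBirationalChart x y) (r c : ℂ) :
    IsBirationalChart (1 / x) (((y - algebraMap ℂ K r) * x - algebraMap ℂ K c) * x) := by
  have := (h.pole' r c).div_right
  rwa [div_div_eq_mul_div, div_one] at this

theorem IsBirationalChart.zero₂ (h : IsBirationalChart x y) :
    IsBirationalChart x (1 / (x * y)) := by
  have := h.inv_right.div_right
  rwa [div_div, mul_comm] at this

theorem IsBirationalChart.zero₂' (h : IsBirationalChart x y) :
    IsBirationalChart x (1 / (x ^ 2 * y)) := by
  have := h.zero₂.div_right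
  rwa [div_div, mul_comm, ← mul_assoc, ← pow_two] at this

theorem IsBirationalChart.sq_mul (h : IsBirationalChart x y) :
    IsBirationalChart x (x ^ 2 * y) := by
  simpa using h.zero₂'.inv_right

theorem IsBirationalChart.zero₃ (h : IsBirationalChart x y) (d : ℂ) :
    IsBirationalChart x (x ^ 2 * y + algebraMap ℂ K d) := h.sq_mul.add_const d

theorem IsBirationalChart.zero₃' (h : IsBirationalChart x y) (d : ℂ) :
    IsBirationalChart x ((x ^ 2 * y + algebraMap ℂ K d) / x) := (h.zero₃ d).div_right

theorem IsBirationalChart.zero₄ (h : IsBirationalChart x y) (d e : ℂ) :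
    IsBirationalChart x ((x ^ 2 * y + algebraMap ℂ K d) / x - algebraMap ℂ K e) :=
  (h.zero₃' d).sub_const e

theorem poleCenter'_mem_exceptional (h : IsBirationalChart x y) (r c : ℂ) :
    poleCenter' x y r c ∈ exceptional (poleCenter x y r) := by
  refine (h.pole r).mem_exceptional_iff.2 (Or.inr (Or.inl ⟨c, ?_⟩))
  rw [poleCenter', div_div_eq_mul_div, div_one]

theorem zeroCenter₂_mem_exceptional (h : IsBirationalChart x y) :
    zeroCenter₂ x y ∈ exceptional (zeroCenter₁ x y) := by
  refine h.inv_right.mem_exceptional_iff.2 (Or.inr (Or.inl ⟨0, ?_⟩))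
  rw [zeroCenter₂, map_zero, sub_zero, div_div, mul_comm]

theorem isLoc_sq_mul_zeroCenter₃ (h : IsBirationalChart x y) (d : ℂ) :
    IsLoc (coordRing x (x ^ 2 * y)) (zeroCenter₃ x y d) := by
  have h1 := (h.zero₃ d).isLoc_origin
  have h2 := coordRing_sub_const (f := x) (g := x ^ 2 * y) (-d)
  rw [map_neg, sub_neg_eq_add] at h2
  rwa [h2] at h1

theorem not_vanishes_sq_mul_zeroCenter₃ (h : IsBirationalChart x y) (hd : d ≠ 0) :
    ¬ Vanishes (zeroCenter₃ x y d) (x ^ 2 * y) := by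
  intro hv
  have h1 := (h.zero₃ d).origin_vanishes_right
  have := h1.sub hv
  rw [add_sub_cancel_left] at this
  exact not_vanishes_algebraMap (h.zero₃ d).isLoc_origin.algebraMap_mem hd this

/-- The blow-up has the coordinate `1 / (x² y)`, whereas the center is given by `x² y`. For `d ≠ 0`
the function `x² y` is a unit at the center, and the two coordinates are interchangeable. -/
theorem zeroCenter₃_mem_exceptional (h : IsBirationalChart x y) (hd : d ≠ 0) :
    zeroCenter₃ x y d ∈ exceptional (zeroCenter₂ x y) := by
  refine h.zero₂.mem_exceptional.2 (Or.inl ⟨?_, (h.zero₃ d).origin_vanishes_left⟩)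
  have := (isLoc_sq_mul_zeroCenter₃ h d).inv_right (not_vanishes_sq_mul_zeroCenter₃ h hd)
  rwa [div_div, mul_comm, ← mul_assoc, ← pow_two]

theorem zeroCenter₄_mem_exceptional (h : IsBirationalChart x y) (d e : ℂ) :
    zeroCenter₄ x y d e ∈ exceptional (zeroCenter₃ x y d) :=
  (h.zero₃ d).mem_exceptional_iff.2 (Or.inr (Or.inl ⟨e, rfl⟩))

theorem poleCenter_le_imp (h : IsBirationalChart x y) {S : LocalSubring K}
    (hS : poleCenter x y r ≤ S) : Vanishes S (1 / x) ∧ Vanishes S (y - algebraMap ℂ K r) :=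
  ⟨(localSubring_le_iff.1 hS).2 _ (h.pole r).origin_vanishes_left,
    (localSubring_le_iff.1 hS).2 _ (h.pole r).origin_vanishes_right⟩

theorem zeroCenter₁_le_imp (h : IsBirationalChart x y) {S : LocalSubring K}
    (hS : zeroCenter₁ x y ≤ S) : Vanishes S x ∧ Vanishes S (1 / y) :=
  ⟨(localSubring_le_iff.1 hS).2 _ h.inv_right.origin_vanishes_left,
    (localSubring_le_iff.1 hS).2 _ h.inv_right.origin_vanishes_right⟩

theorem not_poleCenter_le_of_poleCenter_le (h : IsBirationalChart x y) {S : LocalSubring K}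
    (hr : r ≠ r') (hS : poleCenter x y r ≤ S) : ¬ poleCenter x y r' ≤ S := by
  intro hS'
  have h1 := (poleCenter_le_imp h hS).2.sub (poleCenter_le_imp h hS').2
  rw [sub_sub_sub_cancel_left, ← map_sub] at h1
  refine not_vanishes_algebraMap (fun c => (localSubring_le_iff.1 hS).1
    ((h.pole r).isLoc_origin.algebraMap_mem c)) (sub_ne_zero.2 hr.symm) h1

theorem not_zeroCenter₁_le_of_poleCenter_le (h : IsBirationalChart x y) {S : LocalSubring K}
    (hS : poleCenter x y r ≤ S) : ¬ zeroCenter₁ x y ≤ S := fun hS' =>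
  not_vanishes_one_div h.left_ne_zero (zeroCenter₁_le_imp h hS').1.1 (poleCenter_le_imp h hS).1

theorem poleCenter_le' (h : IsBirationalChart x y) {S : LocalSubring K}
    (hS : poleCenter' x y r c ≤ S) : poleCenter x y r ≤ S :=
  (le_of_mem_exceptional (poleCenter'_mem_exceptional h r c)).trans hS

theorem poleCenter_mem_quadric (h : IsBirationalChart x y) : poleCenter x y r ∈ quadric x y := by
  refine mem_quadric.2 (Or.inr (Or.inl ?_))
  rw [← coordRing_sub_const r]
  exact (h.pole r).isLoc_origin

theorem zeroCenter₁_mem_quadric (h : IsBirationalChart x y) : zeroCenter₁ x y ∈ quadric x y :=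
  mem_quadric.2 (Or.inr (Or.inr (Or.inl h.inv_right.isLoc_origin)))

/-- Four points in the fibre over `x = ∞` of a separated model that contains two points of it. -/
theorem isBlowUpSequence_poleCenters (h : IsBirationalChart x y) (hs : s ≠ 0) {X : Model K}
    (hX : IsSeparatedModel X) (h1 : poleCenter x y s ∈ X) (h2 : poleCenter x y (-s) ∈ X) :
    IsBlowUpSequence X (poleCenters x y s c c') (blowUps X (poleCenters x y s c c')) ∧
    IsSeparatedModel (blowUps X (poleCenters x y s c c')) ∧
    ∀ S, S ∈ blowUps X (poleCenters x y s c c') ↔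
      (S ∈ X ∧ ¬ poleCenter x y s ≤ S ∧ ¬ poleCenter x y (-s) ≤ S) ∨
      (S ∈ exceptional (poleCenter x y s) ∧ ¬ poleCenter' x y s c ≤ S) ∨
      S ∈ exceptional (poleCenter' x y s c) ∨
      (S ∈ exceptional (poleCenter x y (-s)) ∧ ¬ poleCenter' x y (-s) c' ≤ S) ∨
      S ∈ exceptional (poleCenter' x y (-s) c') := by
  have hss : s ≠ -s := fun h0 => hs (self_eq_neg.1 h0)
  have hi : ∀ S, poleCenter x y s ≤ S → ¬ poleCenter x y (-s) ≤ S :=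
    fun S => not_poleCenter_le_of_poleCenter_le h hss
  have x1 : IsSeparatedModel (blowUp X (poleCenter x y s)) := hX.blowUp (h.pole s) h1
  have m2 : poleCenter' x y s c ∈ blowUp X (poleCenter x y s) :=
    (hX.mem_blowUp h1).2 (Or.inr (poleCenter'_mem_exceptional h s c))
  have x2 : IsSeparatedModel (blowUp (blowUp X (poleCenter x y s)) (poleCenter' x y s c)) :=
    x1.blowUp (h.pole' s c) m2
  have m3 : poleCenter x y (-s) ∈ blowUp (blowUp X (poleCenter x y s)) (poleCenter' x y s c) :=
    (x1.mem_blowUp m2).2 (Or.inl ⟨(hX.mem_blowUp h1).2 (Or.inl ⟨h2, fun h3 => hi _ h3 le_rfl⟩),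
      fun h3 => hi _ (poleCenter_le' h h3) le_rfl⟩)
  have x3 : IsSeparatedModel (blowUp (blowUp (blowUp X (poleCenter x y s)) (poleCenter' x y s c))
    (poleCenter x y (-s))) := x2.blowUp (h.pole (-s)) m3
  have m4 : poleCenter' x y (-s) c' ∈
      blowUp (blowUp (blowUp X (poleCenter x y s)) (poleCenter' x y s c)) (poleCenter x y (-s)) :=
    (x2.mem_blowUp m3).2 (Or.inr (poleCenter'_mem_exceptional h (-s) c'))
  have x4 := x3.blowUp (h.pole' (-s) c') m4
  refine ⟨⟨hX.isClosedPoint (h.pole s) h1, x1.isClosedPoint (h.pole' s c) m2,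
    x2.isClosedPoint (h.pole (-s)) m3, x3.isClosedPoint (h.pole' (-s) c') m4, rfl⟩, x4, fun S => ?_⟩
  refine (x3.mem_blowUp m4).trans ?_
  rw [x2.mem_blowUp m3, x1.mem_blowUp m2, hX.mem_blowUp h1]
  -- The rest is propositional: a condition on a later center is void for points above a center with
  -- which it is incomparable.
  have t1 : poleCenter' x y s c ≤ S → poleCenter x y s ≤ S := poleCenter_le' h
  have t2 : poleCenter' x y (-s) c' ≤ S → poleCenter x y (-s) ≤ S := poleCenter_le' h
  have t3 : S ∈ exceptional (poleCenter x y s) → poleCenter x y s ≤ S := le_of_mem_exceptional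
  have t4 : S ∈ exceptional (poleCenter' x y s c) → poleCenter' x y s c ≤ S :=
    le_of_mem_exceptional
  have t5 := hi S
  grind

theorem zeroCenter_le (h : IsBirationalChart x y) (hd : d ≠ 0) {S : LocalSubring K} :
    (zeroCenter₂ x y ≤ S → zeroCenter₁ x y ≤ S) ∧ (zeroCenter₃ x y d ≤ S → zeroCenter₂ x y ≤ S) ∧
      (zeroCenter₄ x y d e ≤ S → zeroCenter₃ x y d ≤ S) :=
  ⟨(le_of_mem_exceptional (zeroCenter₂_mem_exceptional h)).trans,
    (le_of_mem_exceptional (zeroCenter₃_mem_exceptional h hd)).trans,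
    (le_of_mem_exceptional (zeroCenter₄_mem_exceptional h d e)).trans⟩

/-- In contrast to the two chains of length two at `x = ∞`, these centers form a single chain of
infinitely near points, each on the exceptional curve of its predecessor. -/
theorem isBlowUpSequence_zeroCenters (h : IsBirationalChart x y) (hd : d ≠ 0) {X : Model K}
    (hX : IsSeparatedModel X) (h1 : zeroCenter₁ x y ∈ X) :
    IsBlowUpSequence X (zeroCenters x y d e) (blowUps X (zeroCenters x y d e)) ∧
    IsSeparatedModel (blowUps X (zeroCenters x y d e)) ∧
    ∀ S, S ∈ blowUps X (zeroCenters x y d e) ↔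
      (S ∈ X ∧ ¬ zeroCenter₁ x y ≤ S) ∨
      (S ∈ exceptional (zeroCenter₁ x y) ∧ ¬ zeroCenter₂ x y ≤ S) ∨
      (S ∈ exceptional (zeroCenter₂ x y) ∧ ¬ zeroCenter₃ x y d ≤ S) ∨
      (S ∈ exceptional (zeroCenter₃ x y d) ∧ ¬ zeroCenter₄ x y d e ≤ S) ∨
      S ∈ exceptional (zeroCenter₄ x y d e) := by
  have x1 : IsSeparatedModel (blowUp X (zeroCenter₁ x y)) := hX.blowUp h.inv_right h1
  have m2 : zeroCenter₂ x y ∈ blowUp X (zeroCenter₁ x y) :=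
    (hX.mem_blowUp h1).2 (Or.inr (zeroCenter₂_mem_exceptional h))
  have x2 : IsSeparatedModel (blowUp (blowUp X (zeroCenter₁ x y)) (zeroCenter₂ x y)) :=
    x1.blowUp h.zero₂ m2
  have m3 : zeroCenter₃ x y d ∈ blowUp (blowUp X (zeroCenter₁ x y)) (zeroCenter₂ x y) :=
    (x1.mem_blowUp m2).2 (Or.inr (zeroCenter₃_mem_exceptional h hd))
  have x3 : IsSeparatedModel (blowUp (blowUp (blowUp X (zeroCenter₁ x y)) (zeroCenter₂ x y))
    (zeroCenter₃ x y d)) := x2.blowUp (h.zero₃ d) m3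
  have m4 : zeroCenter₄ x y d e ∈
      blowUp (blowUp (blowUp X (zeroCenter₁ x y)) (zeroCenter₂ x y)) (zeroCenter₃ x y d) :=
    (x2.mem_blowUp m3).2 (Or.inr (zeroCenter₄_mem_exceptional h d e))
  have x4 := x3.blowUp (h.zero₄ d e) m4
  refine ⟨⟨hX.isClosedPoint h.inv_right h1, x1.isClosedPoint h.zero₂ m2,
    x2.isClosedPoint (h.zero₃ d) m3, x3.isClosedPoint (h.zero₄ d e) m4, rfl⟩, x4, fun S => ?_⟩
  refine (x3.mem_blowUp m4).trans ?_
  rw [x2.mem_blowUp m3, x1.mem_blowUp m2, hX.mem_blowUp h1]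
  obtain ⟨t1, t2, t3⟩ := zeroCenter_le h hd (S := S) (e := e)
  grind

theorem zeroCenter₁_mem_blowUps (h : IsBirationalChart x y) (hs : s ≠ 0) :
    zeroCenter₁ x y ∈ blowUps (quadric x y) (poleCenters x y s c c') := by
  refine ((isBlowUpSequence_poleCenters h hs h.isSeparatedModel_quadric (poleCenter_mem_quadric h)
    (poleCenter_mem_quadric h)).2.2 _).2 (Or.inl ⟨zeroCenter₁_mem_quadric h, ?_, ?_⟩)
  · exact fun h1 => not_zeroCenter₁_le_of_poleCenter_le h h1 le_rfl
  · exact fun h1 => not_zeroCenter₁_le_of_poleCenter_le h h1 le_rfl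

theorem isSeparatedModel_surface (h : IsBirationalChart x y) (hs : s ≠ 0) (hd : d ≠ 0) :
    IsSeparatedModel (surface x y s c c' d e) :=
  (isBlowUpSequence_zeroCenters h hd (isBlowUpSequence_poleCenters h hs h.isSeparatedModel_quadric
    (poleCenter_mem_quadric h) (poleCenter_mem_quadric h)).2.1 (zeroCenter₁_mem_blowUps h hs)).2.1

/-- The points of the surface, by their images on the quadric. -/
theorem mem_surface (h : IsBirationalChart x y) (hs : s ≠ 0) (hd : d ≠ 0) {S : LocalSubring K} :
    S ∈ surface x y s c c' d e ↔
      (S ∈ quadric x y ∧ ¬ poleCenter x y s ≤ S ∧ ¬ poleCenter x y (-s) ≤ S ∧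
        ¬ zeroCenter₁ x y ≤ S) ∨
      (S ∈ exceptional (poleCenter x y s) ∧ ¬ poleCenter' x y s c ≤ S) ∨
      S ∈ exceptional (poleCenter' x y s c) ∨
      (S ∈ exceptional (poleCenter x y (-s)) ∧ ¬ poleCenter' x y (-s) c' ≤ S) ∨
      S ∈ exceptional (poleCenter' x y (-s) c') ∨
      (S ∈ exceptional (zeroCenter₁ x y) ∧ ¬ zeroCenter₂ x y ≤ S) ∨
      (S ∈ exceptional (zeroCenter₂ x y) ∧ ¬ zeroCenter₃ x y d ≤ S) ∨
      (S ∈ exceptional (zeroCenter₃ x y d) ∧ ¬ zeroCenter₄ x y d e ≤ S) ∨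
      S ∈ exceptional (zeroCenter₄ x y d e) := by
  have h1 := isBlowUpSequence_poleCenters (c := c) (c' := c') h hs h.isSeparatedModel_quadric
    (poleCenter_mem_quadric h) (poleCenter_mem_quadric h)
  refine ((isBlowUpSequence_zeroCenters h hd h1.2.1 (zeroCenter₁_mem_blowUps h hs)).2.2 S).trans ?_
  rw [h1.2.2 S]
  have t1 : S ∈ exceptional (poleCenter x y s) → ¬ zeroCenter₁ x y ≤ S := fun h1 =>
    not_zeroCenter₁_le_of_poleCenter_le h (le_of_mem_exceptional h1)
  have t2 : S ∈ exceptional (poleCenter x y (-s)) → ¬ zeroCenter₁ x y ≤ S := fun h1 =>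
    not_zeroCenter₁_le_of_poleCenter_le h (le_of_mem_exceptional h1)
  have t3 : S ∈ exceptional (poleCenter' x y s c) → ¬ zeroCenter₁ x y ≤ S := fun h1 =>
    not_zeroCenter₁_le_of_poleCenter_le h (poleCenter_le' h (le_of_mem_exceptional h1))
  have t4 : S ∈ exceptional (poleCenter' x y (-s) c') → ¬ zeroCenter₁ x y ≤ S := fun h1 =>
    not_zeroCenter₁_le_of_poleCenter_le h (poleCenter_le' h (le_of_mem_exceptional h1))
  grind

theorem right_mem_poleCenter (h : IsBirationalChart x y) (r : ℂ) :
    y ∈ (poleCenter x y r).toSubring := by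
  have := add_mem (h.pole r).origin_vanishes_right.1 ((h.pole r).isLoc_origin.algebraMap_mem r)
  rwa [sub_add_cancel] at this

theorem right_mem_poleCenter' (h : IsBirationalChart x y) (r c : ℂ) :
    y ∈ (poleCenter' x y r c).toSubring :=
  (localSubring_le_iff.1 (le_of_mem_exceptional (poleCenter'_mem_exceptional h r c))).1
    (right_mem_poleCenter h r)

/-- At each of the eight centers `x` or `y` is regular, while `1/x` and `1/y` both vanish at the
corner. Hence the blow-up of the corner commutes with the others. -/
theorem corner_incomparable (h : IsBirationalChart x y) :
    ∀ q ∈ poleCenters x y s c c' ++ zeroCenters x y d e,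
      ¬ origin (1 / x) (1 / y) ≤ q ∧ ¬ q ≤ origin (1 / x) (1 / y) := by
  have hv := h.inv_left.inv_right.origin_vanishes_left
  have hw := h.inv_left.inv_right.origin_vanishes_right
  have key : ∀ q : LocalSubring K, y ∈ q.toSubring →
      ¬ origin (1 / x) (1 / y) ≤ q ∧ ¬ q ≤ origin (1 / x) (1 / y) := fun q hq =>
    ⟨not_le_of_mem_of_inv_mem hw (by simpa using h.right_ne_zero) (by simpa using hq),
      not_ge_of_mem_of_inv_mem hw (by simpa using h.right_ne_zero) (by simpa using hq)⟩
  have key' : ∀ q : LocalSubring K, x ∈ q.toSubring →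
      ¬ origin (1 / x) (1 / y) ≤ q ∧ ¬ q ≤ origin (1 / x) (1 / y) := fun q hq =>
    ⟨not_le_of_mem_of_inv_mem hv (by simpa using h.left_ne_zero) (by simpa using hq),
      not_ge_of_mem_of_inv_mem hv (by simpa using h.left_ne_zero) (by simpa using hq)⟩
  have hy := right_mem_poleCenter h
  have hy' := right_mem_poleCenter' h
  intro q hq
  simp only [poleCenters, zeroCenters, List.cons_append, List.nil_append, List.mem_cons,
    List.not_mem_nil, or_false] at hq
  rcases hq with rfl | rfl | rfl | rfl | rfl | rfl | rfl | rfl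
  · exact key _ (hy _)
  · exact key _ (hy' _ _)
  · exact key _ (hy _)
  · exact key _ (hy' _ _)
  · exact key' _ h.inv_right.origin_vanishes_left.1
  · exact key' _ h.zero₂.origin_vanishes_left.1
  · exact key' _ (h.zero₃ d).origin_vanishes_left.1
  · exact key' _ (h.zero₄ d e).origin_vanishes_left.1

theorem corner_mem_surface (h : IsBirationalChart x y) (hs : s ≠ 0) (hd : d ≠ 0) :
    origin (1 / x) (1 / y) ∈ surface x y s c c' d e := by
  have hi := corner_incomparable (s := s) (c := c) (c' := c') (d := d) (e := e) h
  refine (mem_surface h hs hd).2 (Or.inl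
    ⟨mem_quadric.2 (Or.inr (Or.inr (Or.inr h.inv_left.inv_right.isLoc_origin))), ?_, ?_, ?_⟩)
  · exact (hi _ (by simp [poleCenters])).2
  · exact (hi _ (by simp [poleCenters])).2
  · exact (hi _ (by simp [zeroCenters])).2

theorem mem_exceptional_projective (h : IsBirationalChart x y) {S : LocalSubring K} :
    S ∈ exceptional (origin (1 / x) (y / x)) ↔
      (IsLoc (coordRing (1 / x) y) S ∧ Vanishes S (1 / x)) ∨
        (IsLoc (coordRing (1 / y) (y / x)) S ∧ Vanishes S (y / x)) := by
  have hx := h.left_ne_zero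
  have hy := h.right_ne_zero
  rw [h.projective.mem_exceptional]
  have h1 : y / x / (1 / x) = y := by field_simp
  have h2 : 1 / x / (y / x) = 1 / y := by field_simp
  rw [h1, h2]

theorem origin_projective_mem (h : IsBirationalChart x y) :
    origin (1 / x) (y / x) ∈ projectivePlane x y :=
  mem_projectivePlane.2 (Or.inr (Or.inl h.projective.isLoc_origin))

theorem origin_projective'_mem (h : IsBirationalChart x y) :
    origin (x / y) (1 / y) ∈ blowUp (projectivePlane x y) (origin (1 / x) (y / x)) := by
  refine (h.isSeparatedModel_projectivePlane.mem_blowUp (origin_projective_mem h)).2 (Or.inl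
    ⟨mem_projectivePlane.2 (Or.inr (Or.inr h.projective'.isLoc_origin)), ?_⟩)
  exact not_le_of_mem_of_inv_mem h.projective.origin_vanishes_right
    (div_ne_zero h.right_ne_zero h.left_ne_zero)
    (by rw [inv_div]; exact h.projective'.origin_vanishes_left.1)

/-- Ten blow-ups of the projective plane. -/
theorem isBlowUpSequence_projectivePlane (h : IsBirationalChart x y) (hs : s ≠ 0) (hd : d ≠ 0) :
    IsBlowUpSequence (projectivePlane x y)
      (([origin (1 / x) (y / x)] ++ poleCenters x y s c c') ++
        ([origin (x / y) (1 / y)] ++ zeroCenters x y d e))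
      (blowUp (surface x y s c c' d e) (origin (1 / x) (1 / y))) := by
  have hP := h.isSeparatedModel_projectivePlane
  have hp1 := origin_projective_mem h
  have hP1 := hP.blowUp h.projective hp1
  have hp2 := origin_projective'_mem h
  have hinc := corner_incomparable (s := s) (c := c) (c' := c') (d := d) (e := e) h
  have hinc' : ∀ q ∈ poleCenters x y s c c',
      ¬ origin (x / y) (1 / y) ≤ q ∧ ¬ q ≤ origin (x / y) (1 / y) := by
    have key : ∀ q : LocalSubring K, y ∈ q.toSubring →
        ¬ origin (x / y) (1 / y) ≤ q ∧ ¬ q ≤ origin (x / y) (1 / y) := fun q hq =>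
      ⟨not_le_of_mem_of_inv_mem h.projective'.origin_vanishes_right (by simpa using h.right_ne_zero)
        (by simpa using hq), not_ge_of_mem_of_inv_mem h.projective'.origin_vanishes_right
        (by simpa using h.right_ne_zero) (by simpa using hq)⟩
    have hy := right_mem_poleCenter h
    have hy' := right_mem_poleCenter' h
    intro q hq
    simp only [poleCenters, List.mem_cons, List.not_mem_nil, or_false] at hq
    rcases hq with rfl | rfl | rfl | rfl
    exacts [key _ (hy _), key _ (hy' _ _), key _ (hy _), key _ (hy' _ _)]
  have hmem : ∀ r, poleCenter x y r ∈
      InceXII.blowUp (projectivePlane x y) (origin (1 / x) (y / x)) := fun r => by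
    refine (hP.mem_blowUp hp1).2 (Or.inr ((mem_exceptional_projective h).2 (Or.inl ⟨?_,
      (h.pole r).origin_vanishes_left⟩)))
    rw [← coordRing_sub_const r]
    exact (h.pole r).isLoc_origin
  have hpole := isBlowUpSequence_poleCenters (c := c) (c' := c') h hs hP1 (hmem s) (hmem (-s))
  have hp2' := (hpole.2.2 (origin (x / y) (1 / y))).2 (Or.inl ⟨hp2,
    (hinc' _ (by simp [poleCenters])).2, (hinc' _ (by simp [poleCenters])).2⟩)
  have hX5 := hpole.2.1.blowUp h.projective' hp2'
  -- The blow-up of `(x/y, 1/y)` is moved in front of the pole centers, where together with the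
  -- first one it becomes the blow-up of the corner of the quadric; that one is moved back behind
  -- the pole centers.
  have heq : InceXII.blowUp (blowUps (InceXII.blowUp (projectivePlane x y)
      (origin (1 / x) (y / x))) (poleCenters x y s c c')) (origin (x / y) (1 / y)) =
      InceXII.blowUp (blowUps (quadric x y) (poleCenters x y s c c')) (origin (1 / x) (1 / y)) := by
    rw [← blowUps_blowUp_comm _ hinc', h.blowUp_projectivePlane,
      blowUps_blowUp_comm _ fun q hq => hinc q (List.mem_append_left _ hq)]
  have hQ := isBlowUpSequence_poleCenters (c := c) (c' := c') h hs h.isSeparatedModel_quadric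
    (poleCenter_mem_quadric h) (poleCenter_mem_quadric h)
  have hcm : origin (1 / x) (1 / y) ∈ blowUps (quadric x y) (poleCenters x y s c c') :=
    (hQ.2.2 _).2 (Or.inl ⟨mem_quadric.2 (Or.inr (Or.inr (Or.inr h.inv_left.inv_right.isLoc_origin))),
      (hinc _ (by simp [poleCenters])).2, (hinc _ (by simp [poleCenters])).2⟩)
  have hz1 : zeroCenter₁ x y ∈ InceXII.blowUp (blowUps (InceXII.blowUp (projectivePlane x y)
      (origin (1 / x) (y / x))) (poleCenters x y s c c')) (origin (x / y) (1 / y)) := by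
    rw [heq]
    exact (hQ.2.1.mem_blowUp hcm).2 (Or.inl ⟨zeroCenter₁_mem_blowUps h hs,
      (hinc _ (by simp [zeroCenters])).1⟩)
  have hzero := isBlowUpSequence_zeroCenters (e := e) h hd hX5 hz1
  -- The corner is moved behind the zero centers as well, so that its blow-up is the last one and is
  -- the one to be contracted.
  have hfin : InceXII.blowUp (surface x y s c c' d e) (origin (1 / x) (1 / y)) =
      blowUps (InceXII.blowUp (blowUps (InceXII.blowUp (projectivePlane x y)
      (origin (1 / x) (y / x))) (poleCenters x y s c c')) (origin (x / y) (1 / y)))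
      (zeroCenters x y d e) := by
    rw [heq, blowUps_blowUp_comm _ fun q hq => hinc q (List.mem_append_right _ hq)]
    rfl
  rw [hfin]
  refine isBlowUpSequence_append (isBlowUpSequence_append (Y := InceXII.blowUp (projectivePlane x y)
    (origin (1 / x) (y / x))) ⟨hP.isClosedPoint h.projective hp1, rfl⟩ hpole.1)
    (isBlowUpSequence_append ⟨hpole.2.1.isClosedPoint h.projective' hp2', rfl⟩ hzero.1)

/-- Nine blow-ups of another projective plane. -/
theorem isBlowUpSequence_projectivePlane' (h : IsBirationalChart x y) (hs : s ≠ 0) (hd : d ≠ 0) :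
    IsBlowUpSequence (projectivePlane x (1 / (y - algebraMap ℂ K s)))
      ([origin (1 / x) ((1 / (y - algebraMap ℂ K s)) / x),
        origin (x * (y - algebraMap ℂ K s)) (y - algebraMap ℂ K s)] ++
        ((poleCenters x y s c c').tail ++ zeroCenters x y d e))
      (surface x y s c c' d e) := by
  have h' : IsBirationalChart x (1 / (y - algebraMap ℂ K s)) := (h.sub_const s).inv_right
  have hP := h'.isSeparatedModel_projectivePlane
  have hp1 := origin_projective_mem h'
  have hP1 := hP.blowUp h'.projective hp1
  have hp2 := origin_projective'_mem h'
  have heq := h'.blowUp_projectivePlane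
  -- For `w = 1 / (y - s)` the corner `1/x = 1/w = 0` is the point `x = ∞, y = s`. The exceptional
  -- line that had to be contracted before is now the exceptional curve of the first pole center.
  rw [quadric_inv_right, h.quadric_sub_const] at heq
  simp only [div_div_eq_mul_div, div_one, one_mul] at heq hp2
  have hc := hP1.isClosedPoint (by simpa using h'.projective') hp2
  have hQ := isBlowUpSequence_poleCenters (c := c) (c' := c') h hs h.isSeparatedModel_quadric
    (poleCenter_mem_quadric h) (poleCenter_mem_quadric h)
  have hzero := isBlowUpSequence_zeroCenters (e := e) h hd hQ.2.1 (zeroCenter₁_mem_blowUps h hs)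
  refine isBlowUpSequence_append (Y := InceXII.blowUp (quadric x y) (poleCenter x y s))
    ⟨hP.isClosedPoint h'.projective hp1, hc, heq.symm⟩
    (isBlowUpSequence_append ?_ hzero.1)
  exact hQ.1.2

end Surface
end InceXII

namespace InceXII

/-! ### The special curves and points of the surface -/

noncomputable section Special

variable {K : Type*} [Field K] [Algebra ℂ K] {f g x y : K} {s c c' d e r b b' : ℂ}

theorem eq_of_vanishes_sub {S : LocalSubring K} (hc : ∀ c, algebraMap ℂ K c ∈ S.toSubring)
    (h1 : Vanishes S (g - algebraMap ℂ K b)) (h2 : Vanishes S (g - algebraMap ℂ K b')) :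
    b = b' := by
  have h3 := h1.sub h2
  rw [sub_sub_sub_cancel_left, ← map_sub] at h3
  by_contra hne
  exact not_vanishes_algebraMap hc (sub_ne_zero.2 (Ne.symm hne)) h3

theorem IsBirationalChart.liesOn_axis (h : IsBirationalChart f g) :
    LiesOn (origin f g) (axis f g) := by
  refine h.isLoc_origin.le_of_vanishes h.isLoc_axis.1 fun a ha hv => ?_
  obtain ⟨a', ha', q, rfl⟩ := exists_eq_mul_add_aeval ha
  rw [h.vanishes_axis ha'] at hv
  rw [h.vanishes_origin ha', hv, Polynomial.eval_zero]

theorem IsBirationalChart.liesOn_axis' (h : IsBirationalChart f g) :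
    LiesOn (origin f g) (axis g f) := by
  rw [origin_comm]; exact h.swap.liesOn_axis

theorem IsBirationalChart.liesOn_axis_sub (h : IsBirationalChart f g) (b : ℂ) :
    LiesOn (origin f (g - algebraMap ℂ K b)) (axis f g) := by
  rw [← axis_sub_const b]; exact (h.sub_const b).liesOn_axis

/-- A curve through the origin of a chart on which the coordinate `f` vanishes is the axis
`f = 0`. -/
theorem IsSeparatedModel.eq_axis {X : Model K} (hX : IsSeparatedModel X)
    (h : IsBirationalChart f g) (hp : origin f g ∈ X) {C : LocalSubring K} (hC : C ∈ curves X)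
    (hle : LiesOn (origin f g) C) (hf : Vanishes C f) : C = axis f g := by
  have hdvr := hC.2
  -- `T` is the center of `C` on the plane. If it is a closed point of the axis, it must be the
  -- origin, since `g - b` is a unit there for `b ≠ 0`; then `C` would be the origin by
  -- separatedness, which is not a discrete valuation ring.
  obtain ⟨T, hT, hTC⟩ := exists_isLoc_le (h.isLoc_origin.1.trans hle)
  have hTf : Vanishes T f := (vanishes_iff_of_le hTC (hT.1 left_mem_coordRing)).1 hf
  rcases h.eq_axis_or_origin hT hTf with rfl | ⟨b, rfl⟩
  · have := h.isDiscreteValuationRing_axis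
    exact (eq_of_toSubring_le (h.hasChart h.isLoc_axis) (localSubring_le_iff.1 hTC).1).symm
  · exfalso
    have hb : b = 0 := by
      by_contra hb
      have h1 : ¬ Vanishes (origin f g) (g - algebraMap ℂ K b) := fun h2 => hb
        (eq_of_vanishes_sub h.isLoc_origin.algebraMap_mem h2
          (b' := 0) (by simpa using h.origin_vanishes_right))
      refine not_vanishes_of_inv_mem (ne_zero_of_not_vanishes h1) (hle (inv_mem_of_not_vanishes
        (sub_mem h.origin_vanishes_right.1 (h.isLoc_origin.algebraMap_mem b)) h1)) ?_
      exact (localSubring_le_iff.1 hTC).2 _ (h.sub_const b).origin_vanishes_right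
    subst hb
    rw [map_zero, sub_zero] at hTC
    have := hX.eq_of_le _ hp C hC.1 C hTC le_rfl
    exact h.not_isDiscreteValuationRing_origin (this ▸ hdvr)

theorem vanishes_aeval_sub {S : LocalSubring K} (hc : ∀ c, algebraMap ℂ K c ∈ S.toSubring)
    {a b : ℂ} (hf : Vanishes S (f - algebraMap ℂ K a)) (hg : Vanishes S (g - algebraMap ℂ K b))
    (P : MvPolynomial (Fin 2) ℂ) :
    Vanishes S (MvPolynomial.aeval ![f, g] P -
      algebraMap ℂ K (MvPolynomial.eval ![a, b] P)) := by
  have hgen : ∀ i, Vanishes S (![f, g] i - algebraMap ℂ K (![a, b] i)) := by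
    intro i; fin_cases i
    · exact hf
    · exact hg
  have hmem : ∀ Q : MvPolynomial (Fin 2) ℂ, ∀ i, ![f, g] i ∈ S.toSubring := fun Q i => by
    simpa using add_mem (hgen i).1 (hc (![a, b] i))
  induction P using MvPolynomial.induction_on with
  | C c => simpa using vanishes_zero S
  | add p q hp hq =>
    have := hp.add hq
    simp only [map_add]
    convert this using 1; ring
  | mul_X p i hp =>
    have := (hp.mul_right (hmem p i)).add ((hgen i).mul_left (hc (MvPolynomial.eval ![a, b] p)))
    simp only [map_mul, MvPolynomial.aeval_X, MvPolynomial.eval_X]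
    convert this using 1; ring

theorem vanishes_aeval_iff_eval {S : LocalSubring K} (hc : ∀ c, algebraMap ℂ K c ∈ S.toSubring)
    {a b : ℂ} (hf : Vanishes S (f - algebraMap ℂ K a)) (hg : Vanishes S (g - algebraMap ℂ K b))
    (P : MvPolynomial (Fin 2) ℂ) :
    Vanishes S (MvPolynomial.aeval ![f, g] P) ↔ MvPolynomial.eval ![a, b] P = 0 := by
  have h1 := vanishes_aeval_sub hc hf hg P
  constructor
  · intro h2
    by_contra h0
    have := h2.sub h1
    rw [sub_sub_cancel] at this
    exact not_vanishes_algebraMap hc h0 this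
  · intro h0
    simpa [h0] using h1

theorem IsBirationalChart.chartPoint (h : IsBirationalChart f g) (a b : ℂ) :
    IsBirationalChart (f - algebraMap ℂ K a) (g - algebraMap ℂ K b) :=
  (h.sub_const b).swap.sub_const a |>.swap

theorem coordRing_chartPoint (a b : ℂ) :
    coordRing (f - algebraMap ℂ K a) (g - algebraMap ℂ K b) = coordRing f g := by
  rw [coordRing_sub_const, coordRing_comm, coordRing_sub_const, coordRing_comm]

/-- The Nullstellensatz for points of an affine plane. -/
theorem IsBirationalChart.exists_liesOn (h : IsBirationalChart f g) {S : LocalSubring K}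
    (hS : IsLoc (coordRing f g) S) :
    ∃ a b, LiesOn (origin (f - algebraMap ℂ K a) (g - algebraMap ℂ K b)) S := by
  have hA : ∀ P : MvPolynomial (Fin 2) ℂ, MvPolynomial.aeval ![f, g] P ∈ coordRing f g := by
    intro P
    have hr : Set.range ![f, g] = {f, g} := by simp [Set.pair_comm]
    have : MvPolynomial.aeval ![f, g] P ∈ Algebra.adjoin ℂ (Set.range ![f, g]) := by
      rw [Algebra.adjoin_range_eq_range_aeval]; exact ⟨P, rfl⟩
    rwa [hr] at this
  -- The maximal ideal of `S` is pulled back to the polynomial ring and enlarged to a maximal ideal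
  -- there, which by the Nullstellensatz is a point of `ℂ²`.
  let φ : MvPolynomial (Fin 2) ℂ →+* S.toSubring :=
    (MvPolynomial.aeval ![f, g]).toRingHom.codRestrict S.toSubring fun P => hS.1 (hA P)
  let I := (IsLocalRing.maximalIdeal S.toSubring).comap φ
  have hI : I.IsPrime := Ideal.comap_isPrime _ _
  obtain ⟨M, hM, hIM⟩ := Ideal.exists_le_maximal I hI.ne_top
  obtain ⟨p, rfl⟩ := MvPolynomial.isMaximal_iff_eq_vanishingIdeal_singleton.1 hM
  have hp : p = ![p 0, p 1] := by ext i; fin_cases i <;> rfl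
  have hc := h.chartPoint (p 0) (p 1)
  have hl := hc.isLoc_origin
  refine ⟨p 0, p 1, ?_⟩
  refine hl.le_of_vanishes (by rw [coordRing_chartPoint]; exact hS.1) fun z hz hv => ?_
  rw [coordRing_chartPoint] at hz
  obtain ⟨P, rfl⟩ : ∃ P, MvPolynomial.aeval ![f, g] P = z := by
    have hr : Set.range ![f, g] = {f, g} := by simp [Set.pair_comm]
    have : z ∈ Algebra.adjoin ℂ (Set.range ![f, g]) := by rw [hr]; exact hz
    rwa [Algebra.adjoin_range_eq_range_aeval] at this
  rw [vanishes_aeval_iff_eval hl.algebraMap_mem hc.origin_vanishes_left hc.origin_vanishes_right,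
    ← hp]
  have hPI : P ∈ I := hv.2
  simpa [MvPolynomial.mem_vanishingIdeal_singleton_iff, MvPolynomial.aeval_def] using hIM hPI

/-! #### Points above the centers -/

theorem mem_exceptional_pole (h : IsBirationalChart x y) {S : LocalSubring K} :
    S ∈ exceptional (poleCenter x y r) ↔ S = axis (1 / x) ((y - algebraMap ℂ K r) * x) ∨
      (∃ b, S = origin (1 / x) ((y - algebraMap ℂ K r) * x - algebraMap ℂ K b)) ∨
      S = origin (1 / x / (y - algebraMap ℂ K r)) (y - algebraMap ℂ K r) := by
  rw [poleCenter, (h.pole r).mem_exceptional_iff, div_div_eq_mul_div, div_one]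

theorem mem_exceptional_pole' (h : IsBirationalChart x y) {S : LocalSubring K} :
    S ∈ exceptional (poleCenter' x y r c) ↔
      S = axis (1 / x) (((y - algebraMap ℂ K r) * x - algebraMap ℂ K c) * x) ∨
      (∃ b, S = origin (1 / x)
        (((y - algebraMap ℂ K r) * x - algebraMap ℂ K c) * x - algebraMap ℂ K b)) ∨
      S = origin (1 / x / ((y - algebraMap ℂ K r) * x - algebraMap ℂ K c))
        ((y - algebraMap ℂ K r) * x - algebraMap ℂ K c) := by
  rw [poleCenter', (h.pole' r c).mem_exceptional_iff, div_div_eq_mul_div, div_one]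

theorem mem_exceptional_zero₁ (h : IsBirationalChart x y) {S : LocalSubring K} :
    S ∈ exceptional (zeroCenter₁ x y) ↔ S = axis x (1 / (x * y)) ∨
      (∃ b, S = origin x (1 / (x * y) - algebraMap ℂ K b)) ∨ S = origin (x / (1 / y)) (1 / y) := by
  rw [zeroCenter₁, h.inv_right.mem_exceptional_iff, div_div 1 y x, mul_comm y x]

theorem mem_exceptional_zero₂ (h : IsBirationalChart x y) {S : LocalSubring K} :
    S ∈ exceptional (zeroCenter₂ x y) ↔ S = axis x (1 / (x ^ 2 * y)) ∨
      (∃ b, S = origin x (1 / (x ^ 2 * y) - algebraMap ℂ K b)) ∨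
      S = origin (x / (1 / (x * y))) (1 / (x * y)) := by
  have : 1 / (x * y) / x = 1 / (x ^ 2 * y) := by rw [div_div]; ring_nf
  rw [zeroCenter₂, h.zero₂.mem_exceptional_iff, this]

theorem mem_exceptional_zero₃ (h : IsBirationalChart x y) {S : LocalSubring K} :
    S ∈ exceptional (zeroCenter₃ x y d) ↔ S = axis x ((x ^ 2 * y + algebraMap ℂ K d) / x) ∨
      (∃ b, S = origin x ((x ^ 2 * y + algebraMap ℂ K d) / x - algebraMap ℂ K b)) ∨
      S = origin (x / (x ^ 2 * y + algebraMap ℂ K d)) (x ^ 2 * y + algebraMap ℂ K d) :=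
  (h.zero₃ d).mem_exceptional_iff

theorem mem_exceptional_zero₄ (h : IsBirationalChart x y) {S : LocalSubring K} :
    S ∈ exceptional (zeroCenter₄ x y d e) ↔
      S = axis x (((x ^ 2 * y + algebraMap ℂ K d) / x - algebraMap ℂ K e) / x) ∨
      (∃ b, S = origin x
        (((x ^ 2 * y + algebraMap ℂ K d) / x - algebraMap ℂ K e) / x - algebraMap ℂ K b)) ∨
      S = origin (x / ((x ^ 2 * y + algebraMap ℂ K d) / x - algebraMap ℂ K e))
        ((x ^ 2 * y + algebraMap ℂ K d) / x - algebraMap ℂ K e) :=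
  (h.zero₄ d e).mem_exceptional_iff

theorem poleCenter'_le_imp (h : IsBirationalChart x y) {S : LocalSubring K}
    (hS : poleCenter' x y r c ≤ S) :
    Vanishes S ((y - algebraMap ℂ K r) * x - algebraMap ℂ K c) :=
  (localSubring_le_iff.1 hS).2 _ (h.pole' r c).origin_vanishes_right

theorem zeroCenter₂_le_imp (h : IsBirationalChart x y) {S : LocalSubring K}
    (hS : zeroCenter₂ x y ≤ S) : Vanishes S (1 / (x * y)) :=
  (localSubring_le_iff.1 hS).2 _ h.zero₂.origin_vanishes_right

theorem zeroCenter₃_le_imp (h : IsBirationalChart x y) {S : LocalSubring K}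
    (hS : zeroCenter₃ x y d ≤ S) : Vanishes S (x ^ 2 * y + algebraMap ℂ K d) :=
  (localSubring_le_iff.1 hS).2 _ (h.zero₃ d).origin_vanishes_right

theorem zeroCenter₄_le_imp (h : IsBirationalChart x y) {S : LocalSubring K}
    (hS : zeroCenter₄ x y d e ≤ S) :
    Vanishes S ((x ^ 2 * y + algebraMap ℂ K d) / x - algebraMap ℂ K e) :=
  (localSubring_le_iff.1 hS).2 _ (h.zero₄ d e).origin_vanishes_right

/-! #### The table of special curves -/

/-- The first coordinate function of a chart in which the special curve is the first axis. -/
def curveX (x y : K) : Fin 11 → K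
  -- In order: the exceptional curves over `y = s` and `y = -s` at `x = ∞`; the fibre `x = ∞`; the
  -- line `y = ∞`; the exceptional curves of the second, first and third zero center; the fibre `x =
  -- 0`; the last exceptional curves over `x = 0`, `y = s` and `y = -s`. The first seven are
  -- numbered as the components `D₀, …, D₆`.
  | 0 => 1 / x
  | 1 => 1 / x
  | 2 => 1 / x
  | 3 => 1 / y
  | 4 => x
  | 5 => x
  | 6 => x
  | 7 => x
  | 8 => x
  | 9 => 1 / x
  | 10 => 1 / x

/-- The second coordinate function of a chart in which the special curve is the first axis. -/
def curveY (x y : K) (s c c' d e : ℂ) : Fin 11 → K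
  | 0 => (y - algebraMap ℂ K s) * x
  | 1 => (y - algebraMap ℂ K (-s)) * x
  | 2 => y
  | 3 => x
  | 4 => 1 / (x ^ 2 * y)
  | 5 => 1 / (x * y)
  | 6 => (x ^ 2 * y + algebraMap ℂ K d) / x
  | 7 => y
  | 8 => ((x ^ 2 * y + algebraMap ℂ K d) / x - algebraMap ℂ K e) / x
  | 9 => ((y - algebraMap ℂ K s) * x - algebraMap ℂ K c) * x
  | 10 => ((y - algebraMap ℂ K (-s)) * x - algebraMap ℂ K c') * x

/-- The eleven curves of the surface outside the open set `x ≠ 0, ∞`, `y ≠ ∞`. -/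
def specialCurve (x y : K) (s c c' d e : ℂ) (i : Fin 11) : LocalSubring K :=
  axis (curveX x y i) (curveY x y s c c' d e i)

/-- The second coordinate of a point of the special curve that is on no other special curve. -/
def basePoint (c c' d e : ℂ) : Fin 11 → ℂ
  -- Each value avoids the finite coordinates of the corners on its curve, namely `c`, `c'`, `± s`,
  -- `0`, both `0` and `-1/d`, `0`, and `e` on the curves 0 to 6. On the curves 7 to 10 the only
  -- corner has infinite coordinate.
  | 0 => c + 1
  | 1 => c' + 1
  | 2 => 0
  | 3 => 1
  | 4 => 1 / d
  | 5 => 1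
  | 6 => e + 1
  | 7 => 0
  | 8 => 0
  | 9 => 0
  | 10 => 0

/-- The first local coordinate at the intersection points of the special curves. -/
def cornerX (x y : K) (s c c' d e : ℂ) : Fin 10 → K
  | 0 => 1 / x
  | 1 => 1 / x / (y - algebraMap ℂ K s)
  | 2 => 1 / x / ((y - algebraMap ℂ K s) * x - algebraMap ℂ K c)
  | 3 => 1 / x / (y - algebraMap ℂ K (-s))
  | 4 => 1 / x / ((y - algebraMap ℂ K (-s)) * x - algebraMap ℂ K c')
  | 5 => x / (1 / y)
  | 6 => x / (1 / (x * y))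
  | 7 => x
  | 8 => x / (x ^ 2 * y + algebraMap ℂ K d)
  | 9 => x / ((x ^ 2 * y + algebraMap ℂ K d) / x - algebraMap ℂ K e)

/-- The second local coordinate at the intersection points of the special curves. -/
def cornerY (x y : K) (s c c' d e : ℂ) : Fin 10 → K
  | 0 => 1 / y
  | 1 => y - algebraMap ℂ K s
  | 2 => (y - algebraMap ℂ K s) * x - algebraMap ℂ K c
  | 3 => y - algebraMap ℂ K (-s)
  | 4 => (y - algebraMap ℂ K (-s)) * x - algebraMap ℂ K c'
  | 5 => 1 / y
  | 6 => 1 / (x * y)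
  | 7 => 1 / (x ^ 2 * y)
  | 8 => x ^ 2 * y + algebraMap ℂ K d
  | 9 => (x ^ 2 * y + algebraMap ℂ K d) / x - algebraMap ℂ K e

/-- The intersection points of the special curves. -/
def corner (x y : K) (s c c' d e : ℂ) (n : Fin 10) : LocalSubring K :=
  origin (cornerX x y s c c' d e n) (cornerY x y s c c' d e n)

/-- The two special curves through a corner. -/
def cornerCurves : Fin 10 → Fin 11 × Fin 11
  | 0 => (2, 3)
  | 1 => (2, 0)
  | 2 => (0, 9)
  | 3 => (2, 1)
  | 4 => (1, 10)
  | 5 => (7, 5)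
  | 6 => (5, 4)
  | 7 => (4, 3)
  | 8 => (4, 6)
  | 9 => (6, 8)

theorem IsBirationalChart.curve (h : IsBirationalChart x y) : ∀ i,
    IsBirationalChart (curveX x y i) (curveY x y s c c' d e i)
  | 0 => h.poleMul s
  | 1 => h.poleMul (-s)
  | 2 => h.inv_left
  | 3 => h.inv_right.swap
  | 4 => h.zero₂'
  | 5 => h.zero₂
  | 6 => h.zero₃' d
  | 7 => h
  | 8 => (h.zero₄ d e).div_right
  | 9 => h.pole'' s c
  | 10 => h.pole'' (-s) c'

theorem IsBirationalChart.corner (h : IsBirationalChart x y) : ∀ n,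
    IsBirationalChart (cornerX x y s c c' d e n) (cornerY x y s c c' d e n)
  | 0 => h.inv_left.inv_right
  | 1 => (h.pole s).div_left
  | 2 => (h.pole' s c).div_left
  | 3 => (h.pole (-s)).div_left
  | 4 => (h.pole' (-s) c').div_left
  | 5 => h.inv_right.div_left
  | 6 => h.zero₂.div_left
  | 7 => h.zero₂'
  | 8 => (h.zero₃ d).div_left
  | 9 => (h.zero₄ d e).div_left

theorem axis_add_const (d : ℂ) : axis f (g + algebraMap ℂ K d) = axis f g := by
  simpa using axis_sub_const (f := f) (g := g) (-d)

/-- Mostly the corner is the meeting point of an exceptional curve and a strict transform: the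
strict transform is the left axis, by `axis_div`, and the exceptional curve is the right one, by
`axis_exceptional`. Corner 0 is the corner of the quadric, and corner 7 is where the strict
transform of `y = ∞` meets the second exceptional curve over `x = 0`. -/
theorem corner_axis_left (h : IsBirationalChart x y) : ∀ n,
    axis (cornerX x y s c c' d e n) (cornerY x y s c c' d e n) =
      specialCurve x y s c c' d e (cornerCurves n).1
  | 0 => h.inv_left.axis_inv
  | 1 => (h.pole s).axis_div.trans (axis_sub_const s)
  | 2 => (h.pole' s c).axis_div.trans (axis_sub_const c)
  | 3 => (h.pole (-s)).axis_div.trans (axis_sub_const (-s))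
  | 4 => (h.pole' (-s) c').axis_div.trans (axis_sub_const c')
  | 5 => h.inv_right.axis_div.trans h.axis_inv
  | 6 => h.zero₂.axis_div
  | 7 => rfl
  | 8 => (h.zero₃ d).axis_div.trans ((axis_add_const d).trans h.sq_mul.axis_inv.symm)
  | 9 => (h.zero₄ d e).axis_div.trans (axis_sub_const e)

theorem axis_one_div_mul (h : IsBirationalChart x y) : axis (1 / (x * y)) x = axis (1 / y) x := by
  have := h.inv_right.swap.axis_div
  rwa [div_div, mul_comm] at this

theorem corner_axis_right (h : IsBirationalChart x y) : ∀ n,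
    axis (cornerY x y s c c' d e n) (cornerX x y s c c' d e n) =
      specialCurve x y s c c' d e (cornerCurves n).2
  | 0 => h.inv_right.swap.axis_inv
  | 1 => by
    refine (h.pole s).axis_exceptional.trans ?_
    rw [div_div_eq_mul_div, div_one]; rfl
  | 2 => by
    refine (h.pole' s c).axis_exceptional.trans ?_
    rw [div_div_eq_mul_div, div_one]; rfl
  | 3 => by
    refine (h.pole (-s)).axis_exceptional.trans ?_
    rw [div_div_eq_mul_div, div_one]; rfl
  | 4 => by
    refine (h.pole' (-s) c').axis_exceptional.trans ?_
    rw [div_div_eq_mul_div, div_one]; rfl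
  | 5 => by
    refine h.inv_right.axis_exceptional.trans ?_
    rw [div_div, mul_comm]; rfl
  | 6 => by
    refine h.zero₂.axis_exceptional.trans ?_
    rw [div_div, mul_comm, ← mul_assoc, ← pow_two]; rfl
  | 7 => by
    have := h.zero₂.swap.axis_div
    rw [div_div, mul_comm, ← mul_assoc, ← pow_two] at this
    exact this.trans (axis_one_div_mul h)
  | 8 => (h.zero₃ d).axis_exceptional
  | 9 => (h.zero₄ d e).axis_exceptional

theorem isDiscreteValuationRing_specialCurve (h : IsBirationalChart x y) (i : Fin 11) :
    IsDiscreteValuationRing (specialCurve x y s c c' d e i).toSubring :=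
  (h.curve i).isDiscreteValuationRing_axis

/-! #### Membership in the surface -/

theorem mem_surface_pole₁ (h : IsBirationalChart x y) (hs : s ≠ 0) (hd : d ≠ 0)
    {S : LocalSubring K}
    (h1 : S ∈ exceptional (poleCenter x y s)) (h2 : ¬ poleCenter' x y s c ≤ S) :
    S ∈ surface x y s c c' d e :=
  (mem_surface h hs hd).2 (Or.inr (Or.inl ⟨h1, h2⟩))

theorem mem_surface_pole₁' (h : IsBirationalChart x y) (hs : s ≠ 0) (hd : d ≠ 0)
    {S : LocalSubring K}
    (h1 : S ∈ exceptional (poleCenter' x y s c)) :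
    S ∈ surface x y s c c' d e :=
  (mem_surface h hs hd).2 (Or.inr (Or.inr (Or.inl h1)))

theorem mem_surface_pole₂ (h : IsBirationalChart x y) (hs : s ≠ 0) (hd : d ≠ 0)
    {S : LocalSubring K}
    (h1 : S ∈ exceptional (poleCenter x y (-s))) (h2 : ¬ poleCenter' x y (-s) c' ≤ S) :
    S ∈ surface x y s c c' d e :=
  (mem_surface h hs hd).2 (Or.inr (Or.inr (Or.inr (Or.inl ⟨h1, h2⟩))))

theorem mem_surface_pole₂' (h : IsBirationalChart x y) (hs : s ≠ 0) (hd : d ≠ 0)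
    {S : LocalSubring K}
    (h1 : S ∈ exceptional (poleCenter' x y (-s) c')) :
    S ∈ surface x y s c c' d e :=
  (mem_surface h hs hd).2 (Or.inr (Or.inr (Or.inr (Or.inr (Or.inl h1)))))

theorem mem_surface_zero₁ (h : IsBirationalChart x y) (hs : s ≠ 0) (hd : d ≠ 0)
    {S : LocalSubring K}
    (h1 : S ∈ exceptional (zeroCenter₁ x y)) (h2 : ¬ zeroCenter₂ x y ≤ S) :
    S ∈ surface x y s c c' d e :=
  (mem_surface h hs hd).2 (Or.inr (Or.inr (Or.inr (Or.inr (Or.inr (Or.inl ⟨h1, h2⟩))))))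

theorem mem_surface_zero₂ (h : IsBirationalChart x y) (hs : s ≠ 0) (hd : d ≠ 0)
    {S : LocalSubring K}
    (h1 : S ∈ exceptional (zeroCenter₂ x y)) (h2 : ¬ zeroCenter₃ x y d ≤ S) :
    S ∈ surface x y s c c' d e :=
  (mem_surface h hs hd).2 (Or.inr (Or.inr (Or.inr (Or.inr (Or.inr (Or.inr (Or.inl ⟨h1, h2⟩)))))))

theorem mem_surface_zero₃ (h : IsBirationalChart x y) (hs : s ≠ 0) (hd : d ≠ 0)
    {S : LocalSubring K}
    (h1 : S ∈ exceptional (zeroCenter₃ x y d)) (h2 : ¬ zeroCenter₄ x y d e ≤ S) :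
    S ∈ surface x y s c c' d e :=
  (mem_surface h hs hd).2 (Or.inr (Or.inr (Or.inr (Or.inr (Or.inr (Or.inr (Or.inr (Or.inl ⟨h1, h2⟩))))))))

theorem mem_surface_zero₄ (h : IsBirationalChart x y) (hs : s ≠ 0) (hd : d ≠ 0)
    {S : LocalSubring K}
    (h1 : S ∈ exceptional (zeroCenter₄ x y d e)) :
    S ∈ surface x y s c c' d e :=
  (mem_surface h hs hd).2 (Or.inr (Or.inr (Or.inr (Or.inr (Or.inr (Or.inr (Or.inr (Or.inr h1))))))))

theorem mem_surface_of_plane (h : IsBirationalChart x y) (hs : s ≠ 0) (hd : d ≠ 0)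
    {S : LocalSubring K} (hS : IsLoc (coordRing x y) S) : S ∈ surface x y s c c' d e := by
  have hx := hS.1 left_mem_coordRing
  have hy := hS.1 right_mem_coordRing
  exact (mem_surface h hs hd).2 (Or.inl ⟨mem_quadric.2 (Or.inl hS),
    fun h1 => not_vanishes_one_div h.left_ne_zero hx (poleCenter_le_imp h h1).1,
    fun h1 => not_vanishes_one_div h.left_ne_zero hx (poleCenter_le_imp h h1).1,
    fun h1 => not_vanishes_one_div h.right_ne_zero hy (zeroCenter₁_le_imp h h1).2⟩)

theorem mem_surface_of_pole (h : IsBirationalChart x y) (hs : s ≠ 0) (hd : d ≠ 0)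
    {S : LocalSubring K} (hS : IsLoc (coordRing (1 / x) y) S)
    (h1 : ¬ Vanishes S (y - algebraMap ℂ K s)) (h2 : ¬ Vanishes S (y - algebraMap ℂ K (-s))) :
    S ∈ surface x y s c c' d e :=
  (mem_surface h hs hd).2 (Or.inl ⟨mem_quadric.2 (Or.inr (Or.inl hS)),
    fun h3 => h1 (poleCenter_le_imp h h3).2, fun h3 => h2 (poleCenter_le_imp h h3).2,
    fun h3 => not_vanishes_one_div h.right_ne_zero (hS.1 right_mem_coordRing)
      (zeroCenter₁_le_imp h h3).2⟩)

theorem mem_surface_of_pole_right (h : IsBirationalChart x y) (hs : s ≠ 0) (hd : d ≠ 0)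
    {S : LocalSubring K} (hS : IsLoc (coordRing x (1 / y)) S) (h1 : ¬ Vanishes S x) :
    S ∈ surface x y s c c' d e :=
  (mem_surface h hs hd).2 (Or.inl ⟨mem_quadric.2 (Or.inr (Or.inr (Or.inl hS))),
    fun h3 => not_vanishes_one_div h.left_ne_zero (hS.1 left_mem_coordRing)
      (poleCenter_le_imp h h3).1,
    fun h3 => not_vanishes_one_div h.left_ne_zero (hS.1 left_mem_coordRing)
      (poleCenter_le_imp h h3).1,
    fun h3 => h1 (zeroCenter₁_le_imp h h3).1⟩)

theorem not_vanishes_sq_mul_add_axis (h : IsBirationalChart x y) (d : ℂ) :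
    ¬ Vanishes (axis x (1 / (x ^ 2 * y))) (x ^ 2 * y + algebraMap ℂ K d) := by
  have := not_vanishes_one_div_sub h.zero₂'.isLoc_axis.algebraMap_mem
    (h.zero₂'.isLoc_axis.1 right_mem_coordRing) h.zero₂'.axis_not_vanishes_sub (-d)
  simpa using this

theorem specialCurve_mem (h : IsBirationalChart x y) (hs : s ≠ 0) (hd : d ≠ 0) : ∀ i,
    specialCurve x y s c c' d e i ∈ surface x y s c c' d e
  | 0 => mem_surface_pole₁ h hs hd ((mem_exceptional_pole h).2 (Or.inl rfl))
      (fun h1 => (h.poleMul s).axis_not_vanishes_sub c (poleCenter'_le_imp h h1))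
  | 1 => mem_surface_pole₂ h hs hd ((mem_exceptional_pole h).2 (Or.inl rfl))
      (fun h1 => (h.poleMul (-s)).axis_not_vanishes_sub c' (poleCenter'_le_imp h h1))
  | 2 => mem_surface_of_pole h hs hd h.inv_left.isLoc_axis (h.inv_left.axis_not_vanishes_sub s)
      (h.inv_left.axis_not_vanishes_sub (-s))
  | 3 => mem_surface_of_pole_right h hs hd
      (by rw [coordRing_comm]; exact h.inv_right.swap.isLoc_axis)
      (by
      have := h.inv_right.swap.axis_not_vanishes_sub 0
      rwa [map_zero, sub_zero] at this)
  | 4 => mem_surface_zero₂ h hs hd ((mem_exceptional_zero₂ h).2 (Or.inl rfl))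
      (fun h1 => not_vanishes_sq_mul_add_axis h d (zeroCenter₃_le_imp h h1))
  | 5 => mem_surface_zero₁ h hs hd ((mem_exceptional_zero₁ h).2 (Or.inl rfl))
      (fun h1 =>
      h.zero₂.axis_not_vanishes_sub 0 (by rw [map_zero, sub_zero]; exact zeroCenter₂_le_imp h h1))
  | 6 => mem_surface_zero₃ h hs hd ((mem_exceptional_zero₃ h).2 (Or.inl rfl))
      (fun h1 =>
      (h.zero₃' d).axis_not_vanishes_sub e (zeroCenter₄_le_imp h h1))
  | 7 => mem_surface_of_plane h hs hd h.isLoc_axis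
  | 8 => mem_surface_zero₄ h hs hd ((mem_exceptional_zero₄ h).2 (Or.inl rfl))
  | 9 => mem_surface_pole₁' h hs hd ((mem_exceptional_pole' h).2 (Or.inl rfl))
  | 10 => mem_surface_pole₂' h hs hd ((mem_exceptional_pole' h).2 (Or.inl rfl))

theorem specialCurve_mem_curves (h : IsBirationalChart x y) (hs : s ≠ 0) (hd : d ≠ 0)
    (i : Fin 11) : specialCurve x y s c c' d e i ∈ curves (surface x y s c c' d e) :=
  ⟨specialCurve_mem h hs hd i, isDiscreteValuationRing_specialCurve h i⟩

theorem not_zeroCenter₃_le_of_vanishes (h : IsBirationalChart x y) (hd : d ≠ 0)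
    {S : LocalSubring K} (hv : Vanishes S (1 / (x ^ 2 * y) - algebraMap ℂ K (1 / d))) :
    ¬ zeroCenter₃ x y d ≤ S := by
  intro h1
  have hc : ∀ c, algebraMap ℂ K c ∈ S.toSubring := fun c =>
    (localSubring_le_iff.1 h1).1 ((h.zero₃ d).isLoc_origin.algebraMap_mem c)
  have h2 := zeroCenter₃_le_imp h h1
  have h3 : x ^ 2 * y ∈ S.toSubring := by simpa using sub_mem h2.1 (hc d)
  have h0 : x ^ 2 * y ≠ 0 := h.sq_mul.right_ne_zero
  have hd' : algebraMap ℂ K d ≠ 0 := by simpa using hd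
  -- Both conditions together would make the constant `2` vanish: one says `x² y = d`, the other `x²
  -- y = -d`.
  have h4 := (hv.mul_left h3).add (h2.mul_left (hc (1 / d)))
  have h5 : x ^ 2 * y * (1 / (x ^ 2 * y) - algebraMap ℂ K (1 / d)) +
      algebraMap ℂ K (1 / d) * (x ^ 2 * y + algebraMap ℂ K d) = algebraMap ℂ K 2 := by
    rw [mul_sub, mul_one_div_cancel h0, map_div₀, map_one, map_ofNat]
    field_simp; ring
  rw [h5] at h4
  exact not_vanishes_algebraMap hc two_ne_zero h4

theorem basePoint_mem (h : IsBirationalChart x y) (hs : s ≠ 0) (hd : d ≠ 0) : ∀ i,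
    origin (curveX x y i) (curveY x y s c c' d e i - algebraMap ℂ K (basePoint c c' d e i)) ∈
      surface x y s c c' d e
  | 0 => mem_surface_pole₁ h hs hd ((mem_exceptional_pole h).2 (Or.inr (Or.inl ⟨_, rfl⟩)))
      (fun h1 => by
        have := eq_of_vanishes_sub (h.pole' s (c + 1)).isLoc_origin.algebraMap_mem
          (h.pole' s (c + 1)).origin_vanishes_right (poleCenter'_le_imp h h1)
        simp at this)
  | 1 => mem_surface_pole₂ h hs hd ((mem_exceptional_pole h).2 (Or.inr (Or.inl ⟨_, rfl⟩)))
      (fun h1 => by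
        have := eq_of_vanishes_sub (h.pole' (-s) (c' + 1)).isLoc_origin.algebraMap_mem
          (h.pole' (-s) (c' + 1)).origin_vanishes_right (poleCenter'_le_imp h h1)
        simp at this)
  | 2 => by
    have hp := h.pole 0
    have hl : IsLoc (coordRing (1 / x) y) (origin (1 / x) (y - algebraMap ℂ K 0)) := by
      have := hp.isLoc_origin
      rwa [coordRing_sub_const] at this
    refine mem_surface_of_pole h hs hd hl (fun h1 => ?_) (fun h1 => ?_)
    · exact hs (eq_of_vanishes_sub hl.algebraMap_mem h1 hp.origin_vanishes_right)
    · exact neg_ne_zero.2 hs (eq_of_vanishes_sub hl.algebraMap_mem h1 hp.origin_vanishes_right)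
  | 3 => by
    have hp := h.inv_right.swap.sub_const 1
    have hl : IsLoc (coordRing x (1 / y)) (origin (1 / y) (x - algebraMap ℂ K 1)) := by
      have := hp.isLoc_origin
      rwa [coordRing_sub_const, coordRing_comm] at this
    refine mem_surface_of_pole_right h hs hd hl fun h1 => ?_
    exact zero_ne_one (eq_of_vanishes_sub (b := 0) hl.algebraMap_mem (by rwa [map_zero, sub_zero])
      hp.origin_vanishes_right)
  | 4 => mem_surface_zero₂ h hs hd ((mem_exceptional_zero₂ h).2 (Or.inr (Or.inl ⟨_, rfl⟩)))
      (not_zeroCenter₃_le_of_vanishes h hd (h.zero₂'.sub_const _).origin_vanishes_right)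
  | 5 => mem_surface_zero₁ h hs hd ((mem_exceptional_zero₁ h).2 (Or.inr (Or.inl ⟨_, rfl⟩)))
      (fun h1 =>
      zero_ne_one (eq_of_vanishes_sub (b := 0) (h.zero₂.sub_const 1).isLoc_origin.algebraMap_mem
        (by rw [map_zero, sub_zero]; exact zeroCenter₂_le_imp h h1) (h.zero₂.sub_const 1).origin_vanishes_right))
  | 6 => mem_surface_zero₃ h hs hd ((mem_exceptional_zero₃ h).2 (Or.inr (Or.inl ⟨_, rfl⟩)))
      (fun h1 => by
        have := eq_of_vanishes_sub (h.zero₄ d (e + 1)).isLoc_origin.algebraMap_mem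
          (h.zero₄ d (e + 1)).origin_vanishes_right (zeroCenter₄_le_imp h h1)
        simp at this)
  | 7 => mem_surface_of_plane h hs hd (by
      have := (h.sub_const 0).isLoc_origin
      rwa [coordRing_sub_const] at this)
  | 8 => mem_surface_zero₄ h hs hd ((mem_exceptional_zero₄ h).2 (Or.inr (Or.inl ⟨_, rfl⟩)))
  | 9 => mem_surface_pole₁' h hs hd ((mem_exceptional_pole' h).2 (Or.inr (Or.inl ⟨_, rfl⟩)))
  | 10 => mem_surface_pole₂' h hs hd ((mem_exceptional_pole' h).2 (Or.inr (Or.inl ⟨_, rfl⟩)))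

theorem IsBirationalChart.inv_left_notMem_origin (h : IsBirationalChart f g) {z : K}
    (hz : z = f⁻¹) : z ∉ (origin f g).toSubring :=
  hz ▸ inv_notMem_of_vanishes h.origin_vanishes_left h.left_ne_zero

theorem corner_mem (h : IsBirationalChart x y) (hs : s ≠ 0) (hd : d ≠ 0) : ∀ n,
    corner x y s c c' d e n ∈ surface x y s c c' d e
  | 0 => corner_mem_surface h hs hd
  | 1 => mem_surface_pole₁ h hs hd ((mem_exceptional_pole h).2 (Or.inr (Or.inr rfl)))
      (fun h1 => by
        have hl := (h.pole s).div_left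
        have := add_mem (poleCenter'_le_imp h h1).1 (hl.isLoc_origin.algebraMap_mem c)
        rw [sub_add_cancel] at this
        exact hl.inv_left_notMem_origin (by simp [mul_comm]) this)
  | 2 => mem_surface_pole₁' h hs hd ((mem_exceptional_pole' h).2 (Or.inr (Or.inr rfl)))
  | 3 => mem_surface_pole₂ h hs hd ((mem_exceptional_pole h).2 (Or.inr (Or.inr rfl)))
      (fun h1 => by
        have hl := (h.pole (-s)).div_left
        have := add_mem (poleCenter'_le_imp h h1).1 (hl.isLoc_origin.algebraMap_mem c')
        rw [sub_add_cancel] at this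
        exact hl.inv_left_notMem_origin (by simp [mul_comm]) this)
  | 4 => mem_surface_pole₂' h hs hd ((mem_exceptional_pole' h).2 (Or.inr (Or.inr rfl)))
  | 5 => mem_surface_zero₁ h hs hd ((mem_exceptional_zero₁ h).2 (Or.inr (Or.inr rfl)))
      (fun h1 =>
        h.inv_right.div_left.inv_left_notMem_origin (by simp [mul_comm])
          (zeroCenter₂_le_imp h h1).1)
  | 6 => mem_surface_zero₂ h hs hd ((mem_exceptional_zero₂ h).2 (Or.inr (Or.inr rfl)))
      (fun h1 => by
        have hl := h.zero₂.div_left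
        have h2 := (zeroCenter₃_le_imp h h1).sub hl.origin_vanishes_left
        have h3 : x ^ 2 * y + algebraMap ℂ K d - x / (1 / (x * y)) = algebraMap ℂ K d := by
          rw [div_div_eq_mul_div, div_one]; ring
        rw [h3] at h2
        exact not_vanishes_algebraMap hl.isLoc_origin.algebraMap_mem hd h2)
  | 7 => mem_surface_zero₂ h hs hd ((mem_exceptional_zero₂ h).2 (Or.inr (Or.inl ⟨0, by simp [corner, cornerX, cornerY]⟩)))
      (fun h1 => by
        have hl := h.zero₂'
        have := sub_mem (zeroCenter₃_le_imp h h1).1 (hl.isLoc_origin.algebraMap_mem d)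
        rw [add_sub_cancel_right, corner, origin_comm] at this
        exact hl.swap.inv_left_notMem_origin (by simp) this)
  | 8 => mem_surface_zero₃ h hs hd ((mem_exceptional_zero₃ h).2 (Or.inr (Or.inr rfl)))
      (fun h1 => by
        have hl := (h.zero₃ d).div_left
        have := add_mem (zeroCenter₄_le_imp h h1).1 (hl.isLoc_origin.algebraMap_mem e)
        rw [sub_add_cancel] at this
        exact hl.inv_left_notMem_origin (by simp) this)
  | 9 => mem_surface_zero₄ h hs hd ((mem_exceptional_zero₄ h).2 (Or.inr (Or.inr rfl)))

end Special
end InceXII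

namespace InceXII

/-! ### Orders along curves -/

section Orders

variable {K : Type*} [Field K] {C : LocalSubring K} {z z' : K} {n m : ℤ}

/-- Two uniformizers differ by a unit, which the factor `e` absorbs; so orders may be computed with
a common uniformizer. -/
theorem isOrd_iff [IsDiscreteValuationRing C.toSubring] {w : C.toSubring} (hw : Irreducible w) :
    IsOrd C z n ↔ ∃ e : (C.toSubring)ˣ, z = ((e : C.toSubring) : K) * (w : K) ^ n := by
  refine ⟨?_, fun ⟨e, he⟩ => ⟨e, w, hw, he⟩⟩
  rintro ⟨e, w', hw', rfl⟩
  obtain ⟨u, hu⟩ := IsDiscreteValuationRing.associated_of_irreducible _ hw hw'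
  refine ⟨e * u ^ n, ?_⟩
  have h1 : ∀ k : ℤ, (((u ^ k : (C.toSubring)ˣ) : C.toSubring) : K) =
      ((u : C.toSubring) : K) ^ k := by
    intro k
    have := congrArg Units.val (map_zpow (Units.map (C.toSubring.subtype : C.toSubring →* K)) u k)
    rw [Units.val_zpow_eq_zpow_val] at this
    exact this
  rw [← hu]
  push_cast
  rw [h1, mul_zpow]
  ring

theorem IsOrd.mul [IsDiscreteValuationRing C.toSubring] (h : IsOrd C z n) (h' : IsOrd C z' m) :
    IsOrd C (z * z') (n + m) := by
  obtain ⟨e, w, hw, rfl⟩ := h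
  obtain ⟨e', rfl⟩ := (isOrd_iff hw).1 h'
  have hw0 : (w : K) ≠ 0 := by simpa using hw.ne_zero
  refine ⟨e * e', w, hw, ?_⟩
  rw [zpow_add₀ hw0]
  push_cast
  ring

theorem IsOrd.inv (h : IsOrd C z n) : IsOrd C z⁻¹ (-n) := by
  obtain ⟨e, w, hw, rfl⟩ := h
  refine ⟨e⁻¹, w, hw, ?_⟩
  rw [mul_inv, zpow_neg]
  congr 1
  refine (eq_inv_of_mul_eq_one_left ?_).symm
  exact congrArg Subtype.val e.inv_mul

theorem isOrd_zero [IsDiscreteValuationRing C.toSubring] (hz : z ∈ C.toSubring)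
    (hv : ¬ Vanishes C z) : IsOrd C z 0 := by
  obtain ⟨w, hw⟩ := IsDiscreteValuationRing.exists_irreducible C.toSubring
  obtain ⟨e, he⟩ := (isUnit_mk_iff hz).2 ⟨ne_zero_of_not_vanishes hv, inv_mem_of_not_vanishes hz hv⟩
  exact ⟨e, w, hw, by simp [he]⟩

theorem IsOrd.pos_iff (hz : z ∈ C.toSubring) (h : IsOrd C z n) : Vanishes C z ↔ 0 < n := by
  obtain ⟨e, w, hw, rfl⟩ := h
  have hwv : Vanishes C (w : K) := (vanishes_mk_iff w).2 hw.not_isUnit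
  have hw0 : (w : K) ≠ 0 := by simpa using hw.ne_zero
  have he : IsUnit (⟨((e : C.toSubring) : K), (e : C.toSubring).2⟩ : C.toSubring) := e.isUnit
  have hev : ¬ Vanishes C ((e : C.toSubring) : K) := fun hv => hv.2 he
  have hei := inv_mem_of_not_vanishes (e : C.toSubring).2 hev
  rcases lt_trichotomy n 0 with hn | rfl | hn
  · refine iff_of_false (fun _ => ?_) hn.le.not_gt
    obtain ⟨k, rfl⟩ : ∃ k : ℕ, n = -((k + 1 : ℕ) : ℤ) := ⟨(-n).toNat - 1, by omega⟩
    have h1 := mul_mem hei hz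
    rw [inv_mul_cancel_left₀ (ne_zero_of_not_vanishes hev), zpow_neg, zpow_natCast] at h1
    have h2 := mul_mem (pow_mem w.2 k) h1
    rw [pow_succ, mul_inv, mul_inv_cancel_left₀ (pow_ne_zero _ hw0)] at h2
    exact inv_notMem_of_vanishes hwv hw0 h2
  · simpa using hev
  · refine iff_of_true ?_ hn
    obtain ⟨k, rfl⟩ : ∃ k : ℕ, n = ((k + 1 : ℕ) : ℤ) := ⟨n.toNat - 1, by omega⟩
    rw [zpow_natCast, pow_succ, ← mul_assoc]
    exact hwv.mul_left (mul_mem (e : C.toSubring).2 (pow_mem w.2 k))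

/-- Otherwise `1 = z z⁻¹` would have a positive order `n - m` or `m - n`, and so would vanish. -/
theorem IsOrd.unique [IsDiscreteValuationRing C.toSubring] (h : IsOrd C z n) (h' : IsOrd C z m) :
    n = m := by
  have h0 : z ≠ 0 := by
    obtain ⟨e, w, hw, rfl⟩ := h
    have hw0 : (w : K) ≠ 0 := by simpa using hw.ne_zero
    have he : ((e : C.toSubring) : K) ≠ 0 := by simp
    exact mul_ne_zero he (zpow_ne_zero _ hw0)
  have h1 := h.mul h'.inv
  have h2 := h'.mul h.inv
  rw [mul_inv_cancel₀ h0] at h1 h2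
  have h3 := (h1.pos_iff (one_mem _)).not.1 (not_vanishes_one C)
  have h4 := (h2.pos_iff (one_mem _)).not.1 (not_vanishes_one C)
  omega

theorem IsOrd.ord_eq [IsDiscreteValuationRing C.toSubring] (h : IsOrd C z n) : ord C z = n := by
  have h1 : ∃ n, IsOrd C z n := ⟨n, h⟩
  rw [ord, dif_pos h1]
  exact h1.choose_spec.unique h

variable [Algebra ℂ K] {f g : K}

theorem IsBirationalChart.isOrd_left (h : IsBirationalChart f g) : IsOrd (axis f g) f 1 := by
  have := h.isDiscreteValuationRing_axis
  have hf := h.axis_vanishes_left.1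
  refine (isOrd_iff (w := ⟨f, hf⟩) ?_).2 ⟨1, by simp⟩
  rw [IsDiscreteValuationRing.irreducible_iff_uniformizer]
  exact h.axis_mem_maximalIdeal_iff hf

end Orders

/-! ### Classification of the special curves and of the closed points -/

noncomputable section Separation

variable {K : Type*} [Field K]

variable [Algebra ℂ K] {f g x y : K} {s c c' d e r : ℂ}

theorem IsBirationalChart.axis_not_vanishes_right (h : IsBirationalChart f g) :
    ¬ Vanishes (axis f g) g := by
  simpa using h.axis_not_vanishes_sub 0

theorem IsBirationalChart.axis_algebraMap_mem (h : IsBirationalChart f g) (c : ℂ) :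
    algebraMap ℂ K c ∈ (axis f g).toSubring := h.isLoc_axis.algebraMap_mem c

theorem IsBirationalChart.axis_right_mem (h : IsBirationalChart f g) :
    g ∈ (axis f g).toSubring := h.isLoc_axis.1 right_mem_coordRing

/-- The order of `x` along the special curves. -/
def orderX : Fin 11 → ℤ := ![-1, -1, -1, 0, 1, 1, 1, 1, 1, -1, -1]

/-- The order of `1 / y` along the special curves. -/
def orderInvY : Fin 11 → ℤ := ![0, 0, 0, 1, 2, 1, 2, 0, 2, 0, 0]

theorem isOrd_specialCurve_left (h : IsBirationalChart x y) (i : Fin 11) :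
    IsOrd (specialCurve x y s c c' d e i) x (orderX i) := by
  have hi := (h.curve (s := s) (c := c) (c' := c') (d := d) (e := e) i).isOrd_left
  have key : ∀ {S : LocalSubring K}, IsOrd S (1 / x) 1 → IsOrd S x (-1) := fun h => by
    simpa using h.inv
  have h3 : IsOrd (specialCurve x y s c c' d e 3) x 0 := by
    have hc := h.inv_right.swap
    have := isDiscreteValuationRing_specialCurve (s := s) (c := c) (c' := c') (d := d) (e := e) h 3
    exact isOrd_zero hc.axis_right_mem hc.axis_not_vanishes_right
  fin_cases i <;> first | exact hi | exact key hi | exact h3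

theorem not_vanishes_mul_sub {S : LocalSubring K} (hd : d ≠ 0)
    (hc : ∀ c, algebraMap ℂ K c ∈ S.toSubring) (hf : Vanishes S f) (hg : g ∈ S.toSubring) :
    f * g - algebraMap ℂ K d ∈ S.toSubring ∧ ¬ Vanishes S (f * g - algebraMap ℂ K d) := by
  refine ⟨sub_mem (mul_mem hf.1 hg) (hc d), fun hv => ?_⟩
  have := (hf.mul_right hg).sub hv
  rw [sub_sub_cancel] at this
  exact not_vanishes_algebraMap hc hd this

/-- Over `x = ∞` the function `y` is a unit, as it has the value `± s ≠ 0` or is a coordinate along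
the curve. On the curves 4 and 5 the unit `1 / (xᵏ y)` gives the order `k`, and on the curves 6 and
8 the function `x² y` has the value `-d ≠ 0`, which gives the order 2. -/
theorem isOrd_specialCurve_inv_right (h : IsBirationalChart x y) (hs : s ≠ 0) (hd : d ≠ 0) :
    ∀ i, IsOrd (specialCurve x y s c c' d e i) (1 / y) (orderInvY i) := by
  have hx := h.left_ne_zero
  have hy := h.right_ne_zero
  have hdvr := isDiscreteValuationRing_specialCurve (s := s) (c := c) (c' := c') (d := d) (e := e) h
  have hch := h.curve (s := s) (c := c) (c' := c') (d := d) (e := e)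
  have key : ∀ i, (y ∈ (specialCurve x y s c c' d e i).toSubring ∧
      ¬ Vanishes (specialCurve x y s c c' d e i) y) →
      IsOrd (specialCurve x y s c c' d e i) (1 / y) 0 := fun i hi => by
    have := hdvr i
    simpa using (isOrd_zero hi.1 hi.2).inv
  have pole : ∀ r : ℂ, r ≠ 0 → ∀ S : LocalSubring K, (∀ c, algebraMap ℂ K c ∈ S.toSubring) →
      Vanishes S (1 / x) → (y - algebraMap ℂ K r) * x ∈ S.toSubring →
      y ∈ S.toSubring ∧ ¬ Vanishes S y := by
    intro r hr S hc h1 h2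
    have := not_vanishes_mul_sub (neg_ne_zero.2 hr) hc h1 h2
    have e1 : 1 / x * ((y - algebraMap ℂ K r) * x) - algebraMap ℂ K (-r) = y := by
      rw [map_neg]; field_simp; ring
    rwa [e1] at this
  have pole' : ∀ r c : ℂ, r ≠ 0 → ∀ S : LocalSubring K, (∀ c, algebraMap ℂ K c ∈ S.toSubring) →
      Vanishes S (1 / x) → ((y - algebraMap ℂ K r) * x - algebraMap ℂ K c) * x ∈ S.toSubring →
      y ∈ S.toSubring ∧ ¬ Vanishes S y := by
    intro r c hr S hc h1 h2
    refine pole r hr S hc h1 ?_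
    have := add_mem (mul_mem h2 h1.1) (hc c)
    rwa [mul_one_div, mul_div_cancel_right₀ _ hx, sub_add_cancel] at this
  have zero : ∀ i, Vanishes (specialCurve x y s c c' d e i) x →
      (x ^ 2 * y + algebraMap ℂ K d) / x ∈ (specialCurve x y s c c' d e i).toSubring →
      IsOrd (specialCurve x y s c c' d e i) x 1 →
      IsOrd (specialCurve x y s c c' d e i) (1 / y) 2 := by
    intro i h1 h2 h3
    have := hdvr i
    obtain ⟨h4, h5⟩ := not_vanishes_mul_sub hd (hch i).axis_algebraMap_mem h1 h2
    have h6 := (h3.mul h3).mul (isOrd_zero (C := specialCurve x y s c c' d e i) h4 h5).inv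
    convert h6 using 1
    · rw [mul_div_cancel₀ _ hx, add_sub_cancel_right]
      field_simp
    · rfl
  have hx' := isOrd_specialCurve_left (s := s) (c := c) (c' := c') (d := d) (e := e) h
  intro i
  have hi := (hch i).axis_vanishes_left
  have hr := (hch i).axis_right_mem
  have hn := (hch i).axis_not_vanishes_right
  have ha := (hch i).axis_algebraMap_mem
  have hj := hx' i
  have := hdvr i
  fin_cases i
  · exact key 0 (pole s hs _ ha hi hr)
  · exact key 1 (pole (-s) (neg_ne_zero.2 hs) _ ha hi hr)
  · exact key 2 ⟨hr, hn⟩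
  · exact (hch 3).isOrd_left
  · have := (hj.mul hj).mul (isOrd_zero hr hn)
    convert this using 1
    · simp only [curveY]
      field_simp
    · rfl
  · have := hj.mul (isOrd_zero hr hn)
    convert this using 1
    · simp only [curveY]
      field_simp
    · rfl
  · exact zero 6 hi hr hj
  · exact key 7 ⟨hr, hn⟩
  · refine zero 8 hi ?_ hj
    have := add_mem (mul_mem hr hi.1) (ha e)
    simp only [curveX, curveY] at this
    rwa [div_mul_cancel₀ _ hx, sub_add_cancel] at this
  · exact key 9 (pole' s c hs _ ha hi hr)
  · exact key 10 (pole' (-s) c' (neg_ne_zero.2 hs) _ ha hi hr)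

theorem vanishes_pole (h : IsBirationalChart x y) (r c : ℂ) :
    Vanishes (axis (1 / x) ((y - algebraMap ℂ K r) * x)) (y - algebraMap ℂ K r) ∧
    ¬ Vanishes (axis (1 / x) ((y - algebraMap ℂ K r) * x))
      ((y - algebraMap ℂ K r) * x - algebraMap ℂ K c) := by
  refine ⟨?_, (h.poleMul r).axis_not_vanishes_sub c⟩
  have := (h.poleMul r).axis_vanishes_left.mul_left (h.poleMul r).axis_right_mem
  rwa [mul_one_div, mul_div_cancel_right₀ _ h.left_ne_zero] at this

theorem vanishes_pole' (h : IsBirationalChart x y) (r c : ℂ) :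
    Vanishes (axis (1 / x) (((y - algebraMap ℂ K r) * x - algebraMap ℂ K c) * x))
      (y - algebraMap ℂ K r) ∧
    Vanishes (axis (1 / x) (((y - algebraMap ℂ K r) * x - algebraMap ℂ K c) * x))
      ((y - algebraMap ℂ K r) * x - algebraMap ℂ K c) := by
  have hc := h.pole'' r c
  have h1 := hc.axis_vanishes_left.mul_left hc.axis_right_mem
  rw [mul_one_div, mul_div_cancel_right₀ _ h.left_ne_zero] at h1
  refine ⟨?_, h1⟩
  have h2 := hc.axis_vanishes_left.mul_left (add_mem h1.1 (hc.axis_algebraMap_mem c))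
  rwa [sub_add_cancel, mul_one_div, mul_div_cancel_right₀ _ h.left_ne_zero] at h2

theorem vanishes_zero₃ (h : IsBirationalChart x y) (d e : ℂ) :
    Vanishes (axis x ((x ^ 2 * y + algebraMap ℂ K d) / x)) (x ^ 2 * y + algebraMap ℂ K d) ∧
    ¬ Vanishes (axis x ((x ^ 2 * y + algebraMap ℂ K d) / x))
      ((x ^ 2 * y + algebraMap ℂ K d) / x - algebraMap ℂ K e) := by
  refine ⟨?_, (h.zero₃' d).axis_not_vanishes_sub e⟩
  have := (h.zero₃' d).axis_vanishes_left.mul_left (h.zero₃' d).axis_right_mem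
  rwa [div_mul_cancel₀ _ h.left_ne_zero] at this

theorem vanishes_zero₄ (h : IsBirationalChart x y) (d e : ℂ) :
    Vanishes (axis x (((x ^ 2 * y + algebraMap ℂ K d) / x - algebraMap ℂ K e) / x))
      (x ^ 2 * y + algebraMap ℂ K d) ∧
    Vanishes (axis x (((x ^ 2 * y + algebraMap ℂ K d) / x - algebraMap ℂ K e) / x))
      ((x ^ 2 * y + algebraMap ℂ K d) / x - algebraMap ℂ K e) := by
  have hc := (h.zero₄ d e).div_right
  have h1 := hc.axis_vanishes_left.mul_left hc.axis_right_mem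
  rw [div_mul_cancel₀ _ h.left_ne_zero] at h1
  refine ⟨?_, h1⟩
  have h2 := hc.axis_vanishes_left.mul_left (add_mem h1.1 (hc.axis_algebraMap_mem e))
  rwa [sub_add_cancel, div_mul_cancel₀ _ h.left_ne_zero] at h2

/-- The orders of `x` and `1/y` separate all but thirteen pairs. These are separated by whether `y ∓
s`, `x² y + d` or the coordinate defining the last center vanishes on the curve; a finite check
shows that no pair is missed. -/
theorem specialCurve_injective (h : IsBirationalChart x y) (hs : s ≠ 0) (hd : d ≠ 0) :
    Function.Injective (specialCurve x y s c c' d e) := by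
  have hx := isOrd_specialCurve_left (s := s) (c := c) (c' := c') (d := d) (e := e) h
  have hy := isOrd_specialCurve_inv_right (c := c) (c' := c') (e := e) h hs hd
  have hdvr := isDiscreteValuationRing_specialCurve (s := s) (c := c) (c' := c') (d := d) (e := e) h
  have hss : s ≠ -s := fun h1 => hs (self_eq_neg.1 h1)
  let E := specialCurve x y s c c' d e
  have a0 : Vanishes (E 0) (y - algebraMap ℂ K s) := (vanishes_pole h s c).1
  have a9 : Vanishes (E 9) (y - algebraMap ℂ K s) := (vanishes_pole' h s c).1
  have b1 : Vanishes (E 1) (y - algebraMap ℂ K (-s)) := (vanishes_pole h (-s) c').1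
  have b10 : Vanishes (E 10) (y - algebraMap ℂ K (-s)) := (vanishes_pole' h (-s) c').1
  have hc : ∀ i c, algebraMap ℂ K c ∈ (E i).toSubring := fun i => (h.curve i).axis_algebraMap_mem
  have aorb : ∀ i, Vanishes (E i) (y - algebraMap ℂ K s) →
      ¬ Vanishes (E i) (y - algebraMap ℂ K (-s)) := fun i h1 h2 =>
    hss (eq_of_vanishes_sub (hc i) h1 h2)
  have a2 : ¬ Vanishes (E 2) (y - algebraMap ℂ K s) := h.inv_left.axis_not_vanishes_sub s
  have b2 : ¬ Vanishes (E 2) (y - algebraMap ℂ K (-s)) := h.inv_left.axis_not_vanishes_sub (-s)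
  have g0 := (vanishes_pole h s c).2
  have g1 := (vanishes_pole h (-s) c').2
  have g9 := (vanishes_pole' h s c).2
  have g10 := (vanishes_pole' h (-s) c').2
  have z4 : ¬ Vanishes (E 4) (x ^ 2 * y + algebraMap ℂ K d) := not_vanishes_sq_mul_add_axis h d
  have z6 := vanishes_zero₃ h d e
  have z8 := vanishes_zero₄ h d e
  have e09 : E 0 ≠ E 9 := fun he => g0 (by
    change Vanishes (E 0) _; rw [he]; exact g9)
  have e110 : E 1 ≠ E 10 := fun he => g1 (by
    change Vanishes (E 1) _; rw [he]; exact g10)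
  have e68 : E 6 ≠ E 8 := fun he => z6.2 (by
    change Vanishes (E 6) _; rw [he]; exact z8.2)
  have z6' : Vanishes (E 6) (x ^ 2 * y + algebraMap ℂ K d) := z6.1
  have z8' : Vanishes (E 8) (x ^ 2 * y + algebraMap ℂ K d) := z8.1
  have e46 : E 4 ≠ E 6 := fun he => z4 (he ▸ z6')
  have e48 : E 4 ≠ E 8 := fun he => z4 (he ▸ z8')
  have e20 : E 2 ≠ E 0 := fun he => a2 (he ▸ a0)
  have e29 : E 2 ≠ E 9 := fun he => a2 (he ▸ a9)
  have e21 : E 2 ≠ E 1 := fun he => b2 (he ▸ b1)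
  have e210 : E 2 ≠ E 10 := fun he => b2 (he ▸ b10)
  have e01 : E 0 ≠ E 1 := fun he => aorb 0 a0 (he ▸ b1)
  have e010 : E 0 ≠ E 10 := fun he => aorb 0 a0 (he ▸ b10)
  have e91 : E 9 ≠ E 1 := fun he => aorb 9 a9 (he ▸ b1)
  have e910 : E 9 ≠ E 10 := fun he => aorb 9 a9 (he ▸ b10)
  intro i j hij
  have hij' : E i = E j := hij
  have h1 : orderX i = orderX j := (hx i).unique (hij ▸ hx j)
  have h2 : orderInvY i = orderInvY j := (hy i).unique (hij ▸ hy j)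
  have hne : ∀ p ∈ [((0 : Fin 11), (9 : Fin 11)), (1, 10), (6, 8), (4, 6), (4, 8), (2, 0), (2, 9),
      (2, 1), (2, 10), (0, 1), (0, 10), (9, 1), (9, 10)], E p.1 ≠ E p.2 := by
    simp only [List.forall_mem_cons]
    exact ⟨e09, e110, e68, e46, e48, e20, e29, e21, e210, e01, e010, e91, e910,
      fun _ h => absurd h List.not_mem_nil⟩
  have h3 : ∀ i j : Fin 11, orderX i = orderX j → orderInvY i = orderInvY j → i = j ∨
      ((i, j) ∈ [((0 : Fin 11), (9 : Fin 11)), (1, 10), (6, 8), (4, 6), (4, 8),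
      (2, 0), (2, 9), (2, 1), (2, 10), (0, 1), (0, 10), (9, 1), (9, 10)]) ∨
      ((j, i) ∈ [((0 : Fin 11), (9 : Fin 11)), (1, 10), (6, 8), (4, 6), (4, 8),
      (2, 0), (2, 9), (2, 1), (2, 10), (0, 1), (0, 10), (9, 1), (9, 10)]) := by
    decide
  clear_value E
  rcases h3 i j h1 h2 with h4 | h4 | h4
  · exact h4
  · exact (hne (i, j) h4 hij').elim
  · exact (hne (j, i) h4 hij'.symm).elim

end Separation
end InceXII

namespace InceXII

/-! ### Points of the surface and incidence with the special curves -/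

noncomputable section Classification

variable {K : Type*} [Field K] {f g x y : K}

/-- `x`, `1 / x` and `y` are regular at the point. -/
def IsGeneral (S : LocalSubring K) (x y : K) : Prop :=
  x ∈ S.toSubring ∧ x⁻¹ ∈ S.toSubring ∧ y ∈ S.toSubring

theorem IsGeneral.of_liesOn {p C : LocalSubring K} (hp : IsGeneral p x y) (h : LiesOn p C) :
    IsGeneral C x y := ⟨h hp.1, h hp.2.1, h hp.2.2⟩

variable [Algebra ℂ K] {s c c' d e : ℂ}

theorem not_isGeneral_specialCurve (h : IsBirationalChart x y) : ∀ i,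
    ¬ IsGeneral (specialCurve x y s c c' d e i) x y := by
  intro i hi
  have hv := (h.curve (s := s) (c := c) (c' := c') (d := d) (e := e) i).axis_vanishes_left
  have h1 : ¬ Vanishes (specialCurve x y s c c' d e i) (1 / x) :=
    not_vanishes_one_div h.left_ne_zero hi.1
  have h2 : ¬ Vanishes (specialCurve x y s c c' d e i) x :=
    not_vanishes_of_inv_mem h.left_ne_zero hi.2.1
  have h3 : ¬ Vanishes (specialCurve x y s c c' d e i) (1 / y) :=
    not_vanishes_one_div h.right_ne_zero hi.2.2
  fin_cases i <;> first | exact h1 hv | exact h2 hv | exact h3 hv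

/-- The points of the quadric in which `(x, y)` are no local coordinates. -/
theorem mem_quadric_cases (h : IsBirationalChart x y) {S : LocalSubring K}
    (hS : S ∈ quadric x y) : IsLoc (coordRing x y) S ∨
      (IsLoc (coordRing (1 / x) y) S ∧ Vanishes S (1 / x)) ∨
      (IsLoc (coordRing (1 / y) x) S ∧ Vanishes S (1 / y)) ∨ S = origin (1 / x) (1 / y) := by
  have key1 : IsLoc (coordRing (1 / x) y) S → IsLoc (coordRing x y) S ∨
      (IsLoc (coordRing (1 / x) y) S ∧ Vanishes S (1 / x)) := fun h1 => by
    by_cases hv : Vanishes S (1 / x)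
    · exact Or.inr ⟨h1, hv⟩
    · have := h1.inv_left hv
      rw [one_div_one_div] at this
      exact Or.inl this
  have key2 : IsLoc (coordRing x (1 / y)) S → IsLoc (coordRing x y) S ∨
      (IsLoc (coordRing (1 / y) x) S ∧ Vanishes S (1 / y)) := fun h1 => by
    by_cases hv : Vanishes S (1 / y)
    · exact Or.inr ⟨by rwa [coordRing_comm], hv⟩
    · have := h1.inv_right hv
      rw [one_div_one_div] at this
      exact Or.inl this
  rcases mem_quadric.1 hS with h1 | h1 | h1 | h1
  · exact Or.inl h1
  · have := key1 h1; tauto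
  · have := key2 h1; tauto
  · by_cases hx : Vanishes S (1 / x)
    · by_cases hy : Vanishes S (1 / y)
      · exact Or.inr (Or.inr (Or.inr (h.inv_left.inv_right.eq_origin h1 hx hy)))
      · have := h1.inv_right hy
        rw [one_div_one_div] at this
        have := key1 this
        tauto
    · have := h1.inv_left hx
      rw [one_div_one_div] at this
      have := key2 this
      tauto

/-- The points of the surface: points of the plane, generic points and closed points of special
curves, and corners. -/
theorem mem_surface_cases (h : IsBirationalChart x y) (hs : s ≠ 0) (hd : d ≠ 0)
    {S : LocalSubring K} (hS : S ∈ surface x y s c c' d e) : IsLoc (coordRing x y) S ∨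
      (∃ i, S = specialCurve x y s c c' d e i) ∨
      (∃ i b, S = origin (curveX x y i) (curveY x y s c c' d e i - algebraMap ℂ K b) ∧
        (i = 3 ∨ i = 4 ∨ i = 5 → b ≠ 0)) ∨ ∃ n, S = corner x y s c c' d e n := by
  have key : ∀ i n, (i ≠ 3 ∧ i ≠ 4 ∧ i ≠ 5) → (S = specialCurve x y s c c' d e i ∨
      (∃ b, S = origin (curveX x y i) (curveY x y s c c' d e i - algebraMap ℂ K b)) ∨
      S = corner x y s c c' d e n) → IsLoc (coordRing x y) S ∨
      (∃ i, S = specialCurve x y s c c' d e i) ∨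
      (∃ i b, S = origin (curveX x y i) (curveY x y s c c' d e i - algebraMap ℂ K b) ∧
        (i = 3 ∨ i = 4 ∨ i = 5 → b ≠ 0)) ∨ ∃ n, S = corner x y s c c' d e n := by
    rintro i n hi (h1 | ⟨b, h1⟩ | h1)
    · exact Or.inr (Or.inl ⟨i, h1⟩)
    · exact Or.inr (Or.inr (Or.inl ⟨i, b, h1, by tauto⟩))
    · exact Or.inr (Or.inr (Or.inr ⟨n, h1⟩))
  -- On the curves 3 and 5 the point with second coordinate zero is the next center and has been
  -- removed; on the curve 4 it is corner 7. Hence `b ≠ 0` can be demanded there.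
  have key' : ∀ i n, (S = specialCurve x y s c c' d e i ∨
      (∃ b, S = origin (curveX x y i) (curveY x y s c c' d e i - algebraMap ℂ K b)) ∨
      S = corner x y s c c' d e n) →
      (S ≠ origin (curveX x y i) (curveY x y s c c' d e i) ∨
        ∃ n, S = corner x y s c c' d e n) → IsLoc (coordRing x y) S ∨
      (∃ i, S = specialCurve x y s c c' d e i) ∨
      (∃ i b, S = origin (curveX x y i) (curveY x y s c c' d e i - algebraMap ℂ K b) ∧
        (i = 3 ∨ i = 4 ∨ i = 5 → b ≠ 0)) ∨ ∃ n, S = corner x y s c c' d e n := by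
    rintro i n (h1 | ⟨b, h1⟩ | h1) (h2 | h2)
    · exact Or.inr (Or.inl ⟨i, h1⟩)
    · exact Or.inr (Or.inl ⟨i, h1⟩)
    · refine Or.inr (Or.inr (Or.inl ⟨i, b, h1, fun _ hb => h2 ?_⟩))
      rw [h1, hb, map_zero, sub_zero]
    · exact Or.inr (Or.inr (Or.inr h2))
    · exact Or.inr (Or.inr (Or.inr ⟨n, h1⟩))
    · exact Or.inr (Or.inr (Or.inr ⟨n, h1⟩))
  rcases (mem_surface h hs hd).1 hS with ⟨h1, h2, h3, h4⟩ | ⟨h1, -⟩ | h1 | ⟨h1, -⟩ | h1 | ⟨h1, h2⟩ |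
    ⟨h1, h2⟩ | ⟨h1, -⟩ | h1
  · rcases mem_quadric_cases h h1 with h5 | ⟨h5, h6⟩ | ⟨h5, h6⟩ | h5
    · exact Or.inl h5
    · refine key 2 0 (by decide) ?_
      have := h.inv_left.eq_axis_or_origin h5 h6
      tauto
    · refine key' 3 0 ?_ (Or.inl ?_)
      · have := h.inv_right.swap.eq_axis_or_origin h5 h6
        tauto
      · rintro rfl
        refine h4 ?_
        rw [zeroCenter₁, origin_comm]
        exact le_rfl
    · exact Or.inr (Or.inr (Or.inr ⟨0, h5⟩))
  · exact key 0 1 (by decide) ((mem_exceptional_pole h).1 h1)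
  · exact key 9 2 (by decide) ((mem_exceptional_pole' h).1 h1)
  · exact key 1 3 (by decide) ((mem_exceptional_pole h).1 h1)
  · exact key 10 4 (by decide) ((mem_exceptional_pole' h).1 h1)
  · refine key' 5 5 ((mem_exceptional_zero₁ h).1 h1) (Or.inl ?_)
    rintro rfl
    exact h2 le_rfl
  · refine key' 4 6 ((mem_exceptional_zero₂ h).1 h1) ?_
    by_cases h3 : S = corner x y s c c' d e 7
    · exact Or.inr ⟨7, h3⟩
    · exact Or.inl h3
  · exact key 6 8 (by decide) ((mem_exceptional_zero₃ h).1 h1)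
  · exact key 8 9 (by decide) ((mem_exceptional_zero₄ h).1 h1)

/-- The center of `S` on the plane is a point of the surface which `S` dominates, so by
separatedness it is `S`. -/
theorem isLoc_coordRing_of_isGeneral (h : IsBirationalChart x y) (hs : s ≠ 0) (hd : d ≠ 0)
    {S : LocalSubring K} (hS : S ∈ surface x y s c c' d e) (hx : x ∈ S.toSubring)
    (hy : y ∈ S.toSubring) : IsLoc (coordRing x y) S := by
  have hX := isSeparatedModel_surface (c := c) (c' := c') (e := e) h hs hd
  obtain ⟨T, hT, hTS⟩ := exists_isLoc_le (coordRing_le (hX.hasChart S hS).algebraMap_mem hx hy)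
  exact hX.eq_of_le T (mem_surface_of_plane h hs hd hT) S hS S hTS le_rfl ▸ hT

theorem eq_specialCurve_or_isGeneral (h : IsBirationalChart x y) (hs : s ≠ 0) (hd : d ≠ 0)
    {C : LocalSubring K} (hC : C ∈ curves (surface x y s c c' d e)) :
    (∃ i, C = specialCurve x y s c c' d e i) ∨ IsGeneral C x y := by
  have hdvr := hC.2
  rcases mem_surface_cases h hs hd hC.1 with h1 | h1 | ⟨i, b, rfl, -⟩ | ⟨n, rfl⟩
  · by_cases hv : Vanishes C x
    · rcases h.eq_axis_or_origin h1 hv with rfl | ⟨b, rfl⟩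
      · exact Or.inl ⟨7, rfl⟩
      · exact absurd hdvr (h.sub_const b).not_isDiscreteValuationRing_origin
    · exact Or.inr ⟨h1.1 left_mem_coordRing,
        inv_mem_of_not_vanishes (h1.1 left_mem_coordRing) hv, h1.1 right_mem_coordRing⟩
  · exact Or.inl h1
  · exact absurd hdvr ((h.curve i).sub_const b).not_isDiscreteValuationRing_origin
  · exact absurd hdvr (h.corner n).not_isDiscreteValuationRing_origin

theorem closedPoint_cases (h : IsBirationalChart x y) (hs : s ≠ 0) (hd : d ≠ 0)
    {p : LocalSubring K} (hp : IsClosedPoint (surface x y s c c' d e) p) : IsGeneral p x y ∨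
      (∃ i b, p = origin (curveX x y i) (curveY x y s c c' d e i - algebraMap ℂ K b) ∧
        (i = 3 ∨ i = 4 ∨ i = 5 → b ≠ 0)) ∨ ∃ n, p = corner x y s c c' d e n := by
  rcases mem_surface_cases h hs hd hp.1 with h1 | ⟨i, rfl⟩ | h1 | h1
  · by_cases hv : Vanishes p x
    · obtain ⟨a, b, hab⟩ := h.exists_liesOn h1
      have hc := h.chartPoint a b
      obtain rfl := hp.2 _ (mem_surface_of_plane h hs hd
        (by rw [← coordRing_chartPoint a b]; exact hc.isLoc_origin)) hab
      obtain rfl : a = 0 := eq_of_vanishes_sub hc.isLoc_origin.algebraMap_mem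
        hc.origin_vanishes_left (by simpa using hv)
      exact Or.inr (Or.inl ⟨7, b, by simp [curveX, curveY],
        fun hi => absurd hi (by decide)⟩)
    · exact Or.inl ⟨h1.1 left_mem_coordRing,
        inv_mem_of_not_vanishes (h1.1 left_mem_coordRing) hv, h1.1 right_mem_coordRing⟩
  -- The generic point of a special curve is not closed, because the base point specializes it.
  · have h1 := hp.2 _ (basePoint_mem h hs hd i) ((h.curve i).liesOn_axis_sub _)
    have h2 := ((h.curve (s := s) (c := c) (c' := c') (d := d) (e := e) i).sub_const
      (basePoint c c' d e i)).not_isDiscreteValuationRing_origin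
    rw [h1] at h2
    exact absurd (isDiscreteValuationRing_specialCurve h i) h2
  · exact Or.inr (Or.inl h1)
  · exact Or.inr (Or.inr h1)

/-- Inverting the chart coordinates leads back to the general open set. Contrapositively, a special
curve through a noncorner point of the curve `i` must have `curveX x y i` vanishing on it. The
curves 3, 4, 5 need the inverse of the second coordinate to recover `x⁻¹` or `y`. -/
theorem isGeneral_of_inv_mem {S : LocalSubring K} (hx : x ≠ 0) (hy : y ≠ 0)
    (hc : ∀ c, algebraMap ℂ K c ∈ S.toSubring) {i : Fin 11}
    (h1 : curveX x y i ∈ S.toSubring) (h2 : (curveX x y i)⁻¹ ∈ S.toSubring)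
    (h3 : curveY x y s c c' d e i ∈ S.toSubring)
    (h4 : i = 3 ∨ i = 4 ∨ i = 5 → (curveY x y s c c' d e i)⁻¹ ∈ S.toSubring) :
    IsGeneral S x y := by
  have pole : ∀ r, 1 / x ∈ S.toSubring → (1 / x)⁻¹ ∈ S.toSubring →
      (y - algebraMap ℂ K r) * x ∈ S.toSubring → IsGeneral S x y := by
    intro r h1 h2 h3
    refine ⟨by simpa using h2, by simpa using h1, ?_⟩
    have := add_mem (mul_mem h3 h1) (hc r)
    rwa [mul_one_div, mul_div_cancel_right₀ _ hx, sub_add_cancel] at this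
  have pole' : ∀ r c, 1 / x ∈ S.toSubring → (1 / x)⁻¹ ∈ S.toSubring →
      ((y - algebraMap ℂ K r) * x - algebraMap ℂ K c) * x ∈ S.toSubring → IsGeneral S x y := by
    intro r c h1 h2 h3
    refine pole r h1 h2 ?_
    have := add_mem (mul_mem h3 h1) (hc c)
    rwa [mul_one_div, mul_div_cancel_right₀ _ hx, sub_add_cancel] at this
  have zero : x ∈ S.toSubring → x⁻¹ ∈ S.toSubring →
      (x ^ 2 * y + algebraMap ℂ K d) / x ∈ S.toSubring → IsGeneral S x y := by
    intro h1 h2 h3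
    refine ⟨h1, h2, ?_⟩
    have := mul_mem (sub_mem (mul_mem h3 h1) (hc d)) (pow_mem h2 2)
    rw [div_mul_cancel₀ _ hx, add_sub_cancel_right] at this
    convert this using 1
    field_simp
  fin_cases i
  · exact pole s h1 h2 h3
  · exact pole (-s) h1 h2 h3
  · exact ⟨by simpa [curveX] using h2, by simpa [curveX] using h1, h3⟩
  · exact ⟨h3, h4 (by simp), by simpa [curveX] using h2⟩
  · refine ⟨h1, h2, ?_⟩
    have := mul_mem (h4 (by simp)) (pow_mem h2 2)
    convert this using 1
    simp only [curveX, curveY]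
    field_simp
  · refine ⟨h1, h2, ?_⟩
    have := mul_mem (h4 (by simp)) h2
    convert this using 1
    simp only [curveX, curveY]
    field_simp
  · exact zero h1 h2 h3
  · exact ⟨h1, h2, h3⟩
  · refine zero h1 h2 ?_
    have := add_mem (mul_mem h3 h1) (hc e)
    simp only [curveX, curveY] at this
    rwa [div_mul_cancel₀ _ hx, sub_add_cancel] at this
  · exact pole' s c h1 h2 h3
  · exact pole' (-s) c' h1 h2 h3

theorem isGeneral_of_corner_inv_mem {S : LocalSubring K} (h : IsBirationalChart x y)
    (hc : ∀ c, algebraMap ℂ K c ∈ S.toSubring) {n : Fin 10}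
    (h1 : cornerX x y s c c' d e n ∈ S.toSubring) (h2 : (cornerX x y s c c' d e n)⁻¹ ∈ S.toSubring)
    (h3 : cornerY x y s c c' d e n ∈ S.toSubring) (h4 : (cornerY x y s c c' d e n)⁻¹ ∈ S.toSubring) :
    IsGeneral S x y := by
  have hx := h.left_ne_zero
  have hy := h.right_ne_zero
  have pole : ∀ {f g : K} (r : ℂ), f ∈ S.toSubring → f⁻¹ ∈ S.toSubring → g ∈ S.toSubring →
      g⁻¹ ∈ S.toSubring → g ≠ 0 → f = 1 / x / g → x ∈ S.toSubring ∧ x⁻¹ ∈ S.toSubring := by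
    rintro f g r h1 h2 h3 h4 hg rfl
    have e1 := mul_mem h1 h3
    have e2 := mul_mem h2 h4
    rw [div_mul_cancel₀ _ hg, one_div] at e1
    rw [← mul_inv, div_mul_cancel₀ _ hg, one_div, inv_inv] at e2
    exact ⟨e2, e1⟩
  have zero : ∀ {f g : K}, f ∈ S.toSubring → f⁻¹ ∈ S.toSubring → g ∈ S.toSubring →
      g⁻¹ ∈ S.toSubring → g ≠ 0 → f = x / g → x ∈ S.toSubring ∧ x⁻¹ ∈ S.toSubring := by
    rintro f g h1 h2 h3 h4 hg rfl
    have e1 := mul_mem h1 h3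
    have e2 := mul_mem h2 h4
    rw [div_mul_cancel₀ _ hg] at e1
    rw [← mul_inv, div_mul_cancel₀ _ hg] at e2
    exact ⟨e1, e2⟩
  have hg := (h.corner (s := s) (c := c) (c' := c') (d := d) (e := e) n).right_ne_zero
  have sub : ∀ {g : K} (r : ℂ), g - algebraMap ℂ K r ∈ S.toSubring → g ∈ S.toSubring :=
    fun r hr => by simpa using add_mem hr (hc r)
  fin_cases n
  · exact ⟨by simpa [cornerX] using h2, by simpa [cornerX] using h1, by simpa [cornerY] using h4⟩
  · obtain ⟨h5, h6⟩ := pole s h1 h2 h3 h4 hg rfl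
    exact ⟨h5, h6, sub s h3⟩
  · obtain ⟨h5, h6⟩ := pole s h1 h2 h3 h4 hg rfl
    refine ⟨h5, h6, sub s ?_⟩
    have := mul_mem (sub c h3) h6
    rwa [mul_inv_cancel_right₀ hx] at this
  · obtain ⟨h5, h6⟩ := pole s h1 h2 h3 h4 hg rfl
    exact ⟨h5, h6, sub (-s) h3⟩
  · obtain ⟨h5, h6⟩ := pole s h1 h2 h3 h4 hg rfl
    refine ⟨h5, h6, sub (-s) ?_⟩
    have := mul_mem (sub c' h3) h6
    rwa [mul_inv_cancel_right₀ hx] at this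
  · obtain ⟨h5, h6⟩ := zero h1 h2 h3 h4 hg rfl
    exact ⟨h5, h6, by simpa [cornerY] using h4⟩
  · obtain ⟨h5, h6⟩ := zero h1 h2 h3 h4 hg rfl
    refine ⟨h5, h6, ?_⟩
    have := mul_mem h6 h4
    simpa [cornerY, hx, mul_comm] using this
  · refine ⟨h1, h2, ?_⟩
    have := mul_mem (pow_mem h2 2) h4
    simpa [cornerX, cornerY, hx, mul_comm] using this
  · obtain ⟨h5, h6⟩ := zero h1 h2 h3 h4 hg rfl
    refine ⟨h5, h6, ?_⟩
    have := mul_mem (pow_mem h6 2) (sub_mem h3 (hc d))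
    simpa [cornerY, hx] using this
  · obtain ⟨h5, h6⟩ := zero h1 h2 h3 h4 hg rfl
    refine ⟨h5, h6, ?_⟩
    have := mul_mem (pow_mem h6 2) (sub_mem (mul_mem (sub e h3) h5) (hc d))
    rw [div_mul_cancel₀ _ hx] at this
    simpa [hx] using this

/-- The only special curve through a point of a special curve that is not a corner. -/
theorem eq_of_liesOn_specialCurve (h : IsBirationalChart x y) (hs : s ≠ 0) (hd : d ≠ 0)
    {i j : Fin 11} {b : ℂ} (hb : i = 3 ∨ i = 4 ∨ i = 5 → b ≠ 0)
    (hp : origin (curveX x y i) (curveY x y s c c' d e i - algebraMap ℂ K b) ∈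
      surface x y s c c' d e)
    (hj : LiesOn (origin (curveX x y i) (curveY x y s c c' d e i - algebraMap ℂ K b))
      (specialCurve x y s c c' d e j)) : j = i := by
  have hX := isSeparatedModel_surface (c := c) (c' := c') (e := e) h hs hd
  have hch := (h.curve (s := s) (c := c) (c' := c') (d := d) (e := e) i).sub_const b
  refine specialCurve_injective h hs hd (c := c) (c' := c') (e := e) ?_
  have hv : Vanishes (specialCurve x y s c c' d e j) (curveX x y i) := by
    by_contra hv
    have h1 := hj hch.origin_vanishes_left.1
    have h3 : curveY x y s c c' d e i ∈ (origin (curveX x y i)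
        (curveY x y s c c' d e i - algebraMap ℂ K b)).toSubring := by
      simpa using add_mem hch.origin_vanishes_right.1 (hch.isLoc_origin.algebraMap_mem b)
    refine not_isGeneral_specialCurve h j (isGeneral_of_inv_mem h.left_ne_zero h.right_ne_zero
      (h.curve j).axis_algebraMap_mem h1 (inv_mem_of_not_vanishes h1 hv) (hj h3) fun hi => ?_)
    refine hj (inv_mem_of_not_vanishes h3 fun h4 => hb hi ?_)
    exact eq_of_vanishes_sub hch.isLoc_origin.algebraMap_mem hch.origin_vanishes_right
      (by simpa using h4)
  rw [hX.eq_axis hch hp (specialCurve_mem_curves h hs hd j) hj hv, axis_sub_const]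
  rfl

/-- The special curves through a corner. -/
theorem eq_of_liesOn_corner (h : IsBirationalChart x y) (hs : s ≠ 0) (hd : d ≠ 0)
    {n : Fin 10} {j : Fin 11}
    (hj : LiesOn (corner x y s c c' d e n) (specialCurve x y s c c' d e j)) :
    j = (cornerCurves n).1 ∨ j = (cornerCurves n).2 := by
  have hX := isSeparatedModel_surface (c := c) (c' := c') (e := e) h hs hd
  have hch := h.corner (s := s) (c := c) (c' := c') (d := d) (e := e) n
  have hinj := specialCurve_injective h hs hd (c := c) (c' := c') (e := e)
  have hp := corner_mem (c := c) (c' := c') (e := e) h hs hd n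
  have hC := specialCurve_mem_curves (c := c) (c' := c') (e := e) h hs hd j
  by_cases h1 : Vanishes (specialCurve x y s c c' d e j) (cornerX x y s c c' d e n)
  · left
    refine hinj ?_
    rw [← corner_axis_left h n]
    exact hX.eq_axis hch hp hC hj h1
  · by_cases h2 : Vanishes (specialCurve x y s c c' d e j) (cornerY x y s c c' d e n)
    · right
      refine hinj ?_
      rw [← corner_axis_right h n]
      rw [corner, origin_comm] at hp hj
      exact hX.eq_axis hch.swap hp hC hj h2
    · have h3 := hj hch.origin_vanishes_left.1
      have h4 := hj hch.origin_vanishes_right.1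
      exact absurd (isGeneral_of_corner_inv_mem h (h.curve j).axis_algebraMap_mem h3
        (inv_mem_of_not_vanishes h3 h1) h4 (inv_mem_of_not_vanishes h4 h2))
        (not_isGeneral_specialCurve h j)

theorem corner_liesOn_left (h : IsBirationalChart x y) (n : Fin 10) :
    LiesOn (corner x y s c c' d e n) (specialCurve x y s c c' d e (cornerCurves n).1) :=
  corner_axis_left (s := s) (c := c) (c' := c') (d := d) (e := e) h n ▸ (h.corner n).liesOn_axis

theorem corner_liesOn_right (h : IsBirationalChart x y) (n : Fin 10) :
    LiesOn (corner x y s c c' d e n) (specialCurve x y s c c' d e (cornerCurves n).2) :=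
  corner_axis_right (s := s) (c := c) (c' := c') (d := d) (e := e) h n ▸ (h.corner n).liesOn_axis'

/-- A corner lies on exactly two special curves, and the ten pairs in the table are different. -/
theorem corner_injective (h : IsBirationalChart x y) (hs : s ≠ 0) (hd : d ≠ 0) :
    Function.Injective (corner x y s c c' d e) := by
  intro n m hnm
  have h1 := eq_of_liesOn_corner h hs hd (hnm ▸ corner_liesOn_left h n)
  have h2 := eq_of_liesOn_corner h hs hd (hnm ▸ corner_liesOn_right h n)
  revert n m
  have : ∀ n m, ((cornerCurves n).1 = (cornerCurves m).1 ∨ (cornerCurves n).1 = (cornerCurves m).2) →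
    ((cornerCurves n).2 = (cornerCurves m).1 ∨ (cornerCurves n).2 = (cornerCurves m).2) → n = m := by
    decide
  exact fun n m _ => this n m

theorem exists_corner_of_liesOn (h : IsBirationalChart x y) (hs : s ≠ 0) (hd : d ≠ 0)
    {p : LocalSubring K} (hp : IsClosedPoint (surface x y s c c' d e) p) {i j : Fin 11}
    (hij : i ≠ j) (hi : LiesOn p (specialCurve x y s c c' d e i))
    (hj : LiesOn p (specialCurve x y s c c' d e j)) :
    ∃ n, p = corner x y s c c' d e n ∧ (cornerCurves n = (i, j) ∨ cornerCurves n = (j, i)) := by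
  rcases closedPoint_cases h hs hd hp with h1 | ⟨k, b, rfl, hb⟩ | ⟨n, rfl⟩
  · exact absurd (h1.of_liesOn hi) (not_isGeneral_specialCurve h i)
  · exact absurd ((eq_of_liesOn_specialCurve h hs hd hb hp.1 hi).trans
      (eq_of_liesOn_specialCurve h hs hd hb hp.1 hj).symm) hij
  · have h1 := eq_of_liesOn_corner h hs hd hi
    have h2 := eq_of_liesOn_corner h hs hd hj
    refine ⟨n, rfl, ?_⟩
    grind

end Classification
end InceXII

namespace InceXII

/-! ### Intersection numbers -/

noncomputable section Intersection

section

variable {K : Type*} [Field K] {p C : LocalSubring K}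

theorem mem_curveIdeal (hp : LiesOn p C) {a : p.toSubring} :
    a ∈ curveIdeal p C ↔ Vanishes C (a : K) := by
  rw [curveIdeal, dif_pos hp, Ideal.mem_comap, ← vanishes_mk_iff]
  rfl

theorem curveIdeal_le (hp : LiesOn p C) :
    curveIdeal p C ≤ IsLocalRing.maximalIdeal p.toSubring := by
  refine IsLocalRing.le_maximalIdeal fun h => ?_
  have := (mem_curveIdeal hp).1 (h ▸ Submodule.mem_top : (1 : p.toSubring) ∈ curveIdeal p C)
  exact not_vanishes_one C this

theorem localInter_eq_zero {C' : LocalSubring K} (h : ¬ LiesOn p C ∨ ¬ LiesOn p C') :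
    localInter p C C' = 0 := by
  have h1 : curveIdeal p C ⊔ curveIdeal p C' = ⊤ := by
    rcases h with h | h
    · rw [curveIdeal, dif_neg h, top_sup_eq]
    · rw [curveIdeal.eq_1 p C', dif_neg h, sup_top_eq]
  rw [localInter, h1]
  have : Subsingleton (p.toSubring ⧸ (⊤ : Ideal p.toSubring)) :=
    Ideal.Quotient.subsingleton_iff.2 rfl
  simp [Module.length_eq_zero]

theorem localInter_comm (p C C' : LocalSubring K) : localInter p C C' = localInter p C' C := by
  rw [localInter, localInter, sup_comm]

end

variable {K : Type*} [Field K] [Algebra ℂ K] {f g x y : K} {s c c' d e : ℂ}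

/-- The equations of the two axes generate the maximal ideal, so the axes meet transversally. -/
theorem IsBirationalChart.localInter_axis (h : IsBirationalChart f g) :
    localInter (origin f g) (axis f g) (axis g f) = 1 := by
  have h1 : curveIdeal (origin f g) (axis f g) ⊔ curveIdeal (origin f g) (axis g f) =
      IsLocalRing.maximalIdeal (origin f g).toSubring := by
    refine le_antisymm (sup_le (curveIdeal_le h.liesOn_axis) (curveIdeal_le h.liesOn_axis')) ?_
    rw [h.maximalIdeal_origin, Ideal.span_le]
    rintro _ (rfl | rfl)
    · exact Ideal.mem_sup_left ((mem_curveIdeal h.liesOn_axis).2 h.axis_vanishes_left)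
    · exact Ideal.mem_sup_right ((mem_curveIdeal h.liesOn_axis').2 h.swap.axis_vanishes_left)
  rw [localInter, h1]
  have : Module.length (origin f g).toSubring ((origin f g).toSubring ⧸
      IsLocalRing.maximalIdeal (origin f g).toSubring) = 1 := by
    rw [Module.length_eq_one_iff, isSimpleModule_iff_isCoatom]
    exact (IsLocalRing.maximalIdeal.isMaximal _).out
  rw [this]; rfl

/-- The number of corners on two special curves. -/
def cornerCount (i j : Fin 11) : ℤ :=
  (Finset.univ.filter fun n => cornerCurves n = (i, j) ∨ cornerCurves n = (j, i)).card

theorem localInter_corner (h : IsBirationalChart x y) {n : Fin 10} {i j : Fin 11}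
    (hn : cornerCurves n = (i, j) ∨ cornerCurves n = (j, i)) :
    localInter (corner x y s c c' d e n) (specialCurve x y s c c' d e i)
      (specialCurve x y s c c' d e j) = 1 := by
  have h1 := (h.corner (s := s) (c := c) (c' := c') (d := d) (e := e) n).localInter_axis
  rw [corner_axis_left h, corner_axis_right h] at h1
  rcases hn with hn | hn
  · rwa [hn] at h1
  · rw [hn] at h1
    rwa [localInter_comm]

/-- Two different special curves can meet only in corners, each of which contributes 1. -/
theorem inter_specialCurve (h : IsBirationalChart x y) (hs : s ≠ 0) (hd : d ≠ 0) {i j : Fin 11}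
    (hij : i ≠ j) : inter (surface x y s c c' d e) (specialCurve x y s c c' d e i)
      (specialCurve x y s c c' d e j) = cornerCount i j := by
  have hinj := corner_injective (c := c) (c' := c') (e := e) h hs hd
  have hX := isSeparatedModel_surface (c := c) (c' := c') (e := e) h hs hd
  let N : Finset (Fin 10) :=
    Finset.univ.filter fun n => cornerCurves n = (i, j) ∨ cornerCurves n = (j, i)
  have hN : ∀ n, n ∈ N ↔ cornerCurves n = (i, j) ∨ cornerCurves n = (j, i) := by simp [N]
  rw [inter, ← finsum_mem_inter_support_eq (s := corner x y s c c' d e '' N) _ _ (by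
    ext p
    simp only [Set.mem_inter_iff, Set.mem_ofPred_eq, Function.mem_support, Set.mem_image,
      Finset.mem_coe]
    refine and_congr_left fun hp => ⟨fun ⟨n, hn, hnp⟩ => hnp ▸ hX.isClosedPoint (h.corner n)
      (corner_mem h hs hd n), fun hcl => ?_⟩
    have hp' : localInter p (specialCurve x y s c c' d e i) (specialCurve x y s c c' d e j) ≠ 0 :=
      by exact_mod_cast hp
    have : LiesOn p (specialCurve x y s c c' d e i) ∧ LiesOn p (specialCurve x y s c c' d e j) :=
      not_not.1 fun h0 => hp' (localInter_eq_zero (not_and_or.1 h0))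
    obtain ⟨n, rfl, hn⟩ := exists_corner_of_liesOn h hs hd hcl hij this.1 this.2
    exact ⟨n, (hN n).2 hn, rfl⟩)]
  rw [finsum_mem_image hinj.injOn, finsum_mem_coe_finset,
    Finset.sum_congr rfl fun n hn => by rw [localInter_corner h ((hN n).1 hn)]]
  simp [cornerCount, N]

/-- Along a curve of the general open set the function `1/y` has order zero unless the curve lies in
`y = 0`. Such a curve does not meet the strict transform of `y = ∞`, because `1/y` is regular at all
closed points of the latter. -/
theorem orderInvY_mul_inter_eq_zero (h : IsBirationalChart x y) (hs : s ≠ 0) (hd : d ≠ 0)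
    {C : LocalSubring K} (hC : C ∈ curves (surface x y s c c' d e)) (hg : IsGeneral C x y) :
    ord C (1 / y) * inter (surface x y s c c' d e) C (specialCurve x y s c c' d e 3) = 0 := by
  have hdvr := hC.2
  by_cases hv : Vanishes C y
  · refine mul_eq_zero_of_right _ ?_
    rw [inter]
    refine finsum_mem_eq_zero_of_forall_eq_zero fun p hp => ?_
    rw [Nat.cast_eq_zero]
    refine localInter_eq_zero (not_and_or.1 fun ⟨h1, h2⟩ => ?_)
    refine not_vanishes_of_inv_mem h.right_ne_zero (one_div y ▸ h1 (?_ : 1 / y ∈ p.toSubring)) hv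
    rcases closedPoint_cases h hs hd hp with h3 | ⟨i, b, rfl, hb⟩ | ⟨n, rfl⟩
    · exact absurd (h3.of_liesOn h2) (not_isGeneral_specialCurve h 3)
    · obtain rfl := eq_of_liesOn_specialCurve h hs hd hb hp.1 h2
      exact ((h.curve (s := s) (c := c) (c' := c') (d := d) (e := e) 3).sub_const
        b).origin_vanishes_left.1
    · have h4 := eq_of_liesOn_corner h hs hd h2
      have hch := h.corner (s := s) (c := c) (c' := c') (d := d) (e := e) n
      have h5 := hch.origin_vanishes_left.1
      have h6 := hch.origin_vanishes_right.1
      have h7 : n = 0 ∨ n = 7 := by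
        clear * - h4
        revert n; decide
      rcases h7 with rfl | rfl
      · exact h6
      · have := mul_mem (pow_mem h5 2) h6
        have hx := h.left_ne_zero
        have e1 : x ^ 2 * (1 / (x ^ 2 * y)) = 1 / y := by field_simp
        exact e1 ▸ this
  · refine mul_eq_zero_of_left ?_ _
    have := (isOrd_zero hg.2.2 hv).inv
    rw [one_div]
    exact this.ord_eq

theorem ord_eq_zero_of_isGeneral (h : IsBirationalChart x y) {C : LocalSubring K}
    [IsDiscreteValuationRing C.toSubring] (hg : IsGeneral C x y) : ord C x = 0 :=
  (isOrd_zero hg.1 (not_vanishes_of_inv_mem h.left_ne_zero hg.2.1)).ord_eq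

/-- If the curves of the general open set contribute nothing, the self-intersection number is a
finite sum over the tables of orders and corners. -/
theorem hasSelfInter_specialCurve (h : IsBirationalChart x y) (hs : s ≠ 0) (hd : d ≠ 0)
    {i : Fin 11} {z : K} {v : Fin 11 → ℤ} (hi : v i = 1)
    (hv : ∀ j, IsOrd (specialCurve x y s c c' d e j) z (v j))
    (hz : ∀ C ∈ curves (surface x y s c c' d e), IsGeneral C x y →
      ord C z * inter (surface x y s c c' d e) C (specialCurve x y s c c' d e i) = 0) :
    HasSelfInter (surface x y s c c' d e) (specialCurve x y s c c' d e i)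
      (-∑ j ∈ Finset.univ.erase i, v j * cornerCount j i) := by
  have hinj := specialCurve_injective h hs hd (c := c) (c' := c') (e := e)
  have hdvr := isDiscreteValuationRing_specialCurve (s := s) (c := c) (c' := c') (d := d) (e := e) h
  refine ⟨z, hi ▸ hv i, congrArg Neg.neg ?_⟩
  rw [← finsum_mem_inter_support_eq
    (s := specialCurve x y s c c' d e '' (Finset.univ.erase i : Finset (Fin 11))) _ _ (by
    ext C
    simp only [Set.mem_inter_iff, Function.mem_support, Set.mem_image, Finset.mem_coe,
      Finset.mem_erase, Finset.mem_univ, and_true, Set.mem_sdiff, Set.mem_singleton_iff]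
    refine and_congr_left fun hp => ⟨?_, fun ⟨hC, hne⟩ => ?_⟩
    · rintro ⟨j, hj, rfl⟩
      exact ⟨specialCurve_mem_curves h hs hd j, fun h1 => hj (hinj h1)⟩
    · rcases eq_specialCurve_or_isGeneral h hs hd hC with ⟨j, rfl⟩ | hg
      · exact ⟨j, fun h1 => hne (h1 ▸ rfl), rfl⟩
      · exact absurd (hz C hC hg) hp)]
  rw [finsum_mem_image hinj.injOn, finsum_mem_coe_finset]
  refine Finset.sum_congr rfl fun j hj => ?_
  have := hdvr j
  rw [inter_specialCurve h hs hd (Finset.ne_of_mem_erase hj), (hv j).ord_eq]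

/-- The function of order one is `1/x` on the curves 0, 1, 2, it is `x` on 4, 5, 6, and `1/y` on the
curve 3, along which `x` has order zero. In the first two cases the function is a unit along general
curves. -/
theorem selfInter_specialCurve (h : IsBirationalChart x y) (hs : s ≠ 0) (hd : d ≠ 0)
    {i : Fin 11} (hi : i ∈ Finset.Icc 0 6) : HasSelfInter (surface x y s c c' d e)
      (specialCurve x y s c c' d e i) (-2) := by
  have hx := isOrd_specialCurve_left (s := s) (c := c) (c' := c') (d := d) (e := e) h
  have key : orderX i = 1 ∧ -∑ j ∈ Finset.univ.erase i, orderX j * cornerCount j i = -2 ∨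
      -orderX i = 1 ∧ -∑ j ∈ Finset.univ.erase i, -orderX j * cornerCount j i = -2 ∨
      i = 3 := by
    clear * - hi
    revert i; decide
  have hdvr : ∀ C ∈ curves (surface x y s c c' d e), IsDiscreteValuationRing C.toSubring :=
    fun C hC => hC.2
  rcases key with ⟨h1, h2⟩ | ⟨h1, h2⟩ | rfl
  · rw [← h2]
    refine hasSelfInter_specialCurve h hs hd h1 hx fun C hC hg => ?_
    have := hdvr C hC
    rw [ord_eq_zero_of_isGeneral h hg, zero_mul]
  · rw [← h2]
    refine hasSelfInter_specialCurve h hs hd (v := fun j => -orderX j) h1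
      (fun j => (hx j).inv) fun C hC hg => ?_
    have := hdvr C hC
    have h3 := (isOrd_zero hg.1 (not_vanishes_of_inv_mem h.left_ne_zero hg.2.1)).inv
    rw [h3.ord_eq, neg_zero, zero_mul]
  · have h2 : -∑ j ∈ Finset.univ.erase 3, orderInvY j * cornerCount j 3 = -2 := by decide
    rw [← h2]
    exact hasSelfInter_specialCurve h hs hd (by decide) (isOrd_specialCurve_inv_right h hs hd)
      fun C hC hg => orderInvY_mul_inter_eq_zero h hs hd hC hg

end Intersection
end InceXII

namespace InceXII

/-! ### Two-forms -/

noncomputable section Forms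

section

variable {K : Type*} [Field K] {M : Type*} [AddCommGroup M] [Module K M]

theorem ιMulti_two_swap (v w : M) :
    exteriorPower.ιMulti K 2 ![v, w] = -exteriorPower.ιMulti K 2 ![w, v] := by
  rw [← AlternatingMap.map_swap _ ![w, v] (show (0 : Fin 2) ≠ 1 by decide)]
  congr 1
  ext i; fin_cases i <;> rfl

theorem ιMulti_two_self (v : M) : exteriorPower.ιMulti K 2 ![v, v] = 0 :=
  AlternatingMap.map_eq_zero_of_eq _ _ (show ![v, v] 0 = ![v, v] 1 from rfl) (by decide)

theorem ιMulti_two_add_smul_left (a b : K) (u v w : M) :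
    exteriorPower.ιMulti K 2 ![a • u + b • v, w] =
      a • exteriorPower.ιMulti K 2 ![u, w] + b • exteriorPower.ιMulti K 2 ![v, w] := by
  rw [AlternatingMap.map_vecCons_add, AlternatingMap.map_vecCons_smul,
    AlternatingMap.map_vecCons_smul]

/-- The exterior square is alternating and bilinear, so a change of two vectors multiplies by the
determinant; applied to differentials this is the Jacobian. -/
theorem ιMulti_two_comb (a b a' b' : K) (u v : M) :
    exteriorPower.ιMulti K 2 ![a • u + b • v, a' • u + b' • v] =
      (a * b' - b * a') • exteriorPower.ιMulti K 2 ![u, v] := by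
  rw [ιMulti_two_add_smul_left, ιMulti_two_swap u, ιMulti_two_swap v, ιMulti_two_add_smul_left,
    ιMulti_two_add_smul_left, ιMulti_two_self, ιMulti_two_self, ιMulti_two_swap v]
  module

end

theorem IsOrd.neg {K : Type*} [Field K] {C : LocalSubring K} {n : ℤ} {z : K} (h : IsOrd C z n) : IsOrd C (-z) n := by
  obtain ⟨e, w, hw, rfl⟩ := h
  exact ⟨-e, w, hw, by simp⟩

variable {K : Type*} [Field K] [Algebra ℂ K] {f g x y : K} {s c c' d e : ℂ}

theorem twoForm_comb {f' g' a b a' b' : K}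
    (hf : KaehlerDifferential.D ℂ K f' =
      a • KaehlerDifferential.D ℂ K f + b • KaehlerDifferential.D ℂ K g)
    (hg : KaehlerDifferential.D ℂ K g' =
      a' • KaehlerDifferential.D ℂ K f + b' • KaehlerDifferential.D ℂ K g) :
    twoForm f' g' = (a * b' - b * a') • twoForm f g := by
  rw [twoForm, hf, hg, ιMulti_two_comb, twoForm]

theorem twoForm_sub_const (c : ℂ) : twoForm f (g - algebraMap ℂ K c) = twoForm f g := by
  rw [twoForm_comb (f := f) (g := g) (a := 1) (b := 0) (a' := 0) (b' := 1) (by simp) (by simp)]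
  simp

theorem twoForm_inv_left : twoForm (1 / f) g = (-(1 / f) ^ 2) • twoForm f g := by
  rw [twoForm_comb (f := f) (g := g) (a := -(1 / f) ^ 2) (b := 0) (a' := 0) (b' := 1)
    (by simp [Derivation.leibniz_inv]) (by simp)]
  simp

theorem twoForm_swap : twoForm g f = -twoForm f g := ιMulti_two_swap _ _

theorem twoForm_inv_right : twoForm f (1 / g) = (-(1 / g) ^ 2) • twoForm f g := by
  rw [twoForm_swap, twoForm_inv_left, twoForm_swap, smul_neg, neg_neg]

theorem twoForm_neg_right : twoForm f (-g) = -twoForm f g := by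
  rw [twoForm_comb (f := f) (g := g) (a := 1) (b := 0) (a' := 0) (b' := -1) (by simp) (by simp)]
  module

theorem twoForm_mul_right : twoForm f (g * f) = f • twoForm f g := by
  rw [twoForm_comb (f := f) (g := g) (a := 1) (b := 0) (a' := g) (b' := f)
    (by simp) (by simp [Derivation.leibniz])]
  simp

theorem twoForm_div_right (hf : f ≠ 0) : twoForm f (g / f) = f⁻¹ • twoForm f g := by
  have := twoForm_mul_right (f := f) (g := g / f)
  rw [div_mul_cancel₀ _ hf] at this
  rw [this, smul_smul, inv_mul_cancel₀ hf, one_smul]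

theorem twoForm_pole (hx : x ≠ 0) (r : ℂ) :
    twoForm (1 / x) ((y - algebraMap ℂ K r) * x) = (-(1 / x)) • twoForm x y := by
  have h1 : (y - algebraMap ℂ K r) * x = (y - algebraMap ℂ K r) / (1 / x) := by
    rw [div_div_eq_mul_div, div_one]
  rw [h1, twoForm_div_right (one_div_ne_zero hx), twoForm_sub_const, twoForm_inv_left, smul_smul]
  congr 1
  field_simp

theorem twoForm_pole' (hx : x ≠ 0) (r c : ℂ) :
    twoForm (1 / x) (((y - algebraMap ℂ K r) * x - algebraMap ℂ K c) * x) = -twoForm x y := by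
  have h1 : ((y - algebraMap ℂ K r) * x - algebraMap ℂ K c) * x =
    ((y - algebraMap ℂ K r) * x - algebraMap ℂ K c) / (1 / x) := by
    rw [div_div_eq_mul_div, div_one]
  rw [h1, twoForm_div_right (one_div_ne_zero hx), twoForm_sub_const, twoForm_pole hx, smul_smul,
    ← neg_one_smul K (twoForm x y)]
  congr 1
  field_simp

theorem twoForm_sq_mul : twoForm x (x ^ 2 * y) = x ^ 2 • twoForm x y := by
  rw [show x ^ 2 * y = y * x * x by ring, twoForm_mul_right, twoForm_mul_right, smul_smul, pow_two]

theorem twoForm_zero₃ (hx : x ≠ 0) (d : ℂ) :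
    twoForm x ((x ^ 2 * y + algebraMap ℂ K d) / x) = x • twoForm x y := by
  rw [twoForm_div_right hx, ← sub_neg_eq_add, ← map_neg, twoForm_sub_const, twoForm_sq_mul,
    smul_smul]
  congr 1
  field_simp

theorem twoForm_zero₄ (hx : x ≠ 0) (d e : ℂ) :
    twoForm x (((x ^ 2 * y + algebraMap ℂ K d) / x - algebraMap ℂ K e) / x) = twoForm x y := by
  rw [twoForm_div_right hx, twoForm_sub_const, twoForm_zero₃ hx, smul_smul, inv_mul_cancel₀ hx,
    one_smul]

/-- The order of `dx ∧ dy` along the special curves. -/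
def formOrder : Fin 11 → ℤ := ![-1, -1, -2, -2, -2, -1, -1, 0, 0, 0, 0]

/-- The ratio of `dx ∧ dy` and the two-form of the coordinates at a special curve. -/
def formCoeff (x y : K) : Fin 11 → K
  | 0 => -x
  | 1 => -x
  | 2 => -(x * x)
  | 3 => (1 / y)⁻¹ * (1 / y)⁻¹
  | 4 => -(x * x * ((1 / y)⁻¹ * (1 / y)⁻¹))
  | 5 => -(x * ((1 / y)⁻¹ * (1 / y)⁻¹))
  | 6 => x⁻¹
  | 7 => 1
  | 8 => 1
  | 9 => -1
  | 10 => -1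

/-- Dividing the second coordinate by the first divides the form by the first; inverting a
coordinate multiplies it by minus the square of the inverse. The factors are kept as products of
`x`, `1/y` and their inverses so that their orders add up from the two tables. -/
theorem twoForm_curve (h : IsBirationalChart x y) : ∀ i : Fin 11,
    twoForm (curveX x y i) (curveY x y s c c' d e i) = (formCoeff x y i)⁻¹ • twoForm x y := by
  have hx := h.left_ne_zero
  have hy := h.right_ne_zero
  have pole : ∀ r, twoForm (1 / x) ((y - algebraMap ℂ K r) * x) = (-x)⁻¹ • twoForm x y := by
    intro r
    rw [twoForm_pole hx]
    congr 1
    field_simp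
  have pole' : ∀ r c, twoForm (1 / x) (((y - algebraMap ℂ K r) * x - algebraMap ℂ K c) * x) =
      (-1 : K)⁻¹ • twoForm x y := by
    intro r c
    rw [twoForm_pole' hx, inv_neg, inv_one]
    module
  have e2 : twoForm (1 / x) y = (-(x * x))⁻¹ • twoForm x y := by
    rw [twoForm_inv_left]
    congr 1
    field_simp
  have e3 : twoForm (1 / y) x = ((1 / y)⁻¹ * (1 / y)⁻¹)⁻¹ • twoForm x y := by
    rw [twoForm_inv_left, twoForm_swap (f := x), smul_neg, ← neg_smul]
    congr 1
    field_simp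
  have e4 : twoForm x (1 / (x ^ 2 * y)) = (-(x * x * ((1 / y)⁻¹ * (1 / y)⁻¹)))⁻¹ • twoForm x y := by
    rw [twoForm_inv_right, twoForm_sq_mul, smul_smul]
    congr 1
    field_simp
  have e5 : twoForm x (1 / (x * y)) = (-(x * ((1 / y)⁻¹ * (1 / y)⁻¹)))⁻¹ • twoForm x y := by
    rw [twoForm_inv_right, mul_comm x y, twoForm_mul_right, smul_smul]
    congr 1
    field_simp
  have e6 : twoForm x ((x ^ 2 * y + algebraMap ℂ K d) / x) = x⁻¹⁻¹ • twoForm x y := by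
    rw [twoForm_zero₃ hx, inv_inv]
  have e7 : twoForm x y = (1 : K)⁻¹ • twoForm x y := by rw [inv_one, one_smul]
  have e8 : twoForm x (((x ^ 2 * y + algebraMap ℂ K d) / x - algebraMap ℂ K e) / x) =
      (1 : K)⁻¹ • twoForm x y := by
    rw [twoForm_zero₄ hx, inv_one, one_smul]
  intro i
  fin_cases i
  exacts [pole s, pole (-s), e2, e3, e4, e5, e6, e7, e8, pole' s c, pole' (-s) c']

theorem isOrd_formCoeff {K : Type*} [Field K] {x y : K} {E : Fin 11 → LocalSubring K}
    (hE : ∀ i, IsDiscreteValuationRing (E i).toSubring) (h1 : ∀ i, IsOrd (E i) x (orderX i))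
    (h2 : ∀ i, IsOrd (E i) (1 / y) (orderInvY i)) (h3 : ∀ i, IsOrd (E i) (1 : K) 0) :
    ∀ i, IsOrd (E i) (formCoeff x y i) (formOrder i) := by
  have key : ∀ {i z n}, formCoeff x y i = z → formOrder i = n → IsOrd (E i) z n →
      IsOrd (E i) (formCoeff x y i) (formOrder i) := fun hz hn h => hz ▸ hn ▸ h
  intro i
  fin_cases i
  · exact key rfl (by decide) (h1 0).neg
  · exact key rfl (by decide) (h1 1).neg
  · exact key rfl (by decide) ((h1 2).mul (h1 2)).neg
  · exact key rfl (by decide) ((h2 3).inv.mul (h2 3).inv)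
  · exact key rfl (by decide) (((h1 4).mul (h1 4)).mul ((h2 4).inv.mul (h2 4).inv)).neg
  · exact key rfl (by decide) ((h1 5).mul ((h2 5).inv.mul (h2 5).inv)).neg
  · exact key rfl (by decide) (h1 6).inv
  · exact key rfl (by decide) (h3 7)
  · exact key rfl (by decide) (h3 8)
  · exact key rfl (by decide) (h3 9).neg
  · exact key rfl (by decide) (h3 10).neg

theorem exists_twoForm_eq (h : IsBirationalChart x y) (hs : s ≠ 0) (hd : d ≠ 0) (i : Fin 11) :
    ∃ z : K, twoForm x y = z • twoForm (curveX x y i) (curveY x y s c c' d e i) ∧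
      IsOrd (specialCurve x y s c c' d e i) z (formOrder i) := by
  have hdvr := isDiscreteValuationRing_specialCurve (s := s) (c := c) (c' := c') (d := d) (e := e) h
  refine ⟨formCoeff x y i, ?_, isOrd_formCoeff hdvr (isOrd_specialCurve_left h)
    (isOrd_specialCurve_inv_right h hs hd) (fun j => ?_) i⟩
  swap
  · have := hdvr j
    exact isOrd_zero (one_mem _) (not_vanishes_one _)
  have h0 : formCoeff x y i ≠ 0 := by
    have hx := h.left_ne_zero
    have hy := h.right_ne_zero
    fin_cases i <;> simp [formCoeff, hx, hy]
  rw [twoForm_curve h, smul_smul, mul_inv_cancel₀ h0, one_smul]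

theorem isFormOrd_of_chart {X : Model K} (hX : IsSeparatedModel X) (h : IsBirationalChart f g)
    (hp : origin f g ∈ X) {C : LocalSubring K} (hC : LiesOn (origin f g) C) {z : K} {n : ℤ}
    (hz : twoForm x y = z • twoForm f g) (hn : IsOrd C z n) : IsFormOrd X x y C n :=
  ⟨origin f g, hX.isClosedPoint h hp, hC, _, _, h.maximalIdeal_origin, z, hz, hn⟩

theorem isFormOrd_specialCurve (h : IsBirationalChart x y) (hs : s ≠ 0) (hd : d ≠ 0)
    (i : Fin 11) : IsFormOrd (surface x y s c c' d e) x y (specialCurve x y s c c' d e i)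
      (formOrder i) := by
  obtain ⟨z, h1, h2⟩ := exists_twoForm_eq (c := c) (c' := c') (e := e) h hs hd i
  refine isFormOrd_of_chart (isSeparatedModel_surface h hs hd) ((h.curve i).sub_const _)
    (basePoint_mem h hs hd i) ((h.curve i).liesOn_axis_sub _) (z := z) ?_ h2
  rw [twoForm_sub_const, h1]

theorem isFormOrd_of_isGeneral (h : IsBirationalChart x y) (hs : s ≠ 0) (hd : d ≠ 0)
    {C : LocalSubring K} (hC : C ∈ curves (surface x y s c c' d e)) (hg : IsGeneral C x y) :
    IsFormOrd (surface x y s c c' d e) x y C 0 := by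
  have hdvr := hC.2
  obtain ⟨a, b, hab⟩ := h.exists_liesOn (isLoc_coordRing_of_isGeneral h hs hd hC.1 hg.1 hg.2.2)
  have hc := h.chartPoint a b
  refine isFormOrd_of_chart (isSeparatedModel_surface h hs hd) hc
    (mem_surface_of_plane h hs hd (by rw [← coordRing_chartPoint a b]; exact hc.isLoc_origin)) hab
    (z := 1) ?_ (isOrd_zero (one_mem _) (not_vanishes_one _))
  rw [one_smul, twoForm_sub_const, twoForm_swap (g := x - algebraMap ℂ K a), twoForm_sub_const, ← twoForm_swap]

/-- At each of its closed points the curve is an axis of a chart with that origin, and a coordinate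
is not in the square of the maximal ideal. -/
theorem isSmoothRationalCurve_specialCurve (h : IsBirationalChart x y) (hs : s ≠ 0) (hd : d ≠ 0)
    (i : Fin 11) :
    IsSmoothRationalCurve (surface x y s c c' d e) (specialCurve x y s c c' d e i) := by
  refine ⟨specialCurve_mem_curves h hs hd i, fun p hp hpi => ?_, (h.curve i).residueField_axis⟩
  have key : ∀ {f g : K}, IsBirationalChart f g → p = origin f g →
      specialCurve x y s c c' d e i = axis f g →
      ∃ a ∈ curveIdeal p (specialCurve x y s c c' d e i),
        a ∉ IsLocalRing.maximalIdeal p.toSubring ^ 2 := by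
    rintro f g hfg rfl hC
    exact ⟨_, (mem_curveIdeal hpi).2 (hC ▸ hfg.axis_vanishes_left),
      hfg.left_notMem_maximalIdeal_sq⟩
  rcases closedPoint_cases h hs hd hp with h1 | ⟨j, b, rfl, hb⟩ | ⟨n, rfl⟩
  · exact absurd (h1.of_liesOn hpi) (not_isGeneral_specialCurve h i)
  · obtain rfl := eq_of_liesOn_specialCurve h hs hd hb hp.1 hpi
    exact key ((h.curve i).sub_const b) rfl (axis_sub_const b).symm
  · have hch := h.corner (s := s) (c := c) (c' := c') (d := d) (e := e) n
    rcases eq_of_liesOn_corner h hs hd hpi with rfl | rfl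
    · exact key hch rfl (corner_axis_left h n).symm
    · exact key hch.swap origin_comm (corner_axis_right h n).symm

/-- The components of the anticanonical divisor among the special curves. -/
def componentIndex : Fin 7 → Fin 11 := Fin.castLE (by decide)

theorem componentIndex_injective : Function.Injective componentIndex := Fin.castLE_injective _

/-- The components of the anticanonical divisor. -/
def component (x y : K) (s c c' d e : ℂ) (i : Fin 7) : LocalSubring K :=
  specialCurve x y s c c' d e (componentIndex i)

theorem isAnticanonicalConfiguration_surface (h : IsBirationalChart x y) (hs : s ≠ 0)
    (hd : d ≠ 0) : IsAnticanonicalConfiguration (surface x y s c c' d e) x y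
      (component x y s c c' d e) nullRootD6 matrixD6 where
  injective := (specialCurve_injective h hs hd).comp componentIndex_injective
  smoothRational i := isSmoothRationalCurve_specialCurve h hs hd _
  selfInter i := by
    have h1 : matrixD6 i i = -2 := by revert i; decide
    rw [h1]
    refine selfInter_specialCurve h hs hd ?_
    revert i; decide
  inter_eq i j hij := by
    refine (inter_specialCurve h hs hd fun h1 => hij (componentIndex_injective h1)).trans ?_
    have : ∀ i j : Fin 7, i ≠ j → cornerCount (componentIndex i) (componentIndex j) = matrixD6 i j := by
      intro i j
      fin_cases i <;> fin_cases j <;> decide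
    exact this i j hij
  order_component i := by
    have h1 : -nullRootD6 i = formOrder (componentIndex i) := by revert i; decide
    rw [h1]
    exact isFormOrd_specialCurve h hs hd _
  order_other C hC hr := by
    rcases eq_specialCurve_or_isGeneral h hs hd hC with ⟨j, rfl⟩ | hg
    · have h1 : (∃ i : Fin 7, componentIndex i = j) ∨ formOrder j = 0 := by
        clear * -
        revert j; decide
      rcases h1 with ⟨i, rfl⟩ | h1
      · exact absurd ⟨i, rfl⟩ hr
      · rw [← h1]
        exact isFormOrd_specialCurve h hs hd _
    · exact isFormOrd_of_isGeneral h hs hd hC hg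

end Forms
end InceXII

namespace InceXII

/-! ### The complement of the anticanonical divisor -/

section Orders

variable {K : Type*} [Field K] {C : LocalSubring K} {z : K} {n : ℤ}

theorem IsOrd.mem (h : IsOrd C z n) (hn : 0 ≤ n) : z ∈ C.toSubring := by
  obtain ⟨e, w, hw, rfl⟩ := h
  obtain ⟨k, rfl⟩ := Int.eq_ofNat_of_zero_le hn
  rw [zpow_natCast]
  exact mul_mem (e : C.toSubring).2 (pow_mem w.2 k)

theorem IsOrd.nonneg [IsDiscreteValuationRing C.toSubring] (h : IsOrd C z n)
    (hz : z ∈ C.toSubring) : 0 ≤ n := by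
  by_contra hn
  have h1 := h.inv
  have h2 := (h1.pos_iff (h1.mem (by omega))).2 (by omega)
  by_cases h0 : z = 0
  · exact hn ((isOrd_zero (one_mem _) (not_vanishes_one C)).unique (by
      obtain ⟨e, w, hw, hz⟩ := h
      have hw0 : (w : K) ≠ 0 := by simpa using hw.ne_zero
      have he : ((e : C.toSubring) : K) ≠ 0 := by simp
      exact absurd (hz.symm.trans h0) (mul_ne_zero he (zpow_ne_zero _ hw0)))).le
  · exact inv_notMem_of_vanishes h2 (inv_ne_zero h0) (by rwa [inv_inv])

end Orders

noncomputable section Complement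

variable {K : Type*} [Field K] [Algebra ℂ K] {f g x y : K} {s c c' d e : ℂ}

theorem IsBirationalChart.liesOn_axis_of_vanishes (h : IsBirationalChart f g) {S : LocalSubring K}
    (hS : IsLoc (coordRing f g) S) (hf : Vanishes S f) : LiesOn S (axis f g) := by
  rcases h.eq_axis_or_origin hS hf with rfl | ⟨b, rfl⟩
  · exact le_rfl
  · exact h.liesOn_axis_sub b

theorem isLoc_of_isLoc_pole (h : IsBirationalChart x y) {S : LocalSubring K} (r c : ℂ)
    (hS : IsLoc (coordRing (1 / x) (((y - algebraMap ℂ K r) * x - algebraMap ℂ K c) * x)) S)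
    (hv : ¬ Vanishes S (1 / x)) : IsLoc (coordRing x y) S := by
  have hx := h.left_ne_zero
  have h1 := hS.mul_right hv
  rw [mul_one_div, mul_div_cancel_right₀ _ hx, coordRing_sub_const] at h1
  have h2 := h1.mul_right hv
  rw [mul_one_div, mul_div_cancel_right₀ _ hx, coordRing_sub_const] at h2
  have h3 := h2.inv_left hv
  rwa [one_div_one_div] at h3

theorem coordRing_add_const (c : ℂ) : coordRing f (g + algebraMap ℂ K c) = coordRing f g := by
  rw [← sub_neg_eq_add, ← map_neg, coordRing_sub_const]

theorem isLoc_of_isLoc_zero (h : IsBirationalChart x y) {S : LocalSubring K} (d e : ℂ)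
    (hS : IsLoc (coordRing x (((x ^ 2 * y + algebraMap ℂ K d) / x - algebraMap ℂ K e) / x)) S)
    (hv : ¬ Vanishes S x) : IsLoc (coordRing x y) S := by
  have hx := h.left_ne_zero
  have h1 := hS.mul_right hv
  rw [div_mul_cancel₀ _ hx, coordRing_sub_const] at h1
  have h2 := h1.mul_right hv
  rw [div_mul_cancel₀ _ hx, coordRing_add_const] at h2
  have h3 := (h2.div_right hv).div_right hv
  rwa [div_div, ← pow_two, mul_div_cancel_left₀ _ (pow_ne_zero 2 hx)] at h3

theorem mem_exceptional_pole'_of_vanishes (h : IsBirationalChart x y) {S : LocalSubring K} {r c : ℂ}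
    (hS : IsLoc (coordRing (1 / x) (((y - algebraMap ℂ K r) * x - algebraMap ℂ K c) * x)) S)
    (hv : Vanishes S (1 / x)) : S ∈ exceptional (poleCenter' x y r c) := by
  refine (h.pole' r c).mem_exceptional.2 (Or.inl ⟨?_, hv⟩)
  rwa [div_div_eq_mul_div, div_one]

theorem mem_exceptional_zero₄_of_vanishes (h : IsBirationalChart x y) {S : LocalSubring K}
    (hS : IsLoc (coordRing x (((x ^ 2 * y + algebraMap ℂ K d) / x - algebraMap ℂ K e) / x)) S)
    (hv : Vanishes S x) : S ∈ exceptional (zeroCenter₄ x y d e) :=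
  (h.zero₄ d e).mem_exceptional.2 (Or.inl ⟨hS, hv⟩)

/-- The special curves on which the coordinates of one of the affine planes of the complement are
regular. -/
theorem eq_of_mem_specialCurve (h : IsBirationalChart x y) (hs : s ≠ 0) (hd : d ≠ 0) {i j : Fin 11}
    (hj : j = 7 ∨ j = 8 ∨ j = 9 ∨ j = 10)
    (h1 : curveX x y j ∈ (specialCurve x y s c c' d e i).toSubring)
    (h2 : curveY x y s c c' d e j ∈ (specialCurve x y s c c' d e i).toSubring) :
    i ∉ Set.range componentIndex := by
  have hx := h.left_ne_zero
  have hc := (h.curve (s := s) (c := c) (c' := c') (d := d) (e := e) i).axis_algebraMap_mem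
  change ∀ c₁, algebraMap ℂ K c₁ ∈ (specialCurve x y s c c' d e i).toSubring at hc
  have hX := isOrd_specialCurve_left (s := s) (c := c) (c' := c') (d := d) (e := e) h i
  have hY := isOrd_specialCurve_inv_right (c := c) (c' := c') (e := e) h hs hd i
  have hi7 : ∀ i : Fin 11, i ∈ Set.range componentIndex ↔ (i : ℕ) < 7 := by
    unfold componentIndex
    simp only [Set.mem_range]
    decide
  rw [hi7]
  intro hi
  have hdvr := isDiscreteValuationRing_specialCurve (s := s) (c := c) (c' := c') (d := d) (e := e) h i
  have hy : y ∈ (specialCurve x y s c c' d e i).toSubring → orderInvY i ≤ 0 := fun h3 => by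
    have h4 := hY.inv
    rw [one_div, inv_inv] at h4
    have := h4.nonneg h3
    omega
  have t1 : ∀ i : Fin 11, (i : ℕ) < 7 → orderInvY i ≤ 0 → 0 ≤ orderX i → False := by decide
  have t2 : ∀ i : Fin 11, (i : ℕ) < 7 → 0 ≤ orderX i → i = 3 ∨ i = 4 ∨ i = 5 ∨ i = 6 := by decide
  have t3 : ∀ i : Fin 11, (i : ℕ) < 7 → orderInvY i ≤ 0 → 0 ≤ -orderX i →
      i = 0 ∨ i = 1 ∨ i = 2 := by decide
  -- Regularity of the coordinates at a component forces `y` and `1/x` to be regular there, which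
  -- leaves the curves 0, 1, 2. On these `1/x` vanishes, hence so do `(y - r) x - k` and `y - r`,
  -- and none of the three curves satisfies both.
  have pole : ∀ r r' k, r' ≠ r → 1 / x ∈ (specialCurve x y s c c' d e i).toSubring →
      ((y - algebraMap ℂ K r) * x - algebraMap ℂ K k) * x ∈
        (specialCurve x y s c c' d e i).toSubring →
      (i = 0 ∨ i = 1 ∨ i = 2) ∧
      Vanishes (specialCurve x y s c c' d e i) ((y - algebraMap ℂ K r) * x - algebraMap ℂ K k) ∧
      Vanishes (specialCurve x y s c c' d e i) (y - algebraMap ℂ K r) ∧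
      ¬ Vanishes (specialCurve x y s c c' d e i) (y - algebraMap ℂ K r') := by
    intro r r' k hr h1 h2
    have e1 : ((y - algebraMap ℂ K r) * x - algebraMap ℂ K k) * x * (1 / x) =
        (y - algebraMap ℂ K r) * x - algebraMap ℂ K k := by
      rw [mul_one_div, mul_div_cancel_right₀ _ hx]
    have e2 : ((y - algebraMap ℂ K r) * x - algebraMap ℂ K k + algebraMap ℂ K k) * (1 / x) =
        y - algebraMap ℂ K r := by
      rw [sub_add_cancel, mul_one_div, mul_div_cancel_right₀ _ hx]
    have h3 := e1 ▸ mul_mem h2 h1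
    have h4 := e2 ▸ mul_mem (add_mem h3 (hc k)) h1
    have h5 := hy (by simpa using add_mem h4 (hc r))
    have h6 : i = 0 ∨ i = 1 ∨ i = 2 := by
      have h7 : 0 ≤ -orderX i := by
        have := hX.inv
        rw [← one_div] at this
        exact this.nonneg h1
      exact t3 i hi h5 h7
    have h7 : Vanishes (specialCurve x y s c c' d e i) (1 / x) := by
      rw [one_div]
      refine (hX.inv.pos_iff (by rwa [← one_div])).2 ?_
      rcases h6 with rfl | rfl | rfl <;> decide
    have h8 := e1 ▸ h7.mul_left h2
    have h9 := e2 ▸ h7.mul_left (add_mem h8.1 (hc k))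
    exact ⟨h6, h8, h9, fun h10 => hr (eq_of_vanishes_sub hc h10 h9)⟩
  rcases hj with rfl | rfl | rfl | rfl
  · exact t1 i hi (hy h2) (hX.nonneg h1)
  · have h1' : x ∈ (specialCurve x y s c c' d e i).toSubring := h1
    have h3 := mul_mem h2 h1'
    simp only [curveY] at h3
    rw [div_mul_cancel₀ _ hx] at h3
    have h4 := mul_mem (add_mem h3 (hc e)) h1'
    rw [sub_add_cancel, div_mul_cancel₀ _ hx] at h4
    have h5 := t2 i hi (hX.nonneg h1)
    -- On the curve 3 the function `x` is a unit, so `y` would be regular. On the curves 4, 5, 6 it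
    -- vanishes, so `x² y + d` and `(x² y + d) / x - e` vanish; the first fails on 4 and 5, the
    -- second on 6.
    by_cases h6 : i = 3
    · subst h6
      have h7 := inv_mem_of_not_vanishes h1' ((hX.pos_iff h1').not.2 (by decide))
      have h8 := hy (by
        have := mul_mem (sub_mem h4 (hc d)) (pow_mem h7 2)
        rw [add_sub_cancel_right] at this
        convert this using 1
        field_simp)
      revert h8; decide
    · have h7 : Vanishes (specialCurve x y s c c' d e i) x := (hX.pos_iff h1').2 (by
        rcases h5 with rfl | rfl | rfl | rfl
        · exact absurd rfl h6
        all_goals decide)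
      have h8 := h7.mul_left h2
      simp only [curveY] at h8
      rw [div_mul_cancel₀ _ hx] at h8
      have h9 := h7.mul_left (add_mem h3 (hc e))
      rw [sub_add_cancel, div_mul_cancel₀ _ hx] at h9
      rcases h5 with rfl | rfl | rfl | rfl
      · exact h6 rfl
      · exact not_vanishes_sq_mul_add_axis h d h9
      · have h10 := (hX.mul hX).mul hY.inv
        rw [one_div, inv_inv, ← pow_two] at h10
        have h11 := (h10.pos_iff (h10.mem (by decide))).2 (by decide)
        have h12 := h9.sub h11
        rw [add_sub_cancel_left] at h12
        exact not_vanishes_algebraMap hc hd h12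
      · exact (vanishes_zero₃ h d e).2 h8
  · obtain ⟨h3, h4, h5, h6⟩ := pole s (-s) c (fun h3 => hs (self_eq_neg.1 h3.symm)) h1 h2
    rcases h3 with rfl | rfl | rfl
    · exact (vanishes_pole h s c).2 h4
    · exact h6 (vanishes_pole h (-s) c).1
    · exact h.inv_left.axis_not_vanishes_sub s h5
  · obtain ⟨h3, h4, h5, h6⟩ := pole (-s) s c' (fun h3 => hs (self_eq_neg.1 h3)) h1 h2
    rcases h3 with rfl | rfl | rfl
    · exact h6 (vanishes_pole h s c).1
    · exact (vanishes_pole h (-s) c').2 h4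
    · exact h.inv_left.axis_not_vanishes_sub (-s) h5

theorem mem_surface_of_isLoc_curve (h : IsBirationalChart x y) (hs : s ≠ 0) (hd : d ≠ 0)
    {S : LocalSubring K} {j : Fin 11} (hj : j = 7 ∨ j = 8 ∨ j = 9 ∨ j = 10)
    (hS : IsLoc (coordRing (curveX x y j) (curveY x y s c c' d e j)) S) :
    S ∈ surface x y s c c' d e := by
  have plane := mem_surface_of_plane (S := S) (c := c) (c' := c') (e := e) h hs hd
  rcases hj with rfl | rfl | rfl | rfl
  · exact plane hS
  · by_cases hv : Vanishes S x
    · exact mem_surface_zero₄ h hs hd (mem_exceptional_zero₄_of_vanishes h hS hv)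
    · exact plane (isLoc_of_isLoc_zero h d e hS hv)
  · by_cases hv : Vanishes S (1 / x)
    · exact mem_surface_pole₁' h hs hd (mem_exceptional_pole'_of_vanishes h hS hv)
    · exact plane (isLoc_of_isLoc_pole h s c hS hv)
  · by_cases hv : Vanishes S (1 / x)
    · exact mem_surface_pole₂' h hs hd (mem_exceptional_pole'_of_vanishes h hS hv)
    · exact plane (isLoc_of_isLoc_pole h (-s) c' hS hv)

/-- An intermediate exceptional curve is a removed component, so all points above its center
disappear. After the last blow-up of a chain the removed component is the strict transform of `f =
0`, and what is left lies in the plane `(f, g / f)`. -/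
theorem IsBirationalChart.exceptional_cases (h : IsBirationalChart f g) {S : LocalSubring K}
    (hS : S ∈ exceptional (origin f g)) :
    LiesOn S (axis f (g / f)) ∧ (IsLoc (coordRing f (g / f)) S ∨ LiesOn S (axis f g)) := by
  rcases h.mem_exceptional_iff.1 hS with rfl | ⟨b, rfl⟩ | rfl
  · exact ⟨le_rfl, Or.inl h.div_right.isLoc_axis⟩
  · refine ⟨h.div_right.liesOn_axis_sub b, Or.inl ?_⟩
    rw [← coordRing_sub_const b]
    exact (h.div_right.sub_const b).isLoc_origin
  · refine ⟨?_, Or.inr ?_⟩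
    · rw [← h.axis_exceptional]
      exact h.div_left.liesOn_axis'
    · rw [← h.axis_div]
      exact h.div_left.liesOn_axis

/-- The complement of the anticanonical divisor is covered by four affine planes. -/
theorem mem_complement_surface (h : IsBirationalChart x y) (hs : s ≠ 0) (hd : d ≠ 0)
    {S : LocalSubring K} : S ∈ complement (surface x y s c c' d e) (component x y s c c' d e) ↔
      ∃ j : Fin 11, (j = 7 ∨ j = 8 ∨ j = 9 ∨ j = 10) ∧
        IsLoc (coordRing (curveX x y j) (curveY x y s c c' d e j)) S := by
  constructor
  · rintro ⟨hS, hD⟩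
    have nD : ∀ i : Fin 11, (i : ℕ) < 7 → ¬ LiesOn S (specialCurve x y s c c' d e i) :=
      fun i hi => hD ⟨i, hi⟩
    rcases (mem_surface h hs hd).1 hS with ⟨h1, -⟩ | ⟨h1, -⟩ | h1 | ⟨h1, -⟩ | h1 | ⟨h1, -⟩ |
      ⟨h1, -⟩ | ⟨h1, -⟩ | h1
    · rcases mem_quadric_cases h h1 with h5 | ⟨h5, h6⟩ | ⟨h5, h6⟩ | h5
      · exact ⟨7, by decide, h5⟩
      · exact absurd (h.inv_left.liesOn_axis_of_vanishes h5 h6) (nD 2 (by decide))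
      · exact absurd (h.inv_right.swap.liesOn_axis_of_vanishes h5 h6) (nD 3 (by decide))
      · exact absurd (h5 ▸ corner_liesOn_left (s := s) (c := c) (c' := c') (d := d) (e := e) h 0)
          (nD 2 (by decide))
    · have := ((h.pole s).exceptional_cases h1).1
      rw [div_div_eq_mul_div, div_one] at this
      exact absurd this (nD 0 (by decide))
    · have := ((h.pole' s c).exceptional_cases h1).2
      rw [div_div_eq_mul_div, div_one, axis_sub_const] at this
      exact ⟨9, by decide, this.resolve_right (nD 0 (by decide))⟩
    · have := ((h.pole (-s)).exceptional_cases h1).1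
      rw [div_div_eq_mul_div, div_one] at this
      exact absurd this (nD 1 (by decide))
    · have := ((h.pole' (-s) c').exceptional_cases h1).2
      rw [div_div_eq_mul_div, div_one, axis_sub_const] at this
      exact ⟨10, by decide, this.resolve_right (nD 1 (by decide))⟩
    · have := (h.inv_right.exceptional_cases h1).1
      rw [div_div, mul_comm] at this
      exact absurd this (nD 5 (by decide))
    · have := (h.zero₂.exceptional_cases h1).1
      rw [div_div, mul_comm, ← mul_assoc, ← pow_two] at this
      exact absurd this (nD 4 (by decide))
    · exact absurd ((h.zero₃ d).exceptional_cases h1).1 (nD 6 (by decide))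
    · have := ((h.zero₄ d e).exceptional_cases h1).2
      rw [axis_sub_const] at this
      exact ⟨8, by decide, this.resolve_right (nD 6 (by decide))⟩
  · rintro ⟨j, hj, hS⟩
    refine ⟨mem_surface_of_isLoc_curve h hs hd hj hS, fun i hi => ?_⟩
    exact eq_of_mem_specialCurve h hs hd hj (hi (hS.1 left_mem_coordRing))
      (hi (hS.1 right_mem_coordRing)) ⟨i, rfl⟩

/-- The line at infinity is the only curve that is contracted. -/
theorem curves_blowUp_diff (h : IsBirationalChart x y) (hs : s ≠ 0) (hd : d ≠ 0) :
    curves (blowUp (surface x y s c c' d e) (origin (1 / x) (1 / y))) \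
      curves (surface x y s c c' d e) = {axis (1 / x) (y / x)} := by
  have hX := isSeparatedModel_surface (c := c) (c' := c') (e := e) h hs hd
  have hc := h.inv_left.inv_right
  have hl : axis (1 / x) (y / x) = axis (1 / x) (1 / y / (1 / x)) := by
    rw [← h.projective.axis_inv, one_div_div, div_div_eq_mul_div, div_one,
      one_div_mul_eq_div]
  have hcor := corner_mem_surface (c := c) (c' := c') (e := e) h hs hd
  have hexc : axis (1 / x) (y / x) ∈ exceptional (origin (1 / x) (1 / y)) :=
    hc.mem_exceptional_iff.2 (Or.inl hl)
  have hdvr : IsDiscreteValuationRing (axis (1 / x) (y / x)).toSubring :=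
    h.projective.isDiscreteValuationRing_axis
  ext C
  rw [Set.mem_singleton_iff]
  constructor
  · rintro ⟨⟨h1, h2⟩, h3⟩
    rcases mem_blowUp.1 h1 with ⟨h4, -⟩ | h4
    · exact absurd ⟨h4, h2⟩ h3
    · rcases hc.mem_exceptional_iff.1 h4 with h5 | ⟨b, rfl⟩ | rfl
      · exact h5.trans hl.symm
      · exact absurd h2 (hc.div_right.sub_const b).not_isDiscreteValuationRing_origin
      · exact absurd h2 hc.div_left.not_isDiscreteValuationRing_origin
  · rintro rfl
    refine ⟨⟨mem_blowUp.2 (Or.inr hexc), hdvr⟩, fun h1 => ?_⟩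
    -- If the line were a curve of the surface, then, as it dominates the corner, it would equal the
    -- corner, which is not a discrete valuation ring.
    have := hX.eq_of_le _ hcor _ h1.1 _ (le_of_mem_exceptional hexc) le_rfl
    exact hc.not_isDiscreteValuationRing_origin (this ▸ hdvr)

end Complement
end InceXII

namespace InceXII

/-! ### The field `ℂ(x, y)` -/

noncomputable section RationalFunctions

open MvPolynomial

theorem isBirationalChart_x_y : IsBirationalChart x y := by
  have hinj : Function.Injective (algebraMap (MvPolynomial (Fin 2) ℂ) K) :=
    IsFractionRing.injective _ _
  have hxy : ∀ i, algebraMap (MvPolynomial (Fin 2) ℂ) K (X i) = ![x, y] i := by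
    intro i; fin_cases i <;> rfl
  refine ⟨?_, top_le_iff.1 fun z _ => ?_⟩
  · have h1 := (algebraicIndependent_X (Fin 2) ℂ).map' (f := IsScalarTower.toAlgHom ℂ
      (MvPolynomial (Fin 2) ℂ) K) hinj
    have h2 : ![x, y] = IsScalarTower.toAlgHom ℂ (MvPolynomial (Fin 2) ℂ) K ∘ X :=
      funext fun i => (hxy i).symm
    rw [h2]
    exact h1
  · have key : ∀ p : MvPolynomial (Fin 2) ℂ,
        algebraMap (MvPolynomial (Fin 2) ℂ) K p ∈ IntermediateField.adjoin ℂ {x, y} := by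
      intro p
      induction p using MvPolynomial.induction_on with
      | C c =>
        rw [show algebraMap (MvPolynomial (Fin 2) ℂ) K (C c) = algebraMap ℂ K c from
          (IsScalarTower.algebraMap_apply ℂ (MvPolynomial (Fin 2) ℂ) K c).symm]
        exact IntermediateField.algebraMap_mem _ c
      | add p q hp hq => rw [map_add]; exact add_mem hp hq
      | mul_X p i hp =>
        rw [map_mul, hxy]
        refine mul_mem hp ?_
        fin_cases i
        · exact left_mem_adjoin x y
        · exact right_mem_adjoin x y
    obtain ⟨a, b, -, rfl⟩ := IsFractionRing.div_surjective (A := MvPolynomial (Fin 2) ℂ) z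
    exact div_mem (key a) (key b)

/-- A derivation of the field of rational functions with given values on the variables. -/
theorem exists_derivation (a b : K) : ∃ v : Derivation ℂ K K, v x = a ∧ v y = b := by
  let d : Derivation ℂ (MvPolynomial (Fin 2) ℂ) K := mkDerivation ℂ ![a, b]
  -- A localization is formally étale, so the differentials of the fraction field are the base
  -- change of those of the polynomial ring and a derivation extends.
  have := Algebra.FormallyEtale.of_isLocalization (R := MvPolynomial (Fin 2) ℂ) (Rₘ := K)
    (nonZeroDivisors (MvPolynomial (Fin 2) ℂ))
  have hb := KaehlerDifferential.isBaseChange_of_formallyEtale ℂ (MvPolynomial (Fin 2) ℂ) K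
  let v : Derivation ℂ K K := (hb.lift d.liftKaehlerDifferential).compDer (KaehlerDifferential.D ℂ K)
  have hv : ∀ i, v (algebraMap (MvPolynomial (Fin 2) ℂ) K (X i)) = ![a, b] i := by
    intro i
    have h1 := hb.lift_eq d.liftKaehlerDifferential
      (KaehlerDifferential.D ℂ (MvPolynomial (Fin 2) ℂ) (X i))
    rw [KaehlerDifferential.map_D, Derivation.liftKaehlerDifferential_comp_D] at h1
    exact h1.trans (mkDerivation_X ..)
  exact ⟨v, hv 0, hv 1⟩

/-- The Hamiltonian in the charts at `x = ∞`. -/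
def hamiltonianPole (r c g δ : ℂ) : MvPolynomial (Fin 2) ℂ :=
  C (1 / 2) * (C c - X 1 * X 0) ^ 2 - C r * X 1 - C g * (C c - X 1 * X 0) +
    C (δ * r) + C δ * (C c - X 1 * X 0) * X 0

/-- The Hamiltonian in the chart at `x = 0`. -/
def hamiltonianZero (α β g δ : ℂ) : MvPolynomial (Fin 2) ℂ :=
  C (1 / 2) * X 0 ^ 2 * X 1 ^ 2 + C g * X 0 * X 1 - C δ * X 1 - C (α / 2) * X 0 ^ 2 - C β * X 0

/-- The Hamiltonians in the four charts. -/
def hamiltonians (α β γ δ s : ℂ) : Fin 4 → MvPolynomial (Fin 2) ℂ :=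
  ![hamiltonian α β γ δ, hamiltonianPole s ((s * γ + β * δ) / (s * δ)) (γ / δ) δ,
    hamiltonianPole (-s) ((s * γ - β * δ) / (s * δ)) (γ / δ) δ, hamiltonianZero α β (γ / δ) δ]

/-- With `u = (w - r) z` the second coordinate `Y` satisfies `u = c - Y / z`. The terms in `z²`
cancel as the coefficient is `r² / 2`, and `r u z` is `r c z - r Y`; the remaining multiple of `z`
is `r c - g r - β`, which is zero by the relation `hc`. -/
theorem aeval_hamiltonianPole {r c g δ β : ℂ} (hc : c * r = g * r + β) {z w : K} (hz : z ≠ 0) :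
    aeval ![1 / z, -(((w - const r) * z - const c) * z)] (hamiltonianPole r c g δ) =
      const (1 / 2) * z ^ 2 * w ^ 2 - const (r ^ 2 / 2) * z ^ 2 - const g * z * w + const δ * w -
        const β * z := by
  have hb : const β = const c * const r - const g * const r := by
    rw [← map_mul, ← map_mul, ← map_sub, hc, add_sub_cancel_left]
  simp only [hamiltonianPole, map_add, map_sub, map_mul, map_pow, aeval_C, aeval_X,
    Matrix.cons_val_zero, Matrix.cons_val_one, hb, map_div₀, map_one, map_ofNat]
  have h2 : (2 : K) ≠ 0 := two_ne_zero
  field_simp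
  ring

/-- The shift by `2 g / z - 2 δ / z²` is chosen so that the Hamiltonian keeps its form with `g` and
`δ` replaced by `-g` and `-δ`; the terms in `1 / z` and `1 / z²` cancel. -/
theorem aeval_hamiltonianZero {α β g δ : ℂ} {z w : K} (hz : z ≠ 0) :
    aeval ![z, w - const (2 * g) / z + const (2 * δ) / z ^ 2] (hamiltonianZero α β g δ) =
      const (1 / 2) * z ^ 2 * w ^ 2 - const (α / 2) * z ^ 2 - const g * z * w + const δ * w -
        const β * z := by
  simp only [hamiltonianZero, map_add, map_sub, map_mul, map_pow, aeval_C, aeval_X,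
    Matrix.cons_val_zero, Matrix.cons_val_one, map_div₀, map_one, map_ofNat]
  have h2 : (2 : K) ≠ 0 := two_ne_zero
  field_simp
  ring

theorem aeval_hamiltonian {α β γ δ : ℂ} : aeval ![x, y] (hamiltonian α β γ δ) =
    const (1 / 2) * x ^ 2 * y ^ 2 - const (α / 2) * x ^ 2 - const (γ / δ) * x * y + const δ * y -
      const β * x := by
  simp [hamiltonian]

theorem pole_relation {β γ δ s : ℂ} (hs : s ≠ 0) (hδ : δ ≠ 0) :
    (s * γ + β * δ) / (s * δ) * s = γ / δ * s + β := by
  field_simp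

theorem pole_relation' {β γ δ s : ℂ} (hs : s ≠ 0) (hδ : δ ≠ 0) :
    (s * γ - β * δ) / (s * δ) * -s = γ / δ * -s + β := by
  field_simp
  ring

theorem chartY_two (s β γ δ : ℂ) : chartY s β γ δ 2 =
    -(((y - const (-s)) * x - const ((s * γ - β * δ) / (s * δ))) * x) := by
  rw [show const (-s) = -const s from map_neg _ s, sub_neg_eq_add]; rfl

theorem chartY_three (s β γ δ : ℂ) : chartY s β γ δ 3 =
    y - const (2 * (γ / δ)) / x + const (2 * δ) / x ^ 2 := by
  rw [← mul_div_assoc]; rfl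

theorem aeval_hamiltonians {α β γ δ s : ℂ} (hs0 : s ≠ 0) (hδ : δ ≠ 0) (hs : s ^ 2 = α) :
    ∀ j, aeval ![chartX j, chartY s β γ δ j] (hamiltonians α β γ δ s j) =
      aeval ![x, y] (hamiltonian α β γ δ) := by
  have hx := isBirationalChart_x_y.left_ne_zero
  intro j
  fin_cases j
  · rfl
  · refine (aeval_hamiltonianPole (pole_relation hs0 hδ) hx).trans ?_
    rw [aeval_hamiltonian, hs]
  · refine Eq.trans ?_ ((aeval_hamiltonianPole (w := y) (δ := δ)
      (pole_relation' (β := β) (γ := γ) hs0 hδ) hx).trans ?_)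
    · change aeval ![_, chartY s β γ δ 2] _ = _
      rw [chartY_two]; rfl
    · rw [aeval_hamiltonian, neg_sq, hs]
  · refine Eq.trans ?_ ((aeval_hamiltonianZero (w := y) (α := α) (β := β)
      (g := γ / δ) (δ := δ) hx).trans ?_)
    · change aeval ![_, chartY s β γ δ 3] _ = _
      rw [chartY_three]; rfl
    · rw [aeval_hamiltonian]

/-! ### The Hamiltonian derivation in the four charts -/

section VectorField

variable {v : Derivation ℂ K K} {α β γ δ g s r c : ℂ}

theorem derivation_const (v : Derivation ℂ K K) (c : ℂ) : v (const c) = 0 := v.map_algebraMap c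

theorem derivation_chart_zero (hx : v x = x ^ 2 * y - const (γ / δ) * x + const δ)
    (hy : v y = -(x * y ^ 2) + const α * x + const (γ / δ) * y + const β) :
    v x = aeval ![x, y] (pderiv 1 (hamiltonian α β γ δ)) ∧
      v y = -aeval ![x, y] (pderiv 0 (hamiltonian α β γ δ)) := by
  have h2 : algebraMap ℂ K 2 = 2 := map_ofNat _ 2
  rw [hx, hy]
  constructor
  · simp [hamiltonian, Derivation.leibniz, Derivation.leibniz_pow, pderiv_X, h2]
    field_simp
  · simp [hamiltonian, Derivation.leibniz, Derivation.leibniz_pow, pderiv_X, h2]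
    field_simp
    ring

theorem derivation_chart_pole (hc : c * r = g * r + β)
    (hx : v x = x ^ 2 * y - const g * x + const δ)
    (hy : v y = -(x * y ^ 2) + const (r ^ 2) * x + const g * y + const β) :
    v (1 / x) = aeval ![1 / x, -(((y - const r) * x - const c) * x)]
        (pderiv 1 (hamiltonianPole r c g δ)) ∧
      v (-(((y - const r) * x - const c) * x)) =
        -aeval ![1 / x, -(((y - const r) * x - const c) * x)]
          (pderiv 0 (hamiltonianPole r c g δ)) := by
  have h2 : algebraMap ℂ K 2 = 2 := map_ofNat _ 2
  have hx0 := isBirationalChart_x_y.left_ne_zero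
  have hb : const β = const c * const r - const g * const r := by
    rw [← map_mul, ← map_mul, ← map_sub, hc, add_sub_cancel_left]
  rw [hb] at hy
  constructor
  · simp only [hamiltonianPole, one_div, Derivation.leibniz_inv, hx]
    simp [Derivation.leibniz, Derivation.leibniz_pow, pderiv_X, h2]
    field_simp
    ring
  · simp only [map_neg, Derivation.leibniz, map_sub, hx, hy, derivation_const, hamiltonianPole]
    simp [Derivation.leibniz, Derivation.leibniz_pow, pderiv_X, h2]
    field_simp
    ring

theorem derivation_chart_three (hx : v x = x ^ 2 * y - const g * x + const δ)
    (hy : v y = -(x * y ^ 2) + const α * x + const g * y + const β) :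
    v x = aeval ![x, y - const (2 * g) / x + const (2 * δ) / x ^ 2]
        (pderiv 1 (hamiltonianZero α β g δ)) ∧
      v (y - const (2 * g) / x + const (2 * δ) / x ^ 2) =
        -aeval ![x, y - const (2 * g) / x + const (2 * δ) / x ^ 2]
          (pderiv 0 (hamiltonianZero α β g δ)) := by
  have h2 : algebraMap ℂ K 2 = 2 := map_ofNat _ 2
  have hx0 := isBirationalChart_x_y.left_ne_zero
  constructor
  · rw [hx]
    simp [hamiltonianZero, Derivation.leibniz, Derivation.leibniz_pow, pderiv_X, h2]
    field_simp
    ring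
  · simp only [map_sub, map_add, Derivation.leibniz_div, Derivation.leibniz_pow, derivation_const,
      hx, hy]
    simp [hamiltonianZero, Derivation.leibniz, Derivation.leibniz_pow, pderiv_X, h2]
    field_simp
    ring

end VectorField

theorem derivation_charts {v : Derivation ℂ K K} {α β γ δ s : ℂ} (hs0 : s ≠ 0) (hδ : δ ≠ 0)
    (hs : s ^ 2 = α) (hx : v x = x ^ 2 * y - const (γ / δ) * x + const δ)
    (hy : v y = -(x * y ^ 2) + const α * x + const (γ / δ) * y + const β) :
    ∀ j, v (chartX j) = aeval ![chartX j, chartY s β γ δ j]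
        (pderiv 1 (hamiltonians α β γ δ s j)) ∧
      v (chartY s β γ δ j) = - aeval ![chartX j, chartY s β γ δ j]
        (pderiv 0 (hamiltonians α β γ δ s j)) := by
  intro j
  fin_cases j
  · exact derivation_chart_zero hx hy
  · exact derivation_chart_pole (pole_relation hs0 hδ) hx (hs ▸ hy)
  · have h := derivation_chart_pole (v := v) (pole_relation' (β := β) (γ := γ) hs0 hδ) hx
      (by rw [neg_sq, hs]; exact hy)
    rw [← chartY_two] at h
    exact h
  · have h := derivation_chart_three hx hy
    rw [← chartY_three] at h
    exact h

/-! ### The surface and the four charts -/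

theorem coordRing_neg {F : Type*} [Field F] [Algebra ℂ F] (f g : F) :
    coordRing f (-g) = coordRing f g :=
  le_antisymm
    (coordRing_le algebraMap_mem_coordRing left_mem_coordRing (neg_mem right_mem_coordRing))
    (coordRing_le algebraMap_mem_coordRing left_mem_coordRing (by
      simpa using neg_mem (right_mem_coordRing (f := f) (g := -g))))

theorem IsBirationalChart.neg_right {F : Type*} [Field F] [Algebra ℂ F] {f g : F}
    (h : IsBirationalChart f g) : IsBirationalChart f (-g) :=
  h.of_mem (left_mem_adjoin _ _) (by simpa using neg_mem (right_mem_adjoin f (-g)))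

variable (s β γ δ : ℂ)

/-- The function `y₃` in terms of the last blow-up. -/
theorem chartY_three' : chartY s β γ δ 3 =
    ((x ^ 2 * y + const (2 * δ)) / x - const (2 * γ / δ)) / x := by
  have hx := isBirationalChart_x_y.left_ne_zero
  change y - const (2 * γ / δ) / x + const (2 * δ) / x ^ 2 = _
  generalize const (2 * γ / δ) = e
  generalize const (2 * δ) = d
  field_simp
  ring

/-- The surface `𝒳`. -/
def spaceModel : Model K :=
  surface x y s ((s * γ + β * δ) / (s * δ)) ((s * γ - β * δ) / (s * δ)) (2 * δ) (2 * γ / δ)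

/-- The components of the anticanonical divisor of `𝒳`. -/
def spaceComponent : Fin 7 → LocalSubring K :=
  component x y s ((s * γ + β * δ) / (s * δ)) ((s * γ - β * δ) / (s * δ)) (2 * δ) (2 * γ / δ)

variable {s β γ δ}

theorem isBirationalChart_charts :
    ∀ j, IsBirationalChart (chartX j) (chartY s β γ δ j) := by
  have h := isBirationalChart_x_y
  intro j
  fin_cases j
  · exact h
  · exact (h.pole'' s ((s * γ + β * δ) / (s * δ))).neg_right
  · change IsBirationalChart (1 / x) (chartY s β γ δ 2)
    rw [chartY_two]
    exact (h.pole'' (-s) ((s * γ - β * δ) / (s * δ))).neg_right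
  · change IsBirationalChart x (chartY s β γ δ 3)
    rw [chartY_three']
    have := (h.zero₄ (2 * δ) (2 * γ / δ)).div_right
    exact this

theorem twoForm_charts :
    ∀ j, twoForm (chartX j) (chartY s β γ δ j) = twoForm x y := by
  have hx := isBirationalChart_x_y.left_ne_zero
  intro j
  fin_cases j
  · rfl
  · exact twoForm_neg_right.trans (neg_eq_iff_eq_neg.2 (twoForm_pole' hx _ _))
  · change twoForm (1 / x) (chartY s β γ δ 2) = _
    rw [chartY_two, twoForm_neg_right, twoForm_pole' hx, neg_neg]
  · change twoForm x (chartY s β γ δ 3) = _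
    rw [chartY_three', twoForm_zero₄ hx]

theorem mem_complement_spaceModel (hs : s ≠ 0) (hδ : δ ≠ 0) {S : LocalSubring K} :
    S ∈ complement (spaceModel s β γ δ) (spaceComponent s β γ δ) ↔
      ∃ j, IsLoc (coordRing (chartX j) (chartY s β γ δ j)) S := by
  have h3 : coordRing (chartX 3) (chartY s β γ δ 3) =
      coordRing x (((x ^ 2 * y + const (2 * δ)) / x - const (2 * γ / δ)) / x) := by
    rw [chartY_three']; rfl
  have h1 : coordRing (chartX 1) (chartY s β γ δ 1) =
      coordRing (1 / x) (((y - const s) * x - const ((s * γ + β * δ) / (s * δ))) * x) :=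
    coordRing_neg _ _
  have h2 : coordRing (chartX 2) (chartY s β γ δ 2) =
      coordRing (1 / x) (((y - const (-s)) * x - const ((s * γ - β * δ) / (s * δ))) * x) := by
    rw [chartY_two]; exact coordRing_neg _ _
  refine (mem_complement_surface isBirationalChart_x_y hs (mul_ne_zero two_ne_zero hδ)).trans ?_
  constructor
  · rintro ⟨j, rfl | rfl | rfl | rfl, hj⟩
    · exact ⟨0, hj⟩
    · exact ⟨3, h3 ▸ hj⟩
    · exact ⟨1, h1 ▸ hj⟩
    · exact ⟨2, h2 ▸ hj⟩
  · rintro ⟨j, hj⟩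
    fin_cases j
    · exact ⟨7, by simp, hj⟩
    · exact ⟨9, by simp, h1 ▸ hj⟩
    · exact ⟨10, by simp, h2 ▸ hj⟩
    · exact ⟨8, by simp, h3 ▸ hj⟩

theorem complement_spaceModel (hs : s ≠ 0) (hδ : δ ≠ 0) :
    complement (spaceModel s β γ δ) (spaceComponent s β γ δ) =
      ⋃ j, affinePlane (chartX j) (chartY s β γ δ j) := by
  ext S
  simp only [mem_complement_spaceModel hs hδ, Set.mem_iUnion, mem_affinePlane]

theorem const_neg (s : ℂ) : y - const (-s) = y + const s := by
  rw [show const (-s) = -const s from map_neg _ s, sub_neg_eq_add]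

theorem isBlowUpSequence_centers (hs : s ≠ 0) (hδ : δ ≠ 0) :
    IsBlowUpSequence (projectivePlane x y) (centers s β γ δ)
      (blowUp (spaceModel s β γ δ) (origin (1 / x) (1 / y))) := by
  have h := isBlowUpSequence_projectivePlane (c := (s * γ + β * δ) / (s * δ))
    (c' := (s * γ - β * δ) / (s * δ)) (e := 2 * γ / δ) isBirationalChart_x_y hs
    (mul_ne_zero two_ne_zero hδ)
  have h1 := const_neg s
  simp only [poleCenters, zeroCenters, poleCenter, poleCenter', zeroCenter₁, zeroCenter₂,
    zeroCenter₃, zeroCenter₄, h1] at h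
  exact h

theorem isBlowUpSequence_centers' (hs : s ≠ 0) (hδ : δ ≠ 0) :
    IsBlowUpSequence (projectivePlane x (1 / (y - const s))) (centers' s β γ δ)
      (spaceModel s β γ δ) := by
  have h := isBlowUpSequence_projectivePlane' (c := (s * γ + β * δ) / (s * δ))
    (c' := (s * γ - β * δ) / (s * δ)) (e := 2 * γ / δ) isBirationalChart_x_y hs
    (mul_ne_zero two_ne_zero hδ)
  have h1 := const_neg s
  simp only [poleCenters, zeroCenters, poleCenter, poleCenter', zeroCenter₁, zeroCenter₂,
    zeroCenter₃, zeroCenter₄, h1] at h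
  exact h

end RationalFunctions
end InceXII

namespace InceXII

/-! ### Holomorphic differential equations -/

section Picard

open Metric Filter Topology

variable {E : Type*} [NormedAddCommGroup E] [NormedSpace ℂ E]

/-- The mean value inequality on a disc; it gives the factor `1/2` both in the Picard iteration and
in the proof of local uniqueness. -/
theorem norm_sub_center_le {f f' : ℂ → E} {c : ℂ} {ε C : ℝ}
    (hf : ∀ t ∈ ball c ε, HasDerivAt f (f' t) t) (hC : ∀ t ∈ ball c ε, ‖f' t‖ ≤ C) {t : ℂ}
    (ht : t ∈ ball c ε) : ‖f t - f c‖ ≤ C * ε := by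
  have hc : c ∈ ball c ε := mem_ball_self (pos_of_mem_ball ht)
  refine ((convex_ball c ε).norm_image_sub_le_of_norm_hasDerivWithin_le
    (fun t ht => (hf t ht).hasDerivWithinAt) hC hc ht).trans ?_
  exact mul_le_mul_of_nonneg_left (mem_ball_iff_norm.1 ht).le ((norm_nonneg _).trans (hC t ht))

/-- Picard iteration on a disc of the complex plane. -/
theorem exists_hasDerivAt_of_lipschitz [CompleteSpace E] {F : E → E} {p : E} {ε B L : ℝ}
    (hF : Differentiable ℂ F) (hε : 0 < ε) (hB : ∀ z ∈ closedBall p 1, ‖F z‖ ≤ B)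
    (hL : ∀ z ∈ closedBall p 1, ∀ w ∈ closedBall p 1, ‖F z - F w‖ ≤ L * ‖z - w‖)
    (hBε : B * ε ≤ 1) (hLε : L * ε ≤ 1 / 2) (hL0 : 0 ≤ L) :
    ∃ u : ℂ → E, u 0 = p ∧ ∀ t ∈ ball (0 : ℂ) ε, HasDerivAt u (F (u t)) t := by
  let Good : Set (ℂ → E) := {u | DifferentiableOn ℂ u (ball 0 ε) ∧
    ∀ t ∈ ball (0 : ℂ) ε, u t ∈ closedBall p 1}
  -- The Picard operator: the holomorphic function `F ∘ u` has a primitive on the disc, normalized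
  -- to the value `p` at `0`. The bound `B ε ≤ 1` keeps it in the closed unit ball about `p`.
  have step : ∀ u : Good, ∃ w : Good, (w : ℂ → E) 0 = p ∧
      ∀ t ∈ ball (0 : ℂ) ε, HasDerivAt (w : ℂ → E) (F ((u : ℂ → E) t)) t := by
    rintro ⟨u, hu, hu'⟩
    obtain ⟨g, hg⟩ := DifferentiableOn.isExactOn_ball (f := fun t => F (u t))
      (hF.comp_differentiableOn hu)
    have hw : ∀ t ∈ ball (0 : ℂ) ε, HasDerivAt (fun t => g t - g 0 + p) (F (u t)) t :=
      fun t ht => ((hg t ht).sub_const _).add_const _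
    refine ⟨⟨fun t => g t - g 0 + p, fun t ht => (hw t ht).differentiableAt.differentiableWithinAt,
      fun t ht => ?_⟩, by simp, hw⟩
    have := norm_sub_center_le hg (fun t ht => hB _ (hu' t ht)) ht
    simpa [mem_closedBall_iff_norm] using this.trans hBε
  choose next hnext0 hnext using step
  let u : ℕ → Good := fun n => next^[n] ⟨fun _ => p, differentiableOn_const _, fun _ _ => by simp⟩
  have hu : ∀ n, u (n + 1) = next (u n) := fun n => Function.iterate_succ_apply' _ _ _
  have hd : ∀ n, ∀ t ∈ ball (0 : ℂ) ε,
      HasDerivAt (u (n + 1) : ℂ → E) (F ((u n : ℂ → E) t)) t := by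
    intro n; rw [hu]; exact hnext _
  have h0 : ∀ n, (u n : ℂ → E) 0 = p := by
    rintro (_ | n)
    · rfl
    · rw [hu]; exact hnext0 _
  -- The first step moves by at most 1, and `L ε ≤ 1/2` halves the distance at each further step.
  have hdist : ∀ n, ∀ t ∈ ball (0 : ℂ) ε,
      dist ((u n : ℂ → E) t) ((u (n + 1) : ℂ → E) t) ≤ 1 * (1 / 2 : ℝ) ^ n := by
    intro n
    induction n with
    | zero =>
      intro t ht
      have := (u 1).2.2 t ht
      rw [dist_comm, pow_zero, one_mul]
      exact this
    | succ n ih =>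
      intro t ht
      have h1 : ∀ t ∈ ball (0 : ℂ) ε, HasDerivAt
          (fun t => (u (n + 2) : ℂ → E) t - (u (n + 1) : ℂ → E) t)
          (F ((u (n + 1) : ℂ → E) t) - F ((u n : ℂ → E) t)) t :=
        fun t ht => (hd (n + 1) t ht).sub (hd n t ht)
      have h2 := norm_sub_center_le h1 (C := L * (1 / 2 : ℝ) ^ n) (fun t ht => by
        refine (hL _ ((u (n + 1)).2.2 t ht) _ ((u n).2.2 t ht)).trans ?_
        refine mul_le_mul_of_nonneg_left ?_ hL0
        have := ih t ht
        rwa [dist_comm, one_mul, dist_eq_norm] at this) ht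
      rw [h0, h0, sub_self, sub_zero] at h2
      rw [dist_comm, dist_eq_norm]
      refine h2.trans ?_
      have : (0 : ℝ) ≤ (1 / 2) ^ n := by positivity
      rw [pow_succ]
      nlinarith
  have hlim : ∀ t ∈ ball (0 : ℂ) ε, ∃ a, Tendsto (fun n => (u n : ℂ → E) t) atTop (𝓝 a) :=
    fun t ht => cauchySeq_tendsto_of_complete
      (cauchySeq_of_le_geometric _ _ (by norm_num) fun n => hdist n t ht)
  choose! v hv using hlim
  have hvB : ∀ t ∈ ball (0 : ℂ) ε, v t ∈ closedBall p 1 := fun t ht =>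
    isClosed_closedBall.mem_of_tendsto (hv t ht) (Eventually.of_forall fun n => (u n).2.2 t ht)
  -- The derivatives of the iterates converge uniformly, so the limit may be differentiated termwise
  -- and satisfies the equation.
  have hunif : TendstoUniformlyOn (fun n t => F ((u n : ℂ → E) t)) (fun t => F (v t)) atTop
      (ball (0 : ℂ) ε) := by
    rw [Metric.tendstoUniformlyOn_iff]
    intro η hη
    have hpow : Tendsto (fun n : ℕ => L * (1 * (1 / 2 : ℝ) ^ n / (1 - 1 / 2))) atTop (𝓝 0) := by
      have := tendsto_pow_atTop_nhds_zero_of_lt_one (r := (1 / 2 : ℝ)) (by norm_num) (by norm_num)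
      simpa using (((this.const_mul 1).div_const (1 - 1 / 2)).const_mul L)
    filter_upwards [hpow.eventually_lt_const hη] with n hn t ht
    have h1 := dist_le_of_le_geometric_of_tendsto (1 / 2) 1 (by norm_num)
      (fun n => hdist n t ht) (hv t ht) n
    rw [dist_comm, dist_eq_norm]
    refine ((hL _ ((u n).2.2 t ht) _ (hvB t ht)).trans ?_).trans_lt hn
    exact mul_le_mul_of_nonneg_left (by rwa [dist_eq_norm] at h1) hL0
  refine ⟨v, ?_, fun t ht => ?_⟩
  · have := hv 0 (mem_ball_self hε)
    simp only [h0] at this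
    exact (tendsto_nhds_unique this tendsto_const_nhds)
  · exact hasDerivAt_of_tendstoUniformlyOn (f := fun n => (u (n + 1) : ℂ → E)) isOpen_ball hunif
      (Eventually.of_forall fun n t ht => hd n t ht)
      (fun t ht => (hv t ht).comp (tendsto_add_atTop_nat 1)) ht

/-- Existence on a disc whose radius is uniform for initial values in a bounded set. -/
theorem exists_hasDerivAt_of_norm_le [FiniteDimensional ℂ E] {F : E → E} (hF : ContDiff ℂ 1 F)
    (M : ℝ) : ∃ ε > 0, ∀ p, ‖p‖ ≤ M → ∃ u : ℂ → E, u 0 = p ∧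
      ∀ t ∈ ball (0 : ℂ) ε, HasDerivAt u (F (u t)) t := by
  have := FiniteDimensional.proper ℂ E
  have := FiniteDimensional.complete ℂ E
  obtain ⟨B, hB⟩ := (isCompact_closedBall (0 : E) (M + 1)).exists_bound_of_continuousOn
    hF.continuous.continuousOn
  obtain ⟨L, hL⟩ := (isCompact_closedBall (0 : E) (M + 1)).exists_bound_of_continuousOn
    (hF.continuous_fderiv one_ne_zero).continuousOn
  have hsub : ∀ p : E, ‖p‖ ≤ M → closedBall p 1 ⊆ closedBall (0 : E) (M + 1) := fun p hp =>
    closedBall_subset_closedBall' (by rw [dist_zero_right]; linarith)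
  have hK : (0 : ℝ) < 2 * (|B| + |L| + 1) := by positivity
  have hbound : ∀ a : ℝ, 0 ≤ a → a ≤ |B| + |L| → a * (1 / (2 * (|B| + |L| + 1))) ≤ 1 / 2 := by
    intro a _ ha
    rw [mul_one_div, div_le_div_iff₀ hK two_pos]
    linarith
  -- `B` and `L` bound `F` and its derivative on the ball of radius `M + 1`, which contains the unit
  -- balls about all admissible initial values, so the radius does not depend on `p`.
  refine ⟨1 / (2 * (|B| + |L| + 1)), by positivity, fun p hp => ?_⟩
  refine exists_hasDerivAt_of_lipschitz (B := |B|) (L := |L|)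
    (hF.differentiable one_ne_zero) (by positivity)
    (fun z hz => (hB z (hsub p hp hz)).trans (le_abs_self B)) (fun z hz w hw => ?_)
    ((hbound _ (abs_nonneg _) (by linarith [abs_nonneg L])).trans (by norm_num))
    (hbound _ (abs_nonneg _) (by linarith [abs_nonneg B])) (abs_nonneg _)
  exact (convex_closedBall p 1).norm_image_sub_le_of_norm_fderiv_le (𝕜 := ℂ)
    (fun z _ => (hF.differentiable one_ne_zero) z)
    (fun z hz => (hL z (hsub p hp hz)).trans (le_abs_self L)) hw hz

/-- On a small disc the Lipschitz bound halves any bound for the difference of the two solutions, so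
the difference is at most `2⁻ⁿ` for every `n`. -/
theorem eventuallyEq_of_hasDerivAt {F : E → E} (hF : ContDiff ℂ 1 F) {u v : ℂ → E} {t₁ : ℂ}
    (hu : ∀ᶠ t in 𝓝 t₁, HasDerivAt u (F (u t)) t) (hv : ∀ᶠ t in 𝓝 t₁, HasDerivAt v (F (v t)) t)
    (h : u t₁ = v t₁) : u =ᶠ[𝓝 t₁] v := by
  obtain ⟨L, s, hs, hL⟩ := (hF.contDiffAt (x := u t₁)).exists_lipschitzOnWith
  have hus := hu.self_of_nhds.continuousAt.eventually hs
  have hvs := hv.self_of_nhds.continuousAt.eventually (h ▸ hs)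
  have hd : ∀ᶠ t in 𝓝 t₁, ‖u t - v t‖ ≤ 1 := by
    have h1 : ContinuousAt (fun t => ‖u t - v t‖) t₁ :=
      (hu.self_of_nhds.continuousAt.sub hv.self_of_nhds.continuousAt).norm
    have h2 : ‖u t₁ - v t₁‖ < 1 := by simp [h]
    exact (h1.eventually_lt_const h2).mono fun _ => le_of_lt
  obtain ⟨ρ, hρ, hball⟩ := Metric.eventually_nhds_iff_ball.1
    (hu.and (hv.and (hus.and (hvs.and hd))))
  let ε := min ρ (1 / (2 * (L + 1)))
  have hε : 0 < ε := lt_min hρ (by positivity)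
  have hLε : (L : ℝ) * ε ≤ 1 / 2 := by
    have h1 : (L : ℝ) * ε ≤ L * (1 / (2 * (L + 1))) :=
      mul_le_mul_of_nonneg_left (min_le_right _ _) L.2
    refine h1.trans ?_
    rw [mul_one_div, div_le_div_iff₀ (by positivity) two_pos]
    linarith
  have hb : ∀ t ∈ ball t₁ ε, t ∈ ball t₁ ρ := fun t ht => ball_subset_ball (min_le_left _ _) ht
  have key : ∀ n : ℕ, ∀ t ∈ ball t₁ ε, ‖u t - v t‖ ≤ (1 / 2 : ℝ) ^ n := by
    intro n
    induction n with
    | zero => intro t ht; simpa using (hball t (hb t ht)).2.2.2.2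
    | succ n ih =>
      intro t ht
      have h1 : ∀ t ∈ ball t₁ ε, HasDerivAt (fun t => u t - v t) (F (u t) - F (v t)) t :=
        fun t ht => (hball t (hb t ht)).1.sub (hball t (hb t ht)).2.1
      have h2 := norm_sub_center_le h1 (C := L * (1 / 2 : ℝ) ^ n) (fun t ht => by
        refine (hL.norm_sub_le (hball t (hb t ht)).2.2.1 (hball t (hb t ht)).2.2.2.1).trans ?_
        exact mul_le_mul_of_nonneg_left (ih t ht) L.2) ht
      rw [h, sub_self, sub_zero] at h2
      refine h2.trans ?_
      have : (0 : ℝ) ≤ (1 / 2) ^ n := by positivity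
      rw [pow_succ]
      nlinarith
  filter_upwards [ball_mem_nhds t₁ hε] with t ht
  have hlim := tendsto_pow_atTop_nhds_zero_of_lt_one (r := (1 / 2 : ℝ)) (by norm_num) (by norm_num)
  have := ge_of_tendsto' hlim fun n => key n t ht
  exact sub_eq_zero.1 (norm_le_zero_iff.1 this)

end Picard

end InceXII

namespace InceXII

/-! ### Differential equations on a space that is glued from charts -/

section Atlas

open Metric Filter Topology

variable {ι P E : Type*} [NormedAddCommGroup E] [NormedSpace ℂ E]

/-- `φ` solves, at each time in `U`, the equation that is given by the vector field `F j` in the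
chart `Φ j`. -/
def IsSolutionOn (Φ : ι → E → P) (F : ι → E → E) (U : Set ℂ) (φ : ℂ → P) : Prop :=
  ∀ t₁ ∈ U, ∃ (j : ι) (u : ℂ → E), ∀ᶠ t in 𝓝 t₁, φ t = Φ j (u t) ∧ HasDerivAt u (F j (u t)) t

/-- The charts `Φ j` are glued to a separated space, on which the vector fields `F j` define a vector
field. -/
structure IsAtlas (Φ : ι → E → P) (F : ι → E → E) : Prop where
  contDiff : ∀ j, ContDiff ℂ 1 (F j)
  isClosed : ∀ j k, IsClosed {z : E × E | Φ j z.1 = Φ k z.2}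
  transition : ∀ (j k : ι) (u : ℂ → E) (t₁ : ℂ) (q : E),
    (∀ᶠ t in 𝓝 t₁, HasDerivAt u (F j (u t)) t) → Φ j (u t₁) = Φ k q →
      ∃ v : ℂ → E, v t₁ = q ∧ ∀ᶠ t in 𝓝 t₁, Φ j (u t) = Φ k (v t) ∧ HasDerivAt v (F k (v t)) t

variable {Φ : ι → E → P} {F : ι → E → E} {U V : Set ℂ} {φ ψ : ℂ → P}

theorem IsSolutionOn.mono (h : IsSolutionOn Φ F U φ) (hV : V ⊆ U) : IsSolutionOn Φ F V φ :=
  fun t ht => h t (hV ht)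

theorem IsSolutionOn.congr (h : IsSolutionOn Φ F U φ) (hψ : ∀ t ∈ U, ψ =ᶠ[𝓝 t] φ) :
    IsSolutionOn Φ F U ψ := by
  intro t ht
  obtain ⟨j, u, hu⟩ := h t ht
  exact ⟨j, u, by filter_upwards [hu, hψ t ht] with t h1 h2 using ⟨h2.trans h1.1, h1.2⟩⟩

theorem IsSolutionOn.comp_add (h : IsSolutionOn Φ F U φ) (c : ℂ) :
    IsSolutionOn Φ F {t | t + c ∈ U} fun t => φ (t + c) := by
  intro t ht
  obtain ⟨j, u, hu⟩ := h (t + c) ht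
  refine ⟨j, fun t => u (t + c), ?_⟩
  have hc : Tendsto (fun t => t + c) (𝓝 t) (𝓝 (t + c)) :=
    (continuous_id.add continuous_const).tendsto t
  filter_upwards [hc.eventually hu] with t h1 using ⟨h1.1, h1.2.comp_add_const t c⟩

/-- The first solution is transported to the chart of the second, where uniqueness of solutions of
an ordinary differential equation applies. -/
theorem IsAtlas.eventuallyEq (hA : IsAtlas Φ F) (hφ : IsSolutionOn Φ F U φ)
    (hψ : IsSolutionOn Φ F U ψ) {t₁ : ℂ} (ht : t₁ ∈ U) (h : φ t₁ = ψ t₁) : φ =ᶠ[𝓝 t₁] ψ := by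
  obtain ⟨j, u, hu⟩ := hφ t₁ ht
  obtain ⟨k, w, hw⟩ := hψ t₁ ht
  obtain ⟨v, hv0, hv⟩ := hA.transition j k u t₁ (w t₁) (hu.mono fun _ h => h.2)
    (hu.self_of_nhds.1.symm.trans (h.trans hw.self_of_nhds.1))
  have := eventuallyEq_of_hasDerivAt (hA.contDiff k) (hv.mono fun _ h => h.2)
    (hw.mono fun _ h => h.2) hv0
  filter_upwards [hu, hv, hw, this] with t h1 h2 h3 h4
  rw [h1.1, h2.1, h3.1, h4]

/-- The Hausdorff property enters here: on a non-separated gluing two solutions could agree near a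
point of the boundary and branch there. -/
theorem IsAtlas.eq_of_mem_closure (hA : IsAtlas Φ F) (hφ : IsSolutionOn Φ F U φ)
    (hψ : IsSolutionOn Φ F U ψ) {t₁ : ℂ} (ht : t₁ ∈ U) (h : t₁ ∈ closure {t | φ t = ψ t}) :
    φ t₁ = ψ t₁ := by
  obtain ⟨j, u, hu⟩ := hφ t₁ ht
  obtain ⟨k, w, hw⟩ := hψ t₁ ht
  have hc : Tendsto (fun t => (u t, w t)) (𝓝 t₁) (𝓝 (u t₁, w t₁)) :=
    hu.self_of_nhds.2.continuousAt.prodMk_nhds hw.self_of_nhds.2.continuousAt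
  have := (hA.isClosed j k).mem_of_frequently_of_tendsto
    (((mem_closure_iff_frequently.1 h).and_eventually (hu.and hw)).mono fun t h => h.2.1.1.symm.trans (h.1.trans h.2.2.1)) hc
  exact hu.self_of_nhds.1.trans (Eq.trans this hw.self_of_nhds.1.symm)

/-- Uniqueness of solutions. -/
theorem IsAtlas.eqOn (hA : IsAtlas Φ F) (hU : IsPreconnected U) (hφ : IsSolutionOn Φ F U φ)
    (hψ : IsSolutionOn Φ F U ψ) {t₀ : ℂ} (ht : t₀ ∈ U) (h : φ t₀ = ψ t₀) : Set.EqOn φ ψ U := by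
  -- The set of times at which the germs agree is open, and relatively closed in the connected set
  -- `U`.
  have hsub : U ⊆ {t | φ =ᶠ[𝓝 t] ψ} := by
    refine hU.subset_of_closure_inter_subset
      (isOpen_iff_mem_nhds.2 fun t ht => eventually_eventually_nhds.2 ht)
      ⟨t₀, ht, hA.eventuallyEq hφ hψ ht h⟩ ?_
    rintro t ⟨h1, h2⟩
    exact hA.eventuallyEq hφ hψ h2 (hA.eq_of_mem_closure hφ hψ h2
      (closure_mono (fun s (hs : φ =ᶠ[𝓝 s] ψ) => hs.self_of_nhds) h1))
  exact fun t ht => (hsub ht).self_of_nhds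

/-- A first integral is constant along solutions. -/
theorem IsSolutionOn.firstIntegral_eq {h : P → ℂ}
    (hh : ∀ (j : ι) (u : ℂ → E) (t : ℂ), HasDerivAt u (F j (u t)) t →
      HasDerivAt (fun t => h (Φ j (u t))) 0 t)
    (hφ : IsSolutionOn Φ F U φ) (hU : IsPreconnected U) (hU' : IsOpen U) {s t : ℂ} (hs : s ∈ U)
    (ht : t ∈ U) : h (φ s) = h (φ t) := by
  have hd : ∀ t ∈ U, HasDerivAt (fun t => h (φ t)) 0 t := by
    intro t ht
    obtain ⟨j, u, hu⟩ := hφ t ht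
    exact (hh j u t hu.self_of_nhds.2).congr_of_eventuallyEq
      (hu.mono fun _ h1 => congrArg h h1.1)
  exact hU'.is_const_of_deriv_eq_zero hU
    (fun t ht => (hd t ht).differentiableAt.differentiableWithinAt) (fun t ht => (hd t ht).deriv)
    hs ht

variable {L : Set P} {R : ℝ}

/-- A flow on a disc extends to the disc of twice the radius. -/
theorem IsAtlas.exists_isSolutionOn_double (hA : IsAtlas Φ F) (hR : 0 < R)
    (h : ∀ p ∈ L, ∃ φ, IsSolutionOn Φ F (ball 0 R) φ ∧ φ 0 = p ∧ ∀ t ∈ ball (0 : ℂ) R, φ t ∈ L) :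
    ∀ p ∈ L, ∃ φ, IsSolutionOn Φ F (ball 0 (2 * R)) φ ∧ φ 0 = p ∧
      ∀ t ∈ ball (0 : ℂ) (2 * R), φ t ∈ L := by
  choose! f hf hf0 hfL using h
  intro p hp
  have half : ∀ {t : ℂ}, t ∈ ball (0 : ℂ) (2 * R) ↔ t / 2 ∈ ball (0 : ℂ) R := by
    intro t
    rw [mem_ball_zero_iff, mem_ball_zero_iff, norm_div, Complex.norm_ofNat, div_lt_iff₀ two_pos,
      mul_comm]
  -- To reach the time `t`, the flow runs for the time `t / 2` twice; both runs stay within the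
  -- known radius, and the second starts in `L` again.
  refine ⟨fun t => f (f p (t / 2)) (t / 2), fun t₁ ht₁ => ?_, by
    simp [hf0 _ hp], fun t ht => hfL _ (hfL p hp _ (half.1 ht)) _ (half.1 ht)⟩
  have ht₁' := half.1 ht₁
  have hq := hfL p hp _ ht₁'
  set q := f p (t₁ / 2)
  have h1 : ∀ᶠ c in 𝓝 (0 : ℂ), f p (c + t₁ / 2) = f q c := by
    refine hA.eventuallyEq (U := {0}) ((hf p hp).comp_add (t₁ / 2) |>.mono ?_)
      ((hf q hq).mono ?_) rfl ?_
    · simpa using ht₁'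
    · simpa using hR
    · rw [zero_add, hf0 q hq]
  have hc : Tendsto (fun t : ℂ => (t - t₁) / 2) (𝓝 t₁) (𝓝 0) := by
    have : Continuous fun t : ℂ => (t - t₁) / 2 := by fun_prop
    simpa using this.tendsto t₁
  have hc' : Tendsto (fun t : ℂ => t / 2 + (t - t₁) / 2) (𝓝 t₁) (𝓝 (t₁ / 2)) := by
    have : Continuous fun t : ℂ => t / 2 + (t - t₁) / 2 := by fun_prop
    simpa using this.tendsto t₁
  -- Both initial point and duration vary with `t`. By the flow law the doubled flow agrees near
  -- `t₁` with the single solution through the fixed point `q`, shifted in time; the law is checked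
  -- by uniqueness on the convex intersection of two discs.
  have h2 : (fun t => f (f p (t / 2)) (t / 2)) =ᶠ[𝓝 t₁] fun t => f q (t + -(t₁ / 2)) := by
    filter_upwards [hc.eventually h1, hc.eventually (ball_mem_nhds 0 hR),
      hc'.eventually (isOpen_ball.mem_nhds ht₁'), isOpen_ball.mem_nhds ht₁] with t k1 k2 k3 k4
    have k5 := hfL p hp _ (half.1 k4)
    have k6 : (t - t₁) / 2 + t₁ / 2 = t / 2 := by ring
    have k7 : t + -(t₁ / 2) = t / 2 + (t - t₁) / 2 := by ring
    have hset : {τ : ℂ | τ + (t - t₁) / 2 ∈ ball (0 : ℂ) R} = ball (-((t - t₁) / 2)) R := by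
      ext τ
      rw [Set.mem_ofPred_eq, mem_ball_zero_iff, mem_ball_iff_norm, sub_neg_eq_add]
    have hpre : IsPreconnected
        (ball (0 : ℂ) R ∩ {τ : ℂ | τ + (t - t₁) / 2 ∈ ball (0 : ℂ) R}) := by
      rw [hset]
      exact ((convex_ball _ _).inter (convex_ball _ _)).isPreconnected
    rw [k7]
    refine hA.eqOn hpre ((hf _ k5).mono Set.inter_subset_left)
      (((hf q hq).comp_add _).mono Set.inter_subset_right) (t₀ := 0) ⟨mem_ball_self hR, ?_⟩ ?_
      ⟨half.1 k4, k3⟩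
    · simpa using k2
    · rw [hf0 _ k5, zero_add, ← k1, k6]
  have hsol : IsSolutionOn Φ F {t₁} fun t => f q (t + -(t₁ / 2)) := by
    refine ((hf q hq).comp_add _).mono (Set.singleton_subset_iff.2 ?_)
    rwa [Set.mem_ofPred_eq, ← sub_eq_add_neg, sub_half]
  refine hsol.congr ?_ t₁ rfl
  rintro _ rfl
  exact h2

/-- A complete flow from flows on discs of a fixed radius. -/
theorem IsAtlas.exists_isSolutionOn_univ (hA : IsAtlas Φ F) (hR : 0 < R)
    (h : ∀ p ∈ L, ∃ φ, IsSolutionOn Φ F (ball 0 R) φ ∧ φ 0 = p ∧ ∀ t ∈ ball (0 : ℂ) R, φ t ∈ L) :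
    ∀ p ∈ L, ∃ φ, IsSolutionOn Φ F Set.univ φ ∧ φ 0 = p := by
  have h2 : ∀ n : ℕ, ∀ p ∈ L, ∃ φ, IsSolutionOn Φ F (ball 0 (2 ^ n * R)) φ ∧ φ 0 = p ∧
      ∀ t ∈ ball (0 : ℂ) (2 ^ n * R), φ t ∈ L := by
    intro n
    induction n with
    | zero => simpa using h
    | succ n ih =>
      have := hA.exists_isSolutionOn_double (by positivity) ih
      rwa [← mul_assoc, ← pow_succ'] at this
  intro p hp
  choose f hf hf0 _ using fun n => h2 n p hp
  have hmono : ∀ {m n : ℕ}, m ≤ n → ball (0 : ℂ) (2 ^ m * R) ⊆ ball 0 (2 ^ n * R) := fun hmn =>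
    ball_subset_ball (mul_le_mul_of_nonneg_right (pow_le_pow_right₀ one_le_two hmn) hR.le)
  have heq : ∀ {m n : ℕ}, m ≤ n → Set.EqOn (f m) (f n) (ball 0 (2 ^ m * R)) := fun {m n} hmn =>
    hA.eqOn (convex_ball _ _).isPreconnected (hf m) ((hf n).mono (hmono hmn))
      (mem_ball_self (by positivity)) ((hf0 m).trans (hf0 n).symm)
  have hex : ∀ t : ℂ, ∃ n : ℕ, t ∈ ball (0 : ℂ) (2 ^ n * R) := by
    intro t
    obtain ⟨n, hn⟩ := pow_unbounded_of_one_lt (‖t‖ / R) one_lt_two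
    exact ⟨n, by rwa [mem_ball_zero_iff, ← div_lt_iff₀ hR]⟩
  choose N hN using hex
  have hφ : ∀ (n : ℕ) (t : ℂ), t ∈ ball (0 : ℂ) (2 ^ n * R) → f (N t) t = f n t := by
    intro n t ht
    rcases le_total (N t) n with h1 | h1
    · exact heq h1 (hN t)
    · exact (heq h1 ht).symm
  refine ⟨fun t => f (N t) t, fun t₁ _ => ?_, (hφ 0 0 (mem_ball_self (by positivity))).trans (hf0 0)⟩
  exact (hf (N t₁)).congr (fun t ht => by
    filter_upwards [isOpen_ball.mem_nhds ht] with s hs using hφ _ s hs) t₁ (hN t₁)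

/-- The flow is complete if each level set of a first integral is bounded in suitable charts. -/
theorem IsAtlas.existsUnique [Finite ι] [FiniteDimensional ℂ E] (hA : IsAtlas Φ F) {h : P → ℂ}
    (hh : ∀ (j : ι) (u : ℂ → E) (t : ℂ), HasDerivAt u (F j (u t)) t →
      HasDerivAt (fun t => h (Φ j (u t))) 0 t)
    (hb : ∀ a : ℂ, ∃ M : ℝ, ∀ j p, h (Φ j p) = a → ∃ k q, Φ j p = Φ k q ∧ ‖q‖ ≤ M)
    (j : ι) (p : E) (t₀ : ℂ) :
    ∃! φ : ℂ → P, IsSolutionOn Φ F Set.univ φ ∧ φ t₀ = Φ j p := by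
  obtain ⟨M, hM⟩ := hb (h (Φ j p))
  choose ε hε hsol using fun k => exists_hasDerivAt_of_norm_le (hA.contDiff k) M
  have : Nonempty ι := ⟨j⟩
  obtain ⟨k₀, hk₀⟩ := Finite.exists_min ε
  -- The level set of the first integral. Its points have representatives of norm at most `M`, and
  -- with finitely many charts the smallest existence radius serves for all of them; solutions do
  -- not leave `L`.
  let L : Set P := {P' | (∃ k q, P' = Φ k q) ∧ h P' = h (Φ j p)}
  have hloc : ∀ P' ∈ L, ∃ φ, IsSolutionOn Φ F (ball 0 (ε k₀)) φ ∧ φ 0 = P' ∧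
      ∀ t ∈ ball (0 : ℂ) (ε k₀), φ t ∈ L := by
    rintro _ ⟨⟨i, z, rfl⟩, hz⟩
    obtain ⟨k, q, hq, hqM⟩ := hM i z hz
    obtain ⟨u, hu0, hu⟩ := hsol k q hqM
    have hs : IsSolutionOn Φ F (ball 0 (ε k₀)) fun t => Φ k (u t) := by
      intro t ht
      refine ⟨k, u, ?_⟩
      filter_upwards [isOpen_ball.mem_nhds (ball_subset_ball (hk₀ k) ht)] with s hs
      exact ⟨rfl, hu s hs⟩
    have h0 : Φ k (u 0) = Φ i z := by rw [hu0, hq]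
    refine ⟨_, hs, h0, fun t ht => ⟨⟨k, u t, rfl⟩, ?_⟩⟩
    rw [hs.firstIntegral_eq hh (convex_ball _ _).isPreconnected isOpen_ball ht
      (mem_ball_self (hε k₀)), h0, hz]
  obtain ⟨φ, hφ, hφ0⟩ := hA.exists_isSolutionOn_univ (hε k₀) hloc _ ⟨⟨j, p, rfl⟩, rfl⟩
  refine ⟨fun t => φ (t + -t₀), ⟨hφ.comp_add (-t₀), by simpa using hφ0⟩, ?_⟩
  rintro ψ ⟨hψ, hψ0⟩
  funext t
  exact hA.eqOn isPreconnected_univ hψ (hφ.comp_add (-t₀)) (Set.mem_univ t₀)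
    (hψ0.trans (by simpa using hφ0.symm)) (Set.mem_univ t)

end Atlas

end InceXII

namespace InceXII

/-! ### Values of functions at points -/

section Values

variable {K : Type*} [Field K] [Algebra ℂ K] {S : LocalSubring K} {z w f g : K} {a b : ℂ}

/-- The function `z` is regular at the point `S` and has the value `a` there. -/
def HasValue (S : LocalSubring K) (z : K) (a : ℂ) : Prop :=
  (∀ c, algebraMap ℂ K c ∈ S.toSubring) ∧ Vanishes S (z - algebraMap ℂ K a)

theorem HasValue.mem (h : HasValue S z a) : z ∈ S.toSubring := by
  simpa using add_mem h.2.1 (h.1 a)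

theorem HasValue.const (h : HasValue S z a) (c : ℂ) : HasValue S (algebraMap ℂ K c) c :=
  ⟨h.1, by simpa using vanishes_zero S⟩

theorem HasValue.one (h : HasValue S z a) : HasValue S (1 : K) 1 := by
  simpa using h.const 1

theorem HasValue.neg (h : HasValue S z a) : HasValue S (-z) (-a) :=
  ⟨h.1, by convert h.2.neg using 1; rw [map_neg]; ring⟩

theorem HasValue.add (hz : HasValue S z a) (hw : HasValue S w b) : HasValue S (z + w) (a + b) :=
  ⟨hz.1, by convert hz.2.add hw.2 using 1; rw [map_add]; ring⟩

theorem HasValue.sub (hz : HasValue S z a) (hw : HasValue S w b) : HasValue S (z - w) (a - b) := by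
  simpa [sub_eq_add_neg] using hz.add hw.neg

theorem HasValue.mul (hz : HasValue S z a) (hw : HasValue S w b) : HasValue S (z * w) (a * b) :=
  ⟨hz.1, by
    convert (hz.2.mul_right hw.mem).add (hw.2.mul_left (hz.1 a)) using 1
    rw [map_mul]; ring⟩

theorem HasValue.unique (h : HasValue S z a) (h' : HasValue S z b) : a = b := by
  by_contra hab
  have := h'.2.sub h.2
  rw [sub_sub_sub_cancel_left, ← map_sub] at this
  exact not_vanishes_algebraMap h.1 (sub_ne_zero.2 hab) this

theorem HasValue.inv (h : HasValue S z a) (ha : a ≠ 0) : HasValue S (1 / z) (1 / a) := by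
  have hv : ¬ Vanishes S z := fun hv => ha (h.unique ⟨h.1, by simpa using hv⟩)
  have hz : z ≠ 0 := fun h0 => hv (h0 ▸ vanishes_zero S)
  have ha' : algebraMap ℂ K a ≠ 0 := by simpa using ha
  refine ⟨h.1, ?_⟩
  have h1 := ((h.2.mul_right (inv_mem_of_not_vanishes h.mem hv)).mul_right (h.1 (1 / a))).neg
  convert h1 using 1
  rw [map_div₀, map_one]
  field_simp
  ring

theorem HasValue.mul_eq_one (hz : HasValue S z a) (hw : HasValue S w b) (h : z * w = 1) :
    a * b = 1 :=
  (hz.mul hw).unique (h ▸ hz.one)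

theorem IsBirationalChart.hasValue_left (h : IsBirationalChart f g) (a b : ℂ) :
    HasValue (origin (f - algebraMap ℂ K a) (g - algebraMap ℂ K b)) f a :=
  ⟨(h.chartPoint a b).isLoc_origin.algebraMap_mem, (h.chartPoint a b).origin_vanishes_left⟩

theorem IsBirationalChart.hasValue_right (h : IsBirationalChart f g) (a b : ℂ) :
    HasValue (origin (f - algebraMap ℂ K a) (g - algebraMap ℂ K b)) g b :=
  ⟨(h.chartPoint a b).isLoc_origin.algebraMap_mem, (h.chartPoint a b).origin_vanishes_right⟩

theorem IsBirationalChart.isLoc_origin_sub (h : IsBirationalChart f g) (a b : ℂ) :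
    IsLoc (coordRing f g) (origin (f - algebraMap ℂ K a) (g - algebraMap ℂ K b)) := by
  rw [← coordRing_chartPoint a b]
  exact (h.chartPoint a b).isLoc_origin

/-- A point at which the coordinates have the values `a, b` dominates the corresponding closed point
of the chart, and by separatedness is equal to it. -/
theorem IsSeparatedModel.eq_chartPoint_iff {X : Model K} (hX : IsSeparatedModel X)
    (h : IsBirationalChart f g) (hS : S ∈ X)
    (hp : origin (f - algebraMap ℂ K a) (g - algebraMap ℂ K b) ∈ X) :
    S = origin (f - algebraMap ℂ K a) (g - algebraMap ℂ K b) ↔ HasValue S f a ∧ HasValue S g b := by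
  constructor
  · rintro rfl
    exact ⟨h.hasValue_left a b, h.hasValue_right a b⟩
  · rintro ⟨h1, h2⟩
    exact hX.eq_of_le _ hS _ hp S le_rfl ((h.chartPoint a b).origin_le h1.1 h1.2 h2.2)

end Values

/-! ### The points of the phase space -/

noncomputable section PhaseSpace

open MvPolynomial

/-- The second coordinate function in the charts at `x = ∞`. -/
def poleY (r c : ℂ) : K := -(((y - const r) * x - const c) * x)

/-- The second coordinate function in the chart at `x = 0`. -/
def zeroY (e d : ℂ) : K := y - const e / x + const d / x ^ 2

theorem x_ne_zero : x ≠ 0 := isBirationalChart_x_y.left_ne_zero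

theorem y_eq_poleY (r c : ℂ) :
    y = const r + const c * (1 / x) - (1 / x) * (1 / x) * poleY r c := by
  have := x_ne_zero
  simp only [poleY]
  field_simp
  ring

theorem sq_mul_zeroY (e d : ℂ) : x * x * zeroY e d = x * x * y - const e * x + const d := by
  have := x_ne_zero
  simp only [zeroY]
  field_simp

theorem zeroY_eq (e d : ℂ) :
    zeroY e d = y - const e * (1 / x) + const d * ((1 / x) * (1 / x)) := by
  have := x_ne_zero
  simp only [zeroY]
  field_simp

/-- The expression is a polynomial in the coordinates of the chart at `x = 0`, so it can be
evaluated at each of its points, even where `x` vanishes. -/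
theorem poleY_eq_zeroY (r c e d : ℂ) :
    poleY r c = -((zeroY e d - const r) * (x * x) + (const e - const c) * x - const d) := by
  have := x_ne_zero
  simp only [zeroY, poleY]
  field_simp
  ring

theorem x_mul_inv : x * (1 / x) = 1 := mul_one_div_cancel x_ne_zero

variable (s β γ δ : ℂ)

/-- The parametrizations of the points of the four charts. -/
def point (j : Fin 4) (p : ℂ × ℂ) : LocalSubring K :=
  chartPoint (chartX j) (chartY s β γ δ j) p.1 p.2

variable {s β γ δ}

theorem point_mem_complement (hs : s ≠ 0) (hδ : δ ≠ 0) (j : Fin 4) (p : ℂ × ℂ) :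
    point s β γ δ j p ∈ complement (spaceModel s β γ δ) (spaceComponent s β γ δ) :=
  (mem_complement_spaceModel hs hδ).2 ⟨j, (isBirationalChart_charts j).isLoc_origin_sub _ _⟩

theorem isSeparatedModel_spaceModel (hs : s ≠ 0) (hδ : δ ≠ 0) :
    IsSeparatedModel (spaceModel s β γ δ) :=
  isSeparatedModel_surface isBirationalChart_x_y hs (mul_ne_zero two_ne_zero hδ)

theorem exists_eq_point (hs : s ≠ 0) (hδ : δ ≠ 0) {S : LocalSubring K}
    (hS : IsClosedPoint (spaceModel s β γ δ) S)
    (hS' : S ∈ complement (spaceModel s β γ δ) (spaceComponent s β γ δ)) :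
    ∃ j p, S = point s β γ δ j p := by
  obtain ⟨j, hj⟩ := (mem_complement_spaceModel hs hδ).1 hS'
  obtain ⟨a, b, hab⟩ := (isBirationalChart_charts j).exists_liesOn hj
  exact ⟨j, (a, b), (hS.2 _ (point_mem_complement hs hδ j (a, b)).1 hab).symm⟩

theorem hasValue_point_left (j : Fin 4) (p : ℂ × ℂ) :
    HasValue (point s β γ δ j p) (chartX j) p.1 := (isBirationalChart_charts j).hasValue_left _ _

theorem hasValue_point_right (j : Fin 4) (p : ℂ × ℂ) :
    HasValue (point s β γ δ j p) (chartY s β γ δ j) p.2 :=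
  (isBirationalChart_charts j).hasValue_right _ _

theorem point_eq_iff (hs : s ≠ 0) (hδ : δ ≠ 0) {j k : Fin 4} {p q : ℂ × ℂ} :
    point s β γ δ j p = point s β γ δ k q ↔ HasValue (point s β γ δ j p) (chartX k) q.1 ∧
      HasValue (point s β γ δ j p) (chartY s β γ δ k) q.2 :=
  (isSeparatedModel_spaceModel hs hδ).eq_chartPoint_iff (isBirationalChart_charts k)
    (point_mem_complement hs hδ j p).1 (point_mem_complement hs hδ k q).1

theorem point_injective (j : Fin 4) : Function.Injective (point s β γ δ j) := by
  intro p q h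
  have h1 := hasValue_point_left (s := s) (β := β) (γ := γ) (δ := δ) j p
  have h2 := hasValue_point_right (s := s) (β := β) (γ := γ) (δ := δ) j p
  rw [h] at h1 h2
  exact Prod.ext (h1.unique (hasValue_point_left j q)) (h2.unique (hasValue_point_right j q))

variable (s β γ δ)

/-- The parameters `r, c` of the charts at `x = ∞`. -/
def poleParam : Fin 4 → ℂ × ℂ :=
  ![(0, 0), (s, (s * γ + β * δ) / (s * δ)), (-s, (s * γ - β * δ) / (s * δ)), (0, 0)]

variable {s β γ δ}

theorem chartX_pole {j : Fin 4} (hj : j = 1 ∨ j = 2) : chartX j = 1 / x := by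
  rcases hj with rfl | rfl <;> rfl

theorem chartY_pole {j : Fin 4} (hj : j = 1 ∨ j = 2) :
    chartY s β γ δ j = poleY (poleParam s β γ δ j).1 (poleParam s β γ δ j).2 := by
  rcases hj with rfl | rfl
  · rfl
  · exact chartY_two s β γ δ

variable {j k : Fin 4} {p q : ℂ × ℂ}

theorem point_zero_eq_pole_iff (hs : s ≠ 0) (hδ : δ ≠ 0) (hk : k = 1 ∨ k = 2) :
    point s β γ δ 0 p = point s β γ δ k q ↔ p.1 * q.1 = 1 ∧
      q.2 = -(((p.2 - (poleParam s β γ δ k).1) * p.1 - (poleParam s β γ δ k).2) * p.1) := by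
  have hx : HasValue (point s β γ δ 0 p) x p.1 := hasValue_point_left 0 p
  have hy : HasValue (point s β γ δ 0 p) y p.2 := hasValue_point_right 0 p
  have hY := ((((hy.sub (hx.const (poleParam s β γ δ k).1)).mul hx).sub
    (hx.const (poleParam s β γ δ k).2)).mul hx).neg
  rw [point_eq_iff hs hδ, chartX_pole hk, chartY_pole hk]
  constructor
  · rintro ⟨h1, h2⟩
    exact ⟨hx.mul_eq_one h1 x_mul_inv, h2.unique hY⟩
  · rintro ⟨h1, h2⟩
    have h3 := hx.inv (left_ne_zero_of_mul_eq_one h1)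
    rw [← eq_one_div_of_mul_eq_one_right h1] at h3
    rw [h2]
    exact ⟨h3, hY⟩

theorem point_three_eq_pole_iff (hs : s ≠ 0) (hδ : δ ≠ 0) (hk : k = 1 ∨ k = 2) :
    point s β γ δ 3 p = point s β γ δ k q ↔ p.1 * q.1 = 1 ∧
      q.2 = -((p.2 - (poleParam s β γ δ k).1) * (p.1 * p.1) +
        (2 * γ / δ - (poleParam s β γ δ k).2) * p.1 - 2 * δ) := by
  have hx : HasValue (point s β γ δ 3 p) x p.1 := hasValue_point_left 3 p
  have hy : HasValue (point s β γ δ 3 p) (zeroY (2 * γ / δ) (2 * δ)) p.2 :=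
    hasValue_point_right 3 p
  have hY := ((((hy.sub (hx.const (poleParam s β γ δ k).1)).mul (hx.mul hx)).add
    (((hx.const (2 * γ / δ)).sub (hx.const (poleParam s β γ δ k).2)).mul hx)).sub
      (hx.const (2 * δ))).neg
  rw [← poleY_eq_zeroY] at hY
  rw [point_eq_iff hs hδ, chartX_pole hk, chartY_pole hk]
  constructor
  · rintro ⟨h1, h2⟩
    exact ⟨hx.mul_eq_one h1 x_mul_inv, h2.unique hY⟩
  · rintro ⟨h1, h2⟩
    have h3 := hx.inv (left_ne_zero_of_mul_eq_one h1)
    rw [← eq_one_div_of_mul_eq_one_right h1] at h3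
    rw [h2]
    exact ⟨h3, hY⟩

/-- The denominators are cleared in order to obtain a closed condition. No inequality has to be
added: for `p.1 = 0` the second equation reads `2 δ = 0`. -/
theorem point_zero_eq_three_iff (hs : s ≠ 0) (hδ : δ ≠ 0) :
    point s β γ δ 0 p = point s β γ δ 3 q ↔ p.1 = q.1 ∧
      q.1 * q.1 * q.2 = p.1 * p.1 * p.2 - 2 * γ / δ * p.1 + 2 * δ := by
  have hx : HasValue (point s β γ δ 0 p) x p.1 := hasValue_point_left 0 p
  have hy : HasValue (point s β γ δ 0 p) y p.2 := hasValue_point_right 0 p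
  have hY := (((hx.mul hx).mul hy).sub ((hx.const (2 * γ / δ)).mul hx)).add (hx.const (2 * δ))
  rw [← sq_mul_zeroY] at hY
  rw [point_eq_iff hs hδ]
  change HasValue _ x _ ∧ HasValue _ (zeroY (2 * γ / δ) (2 * δ)) _ ↔ _
  constructor
  · rintro ⟨h1, h2⟩
    exact ⟨hx.unique h1, ((h1.mul h1).mul h2).unique hY⟩
  · rintro ⟨h1, h2⟩
    have h0 : p.1 ≠ 0 := by
      intro h0
      rw [← h1, h0] at h2
      have : 2 * δ = 0 := by linear_combination -h2
      exact mul_ne_zero two_ne_zero hδ this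
    have h3 := hx.inv h0
    have h4 := (hy.sub ((hx.const (2 * γ / δ)).mul h3)).add ((hx.const (2 * δ)).mul (h3.mul h3))
    rw [← zeroY_eq] at h4
    refine ⟨h1 ▸ hx, ?_⟩
    convert h4 using 1
    rw [← h1] at h2
    have : q.2 = (p.1 * p.1 * p.2 - 2 * γ / δ * p.1 + 2 * δ) / (p.1 * p.1) := by
      rw [← h2, mul_div_cancel_left₀ _ (mul_ne_zero h0 h0)]
    rw [this]
    field_simp

/-- The second equation compares the values of `y`. As before the condition is closed, and it
excludes `p.1 = 0`, where it would say `s = -s`. -/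
theorem point_one_eq_two_iff (hs : s ≠ 0) (hδ : δ ≠ 0) :
    point s β γ δ 1 p = point s β γ δ 2 q ↔ p.1 = q.1 ∧
      s + (s * γ + β * δ) / (s * δ) * p.1 - p.1 * p.1 * p.2 =
        -s + (s * γ - β * δ) / (s * δ) * q.1 - q.1 * q.1 * q.2 := by
  have hX : HasValue (point s β γ δ 1 p) (1 / x) p.1 := hasValue_point_left 1 p
  have hY : HasValue (point s β γ δ 1 p) (poleY s _) p.2 := hasValue_point_right 1 p
  have hy := ((hX.const s).add ((hX.const ((s * γ + β * δ) / (s * δ))).mul hX)).sub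
    ((hX.mul hX).mul hY)
  rw [← y_eq_poleY] at hy
  rw [point_eq_iff hs hδ, chartY_two]
  change HasValue _ (1 / x) _ ∧ HasValue _ (poleY (-s) ((s * γ - β * δ) / (s * δ))) _ ↔ _
  constructor
  · rintro ⟨h1, h2⟩
    have h3 := ((h1.const (-s)).add ((h1.const ((s * γ - β * δ) / (s * δ))).mul h1)).sub
      ((h1.mul h1).mul h2)
    rw [← y_eq_poleY] at h3
    exact ⟨hX.unique h1, hy.unique h3⟩
  · rintro ⟨h1, h2⟩
    have h0 : p.1 ≠ 0 := by
      intro h0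
      rw [← h1, h0] at h2
      have : 2 * s = 0 := by linear_combination h2
      exact (mul_ne_zero two_ne_zero hs) this
    have hx := hX.inv h0
    rw [one_div_one_div] at hx
    have h4 := ((((hy.sub (hx.const (-s))).mul hx).sub
      (hx.const ((s * γ - β * δ) / (s * δ)))).mul hx).neg
    refine ⟨h1 ▸ hX, ?_⟩
    rw [h2, ← h1] at h4
    have h5 : q.2 = -(((-s + (s * γ - β * δ) / (s * δ) * p.1 - p.1 * p.1 * q.2 - -s) * (1 / p.1) -
        (s * γ - β * δ) / (s * δ)) * (1 / p.1)) := by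
      generalize (s * γ - β * δ) / (s * δ) = c'
      field_simp
      ring
    rw [h5]
    exact h4

/-- The Hausdorff property of the phase space: identification of points in any two charts is given
by polynomial equations alone. -/
theorem isClosed_point_eq (hs : s ≠ 0) (hδ : δ ≠ 0) (j k : Fin 4) :
    IsClosed {z : (ℂ × ℂ) × (ℂ × ℂ) | point s β γ δ j z.1 = point s β γ δ k z.2} := by
  have hsymm : ∀ {j k : Fin 4},
      IsClosed {z : (ℂ × ℂ) × (ℂ × ℂ) | point s β γ δ j z.1 = point s β γ δ k z.2} →
        IsClosed {z : (ℂ × ℂ) × (ℂ × ℂ) | point s β γ δ k z.1 = point s β γ δ j z.2} := by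
    intro j k h
    convert h.preimage continuous_swap using 1
    ext z
    exact eq_comm
  have hdiag : ∀ {j : Fin 4},
      IsClosed {z : (ℂ × ℂ) × (ℂ × ℂ) | point s β γ δ j z.1 = point s β γ δ j z.2} := by
    intro j
    simp only [(point_injective j).eq_iff]
    exact isClosed_eq continuous_fst continuous_snd
  have h0 : ∀ {k : Fin 4}, k = 1 ∨ k = 2 →
      IsClosed {z : (ℂ × ℂ) × (ℂ × ℂ) | point s β γ δ 0 z.1 = point s β γ δ k z.2} := by
    intro k hk
    simp only [point_zero_eq_pole_iff hs hδ hk]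
    exact (isClosed_eq (by fun_prop) (by fun_prop)).and (isClosed_eq (by fun_prop) (by fun_prop))
  have h3 : ∀ {k : Fin 4}, k = 1 ∨ k = 2 →
      IsClosed {z : (ℂ × ℂ) × (ℂ × ℂ) | point s β γ δ 3 z.1 = point s β γ δ k z.2} := by
    intro k hk
    simp only [point_three_eq_pole_iff hs hδ hk]
    exact (isClosed_eq (by fun_prop) (by fun_prop)).and (isClosed_eq (by fun_prop) (by fun_prop))
  have h03 : IsClosed {z : (ℂ × ℂ) × (ℂ × ℂ) | point s β γ δ 0 z.1 = point s β γ δ 3 z.2} := by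
    simp only [point_zero_eq_three_iff hs hδ]
    exact (isClosed_eq (by fun_prop) (by fun_prop)).and (isClosed_eq (by fun_prop) (by fun_prop))
  have h12 : IsClosed {z : (ℂ × ℂ) × (ℂ × ℂ) | point s β γ δ 1 z.1 = point s β γ δ 2 z.2} := by
    simp only [point_one_eq_two_iff hs hδ]
    exact (isClosed_eq (by fun_prop) (by fun_prop)).and (isClosed_eq (by fun_prop) (by fun_prop))
  fin_cases j <;> fin_cases k
  · exact hdiag
  · exact h0 (Or.inl rfl)
  · exact h0 (Or.inr rfl)
  · exact h03
  · exact hsymm (h0 (Or.inl rfl))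
  · exact hdiag
  · exact h12
  · exact hsymm (h3 (Or.inl rfl))
  · exact hsymm (h0 (Or.inr rfl))
  · exact hsymm h12
  · exact hdiag
  · exact hsymm (h3 (Or.inr rfl))
  · exact hsymm h03
  · exact h3 (Or.inl rfl)
  · exact h3 (Or.inr rfl)
  · exact hdiag

end PhaseSpace

end InceXII

namespace InceXII

/-! ### Bounds on the level sets of the Hamiltonian -/

section Bounds

/-- The level equation solved for its linear term, to be used with `w = x Y` and `k` the energy with
its bounded corrections. -/
theorem norm_le_of_mul_eq {δ g k w Y : ℂ} {κ : ℝ} (hδ : δ ≠ 0) (h : δ * Y = k - w ^ 2 / 2 + g * w)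
    (hk : ‖k‖ ≤ κ) (hw : ‖w‖ ^ 2 ≤ 2 * κ) :
    ‖Y‖ ≤ (2 * κ + ‖g‖ * (1 + 2 * κ)) / ‖δ‖ := by
  rw [le_div_iff₀ (norm_pos_iff.2 hδ), mul_comm, ← norm_mul, h]
  have h1 : ‖w ^ 2 / 2‖ = ‖w‖ ^ 2 / 2 := by rw [norm_div, norm_pow, Complex.norm_ofNat]
  have h2 : ‖w‖ ≤ 1 + 2 * κ := by nlinarith [sq_nonneg (‖w‖ - 1), norm_nonneg w]
  have h3 := (norm_add_le (k - w ^ 2 / 2) (g * w)).trans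
    (add_le_add_left (norm_sub_le k (w ^ 2 / 2)) _)
  rw [norm_mul, h1] at h3
  have h4 := mul_le_mul_of_nonneg_left h2 (norm_nonneg g)
  linarith

/-- Near `x = 0` the points of a level set are in bounded parts of the charts `0` and `3`. -/
theorem norm_le_of_norm_le_one {α β g δ h x y : ℂ} (hδ : δ ≠ 0)
    (hH : x ^ 2 * y ^ 2 / 2 - α / 2 * x ^ 2 - g * x * y + δ * y - β * x = h) (hx : ‖x‖ ≤ 1) :
    ‖y‖ ≤ (2 * (‖h‖ + ‖α‖ + ‖β‖) + ‖g‖ * (1 + 2 * (‖h‖ + ‖α‖ + ‖β‖))) / ‖δ‖ ∨ x ≠ 0 ∧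
      ‖y - 2 * g / x + 2 * δ / x ^ 2‖ ≤
        (2 * (‖h‖ + ‖α‖ + ‖β‖) + ‖g‖ * (1 + 2 * (‖h‖ + ‖α‖ + ‖β‖))) / ‖δ‖ := by
  have hk : ‖h + α / 2 * x ^ 2 + β * x‖ ≤ ‖h‖ + ‖α‖ + ‖β‖ := by
    have h1 := norm_add₃_le (a := h) (b := α / 2 * x ^ 2) (c := β * x)
    have h2 : ‖α / 2 * x ^ 2‖ ≤ ‖α‖ := by
      rw [norm_mul, norm_div, Complex.norm_ofNat, norm_pow]
      have := pow_le_one₀ (n := 2) (norm_nonneg x) hx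
      nlinarith [norm_nonneg α]
    have h3 : ‖β * x‖ ≤ ‖β‖ := by
      rw [norm_mul]; exact mul_le_of_le_one_right (norm_nonneg β) hx
    linarith
  have key : δ * y = (h + α / 2 * x ^ 2 + β * x) - (x * y) ^ 2 / 2 + g * (x * y) := by
    linear_combination hH
  by_cases hw : ‖x * y‖ ^ 2 ≤ 2 * (‖h‖ + ‖α‖ + ‖β‖)
  · exact Or.inl (norm_le_of_mul_eq hδ key hk hw)
  have hx0 : x ≠ 0 := by
    rintro rfl
    refine hw ?_
    rw [zero_mul, norm_zero, zero_pow two_ne_zero]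
    positivity
  refine Or.inr ⟨hx0, ?_⟩
  set Y := y - 2 * g / x + 2 * δ / x ^ 2 with hY
  have hxY : x * Y = x * y - 2 * g + 2 * δ / x := by rw [hY]; field_simp
  -- On the level set the product of the two candidates is bounded, so if `x y` is large, then `x Y`
  -- is small.
  have hprod : (x * y) * (x * Y) = 2 * (h + α / 2 * x ^ 2 + β * x) := by
    rw [hxY]
    have : x * y * (2 * δ / x) = 2 * (δ * y) := by field_simp
    linear_combination 2 * hH + this
  -- The symmetry of the two charts: the same equation for `Y` with `g` and `δ` replaced by their
  -- negatives.
  have key' : -δ * Y = (h + α / 2 * x ^ 2 + β * x) - (x * Y) ^ 2 / 2 + -g * (x * Y) := by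
    have h1 : x ^ 2 * Y = x ^ 2 * y - 2 * g * x + 2 * δ := by rw [hY]; field_simp
    have h2 : x * Y * (x * Y) = x * Y * (x * y) - 2 * g * (x * Y) + 2 * δ * Y := by
      linear_combination Y * h1
    linear_combination h2 / 2 + hprod / 2
  have hn := norm_le_of_mul_eq (neg_ne_zero.2 hδ) key' hk ?_
  · rwa [norm_neg, norm_neg] at hn
  have h1 : ‖x * y‖ * ‖x * Y‖ ≤ 2 * (‖h‖ + ‖α‖ + ‖β‖) := by
    rw [← norm_mul, hprod, norm_mul, Complex.norm_ofNat]
    linarith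
  push Not at hw
  by_contra! h2
  have h3 : 2 * (‖h‖ + ‖α‖ + ‖β‖) * (2 * (‖h‖ + ‖α‖ + ‖β‖)) < ‖x * y‖ ^ 2 * ‖x * Y‖ ^ 2 :=
    mul_lt_mul'' hw h2 (by positivity) (by positivity)
  have h4 := mul_self_le_mul_self (by positivity) h1
  nlinarith

/-- In a chart at `x = ∞` the level equation is solved for the term `r Y`, with `u = (y - r) x` and
`a = 1/x`; here `r ≠ 0` is essential. -/
theorem norm_le_of_mul_eq' {r g δ h u a Y : ℂ} {U : ℝ} (hr : r ≠ 0)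
    (hY : r * Y = u ^ 2 / 2 - g * u + δ * r + δ * u * a - h) (hu : ‖u‖ ≤ U) (ha : ‖a‖ ≤ 1) :
    ‖Y‖ ≤ (U ^ 2 + ‖g‖ * U + ‖δ‖ * ‖r‖ + ‖δ‖ * U + ‖h‖) / ‖r‖ := by
  rw [le_div_iff₀ (norm_pos_iff.2 hr), mul_comm, ← norm_mul, hY]
  have h0 := norm_nonneg u
  have h1 := norm_sub_le (u ^ 2 / 2 - g * u + δ * r + δ * u * a) h
  have h2 := norm_add₃_le (a := u ^ 2 / 2 - g * u) (b := δ * r) (c := δ * u * a)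
  have h3 := norm_sub_le (u ^ 2 / 2) (g * u)
  have h4 : ‖u ^ 2 / 2‖ ≤ U ^ 2 := by
    rw [norm_div, norm_pow, Complex.norm_ofNat]
    nlinarith
  have h5 : ‖g * u‖ ≤ ‖g‖ * U := by rw [norm_mul]; gcongr
  have h6 : ‖δ * u * a‖ ≤ ‖δ‖ * U := by
    rw [norm_mul, norm_mul]
    calc ‖δ‖ * ‖u‖ * ‖a‖ ≤ ‖δ‖ * U * 1 := by gcongr; exact mul_nonneg (norm_nonneg _) (h0.trans hu)
      _ = ‖δ‖ * U := mul_one _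
  have h7 := norm_mul δ r
  linarith

/-- Near `x = ∞` the points of a level set are in bounded parts of the charts `1` and `2`. -/
theorem exists_norm_le_of_one_le_norm {s β g δ h : ℂ} (hs : s ≠ 0) :
    ∃ U : ℝ, ∀ x y : ℂ, 1 ≤ ‖x‖ →
      x ^ 2 * y ^ 2 / 2 - s ^ 2 / 2 * x ^ 2 - g * x * y + δ * y - β * x = h →
      ‖(y - s) * x‖ ≤ U ∨ ‖(y + s) * x‖ ≤ U := by
  set A := ‖s ^ 2‖ + 2 * (‖β‖ + ‖h‖) with hA
  set B := 2 * (‖g‖ + ‖δ‖) with hB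
  refine ⟨(B * (A + B + 1) + 2 * (‖β‖ + ‖h‖)) / ‖s‖, fun x y hx hH => ?_⟩
  have hx0 : x ≠ 0 := norm_pos_iff.1 (one_pos.trans_le hx)
  obtain ⟨a, ha⟩ : ∃ a, x * a = 1 := ⟨x⁻¹, mul_inv_cancel₀ hx0⟩
  have ha1 : ‖a‖ ≤ 1 := by
    have := congrArg norm ha
    rw [norm_mul, norm_one] at this
    nlinarith [norm_nonneg a]
  have hN : ‖2 * (g * y - δ * y * a + β + h * a)‖ ≤ B * ‖y‖ + 2 * (‖β‖ + ‖h‖) := by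
    rw [norm_mul, Complex.norm_ofNat]
    have h1 := norm_add₃_le (a := g * y - δ * y * a) (b := β) (c := h * a)
    have h2 := norm_sub_le (g * y) (δ * y * a)
    have h3 : ‖h * a‖ ≤ ‖h‖ := by
      rw [norm_mul]; exact mul_le_of_le_one_right (norm_nonneg _) ha1
    have h4 : ‖δ * y * a‖ ≤ ‖δ‖ * ‖y‖ := by
      rw [norm_mul, norm_mul]; exact mul_le_of_le_one_right (by positivity) ha1
    have h5 := norm_mul g y
    rw [hB]
    linarith
  -- The level equation multiplied by `2 / x`. Its right side grows at most linearly in `y`, which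
  -- first bounds `y` and then the left side.
  have hfac : (y - s) * (y + s) * x = 2 * (g * y - δ * y * a + β + h * a) := by
    linear_combination (2 * a) * hH + (-(x * y ^ 2) + s ^ 2 * x + 2 * g * y + 2 * β) * ha
  have hy2 : y ^ 2 = s ^ 2 + 2 * (g * y - δ * y * a + β + h * a) * a := by
    linear_combination a * hfac - (y ^ 2 - s ^ 2) * ha
  have hy : ‖y‖ ≤ A + B + 1 := by
    have h1 := norm_add_le (s ^ 2) (2 * (g * y - δ * y * a + β + h * a) * a)
    rw [← hy2, norm_pow, norm_mul] at h1
    have h2 : ‖2 * (g * y - δ * y * a + β + h * a)‖ * ‖a‖ ≤ B * ‖y‖ + 2 * (‖β‖ + ‖h‖) :=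
      (mul_le_of_le_one_right (norm_nonneg _) ha1).trans hN
    have h3 : ‖y‖ ^ 2 ≤ A + B * ‖y‖ := by rw [hA]; linarith
    have hA0 : 0 ≤ A := by positivity
    have hB0 : 0 ≤ B := by positivity
    by_contra! h4
    nlinarith [norm_nonneg y]
  have hNy : ‖(y - s) * (y + s) * x‖ ≤ B * (A + B + 1) + 2 * (‖β‖ + ‖h‖) := by
    rw [hfac]
    have hB0 : 0 ≤ B := by positivity
    have := mul_le_mul_of_nonneg_left hy hB0
    linarith
  -- The larger of the factors `y ± s` has norm at least `‖s‖`, so the product of the other one with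
  -- `x` is bounded.
  have hs2 : 2 * ‖s‖ ≤ ‖y + s‖ + ‖y - s‖ := by
    have h1 := norm_sub_le (y + s) (y - s)
    rw [show y + s - (y - s) = 2 * s by ring, norm_mul, Complex.norm_ofNat] at h1
    exact h1
  rcases le_total ‖y - s‖ ‖y + s‖ with h1 | h1
  · left
    rw [le_div_iff₀ (norm_pos_iff.2 hs)]
    refine le_trans ?_ hNy
    rw [mul_right_comm, norm_mul _ (y + s)]
    exact mul_le_mul_of_nonneg_left (by linarith) (norm_nonneg _)
  · right
    rw [le_div_iff₀ (norm_pos_iff.2 hs)]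
    refine le_trans ?_ hNy
    rw [mul_assoc, norm_mul (y - s), mul_comm]
    exact mul_le_mul_of_nonneg_right (by linarith) (norm_nonneg _)

end Bounds

/-! ### Polynomials in two variables as holomorphic functions -/

section PolynomialFunctions

open MvPolynomial

theorem contDiff_eval_pair (Q : MvPolynomial (Fin 2) ℂ) :
    ContDiff ℂ 1 fun p : ℂ × ℂ => eval ![p.1, p.2] Q := by
  induction Q using MvPolynomial.induction_on with
  | C c => simpa using contDiff_const
  | add Q₁ Q₂ h₁ h₂ => simpa using h₁.add h₂
  | mul_X Q i h =>
    simp only [map_mul, eval_X]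
    refine h.mul ?_
    fin_cases i
    · exact contDiff_fst
    · exact contDiff_snd

variable {u : ℂ → ℂ × ℂ} {u' : ℂ × ℂ} {t : ℂ}

theorem hasDerivAt_fst (hu : HasDerivAt u u' t) : HasDerivAt (fun t => (u t).1) u'.1 t :=
  (ContinuousLinearMap.fst ℂ ℂ ℂ).hasFDerivAt.comp_hasDerivAt t hu

theorem hasDerivAt_snd (hu : HasDerivAt u u' t) : HasDerivAt (fun t => (u t).2) u'.2 t :=
  (ContinuousLinearMap.snd ℂ ℂ ℂ).hasFDerivAt.comp_hasDerivAt t hu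

theorem hasDerivAt_eval_pair (hu : HasDerivAt u u' t)
    (Q : MvPolynomial (Fin 2) ℂ) :
    HasDerivAt (fun t => eval ![(u t).1, (u t).2] Q)
      (eval ![(u t).1, (u t).2] (pderiv 0 Q) * u'.1 +
        eval ![(u t).1, (u t).2] (pderiv 1 Q) * u'.2) t := by
  have h0 := hasDerivAt_fst hu
  have h1 := hasDerivAt_snd hu
  induction Q using MvPolynomial.induction_on with
  | C c => simpa using hasDerivAt_const t c
  | add Q₁ Q₂ h₁ h₂ =>
    simp only [map_add]
    exact (h₁.add h₂).congr_deriv (by ring)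
  | mul_X Q i h =>
    simp only [map_mul, eval_X]
    fin_cases i
    · refine (h.mul h0).congr_deriv ?_
      simp [pderiv_X]
      ring
    · refine (h.mul h1).congr_deriv ?_
      simp [pderiv_X]
      ring

end PolynomialFunctions

end InceXII

namespace InceXII

/-! ### The Hamiltonian vector field on the phase space -/

noncomputable section Dynamics

open MvPolynomial Filter Topology

variable (α β γ δ s : ℂ)

/-- The Hamiltonian vector field in the chart `j`. -/
def vectorField (j : Fin 4) (p : ℂ × ℂ) : ℂ × ℂ :=
  (eval ![p.1, p.2] (pderiv 1 (hamiltonians α β γ δ s j)),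
    -eval ![p.1, p.2] (pderiv 0 (hamiltonians α β γ δ s j)))

theorem vectorField_zero (p : ℂ × ℂ) : vectorField α β γ δ s 0 p =
    (p.1 ^ 2 * p.2 - γ / δ * p.1 + δ, -(p.1 * p.2 ^ 2) + α * p.1 + γ / δ * p.2 + β) := by
  refine Prod.ext ?_ ?_ <;>
  simp [vectorField, hamiltonians, hamiltonian, Derivation.leibniz, Derivation.leibniz_pow,
    pderiv_X] <;> ring

theorem vectorField_three (p : ℂ × ℂ) : vectorField α β γ δ s 3 p =
    (p.1 ^ 2 * p.2 + γ / δ * p.1 - δ, -(p.1 * p.2 ^ 2) + α * p.1 - γ / δ * p.2 + β) := by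
  refine Prod.ext ?_ ?_ <;>
  simp [vectorField, hamiltonians, hamiltonianZero, Derivation.leibniz, Derivation.leibniz_pow,
    pderiv_X] <;> ring

variable {α β γ δ s} {j k : Fin 4}

theorem hamiltonians_pole (hj : j = 1 ∨ j = 2) : hamiltonians α β γ δ s j =
    hamiltonianPole (poleParam s β γ δ j).1 (poleParam s β γ δ j).2 (γ / δ) δ := by
  rcases hj with rfl | rfl <;> rfl

theorem poleParam_relation (hs : s ≠ 0) (hδ : δ ≠ 0) (hj : j = 1 ∨ j = 2) :
    (poleParam s β γ δ j).2 * (poleParam s β γ δ j).1 =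
      γ / δ * (poleParam s β γ δ j).1 + β := by
  rcases hj with rfl | rfl
  · exact pole_relation hs hδ
  · exact pole_relation' hs hδ

theorem poleParam_sq (hs : s ^ 2 = α) (hj : j = 1 ∨ j = 2) : (poleParam s β γ δ j).1 ^ 2 = α := by
  rcases hj with rfl | rfl
  · exact hs
  · exact (neg_sq s).trans hs

theorem poleParam_ne_zero (hs : s ≠ 0) (hj : j = 1 ∨ j = 2) : (poleParam s β γ δ j).1 ≠ 0 := by
  rcases hj with rfl | rfl
  · exact hs
  · exact neg_ne_zero.2 hs

theorem vectorField_pole (hj : j = 1 ∨ j = 2) (p : ℂ × ℂ) : vectorField α β γ δ s j p =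
    (-p.1 * ((poleParam s β γ δ j).2 - p.2 * p.1) - (poleParam s β γ δ j).1 + γ / δ * p.1 -
        δ * p.1 ^ 2,
      p.2 * ((poleParam s β γ δ j).2 - p.2 * p.1) - γ / δ * p.2 -
        δ * ((poleParam s β γ δ j).2 - p.2 * p.1) + δ * p.1 * p.2) := by
  rw [vectorField, hamiltonians_pole hj]
  refine Prod.ext ?_ ?_ <;>
  simp [hamiltonianPole, Derivation.leibniz, Derivation.leibniz_pow, pderiv_X] <;> ring

/-! #### Solutions in different charts -/

variable {u : ℂ → ℂ × ℂ} {u' : ℂ × ℂ} {t t₁ : ℂ} {p q : ℂ × ℂ}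

theorem eventually_fst_ne_zero (hu : HasDerivAt u u' t₁) (h0 : (u t₁).1 ≠ 0) :
    ∀ᶠ t in 𝓝 t₁, (u t).1 ≠ 0 :=
  (hasDerivAt_fst hu).continuousAt.eventually_ne h0

theorem hasDerivAt_pole_zero (hs0 : s ≠ 0) (hδ : δ ≠ 0) (hs : s ^ 2 = α) (hj : j = 1 ∨ j = 2)
    (hu : HasDerivAt u (vectorField α β γ δ s j (u t)) t) (h0 : (u t).1 ≠ 0) :
    HasDerivAt (fun t => (1 / (u t).1, (poleParam s β γ δ j).1 +
      (poleParam s β γ δ j).2 * (u t).1 - (u t).1 * (u t).1 * (u t).2))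
      (vectorField α β γ δ s 0 (1 / (u t).1, (poleParam s β γ δ j).1 +
        (poleParam s β γ δ j).2 * (u t).1 - (u t).1 * (u t).1 * (u t).2)) t := by
  have h1 := hasDerivAt_fst hu
  have h2 := hasDerivAt_snd hu
  have hβ := poleParam_relation (β := β) (γ := γ) hs0 hδ hj
  have hα := poleParam_sq (β := β) (γ := γ) (δ := δ) hs hj
  rw [vectorField_pole hj] at h1 h2
  rw [vectorField_zero]
  revert h1 h2 hβ hα
  generalize (poleParam s β γ δ j).1 = r
  generalize (poleParam s β γ δ j).2 = c
  generalize γ / δ = g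
  intro h1 h2 hβ hα
  obtain rfl : β = c * r - g * r := by rw [hβ]; ring
  subst hα
  refine HasDerivAt.prodMk (((hasDerivAt_const t 1).div h1 h0).congr_deriv ?_)
    ((((h1.const_mul c).const_add r).sub ((h1.mul h1).mul h2)).congr_deriv ?_)
  · field_simp
    ring
  · simp only [Pi.mul_apply]
    field_simp
    ring

theorem hasDerivAt_zero_pole (hs0 : s ≠ 0) (hδ : δ ≠ 0) (hs : s ^ 2 = α) (hj : j = 1 ∨ j = 2)
    (hu : HasDerivAt u (vectorField α β γ δ s 0 (u t)) t) (h0 : (u t).1 ≠ 0) :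
    HasDerivAt (fun t => (1 / (u t).1, -((((u t).2 - (poleParam s β γ δ j).1) * (u t).1 -
      (poleParam s β γ δ j).2) * (u t).1)))
      (vectorField α β γ δ s j (1 / (u t).1, -((((u t).2 - (poleParam s β γ δ j).1) * (u t).1 -
        (poleParam s β γ δ j).2) * (u t).1))) t := by
  have h1 := hasDerivAt_fst hu
  have h2 := hasDerivAt_snd hu
  have hβ := poleParam_relation (β := β) (γ := γ) hs0 hδ hj
  have hα := poleParam_sq (β := β) (γ := γ) (δ := δ) hs hj
  rw [vectorField_zero] at h1 h2
  rw [vectorField_pole hj]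
  revert h1 h2 hβ hα
  generalize (poleParam s β γ δ j).1 = r
  generalize (poleParam s β γ δ j).2 = c
  generalize γ / δ = g
  intro h1 h2 hβ hα
  obtain rfl : β = c * r - g * r := by rw [hβ]; ring
  subst hα
  refine HasDerivAt.prodMk (((hasDerivAt_const t 1).div h1 h0).congr_deriv ?_)
    ((((((h2.sub_const r).mul h1).sub_const c).mul h1).neg).congr_deriv ?_)
  · field_simp
    ring
  · simp only [Pi.mul_apply]
    field_simp
    ring

theorem hasDerivAt_three_zero (hu : HasDerivAt u (vectorField α β γ δ s 3 (u t)) t)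
    (h0 : (u t).1 ≠ 0) :
    HasDerivAt (fun t => ((u t).1, (u t).2 + 2 * γ / δ / (u t).1 - 2 * δ / ((u t).1 * (u t).1)))
      (vectorField α β γ δ s 0
        ((u t).1, (u t).2 + 2 * γ / δ / (u t).1 - 2 * δ / ((u t).1 * (u t).1))) t := by
  have h1 := hasDerivAt_fst hu
  have h2 := hasDerivAt_snd hu
  rw [vectorField_three] at h1 h2
  rw [vectorField_zero]
  rw [mul_div_assoc]
  revert h1 h2
  generalize γ / δ = g
  intro h1 h2
  refine HasDerivAt.prodMk (h1.congr_deriv ?_)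
    (((h2.add ((hasDerivAt_const t (2 * g)).div h1 h0)).sub
      ((hasDerivAt_const t (2 * δ)).div (h1.mul h1) (mul_ne_zero h0 h0))).congr_deriv ?_)
  · field_simp
    ring
  · simp only [Pi.mul_apply]
    field_simp
    ring

theorem hasDerivAt_zero_three (hu : HasDerivAt u (vectorField α β γ δ s 0 (u t)) t)
    (h0 : (u t).1 ≠ 0) :
    HasDerivAt (fun t => ((u t).1, (u t).2 - 2 * γ / δ / (u t).1 + 2 * δ / ((u t).1 * (u t).1)))
      (vectorField α β γ δ s 3
        ((u t).1, (u t).2 - 2 * γ / δ / (u t).1 + 2 * δ / ((u t).1 * (u t).1))) t := by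
  have h1 := hasDerivAt_fst hu
  have h2 := hasDerivAt_snd hu
  rw [vectorField_zero] at h1 h2
  rw [vectorField_three]
  rw [mul_div_assoc]
  revert h1 h2
  generalize γ / δ = g
  intro h1 h2
  refine HasDerivAt.prodMk (h1.congr_deriv ?_)
    (((h2.sub ((hasDerivAt_const t (2 * g)).div h1 h0)).add
      ((hasDerivAt_const t (2 * δ)).div (h1.mul h1) (mul_ne_zero h0 h0))).congr_deriv ?_)
  · field_simp
    ring
  · simp only [Pi.mul_apply]
    field_simp
    ring

theorem point_pole_eq_zero (hs : s ≠ 0) (hδ : δ ≠ 0) (hj : j = 1 ∨ j = 2) (h0 : p.1 ≠ 0) :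
    point s β γ δ j p = point s β γ δ 0 (1 / p.1, (poleParam s β γ δ j).1 +
      (poleParam s β γ δ j).2 * p.1 - p.1 * p.1 * p.2) := by
  refine ((point_zero_eq_pole_iff hs hδ hj).2 ⟨one_div_mul_cancel h0, ?_⟩).symm
  field_simp
  ring

theorem point_zero_eq_pole (hs : s ≠ 0) (hδ : δ ≠ 0) (hj : j = 1 ∨ j = 2) (h0 : p.1 ≠ 0) :
    point s β γ δ 0 p = point s β γ δ j (1 / p.1, -(((p.2 - (poleParam s β γ δ j).1) * p.1 -
      (poleParam s β γ δ j).2) * p.1)) :=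
  (point_zero_eq_pole_iff hs hδ hj).2 ⟨mul_one_div_cancel h0, rfl⟩

theorem point_three_eq_zero (hs : s ≠ 0) (hδ : δ ≠ 0) (h0 : p.1 ≠ 0) :
    point s β γ δ 3 p = point s β γ δ 0 (p.1, p.2 + 2 * γ / δ / p.1 - 2 * δ / (p.1 * p.1)) := by
  refine ((point_zero_eq_three_iff hs hδ).2 ⟨?_, ?_⟩).symm
  · rfl
  · field_simp
    ring

theorem point_zero_eq_three (hs : s ≠ 0) (hδ : δ ≠ 0) (h0 : p.1 ≠ 0) :
    point s β γ δ 0 p = point s β γ δ 3 (p.1, p.2 - 2 * γ / δ / p.1 + 2 * δ / (p.1 * p.1)) := by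
  refine (point_zero_eq_three_iff hs hδ).2 ⟨rfl, ?_⟩
  field_simp

theorem fst_ne_zero_of_point_eq (hs : s ≠ 0) (hδ : δ ≠ 0) (hj : j ≠ 0)
    (h : point s β γ δ 0 p = point s β γ δ j q) : p.1 ≠ 0 ∧ q.1 ≠ 0 := by
  have hpole : ∀ k : Fin 4, k = 1 ∨ k = 2 → point s β γ δ 0 p = point s β γ δ k q →
      p.1 ≠ 0 ∧ q.1 ≠ 0 := fun k hk h =>
    have h1 := ((point_zero_eq_pole_iff hs hδ hk).1 h).1
    ⟨left_ne_zero_of_mul_eq_one h1, right_ne_zero_of_mul_eq_one h1⟩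
  fin_cases j
  · exact absurd rfl hj
  · exact hpole 1 (Or.inl rfl) h
  · exact hpole 2 (Or.inr rfl) h
  · obtain ⟨h1, h2⟩ := (point_zero_eq_three_iff hs hδ).1 h
    have h0 : p.1 ≠ 0 := by
      intro h0
      rw [← h1, h0] at h2
      have : 2 * δ = 0 := by linear_combination -h2
      exact mul_ne_zero two_ne_zero hδ this
    exact ⟨h0, h1 ▸ h0⟩

/-- The points in two charts are in the chart `0`. -/
theorem exists_eq_point_zero (hs : s ≠ 0) (hδ : δ ≠ 0) (hjk : j ≠ k)
    (h : point s β γ δ j p = point s β γ δ k q) :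
    ∃ z, point s β γ δ j p = point s β γ δ 0 z := by
  have hpole : ∀ {k : Fin 4} {q : ℂ × ℂ}, k = 1 ∨ k = 2 → point s β γ δ 3 p = point s β γ δ k q →
      ∃ z, point s β γ δ 3 p = point s β γ δ 0 z := fun hk h =>
    ⟨_, point_three_eq_zero hs hδ
      (left_ne_zero_of_mul_eq_one ((point_three_eq_pole_iff hs hδ hk).1 h).1)⟩
  have hpole' : ∀ {j : Fin 4}, j = 1 ∨ j = 2 → point s β γ δ 3 q = point s β γ δ j p →
      ∃ z, point s β γ δ j p = point s β γ δ 0 z := fun hk h =>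
    ⟨_, point_pole_eq_zero hs hδ hk
      (right_ne_zero_of_mul_eq_one ((point_three_eq_pole_iff hs hδ hk).1 h).1)⟩
  have h12 : ∀ {p q : ℂ × ℂ}, point s β γ δ 1 p = point s β γ δ 2 q → p.1 ≠ 0 ∧ q.1 ≠ 0 := by
    intro p q h
    obtain ⟨h1, h2⟩ := (point_one_eq_two_iff hs hδ).1 h
    have h0 : p.1 ≠ 0 := by
      intro h0
      rw [← h1, h0] at h2
      have : 2 * s = 0 := by linear_combination h2
      exact mul_ne_zero two_ne_zero hs this
    exact ⟨h0, h1 ▸ h0⟩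
  fin_cases j <;> fin_cases k
  · exact ⟨p, rfl⟩
  · exact ⟨p, rfl⟩
  · exact ⟨p, rfl⟩
  · exact ⟨p, rfl⟩
  · exact ⟨q, h⟩
  · exact absurd rfl hjk
  · exact ⟨_, point_pole_eq_zero hs hδ (Or.inl rfl) (h12 h).1⟩
  · exact hpole' (Or.inl rfl) h.symm
  · exact ⟨q, h⟩
  · exact ⟨_, point_pole_eq_zero hs hδ (Or.inr rfl) (h12 h.symm).2⟩
  · exact absurd rfl hjk
  · exact hpole' (Or.inr rfl) h.symm
  · exact ⟨q, h⟩
  · exact hpole (Or.inl rfl) h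
  · exact hpole (Or.inr rfl) h
  · exact absurd rfl hjk

/-- As all overlaps of two charts lie in the chart 0, only the coordinate changes to and from that
chart have to be differentiated. -/
theorem exists_transition_to_zero (hs0 : s ≠ 0) (hδ : δ ≠ 0) (hs : s ^ 2 = α)
    (hu : ∀ᶠ t in 𝓝 t₁, HasDerivAt u (vectorField α β γ δ s j (u t)) t)
    (h : point s β γ δ j (u t₁) = point s β γ δ 0 q) :
    ∃ v : ℂ → ℂ × ℂ, ∀ᶠ t in 𝓝 t₁, point s β γ δ j (u t) = point s β γ δ 0 (v t) ∧
      HasDerivAt v (vectorField α β γ δ s 0 (v t)) t := by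
  by_cases hj : j = 0
  · subst hj
    exact ⟨u, hu.mono fun _ h => ⟨rfl, h⟩⟩
  have h0 := eventually_fst_ne_zero hu.self_of_nhds (fst_ne_zero_of_point_eq hs0 hδ hj h.symm).2
  obtain hj | rfl : (j = 1 ∨ j = 2) ∨ j = 3 := by revert hj; clear * -; revert j; decide
  · exact ⟨_, by
      filter_upwards [hu, h0] with t h1 h2
      exact ⟨point_pole_eq_zero hs0 hδ hj h2, hasDerivAt_pole_zero hs0 hδ hs hj h1 h2⟩⟩
  · exact ⟨_, by
      filter_upwards [hu, h0] with t h1 h2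
      exact ⟨point_three_eq_zero hs0 hδ h2, hasDerivAt_three_zero h1 h2⟩⟩

theorem exists_transition_from_zero (hs0 : s ≠ 0) (hδ : δ ≠ 0) (hs : s ^ 2 = α)
    (hu : ∀ᶠ t in 𝓝 t₁, HasDerivAt u (vectorField α β γ δ s 0 (u t)) t)
    (h : point s β γ δ 0 (u t₁) = point s β γ δ j q) :
    ∃ v : ℂ → ℂ × ℂ, ∀ᶠ t in 𝓝 t₁, point s β γ δ 0 (u t) = point s β γ δ j (v t) ∧
      HasDerivAt v (vectorField α β γ δ s j (v t)) t := by
  by_cases hj : j = 0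
  · subst hj
    exact ⟨u, hu.mono fun _ h => ⟨rfl, h⟩⟩
  have h0 := eventually_fst_ne_zero hu.self_of_nhds (fst_ne_zero_of_point_eq hs0 hδ hj h).1
  obtain hj | rfl : (j = 1 ∨ j = 2) ∨ j = 3 := by revert hj; clear * -; revert j; decide
  · exact ⟨_, by
      filter_upwards [hu, h0] with t h1 h2
      exact ⟨point_zero_eq_pole hs0 hδ hj h2, hasDerivAt_zero_pole hs0 hδ hs hj h1 h2⟩⟩
  · exact ⟨_, by
      filter_upwards [hu, h0] with t h1 h2
      exact ⟨point_zero_eq_three hs0 hδ h2, hasDerivAt_zero_three h1 h2⟩⟩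

theorem isAtlas_point (hs0 : s ≠ 0) (hδ : δ ≠ 0) (hs : s ^ 2 = α) :
    IsAtlas (point s β γ δ) (vectorField α β γ δ s) where
  contDiff j := (contDiff_eval_pair _).prodMk (contDiff_eval_pair _).neg
  isClosed := isClosed_point_eq hs0 hδ
  transition j k u t₁ q hu h := by
    by_cases hjk : j = k
    · subst hjk
      exact ⟨u, point_injective j h, hu.mono fun _ h => ⟨rfl, h⟩⟩
    -- The change between different charts is composed of a change to the chart 0 and one from it.
    obtain ⟨z, hz⟩ := exists_eq_point_zero hs0 hδ hjk h
    obtain ⟨v, hv⟩ := exists_transition_to_zero hs0 hδ hs hu hz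
    obtain ⟨w, hw⟩ := exists_transition_from_zero hs0 hδ hs (hv.mono fun _ h => h.2)
      (hv.self_of_nhds.1.symm.trans h)
    refine ⟨w, point_injective (s := s) (β := β) (γ := γ) (δ := δ) k ?_, ?_⟩
    · exact (hw.self_of_nhds.1.symm.trans hv.self_of_nhds.1.symm).trans h
    · filter_upwards [hv, hw] with t h1 h2 using ⟨h1.1.trans h2.1, h2.2⟩

/-! #### The Hamiltonian as a first integral -/

variable (α β γ δ)

open scoped Classical in
/-- The value of the Hamiltonian at a point. -/
def energy (S : LocalSubring K) : ℂ :=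
  if h : ∃ a, HasValue S (aeval ![x, y] (hamiltonian α β γ δ)) a then h.choose else 0

variable {α β γ δ}

theorem energy_point (hs0 : s ≠ 0) (hδ : δ ≠ 0) (hs : s ^ 2 = α) (j : Fin 4) (p : ℂ × ℂ) :
    energy α β γ δ (point s β γ δ j p) = eval ![p.1, p.2] (hamiltonians α β γ δ s j) := by
  have hX := hasValue_point_left (s := s) (β := β) (γ := γ) (δ := δ) j p
  have hY := hasValue_point_right (s := s) (β := β) (γ := γ) (δ := δ) j p
  have h : HasValue (point s β γ δ j p) (aeval ![x, y] (hamiltonian α β γ δ))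
      (eval ![p.1, p.2] (hamiltonians α β γ δ s j)) := by
    rw [← aeval_hamiltonians hs0 hδ hs j]
    exact ⟨hX.1, vanishes_aeval_sub hX.1 hX.2 hY.2 _⟩
  have hex : ∃ a, HasValue (point s β γ δ j p) (aeval ![x, y] (hamiltonian α β γ δ)) a := ⟨_, h⟩
  rw [energy, dif_pos hex]
  exact hex.choose_spec.unique h

theorem hasDerivAt_energy (hs0 : s ≠ 0) (hδ : δ ≠ 0) (hs : s ^ 2 = α) (j : Fin 4)
    (u : ℂ → ℂ × ℂ) (t : ℂ) (hu : HasDerivAt u (vectorField α β γ δ s j (u t)) t) :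
    HasDerivAt (fun t => energy α β γ δ (point s β γ δ j (u t))) 0 t := by
  simp only [energy_point hs0 hδ hs]
  refine (hasDerivAt_eval_pair hu _).congr_deriv ?_
  simp only [vectorField]
  ring

theorem eval_hamiltonians_zero (p : ℂ × ℂ) : eval ![p.1, p.2] (hamiltonians α β γ δ s 0) =
    p.1 ^ 2 * p.2 ^ 2 / 2 - α / 2 * p.1 ^ 2 - γ / δ * p.1 * p.2 + δ * p.2 - β * p.1 := by
  simp [hamiltonians, hamiltonian]
  ring

theorem eval_hamiltonians_three (p : ℂ × ℂ) : eval ![p.1, p.2] (hamiltonians α β γ δ s 3) =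
    p.1 ^ 2 * p.2 ^ 2 / 2 + γ / δ * p.1 * p.2 - δ * p.2 - α / 2 * p.1 ^ 2 - β * p.1 := by
  simp [hamiltonians, hamiltonianZero]
  ring

theorem eval_hamiltonians_pole (hj : j = 1 ∨ j = 2) (p : ℂ × ℂ) :
    (poleParam s β γ δ j).1 * p.2 = ((poleParam s β γ δ j).2 - p.2 * p.1) ^ 2 / 2 -
      γ / δ * ((poleParam s β γ δ j).2 - p.2 * p.1) + δ * (poleParam s β γ δ j).1 +
      δ * ((poleParam s β γ δ j).2 - p.2 * p.1) * p.1 -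
      eval ![p.1, p.2] (hamiltonians α β γ δ s j) := by
  rw [hamiltonians_pole hj]
  simp [hamiltonianPole]
  ring

/-- Once `u = (y - r) x` is bounded, the energy determines the second coordinate up to a bounded
amount. -/
theorem exists_norm_le_of_pole (hs : s ≠ 0) (h : ℂ) (hj : j = 1 ∨ j = 2) (U : ℝ) :
    ∃ M : ℝ, ∀ p : ℂ × ℂ, eval ![p.1, p.2] (hamiltonians α β γ δ s j) = h → ‖p.1‖ ≤ 1 →
      ‖(poleParam s β γ δ j).2 - p.2 * p.1‖ ≤ U → ‖p‖ ≤ M :=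
  ⟨max 1 _, fun p hp h1 h2 => norm_prod_le_iff.2 ⟨h1.trans (le_max_left _ _),
    (norm_le_of_mul_eq' (poleParam_ne_zero hs hj) (hp ▸ eval_hamiltonians_pole hj p) h2 h1).trans
      (le_max_right _ _)⟩⟩

/-- Each level set of the Hamiltonian is bounded in suitable charts. -/
theorem exists_norm_le_of_energy_eq (hs0 : s ≠ 0) (hδ : δ ≠ 0) (hs : s ^ 2 = α) (h : ℂ) :
    ∃ M : ℝ, ∀ j p, energy α β γ δ (point s β γ δ j p) = h →
      ∃ k q, point s β γ δ j p = point s β γ δ k q ∧ ‖q‖ ≤ M := by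
  obtain ⟨U, hU⟩ := exists_norm_le_of_one_le_norm (s := s) (β := β) (g := γ / δ) (δ := δ) (h := h)
    hs0
  have hpole : ∀ j : Fin 4, j = 1 ∨ j = 2 → ∃ M : ℝ, ∀ p : ℂ × ℂ,
      eval ![p.1, p.2] (hamiltonians α β γ δ s j) = h → ‖p.1‖ ≤ 1 →
      -- The maximum includes the points with first coordinate zero, at which `(y - r) x` has the
      -- value `c`.
      ‖(poleParam s β γ δ j).2 - p.2 * p.1‖ ≤ max U ‖(poleParam s β γ δ j).2‖ → ‖p‖ ≤ M :=
    fun j hj => exists_norm_le_of_pole hs0 h hj _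
  obtain ⟨M₁, hM₁⟩ := hpole 1 (Or.inl rfl)
  obtain ⟨M₂, hM₂⟩ := hpole 2 (Or.inr rfl)
  set M₀ := (2 * (‖h‖ + ‖α‖ + ‖β‖) + ‖γ / δ‖ * (1 + 2 * (‖h‖ + ‖α‖ + ‖β‖))) / ‖δ‖
  -- The last entry serves the points with `x = 0` of the chart 3, where the energy is `-δ y₃`; the
  -- entry 1 bounds the first coordinate in the charts 0 and 3.
  set M := max (max 1 M₀) (max (max M₁ M₂) (‖h‖ / ‖δ‖))
  have k1 : 1 ≤ M := (le_max_left _ _).trans (le_max_left _ _)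
  have k0 : M₀ ≤ M := (le_max_right _ _).trans (le_max_left _ _)
  have k2 : M₁ ≤ M := ((le_max_left _ _).trans (le_max_left _ _)).trans (le_max_right _ _)
  have k3 : M₂ ≤ M := ((le_max_right _ _).trans (le_max_left _ _)).trans (le_max_right _ _)
  have k4 : ‖h‖ / ‖δ‖ ≤ M := (le_max_right _ _).trans (le_max_right _ _)
  have hM : ∀ j : Fin 4, j = 1 ∨ j = 2 → ∀ p : ℂ × ℂ,
      eval ![p.1, p.2] (hamiltonians α β γ δ s j) = h → ‖p.1‖ ≤ 1 →
      ‖(poleParam s β γ δ j).2 - p.2 * p.1‖ ≤ max U ‖(poleParam s β γ δ j).2‖ → ‖p‖ ≤ M := by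
    rintro j (rfl | rfl) p h1 h2 h3
    · exact (hM₁ p h1 h2 h3).trans k2
    · exact (hM₂ p h1 h2 h3).trans k3
  have hzero : ∀ p : ℂ × ℂ, energy α β γ δ (point s β γ δ 0 p) = h →
      ∃ k q, point s β γ δ 0 p = point s β γ δ k q ∧ ‖q‖ ≤ M := by
    intro p hp
    have hp' := hp
    rw [energy_point hs0 hδ hs, eval_hamiltonians_zero] at hp'
    rcases le_total ‖p.1‖ 1 with h1 | h1
    · rcases norm_le_of_norm_le_one hδ hp' h1 with h2 | ⟨h0, h2⟩
      · exact ⟨0, p, rfl, norm_prod_le_iff.2 ⟨h1.trans k1, h2.trans k0⟩⟩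
      · refine ⟨3, _, point_zero_eq_three hs0 hδ h0, norm_prod_le_iff.2 ⟨h1.trans k1, ?_⟩⟩
        rw [← mul_div_assoc, pow_two] at h2
        exact h2.trans k0
    · have h0 : p.1 ≠ 0 := norm_pos_iff.1 (one_pos.trans_le h1)
      have hcase : ∀ j : Fin 4, j = 1 ∨ j = 2 → ‖(p.2 - (poleParam s β γ δ j).1) * p.1‖ ≤ U →
          ∃ k q, point s β γ δ 0 p = point s β γ δ k q ∧ ‖q‖ ≤ M := by
        intro j hj h2
        have h3 := point_zero_eq_pole (β := β) (γ := γ) hs0 hδ hj h0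
        refine ⟨j, _, h3, hM j hj _ ?_ ?_ ?_⟩
        · rw [← energy_point hs0 hδ hs, ← h3, hp]
        · rw [norm_div, norm_one]
          exact (div_le_one₀ (one_pos.trans_le h1)).2 h1
        · refine le_trans (le_of_eq ?_) (h2.trans (le_max_left _ _))
          congr 1
          field_simp
          ring
      subst hs
      rcases hU p.1 p.2 h1 hp' with h2 | h2
      · exact hcase 1 (Or.inl rfl) h2
      · exact hcase 2 (Or.inr rfl) (by
          change ‖(p.2 - -s) * p.1‖ ≤ U
          rwa [sub_neg_eq_add])
  refine ⟨M, fun j p hp => ?_⟩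
  by_cases hj0 : j = 0
  · subst hj0; exact hzero p hp
  obtain hj | rfl : (j = 1 ∨ j = 2) ∨ j = 3 := by revert hj0; clear * -; revert j; decide
  · by_cases h0 : p.1 = 0
    · refine ⟨j, p, rfl, hM j hj p ?_ ?_ ?_⟩
      · rw [← energy_point hs0 hδ hs, hp]
      · rw [h0, norm_zero]; exact zero_le_one
      · rw [h0, mul_zero, sub_zero]; exact le_max_right _ _
    · have h1 := point_pole_eq_zero (β := β) (γ := γ) hs0 hδ hj h0
      rw [h1] at hp ⊢
      exact hzero _ hp
  · by_cases h0 : p.1 = 0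
    · refine ⟨3, p, rfl, norm_prod_le_iff.2 ⟨?_, ?_⟩⟩
      · rw [h0, norm_zero]; exact zero_le_one.trans k1
      · rw [energy_point hs0 hδ hs, eval_hamiltonians_three, h0] at hp
        have h1 : h = -(δ * p.2) := by rw [← hp]; ring
        refine le_trans (le_of_eq ?_) k4
        rw [h1, norm_neg, norm_mul, mul_div_cancel_left₀ _ (norm_ne_zero_iff.2 hδ)]
    · have h1 := point_three_eq_zero (β := β) (γ := γ) hs0 hδ h0
      rw [h1] at hp ⊢
      exact hzero _ hp

theorem isGlobalSolution_iff {φ : ℂ → LocalSubring K} :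
    IsGlobalSolution chartX (chartY s β γ δ) (hamiltonians α β γ δ s) φ ↔
      IsSolutionOn (point s β γ δ) (vectorField α β γ δ s) Set.univ φ := by
  constructor
  · intro h t₁ _
    obtain ⟨j, ξ, η, hj⟩ := h t₁
    exact ⟨j, fun t => (ξ t, η t), hj.mono fun t ht => ⟨ht.1, ht.2.1.prodMk ht.2.2⟩⟩
  · intro h t₁
    obtain ⟨j, u, hu⟩ := h t₁ (Set.mem_univ _)
    exact ⟨j, fun t => (u t).1, fun t => (u t).2,
      hu.mono fun t ht => ⟨ht.1, hasDerivAt_fst ht.2, hasDerivAt_snd ht.2⟩⟩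

theorem existsUnique_isGlobalSolution (hs0 : s ≠ 0) (hδ : δ ≠ 0) (hs : s ^ 2 = α)
    {S : LocalSubring K} (hS : IsClosedPoint (spaceModel s β γ δ) S)
    (hS' : S ∈ complement (spaceModel s β γ δ) (spaceComponent s β γ δ)) (t₀ : ℂ) :
    ∃! φ : ℂ → LocalSubring K,
      IsGlobalSolution chartX (chartY s β γ δ) (hamiltonians α β γ δ s) φ ∧ φ t₀ = S := by
  obtain ⟨j, p, rfl⟩ := exists_eq_point hs0 hδ hS hS'
  simp only [isGlobalSolution_iff]
  exact (isAtlas_point hs0 hδ hs).existsUnique (hasDerivAt_energy hs0 hδ hs)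
    (exists_norm_le_of_energy_eq hs0 hδ hs) j p t₀

end Dynamics

end InceXII

theorem mainTheorem4 (α β γ δ s : ℂ) (hα : α ≠ 0) (hδ : δ ≠ 0) (hs : s ^ 2 = α) :
    ∃ (Z X : Model InceXII.K) (D : Fin 7 → LocalSubring InceXII.K)
      (H : Fin 4 → MvPolynomial (Fin 2) ℂ) (v : Derivation ℂ InceXII.K InceXII.K),
      -- ten explicit blow-ups of the plane in which `(x, y)` are affine coordinates, then
      -- contraction of the line at infinity, lead to the surface `X`
      IsBlowUpSequence (projectivePlane x y) (centers s β γ δ) Z ∧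
      IsClosedPoint X (origin (1 / x) (1 / y)) ∧
      Z = blowUp X (origin (1 / x) (1 / y)) ∧
      curves Z \ curves X = {lineAtInfinity} ∧
      -- `X` is also the result of nine explicit blow-ups, and no contraction, of the plane
      -- with the affine coordinates `(x, 1 / (y - s))`
      IsBlowUpSequence (projectivePlane x (1 / (y - const s))) (centers' s β γ δ) X ∧
      -- `X` is a rational surface of type `D₆⁽¹⁾`
      IsAnticanonicalConfiguration X x y D nullRootD6 matrixD6 ∧
      -- the complement of the anticanonical divisor is glued from the four planes
      complement X D = ⋃ j, affinePlane (chartX j) (chartY s β γ δ j) ∧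
      -- the coordinate changes are birational and symplectic
      (∀ j, IsBirationalChart (chartX j) (chartY s β γ δ j)) ∧
      (∀ j, twoForm (chartX j) (chartY s β γ δ j) = twoForm x y) ∧
      -- the system becomes a polynomial Hamiltonian system in each chart
      H 0 = hamiltonian α β γ δ ∧
      v x = x ^ 2 * y - const (γ / δ) * x + const δ ∧
      v y = -(x * y ^ 2) + const α * x + const (γ / δ) * y + const β ∧
      (∀ j, MvPolynomial.aeval ![chartX j, chartY s β γ δ j] (H j) =
        MvPolynomial.aeval ![x, y] (hamiltonian α β γ δ)) ∧
      (∀ j, v (chartX j) = MvPolynomial.aeval ![chartX j, chartY s β γ δ j]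
        (MvPolynomial.pderiv 1 (H j))) ∧
      (∀ j, v (chartY s β γ δ j) = - MvPolynomial.aeval ![chartX j, chartY s β γ δ j]
        (MvPolynomial.pderiv 0 (H j))) ∧
      -- the complement parametrizes all solutions: through each of its points, at each time,
      -- there is exactly one solution, and it is holomorphic on the whole `t`-plane
      ∀ p, IsClosedPoint X p → p ∈ complement X D → ∀ t₀ : ℂ,
        ∃! φ : ℂ → LocalSubring InceXII.K,
          IsGlobalSolution chartX (chartY s β γ δ) H φ ∧ φ t₀ = p := by
  have hs0 : s ≠ 0 := by
    rintro rfl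
    exact hα (by rw [← hs, zero_pow two_ne_zero])
  have hd : 2 * δ ≠ 0 := mul_ne_zero two_ne_zero hδ
  -- The vector field as a derivation of the function field: its form in each chart is then an
  -- identity of rational functions.
  obtain ⟨v, hvx, hvy⟩ := exists_derivation (x ^ 2 * y - const (γ / δ) * x + const δ)
    (-(x * y ^ 2) + const α * x + const (γ / δ) * y + const β)
  refine ⟨blowUp (spaceModel s β γ δ) (origin (1 / x) (1 / y)), spaceModel s β γ δ,
    spaceComponent s β γ δ, hamiltonians α β γ δ s, v, isBlowUpSequence_centers hs0 hδ, ?_, rfl,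
    curves_blowUp_diff isBirationalChart_x_y hs0 hd, isBlowUpSequence_centers' hs0 hδ,
    isAnticanonicalConfiguration_surface isBirationalChart_x_y hs0 hd,
    complement_spaceModel hs0 hδ, isBirationalChart_charts, twoForm_charts, rfl, hvx, hvy,
    aeval_hamiltonians hs0 hδ hs, fun j => (derivation_charts hs0 hδ hs hvx hvy j).1,
    fun j => (derivation_charts hs0 hδ hs hvx hvy j).2,
    fun p hp hp' t₀ => existsUnique_isGlobalSolution hs0 hδ hs hp hp' t₀⟩
  exact (isSeparatedModel_spaceModel hs0 hδ).isClosedPoint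
    isBirationalChart_x_y.inv_left.inv_right (corner_mem_surface isBirationalChart_x_y hs0 hd)
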